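/- Let $\beta>0$ and let $V:\mathbb R\to\mathbb R$ be continuous with $V(\lambda)\ge 2(1+\epsilon)\log(1+|\lambda|)$ for some $\epsilon>0$ and all sufficiently large $|\lambda|$. Consider the probability density on $\mathbb R^n$ $$p_{n,\beta}(\lambda_1,\dots,\lambda_n)=Q_{n,\beta}^{-1}\prod_{i=1}^n e^{-n\beta V(\lambda_i)/2}\prod_{1\le i<j\le n}|\lambda_i-\lambda_j|^\beta ,$$ where $Q_{n,\beta}$ is the normalising constant; let $\mathbf E_\beta$ be the corresponding expectation and $\mathcal N_n[f]=\sum_{i=1}^n f(\lambda_i)$. Let $\rho$ be the equilibrium density of $V$, i.e. the compactly supported probability density such that $v(\lambda)=2\int\log|\mu-\lambda|\,\rho(\mu)\,d\mu-V(\lambda)$ equals $\sup v$ on $\operatorname{supp}\rho$. Assume: * (C1) $\operatorname{supp}\rho=\sigma=[-2,2]$. * (C2) $\rho(\lambda)=\frac1{2\pi}P(\lambda)\sqrt{4-\lambda^2}$ on $\sigma$ with $\inf_{\sigma}P>0$, where $P(z)=\frac1\pi\int_{-2}^2\frac{V'(z)-V'(\lambda)}{(z-\lambda)\sqrt{4-\lambda^2}}\,d\lambda$;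 and $v$ attains its maximum exactly on $\sigma$. * (C3) There is an open set $\mathbf D\subset\mathbb C$ containing $\sigma$ and an analytic function on $\mathbf D$, again denoted by $V$, that agrees with $V$ on $\mathbf D\cap\mathbb R$. Let $g(z)=\int\frac{\rho(\lambda)\,d\lambda}{z-\lambda}$, let $X^{1/2}(z)=\sqrt{z^2-4}$ be the branch that is analytic off $\sigma$ with $X^{1/2}(z)\sim z$ at infinity, and let $\mathcal L_r=\{z:\operatorname{dist}(z,\sigma)=r\}$, traversed counterclockwise. Then for every $\kappa\ge0$ there is $n_0(\kappa)$ (depending only on $V,\beta,\kappa$) such that $Q_{n,\beta}$ is finite for $n\ge n_0(\kappa)$, and the following holds. Let $d>0$ be such that $\{z:\operatorname{dist}(z,\sigma)\le 2d\}$ is contained in $\mathbf D$ and contains no zero of $P$. There is a constant $C_d$ (depending, for fixed $V$, $\mathbf D$, $\beta$, only on $d$), and for every $\kappa\ge 0$ there are constants $K$ and $c>0$ (depending only on $V,\mathbf D,\beta,d,\kappa$), such that for all $n\ge n_0(\kappa)$ and all functions $f$ on $\mathbf D\cup\mathbb R$ that are analytic in $\mathbf D$, measurable on $\mathbb R$,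 and satisfy $|f(\lambda)|\le M e^{\kappa V(\lambda)}$ for all real $\lambda$ with $\operatorname{dist}(\lambda,\sigma)>2d$, the variable $\mathcal N_n[f]$ is square integrable, $$\mathbf E_\beta\{\mathcal N_n[f]\}=n\int f(\lambda)\rho(\lambda)\,d\lambda+\Big(\frac2\beta-1\Big)\frac1{(2\pi i)^2}\oint_{\mathcal L_{2d}}\frac{f(z)\,dz}{X^{1/2}(z)}\oint_{\mathcal L_d}\frac{g'(\zeta)\,d\zeta}{P(\zeta)(\zeta-z)}+\frac1n r_{n,\beta}(f),$$ $$\frac1n|r_{n,\beta}(f)|\le \frac{C_d}{n}\sup_{\operatorname{dist}(z,\sigma)\le2d}|f(z)|+K e^{-cn}M,$$ and $$\mathbf E_\beta\big\{|\mathcal N_n[f]-\mathbf E_\beta\{\mathcal N_n[f]\}|^2\big\}\le C_d\sup_{\operatorname{dist}(z,\sigma)\le2d}|f(z)|^2+K e^{-cn}M^2 .$$ In particular, if $f$ vanishes on the real points with $\operatorname{dist}(\lambda,\sigma)>2d$, the bounds hold with $M=0$. -/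

import Mathlib

open MeasureTheory

namespace BetaEnsemble

noncomputable section

/-- The unnormalised joint density
`∏ᵢ exp (-n β V(λᵢ) / 2) * ∏_{i<j} |λᵢ - λⱼ| ^ β` of the eigenvalues. -/
def weight (V : ℝ → ℝ) (β : ℝ) (n : ℕ) (l : Fin n → ℝ) : ℝ :=
  (∏ i, Real.exp (-((n : ℝ) * β * V (l i) / 2))) *
    ∏ i, ∏ j ∈ Finset.Ioi i, |l i - l j| ^ β

/-- The normalisation constant `Q_{n,β}`. -/
def partitionFn (V : ℝ → ℝ) (β : ℝ) (n : ℕ) : ℝ :=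
  ∫ l : Fin n → ℝ, weight V β n l

/-- The law of the eigenvalues: the measure on `ℝⁿ` with density
`p_{n,β} = weight / Q_{n,β}`. -/
def law (V : ℝ → ℝ) (β : ℝ) (n : ℕ) : Measure (Fin n → ℝ) :=
  (volume : Measure (Fin n → ℝ)).withDensity fun l =>
    ENNReal.ofReal (weight V β n l / partitionFn V β n)

/-- The linear eigenvalue statistic `𝒩ₙ[f] = ∑ᵢ f(λᵢ)`. -/
def linStat (f : ℂ → ℂ) (n : ℕ) (l : Fin n → ℝ) : ℂ :=
  ∑ i, f (l i : ℂ)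

/-- The effective potential `v(x) = 2 ∫ log |y - x| ρ(y) dy - V(x)`. -/
def effPotential (V ρ : ℝ → ℝ) (x : ℝ) : ℝ :=
  2 * (∫ y : ℝ, Real.log |y - x| * ρ y) - V x

/-- `ρ` is the (compactly supported) density of the equilibrium measure of `V`: a probability
density whose effective potential equals its maximum at every point of the support of `ρ`. -/
structure IsEquilibriumDensity (V ρ : ℝ → ℝ) : Prop where
  nonneg : ∀ x, 0 ≤ ρ x
  integrable : Integrable ρ
  integral_eq_one : ∫ x, ρ x = 1
  hasCompactSupport : HasCompactSupport ρ
  log_integrable : ∀ x, Integrable fun y : ℝ => Real.log |y - x| * ρ y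
  le_on_support : ∀ x ∈ tsupport ρ, ∀ y, effPotential V ρ y ≤ effPotential V ρ x

/-- The interval `σ = [-2, 2]`, as a subset of `ℂ`. -/
def cut : Set ℂ := (fun x : ℝ => (x : ℂ)) '' Set.Icc (-2) 2

/-- The closed neighbourhood `{z : dist(z, σ) ≤ r}` of the interval. -/
def cutNhd (r : ℝ) : Set ℂ := {z | Metric.infDist z cut ≤ r}

/-- `sup {|f(z)| : dist(z, σ) ≤ r}`. -/
def supNear (f : ℂ → ℂ) (r : ℝ) : ℝ := sSup ((fun z => ‖f z‖) '' cutNhd r)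

/-- The contour integral `∮ F(z) dz` over `{z : dist(z, σ) = r}`, counterclockwise. For `r > 0`
this curve consists of a segment below `σ`, a half circle around `2`, a segment above `σ` and a
half circle around `-2`. -/
def contourIntegral (r : ℝ) (F : ℂ → ℂ) : ℂ :=
  (∫ x in (-2 : ℝ)..2, F (x - r * Complex.I)) +
  (∫ θ in (-(Real.pi / 2))..(Real.pi / 2),
    F (2 + r * Complex.exp (θ * Complex.I)) * (r * Complex.I * Complex.exp (θ * Complex.I))) -
  (∫ x in (-2 : ℝ)..2, F (x + r * Complex.I)) +
  (∫ θ in (Real.pi / 2)..(3 * Real.pi / 2),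
    F (-2 + r * Complex.exp (θ * Complex.I)) * (r * Complex.I * Complex.exp (θ * Complex.I)))

/-- The branch of `(z² - 4)^(1/2)` that is analytic off `σ` and asymptotic to `z` at infinity. -/
def sqrtX (z : ℂ) : ℂ := (z - 2) ^ (1 / 2 : ℂ) * (z + 2) ^ (1 / 2 : ℂ)

/-- The function `P(z) = (1/π) ∫_{-2}^{2} (W'(z) - W'(x)) / ((z - x) √(4 - x²)) dx`, where `W` is
the analytic continuation of the potential. -/
def P (W : ℂ → ℂ) (z : ℂ) : ℂ :=
  (1 / Real.pi : ℂ) * ∫ x in (-2 : ℝ)..2,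
    (deriv W z - deriv W x) / ((z - x) * (Real.sqrt (4 - x ^ 2) : ℂ))

/-- The Stieltjes transform `g(z) = ∫ ρ(x) / (z - x) dx`. -/
def stieltjes (ρ : ℝ → ℝ) (z : ℂ) : ℂ := ∫ x : ℝ, (ρ x : ℂ) / (z - x)

/-- The double contour integral
`(2πi)⁻² ∮_{dist = 2d} f(z) / X^{1/2}(z) ∮_{dist = d} g'(ζ) / (P(ζ) (ζ - z)) dζ dz`. -/
def correction (W : ℂ → ℂ) (ρ : ℝ → ℝ) (d : ℝ) (f : ℂ → ℂ) : ℂ :=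
  1 / (2 * Real.pi * Complex.I) ^ 2 *
    contourIntegral (2 * d) fun z => f z / sqrtX z *
      contourIntegral d fun ζ => deriv (stieltjes ρ) ζ / (P W ζ * (ζ - z))

end

end BetaEnsemble

/-! Let g be the Stieltjes transform of the equilibrium measure μ and m(z) = ∑ 1/(z - λᵢ) - n g(z).
By Cauchy's formula a centred linear statistic of a function analytic near the cut is a contour
integral of f·m. It therefore suffices to control the mean and the second moment of m at a positive
distance from the cut, and to show that eigenvalues away from the cut contribute exponentially
little.

A priori bound. The terms of order n² in the exponent of the density cancel against Jensen's lower
bound for the normalising constant with trial measure μⁿ, because μ is extremal. What remains is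
-β/2 times a regularised logarithmic energy of ∑ δ_{λᵢ} - n μ, the `discrepancy`, plus O(n log n)
(`exists_weight_le`). Hence the discrepancy is O(n log n) up to an exponentially small probability
(`exists_law_discrepancy_le`). The energy is a superposition of positive definite Cauchy kernels, so
it bounds |Im z| |m(z)| (`sq_im_mul_sq_resolventFluct_le`), and a maximum principle turns this into
m = O(n^(5/8)) off the cut (`BoundedDensity.exists_resolventFluct_le`). The discrepancy also
controls the conditional density of one eigenvalue given the others, which confines the eigenvalues
to a neighbourhood of [-2, 2] (`exists_typicalSet`, `exists_tail_bound`).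

Loop equation. Integration by parts against a test function h yields an exact identity
(`EquilibriumSetting.integral_loopFunctional_law`). Since 2g - W' = -P √(z² - 4), the choice h(ζ) =
1/(P(ζ)(z - ζ)) inverts its linear part explicitly: that part becomes -(β/2) n √(z² - 4) m(z)
(`loop_sum_eq`). The rest is quadratic in m or carries the factor 1 - β/2, and the latter produces
the deterministic correction. Correlating the equation with the conjugate of m(z), and using the a
priori bound for one factor of the cubic term, improves the bound on E|m|² by n^(-3/8). Four rounds,
on contours that are moved slightly each time, give a bounded second moment
(`exists_second_moment_le`). The loop equation itself then gives the mean with error O(1/n)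
(`exists_mean_bound`).

Integration over the contour transfers this to linear statistics (`exists_fluct_bound`). The
exceptional configurations are added back through the exponential tail bounds
(`exists_linStat_bound`). -/

open scoped Topology NNReal ENNReal ComplexConjugate

/-! ### Logarithmic potentials of measures with bounded density. -/

namespace BetaEnsemble

/-- `½ log (x² + η²)`, a smoothing of `log |x|`. -/
noncomputable def smoothLog (η x : ℝ) : ℝ := Real.log (x ^ 2 + η ^ 2) / 2

/-- The logarithmic potential of a measure. -/
noncomputable def logPot (μ : Measure ℝ) (x : ℝ) : ℝ := ∫ y, Real.log |y - x| ∂μ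

/-- Probability measures on `[-2, 2]` with density at most `b`. -/
structure BoundedDensity (μ : Measure ℝ) (b : ℝ≥0) : Prop where
  prob : IsProbabilityMeasure μ
  ae_mem : ∀ᵐ x ∂μ, x ∈ Set.Icc (-2 : ℝ) 2
  le_smul : μ ≤ (b : ℝ≥0∞) • volume

lemma lintegral_inv_sqrt_lt_top :
    ∫⁻ u in Set.Icc (-1 : ℝ) 1, ENNReal.ofReal (√|u|)⁻¹ < ∞ := by
  have h1 : IntervalIntegrable (fun u : ℝ => u ^ (-(1 / 2) : ℝ)) volume 0 1 :=
    intervalIntegral.intervalIntegrable_rpow' (by norm_num)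
  have h2 : IntervalIntegrable (fun u : ℝ => (√|u|)⁻¹) volume 0 1 := by
    refine h1.congr ?_
    intro u hu
    rw [Set.uIoc_of_le zero_le_one] at hu
    simp only
    rw [abs_of_pos hu.1, Real.rpow_neg hu.1.le, ← Real.sqrt_eq_rpow]
  have h3 : IntervalIntegrable (fun u : ℝ => (√|u|)⁻¹) volume (-1) 0 := by
    have := (IntervalIntegrable.iff_comp_neg (f := fun u : ℝ => (√|u|)⁻¹) (a := 0) (b := 1)).1 h2
    simpa using this.symm
  have h4 := (h3.trans h2)
  rw [intervalIntegrable_iff_integrableOn_Icc_of_le (by norm_num)] at h4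
  have := h4.2
  rw [hasFiniteIntegral_iff_ofReal (Filter.Eventually.of_forall fun u => by positivity)] at this
  exact this

/-- The kernel within distance 1 of its pole is charged to Lebesgue measure, which is translation
invariant, so the bound does not depend on x. The power -1/2 dominates the logarithmic singularity
and measures the error made by smoothing it. -/
lemma BoundedDensity.exists_inv_sqrt_bound {μ : Measure ℝ} {b : ℝ≥0} (h : BoundedDensity μ b) :
    ∃ C : ℝ, 0 < C ∧ ∀ x, Integrable (fun y => (√|y - x|)⁻¹) μ ∧ ∫ y, (√|y - x|)⁻¹ ∂μ ≤ C := by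
  have := h.prob
  set c := ∫⁻ u in Set.Icc (-1 : ℝ) 1, ENNReal.ofReal (√|u|)⁻¹ with hc
  have hctop : c < ∞ := lintegral_inv_sqrt_lt_top
  have hm : Measurable fun u : ℝ => ENNReal.ofReal (√|u|)⁻¹ := by fun_prop
  have key : ∀ x, ∫⁻ y, ENNReal.ofReal (√|y - x|)⁻¹ ∂μ ≤ 1 + b * c := by
    intro x
    have h1 : ∀ u : ℝ, ENNReal.ofReal (√|u|)⁻¹ ≤
        1 + (Set.Icc (-1 : ℝ) 1).indicator (fun u => ENNReal.ofReal (√|u|)⁻¹) u := by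
      intro u
      by_cases hu : u ∈ Set.Icc (-1 : ℝ) 1
      · rw [Set.indicator_of_mem hu]; exact le_add_self
      · rw [Set.indicator_of_notMem hu, add_zero]
        have h1 : 1 ≤ |u| := by
          by_contra hlt
          push Not at hlt
          exact hu (by rw [abs_lt] at hlt; exact ⟨hlt.1.le, hlt.2.le⟩)
        rw [ENNReal.ofReal_le_one]
        apply inv_le_one_of_one_le₀
        rw [Real.one_le_sqrt]; exact h1
    calc ∫⁻ y, ENNReal.ofReal (√|y - x|)⁻¹ ∂μ
        ≤ ∫⁻ y, (1 + (Set.Icc (-1 : ℝ) 1).indicator (fun u => ENNReal.ofReal (√|u|)⁻¹) (y - x)) ∂μ :=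
          lintegral_mono fun y => h1 _
      _ = 1 + ∫⁻ y, (Set.Icc (-1 : ℝ) 1).indicator (fun u => ENNReal.ofReal (√|u|)⁻¹) (y - x) ∂μ := by
          rw [lintegral_add_left (by fun_prop)]; simp
      _ ≤ 1 + ∫⁻ y, (Set.Icc (-1 : ℝ) 1).indicator (fun u => ENNReal.ofReal (√|u|)⁻¹) (y - x)
            ∂((b : ℝ≥0∞) • volume) := by
          gcongr; exact h.le_smul
      _ = 1 + b * c := by
          rw [lintegral_smul_measure,
            lintegral_sub_right_eq_self (fun y => (Set.Icc (-1 : ℝ) 1).indicator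
              (fun u => ENNReal.ofReal (√|u|)⁻¹) y) x,
            lintegral_indicator measurableSet_Icc, smul_eq_mul]
  have hfin : (1 + b * c : ℝ≥0∞) < ∞ := by
    refine ENNReal.add_lt_top.2 ⟨ENNReal.one_lt_top, ENNReal.mul_lt_top ENNReal.coe_lt_top hctop⟩
  refine ⟨(1 + b * c : ℝ≥0∞).toReal, ENNReal.toReal_pos (by simp) hfin.ne, fun x => ?_⟩
  have hnn : 0 ≤ᵐ[μ] fun y => (√|y - x|)⁻¹ := Filter.Eventually.of_forall fun u => by positivity
  have hms : AEStronglyMeasurable (fun y => (√|y - x|)⁻¹) μ := by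
    apply Measurable.aestronglyMeasurable; fun_prop
  refine ⟨⟨hms, ?_⟩, ?_⟩
  · rw [hasFiniteIntegral_iff_ofReal hnn]
    exact (key x).trans_lt hfin
  · rw [integral_eq_lintegral_of_nonneg_ae hnn hms]
    exact ENNReal.toReal_mono hfin.ne (key x)

lemma log_le_two_mul_sqrt {t : ℝ} (ht : 0 < t) : Real.log t ≤ 2 * √t := by
  have h1 : Real.log (√t) ≤ √t := (Real.log_le_sub_one_of_pos (Real.sqrt_pos.2 ht)).trans (by linarith)
  rw [Real.log_sqrt ht.le] at h1
  linarith

lemma log_one_add_sq_le {t : ℝ} (ht : 0 ≤ t) : Real.log (1 + t ^ 2) / 2 ≤ 2 * √t := by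
  have h1 : Real.log (1 + t ^ 2) ≤ Real.log ((1 + √t) ^ 4) := by
    apply Real.log_le_log (by positivity)
    have h2 : √t ^ 2 = t := Real.sq_sqrt ht
    have h3 := Real.sqrt_nonneg t
    have : t ^ 2 = (√t) ^ 4 := by rw [show (√t) ^ 4 = (√t ^ 2) ^ 2 by ring, h2]
    rw [this]
    nlinarith [pow_nonneg h3 3, pow_nonneg h3 2]
  rw [Real.log_pow] at h1
  have h4 : Real.log (1 + √t) ≤ √t := by
    have := Real.log_le_sub_one_of_pos (show 0 < 1 + √t by positivity)
    linarith
  push_cast at h1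
  linarith

lemma abs_log_abs_le {u : ℝ} (hu : u ≠ 0) : |Real.log (|u|)| ≤ |u| + 2 * (√|u|)⁻¹ := by
  have h0 : 0 < |u| := abs_pos.2 hu
  have h1 := Real.log_le_sub_one_of_pos h0
  have h2 := log_le_two_mul_sqrt (inv_pos.2 h0)
  rw [Real.log_inv, Real.sqrt_inv] at h2
  have : 0 ≤ (√|u|)⁻¹ := by positivity
  rw [abs_le]; constructor <;> linarith

lemma log_abs_le_smoothLog {η u : ℝ} (hu : u ≠ 0) : Real.log |u| ≤ smoothLog η u := by
  unfold smoothLog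
  have : Real.log (|u| ^ 2) ≤ Real.log (u ^ 2 + η ^ 2) :=
    Real.log_le_log (by positivity) (by rw [sq_abs]; nlinarith [sq_nonneg η])
  rw [Real.log_pow] at this
  push_cast at this
  linarith

/-- The error is ½ log(1 + η²/u²), which is at most a multiple of √(η/|u|). This is integrable
against a bounded density and gains a power of η. -/
lemma smoothLog_le {η u : ℝ} (hη : 0 < η) (hu : u ≠ 0) :
    smoothLog η u ≤ Real.log |u| + 2 * √η * (√|u|)⁻¹ := by
  have h0 : 0 < |u| := abs_pos.2 hu
  have h1 := log_one_add_sq_le (t := η / |u|) (by positivity)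
  rw [Real.sqrt_div hη.le, div_pow, sq_abs] at h1
  have h2 : Real.log (u ^ 2 + η ^ 2) = Real.log (|u| ^ 2) + Real.log (1 + η ^ 2 / u ^ 2) := by
    rw [sq_abs, ← Real.log_mul (by positivity) (by positivity)]
    congr 1; field_simp
  rw [Real.log_pow] at h2
  unfold smoothLog
  rw [h2]
  push_cast
  rw [div_eq_mul_inv (√η)] at h1
  linarith

namespace BoundedDensity

variable {μ : Measure ℝ} {b : ℝ≥0} (h : BoundedDensity μ b)
include h

lemma absolutelyContinuous : μ ≪ volume :=
  Measure.absolutelyContinuous_of_le_smul h.le_smul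

lemma ae_ne (x : ℝ) : ∀ᵐ y ∂μ, y - x ≠ 0 := by
  have : ∀ᵐ y : ℝ, y ≠ x := by
    rw [ae_iff]; simp
  filter_upwards [h.absolutelyContinuous.ae_le this] with y hy using sub_ne_zero.2 hy

lemma integrable_log (x : ℝ) : Integrable (fun y => Real.log |y - x|) μ := by
  have := h.prob
  obtain ⟨C, hC, hC'⟩ := h.exists_inv_sqrt_bound
  refine Integrable.mono' (g := fun y => (2 + |x|) + 2 * (√|y - x|)⁻¹)
    ((integrable_const _).add ((hC' x).1.const_mul 2)) ?_ ?_
  · apply Measurable.aestronglyMeasurable; fun_prop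
  · filter_upwards [h.ae_ne x, h.ae_mem] with y hy hy2
    have := abs_log_abs_le hy
    have h3 : |y - x| ≤ 2 + |x| := (abs_sub y x).trans (by
      have : |y| ≤ 2 := abs_le.2 hy2
      linarith)
    rw [Real.norm_eq_abs]; linarith

omit h in
lemma continuous_smoothLog {η : ℝ} (hη : 0 < η) : Continuous (smoothLog η) := by
  unfold smoothLog
  refine (Continuous.log (by fun_prop) fun x => ?_).div_const _
  positivity

omit h in
lemma abs_smoothLog_le {η u R : ℝ} (hη : 0 < η) (hu : |u| ≤ R) :
    |smoothLog η u| ≤ |Real.log η| + |Real.log (R ^ 2 + η ^ 2)| := by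
  have h1 : Real.log (η ^ 2) ≤ Real.log (u ^ 2 + η ^ 2) :=
    Real.log_le_log (by positivity) (by nlinarith [sq_nonneg u])
  have h2 : Real.log (u ^ 2 + η ^ 2) ≤ Real.log (R ^ 2 + η ^ 2) := by
    apply Real.log_le_log (by positivity)
    have := sq_le_sq' (by linarith [abs_nonneg u, neg_abs_le u]) hu
    rw [sq_abs] at this; linarith
  rw [Real.log_pow] at h1
  push_cast at h1
  unfold smoothLog
  have h3 := le_abs_self (Real.log (R ^ 2 + η ^ 2))
  have h4 := neg_abs_le (Real.log η)
  have h5 := abs_nonneg (Real.log η)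
  have h6 := abs_nonneg (Real.log (R ^ 2 + η ^ 2))
  rw [abs_le]; constructor <;> linarith

lemma integrable_of_continuous {E : Type*} [NormedAddCommGroup E] [SecondCountableTopology E]
    {f : ℝ → E} (hf : ContinuousOn f (Set.Icc (-2) 2)) : Integrable f μ := by
  have := h.prob
  have hr : μ.restrict (Set.Icc (-2 : ℝ) 2) = μ := Measure.restrict_eq_self_of_ae_mem h.ae_mem
  rw [← hr]
  exact hf.integrableOn_compact isCompact_Icc

lemma integrable_smoothLog {η : ℝ} (hη : 0 < η) (x : ℝ) :
    Integrable (fun y => smoothLog η (y - x)) μ :=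
  h.integrable_of_continuous ((continuous_smoothLog hη).comp (by fun_prop)).continuousOn

lemma logPot_le_smoothLog {η : ℝ} (hη : 0 < η) (x : ℝ) :
    logPot μ x ≤ ∫ y, smoothLog η (y - x) ∂μ := by
  refine integral_mono_ae (h.integrable_log x) (h.integrable_smoothLog hη x) ?_
  filter_upwards [h.ae_ne x] with y hy using log_abs_le_smoothLog hy

lemma exists_smoothLog_le : ∃ C : ℝ, 0 < C ∧ ∀ η > 0, ∀ x,
    ∫ y, smoothLog η (y - x) ∂μ ≤ logPot μ x + C * √η := by
  obtain ⟨C, hC, hC'⟩ := h.exists_inv_sqrt_bound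
  refine ⟨2 * C, by positivity, fun η hη x => ?_⟩
  have h1 : ∫ y, smoothLog η (y - x) ∂μ ≤ ∫ y, (Real.log |y - x| + 2 * √η * (√|y - x|)⁻¹) ∂μ := by
    refine integral_mono_ae (h.integrable_smoothLog hη x)
      ((h.integrable_log x).add ((hC' x).1.const_mul _)) ?_
    filter_upwards [h.ae_ne x] with y hy using smoothLog_le hη hy
  rw [integral_add (h.integrable_log x) ((hC' x).1.const_mul _), integral_const_mul] at h1
  have := (hC' x).2
  have h2 : 0 ≤ 2 * √η := by positivity
  unfold logPot
  nlinarith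

lemma continuous_integral_sub {κ : ℝ → ℝ} (hκ : Continuous κ) :
    Continuous fun x => ∫ y, κ (y - x) ∂μ := by
  have := h.prob
  rw [continuous_iff_continuousAt]
  intro x₀
  obtain ⟨C, hC⟩ := (isCompact_Icc (a := -(3 + |x₀|)) (b := 3 + |x₀|)).exists_bound_of_continuousOn
    hκ.continuousOn
  refine continuousAt_of_dominated (bound := fun _ => C) ?_ ?_ (integrable_const _) ?_
  · exact Filter.Eventually.of_forall fun x => (hκ.comp (by fun_prop)).aestronglyMeasurable
  · filter_upwards [Metric.ball_mem_nhds x₀ one_pos] with x hx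
    filter_upwards [h.ae_mem] with y hy
    apply hC
    rw [Metric.mem_ball, Real.dist_eq, abs_lt] at hx
    have h1 := le_abs_self x₀
    have h2 := neg_abs_le x₀
    constructor <;> linarith [hy.1, hy.2]
  · exact Filter.Eventually.of_forall fun y => (hκ.comp (by fun_prop)).continuousAt

/-- The smoothed potentials are continuous and converge uniformly, at rate √η. -/
lemma continuous_logPot : Continuous (logPot μ) := by
  obtain ⟨C, hC, hC'⟩ := h.exists_smoothLog_le
  have h1 : TendstoUniformly (fun (η : ℝ) x => ∫ y, smoothLog η (y - x) ∂μ) (logPot μ)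
      (𝓝[>] (0 : ℝ)) := by
    rw [Metric.tendstoUniformly_iff]
    intro ε hε
    have h2 : Filter.Tendsto (fun η : ℝ => C * √η) (𝓝[>] 0) (𝓝 0) := by
      have : Continuous fun η : ℝ => C * √η := by fun_prop
      have := this.tendsto 0
      simp only [Real.sqrt_zero, mul_zero] at this
      exact this.mono_left nhdsWithin_le_nhds
    filter_upwards [h2.eventually (gt_mem_nhds hε), self_mem_nhdsWithin] with η h3 hη x
    rw [dist_comm, Real.dist_eq, abs_lt]
    have := hC' η hη x
    have := h.logPot_le_smoothLog hη x
    constructor <;> linarith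
  refine h1.continuous (Filter.Eventually.frequently ?_)
  filter_upwards [self_mem_nhdsWithin] with η hη
  exact h.continuous_integral_sub (continuous_smoothLog hη)

/-- Near the support the negative part of the logarithm is absorbed by the inverse square root. For
|x| > 3 one has |y - x| ≥ |x| - 2 ≥ (1 + |x|)/4. The bound serves to compare products of 1 + |λⱼ|
with exponentials of the potential. -/
lemma exists_logPot_ge : ∃ C : ℝ, 0 < C ∧ ∀ x, Real.log (1 + |x|) - C ≤ logPot μ x := by
  have := h.prob
  obtain ⟨C, hC, hC'⟩ := h.exists_inv_sqrt_bound
  refine ⟨Real.log 4 + 2 * C, by positivity, fun x => ?_⟩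
  have hlog4 : 0 < Real.log 4 := Real.log_pos (by norm_num)
  by_cases hx : |x| ≤ 3
  · have h1 : ∫ y, (-2 * (√|y - x|)⁻¹) ∂μ ≤ logPot μ x := by
      refine integral_mono_ae ((hC' x).1.const_mul _) (h.integrable_log x) ?_
      filter_upwards [h.ae_ne x] with y hy
      have h0 : 0 < |y - x| := abs_pos.2 hy
      have h2 := log_le_two_mul_sqrt (inv_pos.2 h0)
      rw [Real.log_inv, Real.sqrt_inv] at h2
      linarith
    rw [integral_const_mul] at h1
    have h2 : Real.log (1 + |x|) ≤ Real.log 4 := Real.log_le_log (by positivity) (by linarith)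
    linarith [(hC' x).2]
  · push Not at hx
    have h1 : ∫ y, (Real.log (1 + |x|) - Real.log 4) ∂μ ≤ logPot μ x := by
      refine integral_mono_ae (integrable_const _) (h.integrable_log x) ?_
      filter_upwards [h.ae_mem] with y hy
      rw [← Real.log_div (by positivity) (by norm_num)]
      apply Real.log_le_log (by positivity)
      have : |x| - |y| ≤ |y - x| := by rw [abs_sub_comm]; exact abs_sub_abs_le_abs_sub x y
      have h2 : |y| ≤ 2 := abs_le.2 hy
      linarith
    rw [integral_const] at h1
    simp at h1
    linarith

/-- The outer measure that defines a product is determined by its values on boxes, where the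
comparison holds factor by factor. -/
lemma pi_le_smul (n : ℕ) :
    Measure.pi (fun _ : Fin n => μ) ≤ ((b : ℝ≥0∞) ^ n) • (volume : Measure (Fin n → ℝ)) := by
  have := h.prob
  have h1 : (Measure.pi (fun _ : Fin n => μ)).toOuterMeasure ≤
      OuterMeasure.pi fun _ : Fin n => ((b : ℝ≥0∞) • (volume : Measure ℝ)).toOuterMeasure := by
    rw [OuterMeasure.le_pi]
    intro s _
    calc (Measure.pi fun _ : Fin n => μ) (Set.univ.pi s) = ∏ i, μ (s i) := Measure.pi_pi _ _
      _ ≤ _ := Finset.prod_le_prod' fun i _ => h.le_smul (s i)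
  have h2 : Measure.pi (fun _ : Fin n => (b : ℝ≥0∞) • (volume : Measure ℝ)) =
      ((b : ℝ≥0∞) ^ n) • (volume : Measure (Fin n → ℝ)) := by
    have : SigmaFinite ((b : ℝ≥0∞) • (volume : Measure ℝ)) :=
      inferInstanceAs (SigmaFinite (b • (volume : Measure ℝ)))
    refine Measure.pi_eq (μ := fun _ : Fin n => (b : ℝ≥0∞) • (volume : Measure ℝ)) fun s _ => ?_
    simp [volume_pi, Finset.prod_mul_distrib]
  rw [← h2]
  refine Measure.le_iff.2 fun s hs => (h1 s).trans_eq ?_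
  rw [Measure.pi_def]
  exact (toMeasure_apply _ (Measure.pi_caratheodory _) hs).symm

end BoundedDensity

end BetaEnsemble

/-! ### The unnormalised density: factorisations and domination. -/

namespace BetaEnsemble

/-- The unnormalised density with `|λᵢ - λⱼ|` replaced by `((λᵢ - λⱼ)² + δ²)^(1/2)`. -/
noncomputable def regWeight (V : ℝ → ℝ) (β : ℝ) (n : ℕ) (δ : ℝ) (l : Fin n → ℝ) : ℝ :=
  (∏ i, Real.exp (-((n : ℝ) * β * V (l i) / 2))) *
    ∏ i, ∏ j ∈ ({i}ᶜ : Finset (Fin n)), ((l i - l j) ^ 2 + δ ^ 2) ^ (β / 4)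

/-- The dependence of the unnormalised density on a single eigenvalue. -/
noncomputable def condWeight (V : ℝ → ℝ) (β : ℝ) (n : ℕ) (l : Fin n → ℝ) (i : Fin n) (x : ℝ) : ℝ :=
  Real.exp (-((n : ℝ) * β * V x / 2)) * ∏ j ∈ ({i}ᶜ : Finset (Fin n)), |x - l j| ^ β

section weight

variable {V : ℝ → ℝ} {β : ℝ} {n : ℕ}

lemma weight_nonneg (l : Fin n → ℝ) : 0 ≤ weight V β n l := by
  unfold weight; positivity

lemma regWeight_nonneg (δ : ℝ) (l : Fin n → ℝ) : 0 ≤ regWeight V β n δ l := by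
  unfold regWeight; positivity

/-- Running over ordered pairs counts each factor twice and halves the exponent. The symmetric form
makes it easy to isolate or differentiate in a single eigenvalue. -/
lemma weight_eq_offDiag (l : Fin n → ℝ) : weight V β n l =
    (∏ i, Real.exp (-((n : ℝ) * β * V (l i) / 2))) *
      ∏ i, ∏ j ∈ ({i}ᶜ : Finset (Fin n)), |l i - l j| ^ (β / 2) := by
  unfold weight
  congr 1
  have := Finset.prod_prod_Ioi_mul_eq_prod_prod_off_diag fun i j : Fin n => |l j - l i| ^ (β / 2)
  rw [← this]
  refine Finset.prod_congr rfl fun i _ => Finset.prod_congr rfl fun j _ => ?_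
  rw [abs_sub_comm (l j), ← Real.mul_rpow (abs_nonneg _) (abs_nonneg _), ← sq,
    ← Real.rpow_natCast, ← Real.rpow_mul (abs_nonneg _)]
  congr 1; push_cast; ring

lemma regWeight_zero (l : Fin n → ℝ) : regWeight V β n 0 l = weight V β n l := by
  rw [weight_eq_offDiag, regWeight]
  congr 1
  refine Finset.prod_congr rfl fun i _ => Finset.prod_congr rfl fun j _ => ?_
  rw [← sq_abs (l i - l j), zero_pow two_ne_zero, add_zero, ← Real.rpow_natCast,
    ← Real.rpow_mul (abs_nonneg _)]
  congr 1; push_cast; ring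

lemma weight_eq_zero_of_eq (hβ : 0 < β) {l : Fin n → ℝ} {i j : Fin n} (hij : i ≠ j)
    (h : l i = l j) : weight V β n l = 0 := by
  rw [weight_eq_offDiag]
  apply mul_eq_zero_of_right
  refine Finset.prod_eq_zero (Finset.mem_univ i) (Finset.prod_eq_zero (i := j) ?_ ?_)
  · simpa using hij.symm
  · rw [h, sub_self, abs_zero, Real.zero_rpow (by positivity)]

/-- The diagonal terms are `Real.log 0 = 0`, so the full double sum may be used. -/
lemma weight_eq_exp {l : Fin n → ℝ} (hl : Function.Injective l) : weight V β n l =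
    Real.exp (-((n : ℝ) * β / 2 * ∑ i, V (l i)) + β / 2 * ∑ i, ∑ j, Real.log |l i - l j|) := by
  rw [weight_eq_offDiag, Real.exp_add]
  congr 1
  · rw [← Real.exp_sum, Finset.mul_sum, ← Finset.sum_neg_distrib]
    congr 1
    exact Finset.sum_congr rfl fun i _ => by ring
  · rw [Finset.mul_sum, Real.exp_sum]
    refine Finset.prod_congr rfl fun i _ => ?_
    have : ∑ j, Real.log |l i - l j| = ∑ j ∈ ({i}ᶜ : Finset (Fin n)), Real.log |l i - l j| := by
      rw [Fintype.sum_eq_add_sum_compl i]; simp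
    rw [this, Finset.mul_sum, Real.exp_sum]
    refine Finset.prod_congr rfl fun j hj => ?_
    have hne : l i - l j ≠ 0 := sub_ne_zero.2 fun h => by
      simp at hj; exact hj (hl h.symm)
    rw [Real.rpow_def_of_pos (abs_pos.2 hne), mul_comm]

lemma continuous_weight (hβ : 0 < β) (hV : Continuous V) : Continuous (weight V β n) := by
  unfold weight
  refine Continuous.mul ?_ ?_
  · fun_prop
  · refine continuous_finsetProd _ fun i _ => continuous_finsetProd _ fun j _ => ?_
    exact Continuous.rpow_const (by fun_prop) fun _ => Or.inr hβ.le

lemma continuous_regWeight (hβ : 0 < β) (hV : Continuous V) (δ : ℝ) :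
    Continuous (regWeight V β n δ) := by
  unfold regWeight
  refine Continuous.mul ?_ ?_
  · fun_prop
  · refine continuous_finsetProd _ fun i _ => continuous_finsetProd _ fun j _ => ?_
    exact Continuous.rpow_const (by fun_prop) fun _ => Or.inr (by positivity)

/-- The factors that do not involve the i-th eigenvalue form the constant. It may vanish, when two
of the other eigenvalues coincide. -/
lemma exists_weight_update (l : Fin n → ℝ) (i : Fin n) : ∃ c : ℝ, 0 ≤ c ∧
    ∀ x, weight V β n (Function.update l i x) = c * condWeight V β n l i x := by
  classical
  refine ⟨(∏ k ∈ ({i}ᶜ : Finset (Fin n)), Real.exp (-((n : ℝ) * β * V (l k) / 2))) *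
    ∏ k ∈ ({i}ᶜ : Finset (Fin n)), ∏ m ∈ ({k}ᶜ : Finset (Fin n)).erase i, |l k - l m| ^ (β / 2),
    by positivity, fun x => ?_⟩
  rw [weight_eq_offDiag, condWeight, Fintype.prod_eq_mul_prod_compl i,
    Fintype.prod_eq_mul_prod_compl i (fun k => ∏ m ∈ ({k}ᶜ : Finset (Fin n)),
      |Function.update l i x k - Function.update l i x m| ^ (β / 2))]
  have h1 : ∏ k ∈ ({i}ᶜ : Finset (Fin n)),
      Real.exp (-((n : ℝ) * β * V (Function.update l i x k) / 2)) =
      ∏ k ∈ ({i}ᶜ : Finset (Fin n)), Real.exp (-((n : ℝ) * β * V (l k) / 2)) := by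
    refine Finset.prod_congr rfl fun k hk => ?_
    rw [Function.update_of_ne (by simpa using hk)]
  have h2 : ∏ m ∈ ({i}ᶜ : Finset (Fin n)),
      |Function.update l i x i - Function.update l i x m| ^ (β / 2) =
      ∏ m ∈ ({i}ᶜ : Finset (Fin n)), |x - l m| ^ (β / 2) := by
    refine Finset.prod_congr rfl fun k hk => ?_
    rw [Function.update_self, Function.update_of_ne (by simpa using hk)]
  have h3 : ∏ k ∈ ({i}ᶜ : Finset (Fin n)), ∏ m ∈ ({k}ᶜ : Finset (Fin n)),
      |Function.update l i x k - Function.update l i x m| ^ (β / 2) =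
      (∏ k ∈ ({i}ᶜ : Finset (Fin n)), |x - l k| ^ (β / 2)) *
      ∏ k ∈ ({i}ᶜ : Finset (Fin n)), ∏ m ∈ ({k}ᶜ : Finset (Fin n)).erase i,
        |l k - l m| ^ (β / 2) := by
    rw [← Finset.prod_mul_distrib]
    refine Finset.prod_congr rfl fun k hk => ?_
    have hk' : k ≠ i := by simpa using hk
    rw [← Finset.mul_prod_erase _ _ (show i ∈ ({k}ᶜ : Finset (Fin n)) by simpa using hk'.symm)]
    congr 1
    · rw [Function.update_self, Function.update_of_ne hk', abs_sub_comm]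
    · refine Finset.prod_congr rfl fun m hm => ?_
      rw [Function.update_of_ne hk', Function.update_of_ne (Finset.ne_of_mem_erase hm)]
  have h4 : ∏ j ∈ ({i}ᶜ : Finset (Fin n)), |x - l j| ^ β =
      (∏ m ∈ ({i}ᶜ : Finset (Fin n)), |x - l m| ^ (β / 2)) *
      ∏ m ∈ ({i}ᶜ : Finset (Fin n)), |x - l m| ^ (β / 2) := by
    rw [← Finset.prod_mul_distrib]
    refine Finset.prod_congr rfl fun m _ => ?_
    rw [← sq, ← Real.rpow_natCast, ← Real.rpow_mul (abs_nonneg _)]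
    congr 1; push_cast; ring
  rw [h1, h2, h3, h4, Function.update_self]
  ring

/-- Each `a i` sits in 2(n - 1) ordered pairs. In the proof the inner product is completed to one
over all j, which lowers the exponent of the outer factor from n - 1 to n - 2. -/
lemma prod_offDiag_mul_rpow {a : Fin n → ℝ} (ha : ∀ i, 0 < a i) (s : ℝ) :
    ∏ i, ∏ j ∈ ({i}ᶜ : Finset (Fin n)), (a i * a j) ^ (s / 2) = ∏ i, a i ^ (s * ((n : ℝ) - 1)) := by
  have h1 : ∀ i, ∏ j ∈ ({i}ᶜ : Finset (Fin n)), (a i * a j) ^ (s / 2) =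
      a i ^ (s / 2 * ((n : ℝ) - 2)) * ∏ j, a j ^ (s / 2) := by
    intro i
    have h2 : ∏ j ∈ ({i}ᶜ : Finset (Fin n)), (a i * a j) ^ (s / 2) =
        ∏ j ∈ ({i}ᶜ : Finset (Fin n)), (a i ^ (s / 2) * a j ^ (s / 2)) :=
      Finset.prod_congr rfl fun j _ => Real.mul_rpow (ha i).le (ha j).le
    rw [h2, Finset.prod_mul_distrib, Finset.prod_const, Fintype.prod_eq_mul_prod_compl i
      (fun j => a j ^ (s / 2)), ← mul_assoc]
    congr 1
    rw [Finset.card_compl, Finset.card_singleton, Fintype.card_fin, ← Real.rpow_natCast,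
      ← Real.rpow_mul (ha i).le, ← Real.rpow_add (ha i)]
    congr 1
    have : 1 ≤ n := Nat.one_le_iff_ne_zero.2 fun h => by subst h; exact i.elim0
    push_cast [this]; ring
  rw [Finset.prod_congr rfl fun i _ => h1 i, Finset.prod_mul_distrib, Finset.prod_const,
    Finset.card_univ, Fintype.card_fin, ← Finset.prod_pow, ← Finset.prod_mul_distrib]
  refine Finset.prod_congr rfl fun i _ => ?_
  rw [← Real.rpow_natCast, ← Real.rpow_mul (ha i).le, ← Real.rpow_add (ha i)]
  congr 1; ring

/-- Since |x - y|² + δ² ≤ ((1 + |x|)(1 + |y|))², the density is dominated by a product of functions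
of one variable, uniformly in δ. This reduces integrability and dominated convergence to one
dimension. -/
lemma regWeight_le (hβ : 0 < β) {δ : ℝ} (hδ : |δ| ≤ 1) (l : Fin n → ℝ) : regWeight V β n δ l ≤
    ∏ i, (Real.exp (-((n : ℝ) * β * V (l i) / 2)) * (1 + |l i|) ^ (β * ((n : ℝ) - 1))) := by
  rw [Finset.prod_mul_distrib,
    ← prod_offDiag_mul_rpow (a := fun i => 1 + |l i|) (fun i => by positivity), regWeight]
  refine mul_le_mul_of_nonneg_left ?_ (by positivity)
  refine Finset.prod_le_prod (fun i _ => Finset.prod_nonneg fun j _ => by positivity) fun i _ =>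
    Finset.prod_le_prod (fun j _ => by positivity) fun j _ => ?_
  have h1 : (l i - l j) ^ 2 + δ ^ 2 ≤ ((1 + |l i|) * (1 + |l j|)) ^ 2 := by
    have h2 : |l i - l j| ≤ |l i| + |l j| := abs_sub _ _
    have h3 : (l i - l j) ^ 2 ≤ (|l i| + |l j|) ^ 2 := by
      rw [← sq_abs]; gcongr
    have h4 : δ ^ 2 ≤ 1 := by rw [← sq_abs]; nlinarith [abs_nonneg δ]
    have h5 : 1 + (|l i| + |l j|) ≤ (1 + |l i|) * (1 + |l j|) := by
      nlinarith [abs_nonneg (l i), abs_nonneg (l j), mul_nonneg (abs_nonneg (l i)) (abs_nonneg (l j))]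
    have h6 : (1 + (|l i| + |l j|)) ^ 2 ≤ ((1 + |l i|) * (1 + |l j|)) ^ 2 := by gcongr
    nlinarith [abs_nonneg (l i), abs_nonneg (l j)]
  calc ((l i - l j) ^ 2 + δ ^ 2) ^ (β / 4) ≤ (((1 + |l i|) * (1 + |l j|)) ^ 2) ^ (β / 4) :=
        Real.rpow_le_rpow (by positivity) h1 (by positivity)
    _ = _ := by
        rw [← Real.rpow_natCast, ← Real.rpow_mul (by positivity)]
        congr 1; push_cast; ring

lemma condWeight_le (hβ : 0 < β) (l : Fin n → ℝ) (i : Fin n) (x : ℝ) : condWeight V β n l i x ≤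
    Real.exp (-((n : ℝ) * β * V x / 2)) * (1 + |x|) ^ (β * ((n : ℝ) - 1)) *
      Real.exp (β * ∑ j ∈ ({i}ᶜ : Finset (Fin n)), Real.log (1 + |l j|)) := by
  rw [condWeight, mul_assoc (Real.exp _)]
  refine mul_le_mul_of_nonneg_left ?_ (by positivity)
  have h1 : (1 + |x|) ^ (β * ((n : ℝ) - 1)) = ∏ j ∈ ({i}ᶜ : Finset (Fin n)), (1 + |x|) ^ β := by
    rw [Finset.prod_const, Finset.card_compl, Finset.card_singleton, Fintype.card_fin,
      ← Real.rpow_natCast, ← Real.rpow_mul (by positivity)]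
    congr 1
    have : 1 ≤ n := Nat.one_le_iff_ne_zero.2 fun h => by subst h; exact i.elim0
    push_cast [this]; ring
  rw [h1, Finset.mul_sum, Real.exp_sum, ← Finset.prod_mul_distrib]
  refine Finset.prod_le_prod (fun _ _ => by positivity) fun j _ => ?_
  have h2 : Real.exp (β * Real.log (1 + |l j|)) = (1 + |l j|) ^ β := by
    rw [Real.rpow_def_of_pos (by positivity), mul_comm]
  rw [h2, ← Real.mul_rpow (by positivity) (by positivity)]
  refine Real.rpow_le_rpow (abs_nonneg _) ?_ hβ.le
  have := abs_sub x (l j)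
  nlinarith [abs_nonneg x, abs_nonneg (l j), mul_nonneg (abs_nonneg x) (abs_nonneg (l j))]

end weight

/-! ### Integrability from the growth of the potential. -/

section growth

variable {V : ℝ → ℝ} {β ε L : ℝ}

/-- The envelope of the density of a single eigenvalue. -/
noncomputable def envelope (V : ℝ → ℝ) (β : ℝ) (n : ℕ) (κ x : ℝ) : ℝ :=
  Real.exp (-((n : ℝ) * β * V x / 2)) * (1 + |x|) ^ (β * ((n : ℝ) - 1)) * Real.exp (2 * κ * V x)

lemma envelope_nonneg (n : ℕ) (κ x : ℝ) : 0 ≤ envelope V β n κ x := by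
  unfold envelope; positivity

lemma continuous_envelope (hV : Continuous V) (n : ℕ) (κ : ℝ) :
    Continuous (envelope V β n κ) := by
  unfold envelope
  refine Continuous.mul (Continuous.mul (by fun_prop) ?_) (by fun_prop)
  exact Continuous.rpow_const (by fun_prop) fun x => Or.inl (by positivity)

/-- The number of eigenvalues beyond which `exp (2 κ V)` is integrable. -/
noncomputable def sizeThreshold (β ε κ : ℝ) : ℝ := (4 * κ * (1 + ε) + 2) / (ε * β) + 4 * κ / β

/-- The growth of V beats the factor (1 + |x|)^(β(n - 1)) by the power -εβn, up to a fixed exponent.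
A power -2 is set aside for integrability; the rest decreases in |x| and is evaluated at R, where it
decays exponentially in n. -/
lemma envelope_le (hβ : 0 < β) (hε : 0 < ε)
    (hgrowth : ∀ x : ℝ, L ≤ |x| → 2 * (1 + ε) * Real.log (1 + |x|) ≤ V x)
    {κ : ℝ} (hκ : 0 ≤ κ) {n : ℕ} (hn : sizeThreshold β ε κ ≤ n) {R x : ℝ} (hR : L ≤ R)
    (hR0 : 0 ≤ R) (hx : R ≤ |x|) :
    envelope V β n κ x ≤ (1 + R) ^ (-(ε * β * (n - sizeThreshold β ε κ))) * (1 + |x|) ^ (-2 : ℝ) := by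
  have hb : 0 < 1 + |x| := by positivity
  -- The second summand of `sizeThreshold` keeps the coefficient of V nonnegative, as needed to
  -- insert a lower bound for V.
  have hn2 : 4 * κ / β ≤ n := by
    have : 0 ≤ (4 * κ * (1 + ε) + 2) / (ε * β) := by positivity
    unfold sizeThreshold at hn; linarith
  have hs : 0 ≤ n * β / 2 - 2 * κ := by
    rw [div_le_iff₀ hβ] at hn2; linarith
  have h1 : envelope V β n κ x = (1 + |x|) ^ (β * ((n : ℝ) - 1)) *
      Real.exp (-((n * β / 2 - 2 * κ) * V x)) := by
    unfold envelope
    rw [mul_comm (Real.exp _), mul_assoc, ← Real.exp_add]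
    congr 2; ring
  have h2 : Real.exp (-((n * β / 2 - 2 * κ) * V x)) ≤
      (1 + |x|) ^ (-((n * β / 2 - 2 * κ) * (2 * (1 + ε)))) := by
    rw [Real.rpow_def_of_pos hb]
    apply Real.exp_le_exp.2
    have := mul_le_mul_of_nonneg_left (hgrowth x (hR.trans hx)) hs
    linarith
  have h3 : β * ((n : ℝ) - 1) + -((n * β / 2 - 2 * κ) * (2 * (1 + ε))) ≤
      -(ε * β * (n - sizeThreshold β ε κ)) + -2 := by
    have : ε * β * sizeThreshold β ε κ = 4 * κ * (1 + ε) + 2 + 4 * κ * ε := by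
      unfold sizeThreshold; field_simp
    have h4 : 0 ≤ 4 * κ * ε := by positivity
    nlinarith
  have h5 : 0 ≤ ε * β * (n - sizeThreshold β ε κ) := by
    have : 0 ≤ n - sizeThreshold β ε κ := by linarith
    positivity
  calc envelope V β n κ x ≤ (1 + |x|) ^ (β * ((n : ℝ) - 1)) *
        (1 + |x|) ^ (-((n * β / 2 - 2 * κ) * (2 * (1 + ε)))) := by
        rw [h1]; gcongr
    _ = (1 + |x|) ^ (β * ((n : ℝ) - 1) + -((n * β / 2 - 2 * κ) * (2 * (1 + ε)))) := by
        rw [Real.rpow_add hb]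
    _ ≤ (1 + |x|) ^ (-(ε * β * (n - sizeThreshold β ε κ)) + -2) :=
        Real.rpow_le_rpow_of_exponent_le (by linarith [abs_nonneg x]) h3
    _ = (1 + |x|) ^ (-(ε * β * (n - sizeThreshold β ε κ))) * (1 + |x|) ^ (-2 : ℝ) :=
        Real.rpow_add hb _ _
    _ ≤ _ := by
        gcongr ?_ * _
        exact Real.rpow_le_rpow_of_nonpos (by positivity) (by linarith) (by linarith)

lemma integrable_one_add_abs_rpow : Integrable fun x : ℝ => (1 + |x|) ^ (-2 : ℝ) := by
  have := integrable_one_add_norm (E := ℝ) (μ := volume) (r := 2) (by simp)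
  simpa using this

lemma integrable_envelope (hβ : 0 < β) (hε : 0 < ε) (hV : Continuous V)
    (hgrowth : ∀ x : ℝ, L ≤ |x| → 2 * (1 + ε) * Real.log (1 + |x|) ≤ V x)
    {κ : ℝ} (hκ : 0 ≤ κ) {n : ℕ} (hn : sizeThreshold β ε κ ≤ n) :
    Integrable (envelope V β n κ) := by
  have hc := continuous_envelope (β := β) hV n κ
  obtain ⟨C, hC⟩ := (isCompact_Icc (a := -|L|) (b := |L|)).exists_bound_of_continuousOn hc.continuousOn
  have h1 : Integrable (fun x : ℝ => (1 + |L|) ^ (-(ε * β * (n - sizeThreshold β ε κ))) *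
      (1 + |x|) ^ (-2 : ℝ) + (Set.Icc (-|L|) |L|).indicator (fun _ => C) x) := by
    refine (integrable_one_add_abs_rpow.const_mul _).add ?_
    exact (integrable_indicator_iff measurableSet_Icc).2 (by simp)
  refine h1.mono' hc.aestronglyMeasurable (Filter.Eventually.of_forall fun x => ?_)
  by_cases hx : x ∈ Set.Icc (-|L|) |L|
  · rw [Set.indicator_of_mem hx]
    have := hC x hx
    have h2 : 0 ≤ (1 + |L|) ^ (-(ε * β * (n - sizeThreshold β ε κ))) * (1 + |x|) ^ (-2 : ℝ) := by
      positivity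
    linarith
  · rw [Set.indicator_of_notMem hx, add_zero, Real.norm_of_nonneg (envelope_nonneg _ _ _)]
    refine envelope_le hβ hε hgrowth hκ hn (le_abs_self L) (abs_nonneg L) ?_
    by_contra hlt
    push Not at hlt
    exact hx (abs_le.1 hlt.le)

end growth

/-! ### The normalised law of the eigenvalues. -/

section law

variable {V : ℝ → ℝ} {β ε L : ℝ}

lemma integrable_prod_envelope (hβ : 0 < β) (hε : 0 < ε) (hV : Continuous V)
    (hgrowth : ∀ x : ℝ, L ≤ |x| → 2 * (1 + ε) * Real.log (1 + |x|) ≤ V x)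
    {n : ℕ} (hn : sizeThreshold β ε 0 ≤ n) :
    Integrable (fun l : Fin n → ℝ => ∏ i, envelope V β n 0 (l i)) :=
  Integrable.fintype_prod fun _ => integrable_envelope hβ hε hV hgrowth le_rfl hn

lemma regWeight_le_prod_envelope (hβ : 0 < β) {δ : ℝ} (hδ : |δ| ≤ 1) {n : ℕ} (l : Fin n → ℝ) :
    regWeight V β n δ l ≤ ∏ i, envelope V β n 0 (l i) := by
  refine (regWeight_le hβ hδ l).trans_eq (Finset.prod_congr rfl fun i _ => ?_)
  simp [envelope]

lemma integrable_regWeight (hβ : 0 < β) (hε : 0 < ε) (hV : Continuous V)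
    (hgrowth : ∀ x : ℝ, L ≤ |x| → 2 * (1 + ε) * Real.log (1 + |x|) ≤ V x)
    {n : ℕ} (hn : sizeThreshold β ε 0 ≤ n) {δ : ℝ} (hδ : |δ| ≤ 1) :
    Integrable (regWeight V β n δ) := by
  refine (integrable_prod_envelope hβ hε hV hgrowth hn).mono'
    (continuous_regWeight hβ hV δ).aestronglyMeasurable (Filter.Eventually.of_forall fun l => ?_)
  rw [Real.norm_of_nonneg (regWeight_nonneg δ l)]
  exact regWeight_le_prod_envelope hβ hδ l

lemma integrable_weight (hβ : 0 < β) (hε : 0 < ε) (hV : Continuous V)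
    (hgrowth : ∀ x : ℝ, L ≤ |x| → 2 * (1 + ε) * Real.log (1 + |x|) ≤ V x)
    {n : ℕ} (hn : sizeThreshold β ε 0 ≤ n) : Integrable (weight V β n) := by
  have := integrable_regWeight hβ hε hV hgrowth hn (δ := 0) (by simp)
  simpa only [funext (regWeight_zero (V := V) (β := β) (n := n))] using this

lemma partitionFn_pos (hβ : 0 < β) (hV : Continuous V) {n : ℕ}
    (hint : Integrable (weight V β n)) : 0 < partitionFn V β n := by
  unfold partitionFn
  rw [integral_pos_iff_support_of_nonneg weight_nonneg hint]
  -- The configuration 0, 1, …, n - 1 has distinct entries, so the continuous density is positive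
  -- around it.
  refine (continuous_weight hβ hV).isOpen_support.measure_pos _ ⟨fun i => (i : ℝ), ?_⟩
  rw [Function.mem_support, weight_eq_exp]
  · exact (Real.exp_pos _).ne'
  · intro i j hij
    simp only [Nat.cast_inj] at hij
    exact Fin.ext hij

lemma lintegral_law (hV : Continuous V) (hβ : 0 < β) (n : ℕ) (F : (Fin n → ℝ) → ℝ≥0∞) :
    ∫⁻ l, F l ∂(law V β n) = ENNReal.ofReal (partitionFn V β n)⁻¹ *
      ∫⁻ l, ENNReal.ofReal (weight V β n l) * F l := by
  have hm : Measurable fun l : Fin n → ℝ => ENNReal.ofReal (weight V β n l / partitionFn V β n) :=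
    ((continuous_weight hβ hV).measurable.div_const _).ennreal_ofReal
  rw [law, lintegral_withDensity_eq_lintegral_mul_non_measurable _ hm (by simp),
    ← lintegral_const_mul' _ _ ENNReal.ofReal_ne_top]
  refine lintegral_congr fun l => ?_
  rw [Pi.mul_apply, div_eq_mul_inv, mul_comm (weight V β n l)]
  by_cases hQ : 0 ≤ (partitionFn V β n)⁻¹
  · rw [ENNReal.ofReal_mul hQ, mul_assoc]
  · push Not at hQ
    rw [ENNReal.ofReal_of_nonpos hQ.le, ENNReal.ofReal_of_nonpos
      (mul_nonpos_of_nonpos_of_nonneg hQ.le (weight_nonneg l))]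
    simp

lemma isProbabilityMeasure_law (hβ : 0 < β) (hV : Continuous V) {n : ℕ}
    (hint : Integrable (weight V β n)) : IsProbabilityMeasure (law V β n) := by
  have hQ := partitionFn_pos hβ hV hint
  refine ⟨?_⟩
  rw [← setLIntegral_one, Measure.restrict_univ, lintegral_law hV hβ]
  simp only [mul_one]
  rw [← ofReal_integral_eq_lintegral_ofReal hint (Filter.Eventually.of_forall weight_nonneg),
    ← ENNReal.ofReal_mul (by positivity)]
  change ENNReal.ofReal ((partitionFn V β n)⁻¹ * partitionFn V β n) = 1
  rw [inv_mul_cancel₀ hQ.ne', ENNReal.ofReal_one]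

lemma integral_law {E : Type*} [NormedAddCommGroup E] [NormedSpace ℝ E]
    (hV : Continuous V) (hβ : 0 < β) {n : ℕ} (hQ : 0 < partitionFn V β n) (F : (Fin n → ℝ) → E) :
    ∫ l, F l ∂(law V β n) = (partitionFn V β n)⁻¹ • ∫ l, weight V β n l • F l := by
  have hm : Measurable fun l : Fin n → ℝ => ENNReal.ofReal (weight V β n l / partitionFn V β n) :=
    ((continuous_weight hβ hV).measurable.div_const _).ennreal_ofReal
  rw [law, integral_withDensity_eq_integral_toReal_smul hm (by simp), ← integral_smul]
  refine integral_congr_ae (Filter.Eventually.of_forall fun l => ?_)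
  simp only
  rw [ENNReal.toReal_ofReal (div_nonneg (weight_nonneg l) hQ.le), smul_smul, div_eq_inv_mul]

end law

end BetaEnsemble

/-! ### Lower bounds by Jensen's inequality with the equilibrium measure as trial measure. -/

namespace BetaEnsemble

/-- Jensen's inequality, from the tangent line of the exponential at the mean of F. The right side
is a lower integral because exp ∘ F need not be integrable. -/
lemma ofReal_exp_integral_le {α : Type*} [MeasurableSpace α] {ν : Measure α} [IsProbabilityMeasure ν]
    {F : α → ℝ} (hF : Integrable F ν) :
    ENNReal.ofReal (Real.exp (∫ x, F x ∂ν)) ≤ ∫⁻ x, ENNReal.ofReal (Real.exp (F x)) ∂ν := by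
  set a := ∫ x, F x ∂ν with ha
  have hg : Integrable (fun x => Real.exp a * (1 + F x - a)) ν := by fun_prop
  have h1 : ∫ x, Real.exp a * (1 + F x - a) ∂ν = Real.exp a := by
    rw [integral_const_mul, integral_sub (by fun_prop) (by fun_prop), integral_add (by fun_prop) hF]
    simp [← ha]
  have h2 : ENNReal.ofReal (∫ x, Real.exp a * (1 + F x - a) ∂ν) ≤
      ∫⁻ x, ENNReal.ofReal (Real.exp a * (1 + F x - a)) ∂ν := by
    rw [integral_eq_lintegral_pos_part_sub_lintegral_neg_part hg]
    refine (ENNReal.ofReal_le_ofReal (sub_le_self _ ENNReal.toReal_nonneg)).trans ?_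
    exact ENNReal.ofReal_toReal_le
  rw [h1] at h2
  refine h2.trans (lintegral_mono fun x => ENNReal.ofReal_le_ofReal ?_)
  have h3 := Real.add_one_le_exp (F x - a)
  rw [show F x = a + (F x - a) by ring, Real.exp_add]
  refine mul_le_mul_of_nonneg_left ?_ (Real.exp_pos a).le
  linarith

namespace BoundedDensity

variable {μ : Measure ℝ} {b : ℝ≥0} (h : BoundedDensity μ b) {V : ℝ → ℝ} {β : ℝ} {n : ℕ}
include h

/-- Jensen for μ, followed by μ ≤ b · Lebesgue. This is a lower bound for the normalisation of the
conditional density of one eigenvalue; the error is only the constant factor b, not one growing with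
n. -/
lemma ofReal_exp_le_lintegral_condWeight (hV : Continuous V) (l : Fin n → ℝ) (i : Fin n) :
    ENNReal.ofReal (Real.exp (β * ∑ j ∈ ({i}ᶜ : Finset (Fin n)), logPot μ (l j) -
      n * β / 2 * ∫ x, V x ∂μ)) ≤
      b * ∫⁻ x, ENNReal.ofReal (condWeight V β n l i x) := by
  have := h.prob
  set F : ℝ → ℝ := fun x => β * ∑ j ∈ ({i}ᶜ : Finset (Fin n)), Real.log |x - l j| -
    n * β / 2 * V x with hF
  have hVi : Integrable V μ := h.integrable_of_continuous hV.continuousOn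
  have hs : Integrable (fun x => ∑ j ∈ ({i}ᶜ : Finset (Fin n)), Real.log |x - l j|) μ :=
    integrable_finsetSum _ fun j _ => h.integrable_log (l j)
  have hFi : Integrable F μ := (hs.const_mul _).sub (hVi.const_mul _)
  have h1 : ∫ x, F x ∂μ = β * ∑ j ∈ ({i}ᶜ : Finset (Fin n)), logPot μ (l j) -
      n * β / 2 * ∫ x, V x ∂μ := by
    rw [hF, integral_sub (hs.const_mul _) (hVi.const_mul _), integral_const_mul,
      integral_const_mul, integral_finsetSum _ fun j _ => h.integrable_log (l j)]
    rfl
  rw [← h1]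
  refine (ofReal_exp_integral_le hFi).trans ?_
  have h2 : ∫⁻ x, ENNReal.ofReal (Real.exp (F x)) ∂μ =
      ∫⁻ x, ENNReal.ofReal (condWeight V β n l i x) ∂μ := by
    refine lintegral_congr_ae ?_
    have : ∀ᵐ x ∂μ, ∀ j, x - l j ≠ 0 := ae_all_iff.2 fun j => h.ae_ne (l j)
    filter_upwards [this] with x hx
    congr 1
    rw [hF, condWeight]
    simp only
    rw [sub_eq_add_neg, add_comm, Real.exp_add, Finset.mul_sum, Real.exp_sum]
    congr 1
    · congr 1; ring
    · refine Finset.prod_congr rfl fun j _ => ?_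
      rw [Real.rpow_def_of_pos (abs_pos.2 (hx j)), mul_comm]
  rw [h2]
  calc ∫⁻ x, ENNReal.ofReal (condWeight V β n l i x) ∂μ
      ≤ ∫⁻ x, ENNReal.ofReal (condWeight V β n l i x) ∂((b : ℝ≥0∞) • volume) :=
        lintegral_mono' h.le_smul le_rfl
    _ = _ := by rw [lintegral_smul_measure, smul_eq_mul]

lemma map_pair_pi {i j : Fin n} (hij : i ≠ j) :
    Measure.map (fun l : Fin n → ℝ => (l i, l j)) (Measure.pi fun _ => μ) = μ.prod μ := by
  have := h.prob
  have h1 := ProbabilityTheory.iIndepFun_pi (μ := fun _ : Fin n => μ)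
    (X := fun _ : Fin n => (id : ℝ → ℝ)) fun _ => aemeasurable_id
  have h2 := h1.indepFun hij
  have hm : ∀ k : Fin n, AEMeasurable (fun l : Fin n → ℝ => id (l k)) (Measure.pi fun _ => μ) :=
    fun k => (measurable_pi_apply k).aemeasurable
  rw [ProbabilityTheory.indepFun_iff_map_prod_eq_prod_map_map (hm i) (hm j)] at h2
  have h3 : ∀ k : Fin n, Measure.map (fun l : Fin n → ℝ => id (l k)) (Measure.pi fun _ => μ) = μ :=
    fun k => (measurePreserving_eval (fun _ : Fin n => μ) k).map_eq
  rw [h3 i, h3 j] at h2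
  exact h2

lemma integrable_log_prod : Integrable (fun p : ℝ × ℝ => Real.log |p.2 - p.1|) (μ.prod μ) := by
  have := h.prob
  obtain ⟨C, hC, hC'⟩ := h.exists_inv_sqrt_bound
  have hm : AEStronglyMeasurable (fun p : ℝ × ℝ => Real.log |p.2 - p.1|) (μ.prod μ) := by
    apply Measurable.aestronglyMeasurable; fun_prop
  rw [integrable_prod_iff hm]
  refine ⟨Filter.Eventually.of_forall fun x => h.integrable_log x, ?_⟩
  refine Integrable.mono' (integrable_const (4 + 2 * C)) hm.norm.integral_prod_right' ?_
  filter_upwards [h.ae_mem] with x hx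
  rw [Real.norm_of_nonneg (integral_nonneg fun _ => norm_nonneg _)]
  have h1 : ∫ y, ‖Real.log |y - x|‖ ∂μ ≤ ∫ y, (4 + 2 * (√|y - x|)⁻¹) ∂μ := by
    refine integral_mono_ae (h.integrable_log x).norm
      ((integrable_const _).add ((hC' x).1.const_mul 2)) ?_
    filter_upwards [h.ae_ne x, h.ae_mem] with y hy hy2
    have h4 := abs_log_abs_le hy
    have h3 : |y - x| ≤ 4 := (abs_sub y x).trans (by linarith [abs_le.2 hx, abs_le.2 hy2])
    simp only [Real.norm_eq_abs]
    linarith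
  rw [integral_add (integrable_const _) ((hC' x).1.const_mul 2), integral_const_mul] at h1
  simp only [integral_const, probReal_univ, one_smul] at h1
  exact h1.trans (by linarith [(hC' x).2])

lemma ae_pi_injective : ∀ᵐ l ∂(Measure.pi fun _ : Fin n => μ), Function.Injective l := by
  have := h.prob
  have h1 : ∀ i j : Fin n, ∀ᵐ l ∂(Measure.pi fun _ : Fin n => μ), i ≠ j → l i ≠ l j := by
    intro i j
    by_cases hij : i = j
    · simp [hij]
    have h2 : ∀ᵐ p ∂(μ.prod μ), p.1 ≠ p.2 := by
      have hms : MeasurableSet {p : ℝ × ℝ | p.1 ≠ p.2} :=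
        (measurableSet_eq_fun measurable_fst measurable_snd).compl
      rw [Measure.ae_prod_iff_ae_ae hms]
      refine Filter.Eventually.of_forall fun x => ?_
      filter_upwards [h.ae_ne x] with y hy hxy
      exact hy (sub_eq_zero.2 (Eq.symm hxy))
    rw [← h.map_pair_pi hij] at h2
    have h3 := ae_of_ae_map (by fun_prop) h2
    filter_upwards [h3] with l hl _ using hl
  filter_upwards [ae_all_iff.2 fun i => ae_all_iff.2 (h1 i)] with l hl i j hij
  by_contra hne
  exact hl i j hne hij

/-- Jensen for the product measure μⁿ. Its configurations are almost surely injective, so the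
exponential form of the density applies, and each of the n(n - 1) ordered pairs contributes the
logarithmic energy of μ. -/
lemma ofReal_exp_le_lintegral_weight (hV : Continuous V) :
    ENNReal.ofReal (Real.exp (β / 2 * (n * (n - 1)) * (∫ x, logPot μ x ∂μ) -
      n ^ 2 * β / 2 * ∫ x, V x ∂μ)) ≤ (b : ℝ≥0∞) ^ n * ∫⁻ l, ENNReal.ofReal (weight V β n l) := by
  have := h.prob
  set ν := Measure.pi fun _ : Fin n => μ with hν
  set F : (Fin n → ℝ) → ℝ := fun l =>
    -((n : ℝ) * β / 2 * ∑ i, V (l i)) + β / 2 * ∑ i, ∑ j, Real.log |l i - l j| with hF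
  have hVi : Integrable V μ := h.integrable_of_continuous hV.continuousOn
  have hmp := fun i : Fin n => measurePreserving_eval (fun _ : Fin n => μ) i
  have hV1 : ∀ i, Integrable (fun l : Fin n → ℝ => V (l i)) ν := fun i =>
    (hmp i).integrable_comp_of_integrable hVi
  have hV2 : ∀ i, ∫ l, V (l i) ∂ν = ∫ x, V x ∂μ := fun i => by
    have h1 := integral_map (μ := ν) (φ := fun l : Fin n → ℝ => l i) (f := V)
      (measurable_pi_apply i).aemeasurable hV.aestronglyMeasurable
    rw [← h1]
    congr 1
    exact (hmp i).map_eq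
  have hlm : ∀ i j : Fin n, i ≠ j → MeasurePreserving (fun l : Fin n → ℝ => (l i, l j)) ν (μ.prod μ) :=
    fun i j hij => ⟨by fun_prop, h.map_pair_pi hij⟩
  have hL1 : ∀ i j : Fin n, Integrable (fun l : Fin n → ℝ => Real.log |l i - l j|) ν := by
    intro i j
    by_cases hij : i = j
    · simp [hij]
    have := (hlm i j hij).integrable_comp_of_integrable h.integrable_log_prod
    refine this.congr (Filter.Eventually.of_forall fun l => ?_)
    simp [abs_sub_comm]
  have hL2 : ∀ i j : Fin n, i ≠ j →
      ∫ l, Real.log |l i - l j| ∂ν = ∫ x, logPot μ x ∂μ := by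
    intro i j hij
    have h1 := integral_map (μ := ν) (φ := fun l : Fin n → ℝ => (l i, l j))
      (f := fun p : ℝ × ℝ => Real.log |p.2 - p.1|) (by fun_prop)
      (by apply Measurable.aestronglyMeasurable; fun_prop)
    rw [hν, h.map_pair_pi hij, integral_prod _ h.integrable_log_prod] at h1
    rw [show ∫ x, logPot μ x ∂μ = ∫ x, ∫ y, Real.log |y - x| ∂μ ∂μ from rfl, h1]
    simp only [abs_sub_comm, hν]
  have hS1 : Integrable (fun l : Fin n → ℝ => ∑ i, V (l i)) ν :=
    integrable_finsetSum _ fun i _ => hV1 i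
  have hS2 : Integrable (fun l : Fin n → ℝ => ∑ i, ∑ j, Real.log |l i - l j|) ν :=
    integrable_finsetSum _ fun i _ => integrable_finsetSum _ fun j _ => hL1 i j
  have hFi : Integrable F ν := (hS1.const_mul _).neg.add (hS2.const_mul _)
  have hFint : ∫ l, F l ∂ν = β / 2 * (n * (n - 1)) * (∫ x, logPot μ x ∂μ) -
      n ^ 2 * β / 2 * ∫ x, V x ∂μ := by
    have h1 : ∫ l, ∑ i, V (l i) ∂ν = n * ∫ x, V x ∂μ := by
      rw [integral_finsetSum _ fun i _ => hV1 i]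
      simp [hV2]
    have h2 : ∫ l, ∑ i, ∑ j, Real.log |l i - l j| ∂ν = n * (n - 1) * ∫ x, logPot μ x ∂μ := by
      rw [integral_finsetSum _ fun i _ => integrable_finsetSum _ fun j _ => hL1 i j]
      have h3 : ∀ i : Fin n, ∫ l, ∑ j, Real.log |l i - l j| ∂ν = (n - 1) * ∫ x, logPot μ x ∂μ := by
        intro i
        rw [integral_finsetSum _ fun j _ => hL1 i j, Fintype.sum_eq_add_sum_compl i]
        have h4 : ∀ j ∈ ({i}ᶜ : Finset (Fin n)), ∫ l, Real.log |l i - l j| ∂ν =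
            ∫ x, logPot μ x ∂μ := fun j hj => hL2 i j (by simpa [eq_comm] using hj)
        rw [Finset.sum_congr rfl h4, Finset.sum_const, Finset.card_compl, Finset.card_singleton,
          Fintype.card_fin]
        have : 1 ≤ n := Nat.one_le_iff_ne_zero.2 fun h => by subst h; exact i.elim0
        simp [this]
      rw [Finset.sum_congr rfl fun i _ => h3 i]
      simp
      ring
    have h4 := integral_add (hS1.const_mul (n * β / 2)).neg (hS2.const_mul (β / 2))
    simp only [Pi.neg_apply] at h4
    rw [hF, h4, integral_neg, integral_const_mul, integral_const_mul, h1, h2]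
    ring
  rw [← hFint]
  refine (ofReal_exp_integral_le hFi).trans ?_
  have h2 : ∫⁻ l, ENNReal.ofReal (Real.exp (F l)) ∂ν = ∫⁻ l, ENNReal.ofReal (weight V β n l) ∂ν := by
    refine lintegral_congr_ae ?_
    filter_upwards [h.ae_pi_injective] with l hl
    rw [weight_eq_exp hl]
  rw [h2]
  calc ∫⁻ l, ENNReal.ofReal (weight V β n l) ∂ν
      ≤ ∫⁻ l, ENNReal.ofReal (weight V β n l) ∂((b : ℝ≥0∞) ^ n • volume) :=
        lintegral_mono' (h.pi_le_smul n) le_rfl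
    _ = _ := by rw [lintegral_smul_measure, smul_eq_mul]

lemma exp_le_partitionFn (hV : Continuous V) (hint : Integrable (weight V β n)) :
    Real.exp (β / 2 * (n * (n - 1)) * (∫ x, logPot μ x ∂μ) - n ^ 2 * β / 2 * ∫ x, V x ∂μ) ≤
      b ^ n * partitionFn V β n := by
  have h1 := h.ofReal_exp_le_lintegral_weight (β := β) (n := n) hV
  rw [← ofReal_integral_eq_lintegral_ofReal hint (Filter.Eventually.of_forall weight_nonneg)] at h1
  have h2 : (b : ℝ≥0∞) ^ n = ENNReal.ofReal ((b : ℝ) ^ n) := by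
    rw [ENNReal.ofReal_pow b.coe_nonneg, ENNReal.ofReal_coe_nnreal]
  rw [h2, ← ENNReal.ofReal_mul (by positivity)] at h1
  refine (ENNReal.ofReal_le_ofReal_iff ?_).1 h1
  exact mul_nonneg (by positivity) (integral_nonneg weight_nonneg)

end BoundedDensity

end BetaEnsemble

/-! ### Quadratic energies of signed measures by Fourier transform. -/

namespace BetaEnsemble

lemma integral_mul_sq_le {α : Type*} [MeasurableSpace α] {ν : Measure α} {f g : α → ℝ}
    (hf : Integrable (fun x => f x ^ 2) ν) (hg : Integrable (fun x => g x ^ 2) ν)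
    (hfg : Integrable (fun x => f x * g x) ν) :
    (∫ x, f x * g x ∂ν) ^ 2 ≤ (∫ x, f x ^ 2 ∂ν) * ∫ x, g x ^ 2 ∂ν := by
  have key : ∀ t : ℝ, 0 ≤ (∫ x, f x ^ 2 ∂ν) * (t * t) + (-2 * ∫ x, f x * g x ∂ν) * t +
      ∫ x, g x ^ 2 ∂ν := by
    intro t
    have h1 : 0 ≤ ∫ x, (t * f x - g x) ^ 2 ∂ν := integral_nonneg fun x => sq_nonneg _
    have h2 : ∀ x, (t * f x - g x) ^ 2 = t ^ 2 * f x ^ 2 - 2 * t * (f x * g x) + g x ^ 2 :=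
      fun x => by ring
    simp_rw [h2] at h1
    rw [integral_add (f := fun x => t ^ 2 * f x ^ 2 - 2 * t * (f x * g x))
      ((hf.const_mul _).sub (hfg.const_mul _)) hg,
      integral_sub (hf.const_mul _) (hfg.const_mul _), integral_const_mul, integral_const_mul] at h1
    linarith
  have := discrim_le_zero key
  rw [discrim] at this
  nlinarith

section fourier

variable {Ω : Type*} [MeasurableSpace Ω] {α : Measure Ω} [IsFiniteMeasure α] {s p : Ω → ℝ}

/-- The Fourier transform of the image under `p` of the signed measure `s α`. -/
noncomputable def signedFourier (α : Measure Ω) (s p : Ω → ℝ) (k : ℝ) : ℂ :=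
  ∫ ω, (s ω : ℂ) * Complex.exp (Complex.I * (k * p ω)) ∂α

omit [MeasurableSpace Ω] in
lemma norm_signed_exp_le (hs : ∀ ω, |s ω| ≤ 1) (k : ℝ) (ω : Ω) :
    ‖(s ω : ℂ) * Complex.exp (Complex.I * (k * p ω))‖ ≤ 1 := by
  rw [norm_mul, mul_comm Complex.I, ← Complex.ofReal_mul, Complex.norm_exp_ofReal_mul_I, mul_one,
    Complex.norm_real]
  exact hs ω

lemma norm_signedFourier_le (hs : ∀ ω, |s ω| ≤ 1) (k : ℝ) :
    ‖signedFourier α s p k‖ ≤ α.real Set.univ := by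
  have := norm_integral_le_of_norm_le_const (μ := α) (C := 1)
    (Filter.Eventually.of_forall fun ω => norm_signed_exp_le (p := p) hs k ω)
  simpa [signedFourier] using this

lemma stronglyMeasurable_signedFourier (hsm : Measurable s) (hpm : Measurable p) :
    StronglyMeasurable (signedFourier α s p) := by
  unfold signedFourier
  refine StronglyMeasurable.integral_prod_right' (f := fun q : ℝ × Ω =>
    (s q.2 : ℂ) * Complex.exp (Complex.I * (q.1 * p q.2))) ?_
  apply Measurable.stronglyMeasurable
  fun_prop

lemma integrable_exp_neg_Ioi {τ : ℝ} (hτ : 0 < τ) :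
    Integrable (fun k : ℝ => Real.exp (-τ * k)) (volume.restrict (Set.Ioi 0)) :=
  exp_neg_integrableOn_Ioi 0 hτ

lemma integral_exp_neg_Ioi {τ : ℝ} (hτ : 0 < τ) :
    ∫ k in Set.Ioi (0 : ℝ), Real.exp (-τ * k) = 1 / τ := by
  have := integral_exp_mul_Ioi (a := -τ) (by linarith) 0
  rw [this]; simp

lemma integrable_exp_mul_sq_norm_signedFourier (hs : ∀ ω, |s ω| ≤ 1) (hsm : Measurable s)
    (hpm : Measurable p) {τ : ℝ} (hτ : 0 < τ) :
    Integrable (fun k : ℝ => Real.exp (-τ * k) * ‖signedFourier α s p k‖ ^ 2)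
      (volume.restrict (Set.Ioi 0)) := by
  refine ((integrable_exp_neg_Ioi hτ).mul_const (α.real Set.univ ^ 2)).mono' ?_
    (Filter.Eventually.of_forall fun k => ?_)
  · exact (Measurable.aestronglyMeasurable (by fun_prop)).mul
      ((stronglyMeasurable_signedFourier hsm hpm).norm.pow 2).aestronglyMeasurable
  · rw [Real.norm_of_nonneg (by positivity)]
    gcongr
    exact norm_signedFourier_le hs k

/-- This is the positive definiteness of the Cauchy kernel: ∫₀^∞ exp(-τk + iku) dk = 1/(τ - iu) has
real part τ/(u² + τ²), and expanding the square together with Fubini gives the double integral. -/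
lemma integral_exp_mul_sq_norm_signedFourier (hs : ∀ ω, |s ω| ≤ 1) (hsm : Measurable s)
    (hpm : Measurable p) {τ : ℝ} (hτ : 0 < τ) :
    ∫ k in Set.Ioi (0 : ℝ), Real.exp (-τ * k) * ‖signedFourier α s p k‖ ^ 2 =
      ∫ q, s q.1 * s q.2 * (τ / ((p q.2 - p q.1) ^ 2 + τ ^ 2)) ∂(α.prod α) := by
  set ν := volume.restrict (Set.Ioi (0 : ℝ)) with hν
  have hF : Integrable (Function.uncurry fun (k : ℝ) (q : Ω × Ω) =>
      (Real.exp (-τ * k) : ℂ) * (((s q.1 : ℂ) * Complex.exp (Complex.I * (k * p q.1))) *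
        ((s q.2 : ℂ) * Complex.exp (-(Complex.I * (k * p q.2)))))) (ν.prod (α.prod α)) := by
    have h1 : Integrable (fun x : ℝ × (Ω × Ω) => Real.exp (-τ * x.1) * (1 : ℝ))
        (ν.prod (α.prod α)) := (integrable_exp_neg_Ioi hτ).mul_prod (integrable_const (1 : ℝ))
    refine h1.mono' (Measurable.aestronglyMeasurable (by unfold Function.uncurry; fun_prop))
      (Filter.Eventually.of_forall fun x => ?_)
    simp only [Function.uncurry]
    rw [norm_mul, Complex.norm_real, Real.norm_of_nonneg (Real.exp_pos _).le, norm_mul]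
    have h2 := norm_signed_exp_le (p := p) hs x.1 x.2.1
    have h3 := norm_signed_exp_le (p := p) hs (-x.1) x.2.2
    rw [show Complex.I * (((-x.1 : ℝ) : ℂ) * p x.2.2) = -(Complex.I * (x.1 * p x.2.2)) by
      push_cast; ring] at h3
    gcongr
    exact mul_le_one₀ h2 (norm_nonneg _) h3
  have hsq : ∀ k : ℝ, ((‖signedFourier α s p k‖ ^ 2 : ℝ) : ℂ) =
      ∫ q, ((s q.1 : ℂ) * Complex.exp (Complex.I * (k * p q.1))) *
        ((s q.2 : ℂ) * Complex.exp (-(Complex.I * (k * p q.2)))) ∂(α.prod α) := by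
    intro k
    rw [integral_prod_mul (fun ω => (s ω : ℂ) * Complex.exp (Complex.I * (k * p ω)))
      (fun ω => (s ω : ℂ) * Complex.exp (-(Complex.I * (k * p ω))))]
    have h1 : ∫ ω, (s ω : ℂ) * Complex.exp (-(Complex.I * (k * p ω))) ∂α =
        conj (signedFourier α s p k) := by
      rw [signedFourier, ← integral_conj]
      refine integral_congr_ae (Filter.Eventually.of_forall fun ω => ?_)
      simp [← Complex.exp_conj]
    rw [h1]
    change _ = signedFourier α s p k * _
    rw [Complex.mul_conj, Complex.normSq_eq_norm_sq]
  have hmain : ((∫ k, Real.exp (-τ * k) * ‖signedFourier α s p k‖ ^ 2 ∂ν : ℝ) : ℂ) =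
      ∫ q, (s q.1 : ℂ) * s q.2 * (1 / ((τ : ℂ) - Complex.I * (p q.1 - p q.2))) ∂(α.prod α) := by
    rw [← integral_complex_ofReal]
    have h1 : ∀ k : ℝ, ((Real.exp (-τ * k) * ‖signedFourier α s p k‖ ^ 2 : ℝ) : ℂ) =
        ∫ q, (Real.exp (-τ * k) : ℂ) * (((s q.1 : ℂ) * Complex.exp (Complex.I * (k * p q.1))) *
        ((s q.2 : ℂ) * Complex.exp (-(Complex.I * (k * p q.2))))) ∂(α.prod α) := by
      intro k
      rw [integral_const_mul, ← hsq k]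
      push_cast; rfl
    simp_rw [h1]
    rw [integral_integral_swap hF]
    refine integral_congr_ae (Filter.Eventually.of_forall fun q => ?_)
    simp only
    have h2 : ∀ k : ℝ, (Real.exp (-τ * k) : ℂ) * (((s q.1 : ℂ) *
        Complex.exp (Complex.I * (k * p q.1))) * ((s q.2 : ℂ) *
        Complex.exp (-(Complex.I * (k * p q.2))))) = (s q.1 : ℂ) * s q.2 *
          Complex.exp (-((τ : ℂ) - Complex.I * (p q.1 - p q.2)) * k) := by
      intro k
      have h3 : Complex.exp (-((τ : ℂ) - Complex.I * (p q.1 - p q.2)) * k) =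
          Complex.exp (((-τ * k : ℝ) : ℂ)) * (Complex.exp (Complex.I * (k * p q.1)) *
          Complex.exp (-(Complex.I * (k * p q.2)))) := by
        rw [← Complex.exp_add, ← Complex.exp_add]
        congr 1; push_cast; ring
      rw [h3, Complex.ofReal_exp]; ring
    simp_rw [h2]
    rw [integral_const_mul, hν, integral_exp_mul_complex_Ioi (by simpa using hτ)]
    congr 1
    rw [Complex.ofReal_zero, mul_zero, Complex.exp_zero, neg_div_neg_eq]
  have h4 := congrArg Complex.re hmain
  rw [Complex.ofReal_re] at h4
  rw [h4]
  have hne : ∀ u : ℝ, (τ : ℂ) - Complex.I * u ≠ 0 := fun u h => by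
    have := congrArg Complex.re h
    simp at this; linarith
  have hint : Integrable (fun q : Ω × Ω => (s q.1 : ℂ) * s q.2 *
      (1 / ((τ : ℂ) - Complex.I * (p q.1 - p q.2)))) (α.prod α) := by
    refine Integrable.mono' (integrable_const (1 / τ))
      (Measurable.aestronglyMeasurable (by fun_prop)) (Filter.Eventually.of_forall fun q => ?_)
    rw [norm_mul, norm_mul, Complex.norm_real, Complex.norm_real, norm_div, norm_one]
    have h5 : τ ≤ ‖(τ : ℂ) - Complex.I * (p q.1 - p q.2)‖ := by
      refine le_trans ?_ (Complex.re_le_norm _)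
      simp
    calc |s q.1| * |s q.2| * (1 / ‖(τ : ℂ) - Complex.I * (p q.1 - p q.2)‖) ≤ 1 * 1 * (1 / τ) := by
          gcongr
          · exact hs _
          · exact hs _
      _ = 1 / τ := by ring
  have h6 := Complex.reCLM.integral_comp_comm hint
  simp only [Complex.reCLM_apply] at h6
  rw [← h6]
  refine integral_congr_ae (Filter.Eventually.of_forall fun q => ?_)
  simp only
  have h7 : (1 / ((τ : ℂ) - Complex.I * (p q.1 - p q.2))).re =
      τ / ((p q.2 - p q.1) ^ 2 + τ ^ 2) := by
    rw [one_div, Complex.inv_re, Complex.normSq_apply]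
    simp
    ring_nf
  rw [← Complex.ofReal_mul, Complex.re_ofReal_mul, h7]

/-- In the upper half plane 1/(z - p) = -i ∫₀^∞ exp(ik(z - p)) dk, so the Cauchy transform of the
signed measure is a Laplace transform of its Fourier transform, and Cauchy-Schwarz applies. -/
lemma two_mul_im_sub_mul_sq_norm_le (hs : ∀ ω, |s ω| ≤ 1) (hsm : Measurable s)
    (hpm : Measurable p) {τ : ℝ} (hτ : 0 < τ) {z : ℂ} (hz : τ < 2 * z.im) :
    (2 * z.im - τ) * ‖∫ ω, (s ω : ℂ) / (z - p ω) ∂α‖ ^ 2 ≤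
      ∫ q, s q.1 * s q.2 * (τ / ((p q.2 - p q.1) ^ 2 + τ ^ 2)) ∂(α.prod α) := by
  have hy : 0 < z.im := by linarith
  rw [← integral_exp_mul_sq_norm_signedFourier hs hsm hpm hτ]
  set ν := volume.restrict (Set.Ioi (0 : ℝ)) with hν
  have hexp : ∀ k : ℝ, ‖Complex.exp (Complex.I * (z * k))‖ = Real.exp (-z.im * k) := by
    intro k
    rw [Complex.norm_exp]
    congr 1; simp
  have hF : Integrable (Function.uncurry fun (ω : Ω) (k : ℝ) => Complex.exp (Complex.I * (z * k)) *
      ((s ω : ℂ) * Complex.exp (Complex.I * (((-k : ℝ) : ℂ) * p ω)))) (α.prod ν) := by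
    have h1 : Integrable (fun x : Ω × ℝ => (1 : ℝ) * Real.exp (-z.im * x.2))
        (α.prod ν) := (integrable_const (1 : ℝ)).mul_prod (integrable_exp_neg_Ioi hy)
    refine h1.mono' (Measurable.aestronglyMeasurable (by unfold Function.uncurry; fun_prop))
      (Filter.Eventually.of_forall fun x => ?_)
    simp only [Function.uncurry]
    rw [norm_mul, hexp, one_mul]
    exact mul_le_of_le_one_right (Real.exp_pos _).le (norm_signed_exp_le hs _ _)
  have h1 : ∫ ω, (s ω : ℂ) / (z - p ω) ∂α =
      -Complex.I * ∫ k, Complex.exp (Complex.I * (z * k)) * signedFourier α s p (-k) ∂ν := by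
    simp_rw [signedFourier, ← integral_const_mul]
    simp_rw [integral_const_mul (-Complex.I)]
    rw [← integral_integral_swap hF, ← integral_const_mul]
    refine integral_congr_ae (Filter.Eventually.of_forall fun ω => ?_)
    simp only
    have h2 : ∀ k : ℝ, Complex.exp (Complex.I * (z * k)) *
        ((s ω : ℂ) * Complex.exp (Complex.I * (((-k : ℝ) : ℂ) * p ω))) =
        (s ω : ℂ) * Complex.exp ((Complex.I * (z - p ω)) * k) := by
      intro k
      rw [mul_left_comm, ← Complex.exp_add]
      congr 2; push_cast; ring
    simp_rw [h2]
    have hne : z - p ω ≠ 0 := fun h => by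
      have := congrArg Complex.im h
      simp at this; linarith
    rw [integral_const_mul, hν, integral_exp_mul_complex_Ioi (by simpa using hy)]
    simp
    field_simp
  have hnorm : ∀ k, ‖signedFourier α s p (-k)‖ = ‖signedFourier α s p k‖ := by
    intro k
    rw [← Complex.norm_conj (signedFourier α s p k)]
    congr 1
    rw [signedFourier, signedFourier, ← integral_conj]
    refine integral_congr_ae (Filter.Eventually.of_forall fun ω => ?_)
    simp [← Complex.exp_conj]
  -- The factor exp(-k Im z) is split so that the square of the second function is the integrand of
  -- the energy at scale τ. The square of the first then integrates to 1/(2 Im z - τ).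
  set f : ℝ → ℝ := fun k => Real.exp (-(z.im - τ / 2) * k) with hf
  set g : ℝ → ℝ := fun k => Real.exp (-(τ / 2) * k) * ‖signedFourier α s p k‖ with hg
  have hf2 : ∀ k, f k ^ 2 = Real.exp (-(2 * z.im - τ) * k) := fun k => by
    rw [hf, ← Real.exp_nat_mul]; congr 1; push_cast; ring
  have hg2 : ∀ k, g k ^ 2 = Real.exp (-τ * k) * ‖signedFourier α s p k‖ ^ 2 := fun k => by
    rw [hg, mul_pow, ← Real.exp_nat_mul]; congr 2; push_cast; ring
  have hfg : ∀ k, f k * g k = Real.exp (-z.im * k) * ‖signedFourier α s p k‖ := fun k => by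
    rw [hf, hg, ← mul_assoc, ← Real.exp_add]; congr 2; ring
  have h3 : ‖∫ ω, (s ω : ℂ) / (z - p ω) ∂α‖ ≤ ∫ k, f k * g k ∂ν := by
    rw [h1, norm_mul, norm_neg, Complex.norm_I, one_mul]
    refine (norm_integral_le_integral_norm _).trans_eq ?_
    refine integral_congr_ae (Filter.Eventually.of_forall fun k => ?_)
    simp only
    rw [norm_mul, hexp, hnorm, hfg]
  have hfi : Integrable (fun k => f k ^ 2) ν := by
    simp_rw [hf2]; exact integrable_exp_neg_Ioi (by linarith)
  have hgi : Integrable (fun k => g k ^ 2) ν := by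
    simp_rw [hg2]; exact integrable_exp_mul_sq_norm_signedFourier hs hsm hpm hτ
  have hfgi : Integrable (fun k => f k * g k) ν := by
    simp_rw [hfg]
    refine ((integrable_exp_neg_Ioi hy).mul_const (α.real Set.univ)).mono' ?_
      (Filter.Eventually.of_forall fun k => ?_)
    · exact (Measurable.aestronglyMeasurable (by fun_prop)).mul
        (stronglyMeasurable_signedFourier hsm hpm).norm.aestronglyMeasurable
    · rw [Real.norm_of_nonneg (by positivity)]
      gcongr
      exact norm_signedFourier_le hs k
  have h4 := integral_mul_sq_le hfi hgi hfgi
  have h5 : ∫ k, f k ^ 2 ∂ν = 1 / (2 * z.im - τ) := by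
    simp_rw [hf2]; exact integral_exp_neg_Ioi (by linarith)
  rw [h5] at h4
  simp_rw [hg2] at h4
  have h6 : ‖∫ ω, (s ω : ℂ) / (z - p ω) ∂α‖ ^ 2 ≤ (∫ k, f k * g k ∂ν) ^ 2 := by gcongr
  have h7 : 0 < 2 * z.im - τ := by linarith
  calc _ ≤ (2 * z.im - τ) * (1 / (2 * z.im - τ) *
        ∫ k, Real.exp (-τ * k) * ‖signedFourier α s p k‖ ^ 2 ∂ν) := by
        gcongr; exact h6.trans h4
    _ = _ := by field_simp

end fourier

end BetaEnsemble

/-! ### Quadratic energies of the empirical measure minus n times the equilibrium measure. -/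

namespace BetaEnsemble

/-- The centred linear statistic `∑ᵢ φ(λᵢ) - n ∫ φ dμ`. -/
noncomputable def fluct (μ : Measure ℝ) {n : ℕ} (l : Fin n → ℝ) (φ : ℝ → ℂ) : ℂ :=
  ∑ i, φ (l i) - n * ∫ x, φ x ∂μ

/-- The centred resolvent trace `∑ᵢ (z - λᵢ)⁻¹ - n ∫ (z - x)⁻¹ dμ(x)`. -/
noncomputable def resolventFluct (μ : Measure ℝ) {n : ℕ} (l : Fin n → ℝ) (z : ℂ) : ℂ :=
  fluct μ l fun x => (z - x)⁻¹

/-- The quadratic form of an even kernel on `∑ᵢ δ_{λᵢ} - n μ`. -/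
noncomputable def energy (μ : Measure ℝ) {n : ℕ} (l : Fin n → ℝ) (κ : ℝ → ℝ) : ℝ :=
  ∑ i, ∑ j, κ (l j - l i) - 2 * n * ∑ i, ∫ y, κ (y - l i) ∂μ + n ^ 2 * ∫ x, ∫ y, κ (y - x) ∂μ ∂μ

/-- The measure `∑ᵢ δ_{λᵢ} + n μ`, with the two summands on separate sheets. -/
noncomputable def twoSheet (μ : Measure ℝ) {n : ℕ} (l : Fin n → ℝ) : Measure (ℝ × Bool) :=
  (∑ i, Measure.dirac (l i, true)) + (n : ℝ≥0∞) • μ.map (fun x => (x, false))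

/-- The sign of a sheet. -/
def sheetSign (q : ℝ × Bool) : ℝ := if q.2 then 1 else -1

lemma abs_sheetSign_le (q : ℝ × Bool) : |sheetSign q| ≤ 1 := by
  unfold sheetSign; split_ifs <;> simp

lemma measurable_sheetSign : Measurable sheetSign := by
  unfold sheetSign
  exact (measurable_from_top (f := fun b : Bool => if b then (1 : ℝ) else -1)).comp measurable_snd

section twoSheet

variable {μ : Measure ℝ} [IsProbabilityMeasure μ] {n : ℕ} (l : Fin n → ℝ)

instance : IsFiniteMeasure (twoSheet μ l) := by
  unfold twoSheet
  have h1 : IsFiniteMeasure (μ.map (fun x : ℝ => (x, false))) := inferInstance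
  have h2 : IsFiniteMeasure ((n : ℝ≥0∞) • μ.map (fun x : ℝ => (x, false))) :=
    Measure.smul_finite _ (by simp)
  infer_instance

omit [IsProbabilityMeasure μ] in
lemma integral_twoSheet {E : Type*} [NormedAddCommGroup E] [NormedSpace ℝ E] [CompleteSpace E]
    {f : ℝ × Bool → E} (hf : Integrable (fun x => f (x, false)) μ) :
    ∫ q, f q ∂(twoSheet μ l) = ∑ i, f (l i, true) + (n : ℝ) • ∫ x, f (x, false) ∂μ := by
  have he : MeasurableEmbedding (fun x : ℝ => (x, false)) := measurableEmbedding_prod_mk_right false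
  have h1 : Integrable f ((n : ℝ≥0∞) • μ.map (fun x : ℝ => (x, false))) :=
    Integrable.smul_measure (he.integrable_map_iff.2 hf) (by simp)
  have h2 : ∀ i, Integrable f (Measure.dirac (l i, true)) := fun i => integrable_dirac (by finiteness)
  rw [twoSheet, integral_add_measure (integrable_finsetSum_measure.2 fun i _ => h2 i) h1,
    integral_finsetSum_measure fun i _ => h2 i, integral_smul_measure, he.integral_map]
  simp [integral_dirac]

/-- Keeping the atoms and n μ on separate sheets presents their difference as a density ±1 against a
positive measure, without a Hahn decomposition. The Fourier bounds then apply directly. -/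
lemma integral_twoSheet_sign_mul {φ : ℝ → ℂ} (hφ : Integrable φ μ) :
    ∫ q, (sheetSign q : ℂ) * φ q.1 ∂(twoSheet μ l) = fluct μ l φ := by
  rw [integral_twoSheet]
  · simp [sheetSign, fluct, integral_neg]
    ring
  · simpa [sheetSign] using hφ

/-- Of the four blocks of the double integral the two mixed ones agree because the kernel is even;
boundedness permits Fubini. -/
lemma integral_prod_twoSheet {κ : ℝ → ℝ} (hκ : Continuous κ) (heven : ∀ x, κ (-x) = κ x)
    {C : ℝ} (hb : ∀ x, |κ x| ≤ C) :
    ∫ q, sheetSign q.1 * sheetSign q.2 * κ (q.2.1 - q.1.1) ∂((twoSheet μ l).prod (twoSheet μ l)) =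
      energy μ l κ := by
  have hm := measurable_sheetSign
  have hκm : Measurable κ := hκ.measurable
  have hint : Integrable (fun q : (ℝ × Bool) × (ℝ × Bool) =>
      sheetSign q.1 * sheetSign q.2 * κ (q.2.1 - q.1.1)) ((twoSheet μ l).prod (twoSheet μ l)) := by
    refine (integrable_const C).mono' (Measurable.aestronglyMeasurable (by fun_prop))
      (Filter.Eventually.of_forall fun q => ?_)
    rw [Real.norm_eq_abs, abs_mul, abs_mul]
    calc _ ≤ 1 * 1 * C := by
          gcongr
          · exact abs_sheetSign_le _
          · exact abs_sheetSign_le _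
          · exact hb _
      _ = C := by ring
  have hκi : ∀ a, Integrable (fun x => κ (x - a)) μ := fun a =>
    (integrable_const C).mono' (Measurable.aestronglyMeasurable (by fun_prop))
      (Filter.Eventually.of_forall fun x => hb _)
  have hU : StronglyMeasurable fun a => ∫ y, κ (y - a) ∂μ :=
    StronglyMeasurable.integral_prod_right' (f := fun q : ℝ × ℝ => κ (q.2 - q.1))
      (Measurable.stronglyMeasurable (by fun_prop))
  have hU1 : Integrable (fun a => ∫ y, κ (y - a) ∂μ) μ := by
    refine (integrable_const C).mono' hU.aestronglyMeasurable (Filter.Eventually.of_forall fun x => ?_)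
    have := norm_integral_le_of_norm_le_const (μ := μ) (C := C) (f := fun y => κ (y - x))
      (Filter.Eventually.of_forall fun y => (hb (y - x)))
    simpa using this
  have hinner : ∀ q₁ : ℝ × Bool, ∫ q₂, sheetSign q₁ * sheetSign q₂ * κ (q₂.1 - q₁.1) ∂(twoSheet μ l) =
      sheetSign q₁ * (∑ j, κ (l j - q₁.1) - n * ∫ y, κ (y - q₁.1) ∂μ) := by
    intro q₁
    simp_rw [mul_assoc]
    rw [integral_const_mul, integral_twoSheet]
    · congr 1
      simp [sheetSign, integral_neg]
      ring
    · simpa [sheetSign] using (hκi q₁.1).neg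
  rw [integral_prod _ hint]
  simp_rw [hinner]
  have hS : Integrable (fun x => ∑ j, κ (l j - x)) μ := by
    refine integrable_finsetSum _ fun j _ => (hκi (l j)).congr (Filter.Eventually.of_forall fun x => ?_)
    simp only
    rw [← heven]; ring_nf
  have hS2 : ∫ x, ∑ j, κ (l j - x) ∂μ = ∑ j, ∫ y, κ (y - l j) ∂μ := by
    rw [integral_finsetSum]
    · refine Finset.sum_congr rfl fun j _ => integral_congr_ae (Filter.Eventually.of_forall fun x => ?_)
      simp only
      rw [← heven]; ring_nf
    · refine fun j _ => (hκi (l j)).congr (Filter.Eventually.of_forall fun x => ?_)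
      simp only
      rw [← heven]; ring_nf
  rw [integral_twoSheet]
  · simp only [sheetSign, if_true, one_mul, Bool.false_eq_true, if_false, neg_mul, integral_neg]
    rw [integral_sub hS (hU1.const_mul _), integral_const_mul, hS2, energy,
      Finset.sum_sub_distrib, ← Finset.mul_sum, smul_eq_mul]
    ring
  · simp only [sheetSign, Bool.false_eq_true, if_false]
    exact (hS.sub (hU1.const_mul _)).const_mul _

end twoSheet

lemma hasDerivAt_smoothLog {u τ : ℝ} (hτ : 0 < τ) :
    HasDerivAt (fun t => smoothLog t u) (τ / (u ^ 2 + τ ^ 2)) τ := by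
  unfold smoothLog
  have h1 : HasDerivAt (fun t : ℝ => u ^ 2 + t ^ 2) (2 * τ) τ := by
    simpa using (hasDerivAt_pow 2 τ).const_add (u ^ 2)
  convert! (h1.log (by positivity)).div_const 2 using 1
  field_simp

lemma continuousOn_cauchyKernel (u : ℝ) : ContinuousOn (fun τ : ℝ => τ / (u ^ 2 + τ ^ 2)) (Set.Ioi 0) := by
  refine ContinuousOn.div (by fun_prop) (by fun_prop) fun τ hτ => ?_
  have : 0 < τ := hτ
  positivity

lemma integral_cauchyKernel {η T u : ℝ} (hη : 0 < η) (hT : η ≤ T) :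
    ∫ τ in η..T, τ / (u ^ 2 + τ ^ 2) = smoothLog T u - smoothLog η u := by
  have hsub : Set.uIcc η T ⊆ Set.Ioi 0 := by
    rw [Set.uIcc_of_le hT]
    exact fun x hx => lt_of_lt_of_le hη hx.1
  exact intervalIntegral.integral_eq_sub_of_hasDerivAt
    (fun τ hτ => hasDerivAt_smoothLog (hsub hτ))
    ((continuousOn_cauchyKernel u).mono hsub).intervalIntegrable

lemma abs_cauchyKernel_le {τ : ℝ} (hτ : 0 < τ) (u : ℝ) : |τ / (u ^ 2 + τ ^ 2)| ≤ 1 / τ := by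
  rw [abs_of_nonneg (by positivity), div_le_div_iff₀ (by positivity) hτ]
  nlinarith [sq_nonneg u]

lemma continuous_cauchyKernel {τ : ℝ} (hτ : 0 < τ) : Continuous fun u : ℝ => τ / (u ^ 2 + τ ^ 2) := by
  refine Continuous.div (by fun_prop) (by fun_prop) fun u => ?_
  positivity

section energy

variable {μ : Measure ℝ} [IsProbabilityMeasure μ] {n : ℕ} (l : Fin n → ℝ)

lemma im_mul_sq_resolventFluct_le {τ : ℝ} (hτ : 0 < τ) {z : ℂ} (hz : τ < 2 * z.im) :
    (2 * z.im - τ) * ‖resolventFluct μ l z‖ ^ 2 ≤ energy μ l fun u => τ / (u ^ 2 + τ ^ 2) := by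
  have h1 := two_mul_im_sub_mul_sq_norm_le (α := twoSheet μ l) (s := sheetSign) (p := Prod.fst)
    abs_sheetSign_le measurable_sheetSign measurable_fst hτ hz
  rw [integral_prod_twoSheet l (continuous_cauchyKernel hτ) (by simp) (abs_cauchyKernel_le hτ)] at h1
  convert! h1 using 3
  rw [resolventFluct, ← integral_twoSheet_sign_mul]
  · rfl
  · have hy : 0 < z.im := by linarith
    refine (integrable_const (1 / z.im)).mono' (Measurable.aestronglyMeasurable (by fun_prop))
      (Filter.Eventually.of_forall fun x => ?_)
    rw [norm_inv, one_div]
    apply inv_anti₀ hy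
    have := Complex.abs_im_le_norm (z - x)
    simp at this
    exact (le_abs_self _).trans this

/-- Positive definiteness, read off from the resolvent bound at z = iτ, where the coefficient 2 Im z
- τ equals τ. -/
lemma energy_cauchyKernel_nonneg {τ : ℝ} (hτ : 0 < τ) :
    0 ≤ energy μ l fun u => τ / (u ^ 2 + τ ^ 2) := by
  have h := im_mul_sq_resolventFluct_le (μ := μ) l hτ (z := τ * Complex.I) (by simp; linarith)
  refine le_trans (mul_nonneg ?_ (sq_nonneg _)) h
  simp; linarith

/-- The derivative of the smoothed logarithm in its scale is the Cauchy kernel. So a difference of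
smoothed logarithms has an energy that is an integral of nonnegative energies over the scales in
between. -/
lemma energy_smoothLog_sub {η T : ℝ} (hη : 0 < η) (hT : η ≤ T) :
    IntervalIntegrable (fun τ => energy μ l fun u => τ / (u ^ 2 + τ ^ 2)) volume η T ∧
    energy μ l (fun u => smoothLog T u - smoothLog η u) =
      ∫ τ in η..T, energy μ l fun u => τ / (u ^ 2 + τ ^ 2) := by
  set α := (twoSheet μ l).prod (twoSheet μ l) with hα
  have hm := measurable_sheetSign
  have hpos : ∀ τ ∈ Set.Ioc η T, 0 < τ := fun τ hτ => hη.trans hτ.1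
  have hF : Integrable (Function.uncurry fun (τ : ℝ) (q : (ℝ × Bool) × (ℝ × Bool)) =>
      sheetSign q.1 * sheetSign q.2 * (τ / ((q.2.1 - q.1.1) ^ 2 + τ ^ 2)))
      ((volume.restrict (Set.Ioc η T)).prod α) := by
    refine (integrable_const (1 / η)).mono' (Measurable.aestronglyMeasurable
      (by unfold Function.uncurry; fun_prop)) ?_
    have h1 : ∀ᵐ x ∂((volume.restrict (Set.Ioc η T)).prod α), x.1 ∈ Set.Ioc η T := by
      have h2 : ∀ᵐ τ ∂(volume.restrict (Set.Ioc η T)), τ ∈ Set.Ioc η T :=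
        ae_restrict_mem measurableSet_Ioc
      exact Measure.quasiMeasurePreserving_fst.ae h2
    filter_upwards [h1] with x hx
    simp only [Function.uncurry]
    rw [Real.norm_eq_abs, abs_mul, abs_mul]
    calc _ ≤ 1 * 1 * (1 / η) := by
          gcongr
          · exact abs_sheetSign_le _
          · exact abs_sheetSign_le _
          · refine (abs_cauchyKernel_le (hpos _ hx) _).trans ?_
            exact one_div_le_one_div_of_le hη hx.1.le
      _ = 1 / η := by ring
  have h1 : ∀ τ ∈ Set.Ioc η T, ∫ q, sheetSign q.1 * sheetSign q.2 *
      (τ / ((q.2.1 - q.1.1) ^ 2 + τ ^ 2)) ∂α = energy μ l fun u => τ / (u ^ 2 + τ ^ 2) :=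
    fun τ hτ => integral_prod_twoSheet l (continuous_cauchyKernel (hpos τ hτ)) (by simp)
      (abs_cauchyKernel_le (hpos τ hτ))
  constructor
  · rw [intervalIntegrable_iff_integrableOn_Ioc_of_le hT]
    refine (hF.integral_prod_left).congr ?_
    filter_upwards [ae_restrict_mem measurableSet_Ioc] with τ hτ
    exact h1 τ hτ
  · rw [intervalIntegral.integral_of_le hT,
      ← setIntegral_congr_fun measurableSet_Ioc h1, integral_integral_swap hF]
    have hκc : Continuous fun u => smoothLog T u - smoothLog η u :=
      (BoundedDensity.continuous_smoothLog (hη.trans_le hT)).sub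
        (BoundedDensity.continuous_smoothLog hη)
    have hb : ∀ u, |smoothLog T u - smoothLog η u| ≤ (1 / η) * |T - η| := by
      intro u
      rw [← integral_cauchyKernel hη hT, ← Real.norm_eq_abs]
      refine intervalIntegral.norm_integral_le_of_norm_le_const fun τ hτ => ?_
      rw [Set.uIoc_of_le hT] at hτ
      exact (abs_cauchyKernel_le (hpos _ hτ) _).trans (one_div_le_one_div_of_le hη hτ.1.le)
    rw [← integral_prod_twoSheet l hκc (by simp [smoothLog]) hb]
    refine integral_congr_ae (Filter.Eventually.of_forall fun q => ?_)
    simp only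
    rw [integral_const_mul, ← intervalIntegral.integral_of_le hT, integral_cauchyKernel hη hT]

/-- Only the scales τ between Im z / 2 and Im z are used. There 2 Im z - τ ≥ Im z, and the interval
has length Im z / 2. All other scales contribute nonnegatively. -/
lemma sq_im_mul_sq_resolventFluct_le {η T : ℝ} (hη : 0 < η) {z : ℂ} (hz1 : 2 * η ≤ z.im)
    (hz2 : z.im ≤ T) : z.im ^ 2 / 2 * ‖resolventFluct μ l z‖ ^ 2 ≤
      energy μ l fun u => smoothLog T u - smoothLog η u := by
  have hT : η ≤ T := by linarith
  obtain ⟨hi, he⟩ := energy_smoothLog_sub (μ := μ) l hη hT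
  set y := z.im
  rw [he]
  have hsub : Set.uIcc (y / 2) y ⊆ Set.uIcc η T := by
    rw [Set.uIcc_of_le (by linarith), Set.uIcc_of_le hT]
    exact Set.Icc_subset_Icc (by linarith) hz2
  have h1 : ∫ _ in (y / 2)..y, y * ‖resolventFluct μ l z‖ ^ 2 ≤
      ∫ τ in (y / 2)..y, energy μ l fun u => τ / (u ^ 2 + τ ^ 2) := by
    refine intervalIntegral.integral_mono_on (by linarith) (by simp) (hi.mono_set hsub) fun τ hτ => ?_
    have hτ0 : 0 < τ := by linarith [hτ.1]
    refine le_trans ?_ (im_mul_sq_resolventFluct_le l hτ0 (z := z) (by linarith [hτ.2]))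
    gcongr
    linarith [hτ.2]
  rw [intervalIntegral.integral_const, smul_eq_mul] at h1
  have h2 : ∫ τ in (y / 2)..y, energy μ l (fun u => τ / (u ^ 2 + τ ^ 2)) ≤
      ∫ τ in η..T, energy μ l fun u => τ / (u ^ 2 + τ ^ 2) := by
    refine intervalIntegral.integral_mono_interval (by linarith) (by linarith) hz2 ?_ hi
    filter_upwards [ae_restrict_mem measurableSet_Ioc] with τ hτ
    exact energy_cauchyKernel_nonneg l (hη.trans hτ.1)
  refine le_trans (le_of_eq ?_) (h1.trans h2)
  ring

end energy

end BetaEnsemble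

/-! ### The discrepancy and its concentration. -/

namespace BetaEnsemble

/-- The regularised quadratic energy of `∑ᵢ δ_{λᵢ} - n μ` at scales between `n⁻⁴` and `n`. -/
noncomputable def discrepancy (μ : Measure ℝ) {n : ℕ} (l : Fin n → ℝ) : ℝ :=
  energy μ l fun u => smoothLog n u - smoothLog ((n : ℝ) ^ 4)⁻¹ u

/-- A confining potential `V` with equilibrium measure `μ`, whose effective potential
`2 ∫ log |y - x| dμ(y) - V x` is maximal exactly on `[-2, 2]`. -/
structure EquilibriumSetting (V : ℝ → ℝ) (β : ℝ) (μ : Measure ℝ) (b : ℝ≥0) (ε L : ℝ) : Prop where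
  beta_pos : 0 < β
  continuous_V : Continuous V
  eps_pos : 0 < ε
  growth : ∀ x : ℝ, L ≤ |x| → 2 * (1 + ε) * Real.log (1 + |x|) ≤ V x
  density : BoundedDensity μ b
  le_max : ∀ x, 2 * logPot μ x - V x ≤ 2 * (∫ x, logPot μ x ∂μ) - ∫ x, V x ∂μ
  lt_max : ∀ x, x ∉ Set.Icc (-2 : ℝ) 2 →
    2 * logPot μ x - V x < 2 * (∫ x, logPot μ x ∂μ) - ∫ x, V x ∂μ

namespace BoundedDensity

variable {μ : Measure ℝ} {b : ℝ≥0} (h : BoundedDensity μ b) {n : ℕ} (l : Fin n → ℝ)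
include h

lemma integrable_comp_sub {κ : ℝ → ℝ} (hκ : Continuous κ) (x : ℝ) :
    Integrable (fun y => κ (y - x)) μ :=
  h.integrable_of_continuous (hκ.comp (by fun_prop)).continuousOn

lemma integrable_integral_sub {κ : ℝ → ℝ} (hκ : Continuous κ) :
    Integrable (fun x => ∫ y, κ (y - x) ∂μ) μ :=
  h.integrable_of_continuous (h.continuous_integral_sub hκ).continuousOn

lemma energy_sub {κ₁ κ₂ : ℝ → ℝ} (h₁ : Continuous κ₁) (h₂ : Continuous κ₂) :
    energy μ l (fun u => κ₁ u - κ₂ u) = energy μ l κ₁ - energy μ l κ₂ := by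
  unfold energy
  have e1 : ∀ x, ∫ y, (κ₁ (y - x) - κ₂ (y - x)) ∂μ = ∫ y, κ₁ (y - x) ∂μ - ∫ y, κ₂ (y - x) ∂μ :=
    fun x => integral_sub (h.integrable_comp_sub h₁ x) (h.integrable_comp_sub h₂ x)
  simp_rw [e1]
  rw [integral_sub (h.integrable_integral_sub h₁) (h.integrable_integral_sub h₂)]
  simp_rw [Finset.sum_sub_distrib]
  ring

lemma energy_const (c : ℝ) : energy μ l (fun _ => c) = 0 := by
  have := h.prob
  simp [energy]
  ring

omit h in
lemma continuous_discrepancy_kernel (hn : n ≠ 0) :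
    Continuous fun u => smoothLog n u - smoothLog ((n : ℝ) ^ 4)⁻¹ u := by
  have : (0 : ℝ) < n := by positivity
  exact (continuous_smoothLog this).sub (continuous_smoothLog (by positivity))

lemma continuous_discrepancy (hn : n ≠ 0) : Continuous (discrepancy μ (n := n)) := by
  have hκ := continuous_discrepancy_kernel hn
  unfold discrepancy energy
  refine Continuous.add (Continuous.sub ?_ ?_) continuous_const
  · exact continuous_finsetSum _ fun i _ => continuous_finsetSum _ fun j _ =>
      hκ.comp (by fun_prop)
  · refine Continuous.mul continuous_const (continuous_finsetSum _ fun i _ => ?_)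
    exact (h.continuous_integral_sub hκ).comp (continuous_apply i)

lemma abs_integral_le_of_bound {κ : ℝ → ℝ} {c R x : ℝ} (hR : 2 ≤ R)
    (hx : |x| ≤ R) (hc : ∀ u, |u| ≤ 2 * R → |κ u| ≤ c) : |∫ y, κ (y - x) ∂μ| ≤ c := by
  have := h.prob
  have h1 : ∀ᵐ y ∂μ, ‖κ (y - x)‖ ≤ c := by
    filter_upwards [h.ae_mem] with y hy
    apply hc
    have := abs_sub y x
    have h2 : |y| ≤ 2 := abs_le.2 hy
    linarith
  simpa using norm_integral_le_of_norm_le_const h1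

/-- The total variation of ∑ δ_{λᵢ} - n μ is at most 2n, whence the factor (2n)². -/
lemma abs_energy_le {κ : ℝ → ℝ} {c R : ℝ} (hR : 2 ≤ R) (hl : ∀ i, |l i| ≤ R)
    (hc : ∀ u, |u| ≤ 2 * R → |κ u| ≤ c) : |energy μ l κ| ≤ 4 * n ^ 2 * c := by
  have := h.prob
  have e1 : |∑ i, ∑ j, κ (l j - l i)| ≤ n ^ 2 * c := by
    have h1 : ∀ i ∈ Finset.univ, |∑ j, κ (l j - l i)| ≤ n * c := fun i _ => by
      refine (Finset.abs_sum_le_sum_abs _ _).trans ?_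
      refine (Finset.sum_le_card_nsmul _ _ c fun j _ => hc _ ?_).trans_eq (by simp)
      exact (abs_sub _ _).trans (by linarith [hl i, hl j])
    refine (Finset.abs_sum_le_sum_abs _ _).trans ((Finset.sum_le_card_nsmul _ _ _ h1).trans_eq ?_)
    simp; ring
  have e2 : |∑ i, ∫ y, κ (y - l i) ∂μ| ≤ n * c := by
    refine (Finset.abs_sum_le_sum_abs _ _).trans ((Finset.sum_le_card_nsmul _ _ c fun i _ =>
      h.abs_integral_le_of_bound hR (hl i) hc).trans_eq (by simp))
  have e3 : |∫ x, ∫ y, κ (y - x) ∂μ ∂μ| ≤ c := by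
    have h1 : ∀ᵐ x ∂μ, ‖∫ y, κ (y - x) ∂μ‖ ≤ c := by
      filter_upwards [h.ae_mem] with x hx
      exact h.abs_integral_le_of_bound hR ((abs_le.2 hx).trans hR) hc
    simpa using norm_integral_le_of_norm_le_const h1
  unfold energy
  rw [abs_le] at e1 e2 e3 ⊢
  have hn : (0 : ℝ) ≤ n := by positivity
  have e4 := mul_le_mul_of_nonneg_left e2.1 (show (0 : ℝ) ≤ 2 * n by positivity)
  have e5 := mul_le_mul_of_nonneg_left e2.2 (show (0 : ℝ) ≤ 2 * n by positivity)
  have e6 := mul_le_mul_of_nonneg_left e3.1 (show (0 : ℝ) ≤ n ^ 2 by positivity)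
  have e7 := mul_le_mul_of_nonneg_left e3.2 (show (0 : ℝ) ≤ n ^ 2 by positivity)
  constructor <;> nlinarith [e1.1, e1.2]

end BoundedDensity

lemma abs_smoothLog_sub_log_le {T u : ℝ} (hT : 0 < T) :
    |smoothLog T u - Real.log T| ≤ u ^ 2 / (2 * T ^ 2) := by
  have h1 : smoothLog T u - Real.log T = Real.log (1 + u ^ 2 / T ^ 2) / 2 := by
    have h2 : u ^ 2 + T ^ 2 = T ^ 2 * (1 + u ^ 2 / T ^ 2) := by field_simp; ring
    rw [smoothLog, h2, Real.log_mul (by positivity) (by positivity), Real.log_pow]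
    push_cast; ring
  have h3 : 0 ≤ u ^ 2 / T ^ 2 := by positivity
  have h4 := Real.log_nonneg (show 1 ≤ 1 + u ^ 2 / T ^ 2 by linarith)
  have h5 := Real.log_le_sub_one_of_pos (show 0 < 1 + u ^ 2 / T ^ 2 by positivity)
  rw [h1, abs_of_nonneg (by positivity)]
  have h6 : u ^ 2 / (2 * T ^ 2) = u ^ 2 / T ^ 2 / 2 := by field_simp
  rw [h6]
  linarith

namespace EquilibriumSetting

variable {V : ℝ → ℝ} {β : ℝ} {μ : Measure ℝ} {b : ℝ≥0} {ε L : ℝ}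
  (S : EquilibriumSetting V β μ b ε L)
include S

lemma b_pos : 0 < (b : ℝ) := by
  have := S.density.prob
  rw [NNReal.coe_pos, pos_iff_ne_zero]
  rintro rfl
  have h1 := S.density.le_smul Set.univ
  simp at h1

/-- Replacing log by the smoothed logarithm at scale η = n⁻⁴ costs n log(1/η) = 4 n log n on the
diagonal and O(n² √η) = O(1) in the potential of μ. At the upper scale n the smoothed logarithm is
constant up to O(n⁻²) on bounded sets, and constants have zero energy because ∑ δ_{λᵢ} - n μ has
total mass zero, so that end costs O(1) as well. -/
lemma exists_sum_log_le {R : ℝ} (hR : 2 ≤ R) : ∃ C : ℝ, 0 ≤ C ∧ ∀ n : ℕ, 2 ≤ n →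
    ∀ l : Fin n → ℝ, (∀ i, |l i| ≤ R) → Function.Injective l →
    ∑ i, ∑ j, Real.log |l i - l j| ≤ -discrepancy μ l + 2 * n * ∑ i, logPot μ (l i) -
      n ^ 2 * ∫ x, logPot μ x ∂μ + 4 * n * Real.log n + C := by
  have h := S.density
  have := h.prob
  obtain ⟨C, hC, hC'⟩ := h.exists_smoothLog_le
  refine ⟨8 * R ^ 2 + 2 * C, by positivity, fun n hn l hl hinj => ?_⟩
  have hn0 : (0 : ℝ) < n := by positivity
  set η : ℝ := ((n : ℝ) ^ 4)⁻¹ with hη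
  have hη0 : 0 < η := by positivity
  have cη := BoundedDensity.continuous_smoothLog hη0
  have cT := BoundedDensity.continuous_smoothLog hn0
  have e1 : ∑ i, ∑ j, Real.log |l i - l j| ≤
      ∑ i, ∑ j, smoothLog η (l j - l i) - n * Real.log η := by
    have h1 : ∀ i, ∑ j, Real.log |l i - l j| ≤ ∑ j, smoothLog η (l j - l i) - Real.log η := by
      intro i
      rw [Fintype.sum_eq_add_sum_compl i, Fintype.sum_eq_add_sum_compl i
        (fun j => smoothLog η (l j - l i))]
      have h2 : smoothLog η (l i - l i) = Real.log η := by
        simp [smoothLog, Real.log_pow]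
      have h3 : ∑ j ∈ ({i}ᶜ : Finset (Fin n)), Real.log |l i - l j| ≤
          ∑ j ∈ ({i}ᶜ : Finset (Fin n)), smoothLog η (l j - l i) := by
        refine Finset.sum_le_sum fun j hj => ?_
        rw [abs_sub_comm]
        refine log_abs_le_smoothLog (sub_ne_zero.2 fun h => ?_)
        simp at hj
        exact hj (hinj h)
      rw [h2, sub_self, abs_zero, Real.log_zero]
      linarith
    refine (Finset.sum_le_sum fun i _ => h1 i).trans_eq ?_
    rw [Finset.sum_sub_distrib]; simp
  have e2 : energy μ l (smoothLog η) = -discrepancy μ l + energy μ l (smoothLog n) := by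
    rw [discrepancy, h.energy_sub l cT cη]; ring
  have e3 : energy μ l (smoothLog n) ≤ 8 * R ^ 2 := by
    have h1 := h.energy_sub l cT (continuous_const (y := Real.log (n : ℝ)))
    rw [h.energy_const, sub_zero] at h1
    rw [← h1]
    refine (le_abs_self _).trans ((h.abs_energy_le l (c := (2 * R) ^ 2 / (2 * (n : ℝ) ^ 2)) hR hl
      fun u hu => ?_).trans_eq ?_)
    · refine (abs_smoothLog_sub_log_le hn0).trans ?_
      gcongr ?_ / _
      rw [← sq_abs]
      gcongr
    · field_simp; ring
  have e4 : ∑ i, ∫ y, smoothLog η (y - l i) ∂μ ≤ ∑ i, logPot μ (l i) + n * (C * √η) := by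
    refine (Finset.sum_le_sum fun i _ => hC' η hη0 (l i)).trans_eq ?_
    rw [Finset.sum_add_distrib]; simp
  have e5 : ∫ x, logPot μ x ∂μ ≤ ∫ x, ∫ y, smoothLog η (y - x) ∂μ ∂μ :=
    integral_mono (h.integrable_of_continuous h.continuous_logPot.continuousOn)
      (h.integrable_integral_sub cη) fun x => h.logPot_le_smoothLog hη0 x
  have e6 : √η = ((n : ℝ) ^ 2)⁻¹ := by
    rw [hη, Real.sqrt_inv, show (n : ℝ) ^ 4 = (n ^ 2) ^ 2 by ring, Real.sqrt_sq (by positivity)]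
  have e7 : Real.log η = -(4 * Real.log n) := by
    rw [hη, Real.log_inv, Real.log_pow]; push_cast; ring
  rw [e6] at e4
  have e8 : 2 * n * (n * (C * ((n : ℝ) ^ 2)⁻¹)) = 2 * C := by field_simp
  unfold energy at e2
  have e9 := mul_le_mul_of_nonneg_left e4 (show (0 : ℝ) ≤ 2 * n by positivity)
  have e10 := mul_le_mul_of_nonneg_left e5 (show (0 : ℝ) ≤ n ^ 2 by positivity)
  rw [mul_add, e8] at e9
  rw [e7] at e1
  unfold energy at e3
  linarith

/-- The upper bound for the density and Jensen's lower bound for the partition function have the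
same terms of order n², by the maximality of the effective potential. The discrepancy survives with
a negative sign. -/
lemma exists_weight_le {R : ℝ} (hR : 2 ≤ R) : ∃ C : ℝ, 0 ≤ C ∧ ∀ n : ℕ, 2 ≤ n →
    Integrable (weight V β n) → ∀ l : Fin n → ℝ, (∀ i, |l i| ≤ R) →
    weight V β n l ≤ partitionFn V β n *
      Real.exp (-(β / 2 * discrepancy μ l) + C * (n * Real.log n)) := by
  have h := S.density
  have hβ := S.beta_pos
  obtain ⟨C, hC, hC'⟩ := S.exists_sum_log_le hR
  set u₀ := ∫ x, logPot μ x ∂μ with hu₀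
  set v₀ := ∫ x, V x ∂μ with hv₀
  set c := |u₀| * β / 2 + β / 2 * C + |Real.log b| with hc
  have hc0 : 0 ≤ c := by positivity
  have hlog2 : 0 < Real.log 2 := Real.log_pos (by norm_num)
  refine ⟨c / Real.log 2 + 2 * β, by positivity, fun n hn hint l hl => ?_⟩
  have hn0 : (0 : ℝ) < n := by positivity
  have hn2 : (2 : ℝ) ≤ n := by exact_mod_cast hn
  have hQ := partitionFn_pos hβ S.continuous_V hint
  by_cases hinj : Function.Injective l
  swap
  · obtain ⟨i, j, hij, hne⟩ : ∃ i j, l i = l j ∧ i ≠ j := by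
      simpa [Function.Injective] using hinj
    rw [weight_eq_zero_of_eq hβ hne hij]
    positivity
  have e1 := hC' n hn l hl hinj
  have e2 := h.exp_le_partitionFn S.continuous_V hint
  have hb := S.b_pos
  have e3 : (b : ℝ) ^ n ≤ Real.exp (n * |Real.log b|) := by
    rw [← Real.exp_log (pow_pos hb n), Real.log_pow]
    gcongr
    exact le_abs_self _
  have e4 : Real.exp (β / 2 * (n * (n - 1)) * u₀ - n ^ 2 * β / 2 * v₀) ≤
      Real.exp (n * |Real.log b|) * partitionFn V β n :=
    e2.trans (by gcongr)
  -- The variational inequality trades the potentials at the eigenvalues for the external field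
  -- there.
  have e5 : ∑ i, (2 * logPot μ (l i)) ≤ n * (2 * u₀ - v₀) + ∑ i, V (l i) := by
    have : ∑ i, (2 * logPot μ (l i)) ≤ ∑ i, ((2 * u₀ - v₀) + V (l i)) :=
      Finset.sum_le_sum fun i _ => by linarith [S.le_max (l i)]
    refine this.trans_eq ?_
    rw [Finset.sum_add_distrib]; simp; ring
  rw [← Finset.mul_sum] at e5
  have hlogn : Real.log 2 ≤ Real.log n := Real.log_le_log (by norm_num) hn2
  have e6 : c * n ≤ c / Real.log 2 * (n * Real.log n) := by
    have : c / Real.log 2 * (n * Real.log n) = c * n * (Real.log n / Real.log 2) := by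
      field_simp
    rw [this]
    refine le_mul_of_one_le_right (by positivity) ?_
    rwa [one_le_div hlog2]
  have e7 : -((n : ℝ) * β / 2 * ∑ i, V (l i)) + β / 2 * ∑ i, ∑ j, Real.log |l i - l j| ≤
      (β / 2 * (n * (n - 1)) * u₀ - n ^ 2 * β / 2 * v₀) - n * |Real.log b| +
      (-(β / 2 * discrepancy μ l) + (c / Real.log 2 + 2 * β) * (n * Real.log n)) := by
    have f1 := mul_le_mul_of_nonneg_left e1 (show 0 ≤ β / 2 by positivity)
    have f2 := mul_le_mul_of_nonneg_left e5 (show 0 ≤ n * β / 2 by positivity)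
    have f3 : β / 2 * C ≤ β / 2 * C * n := le_mul_of_one_le_right (by positivity) (by linarith)
    have f4 : β / 2 * n * u₀ ≤ |u₀| * β / 2 * n := by
      have := mul_le_mul_of_nonneg_left (le_abs_self u₀) (show 0 ≤ β / 2 * n by positivity)
      linarith
    rw [hc] at e6 ⊢
    nlinarith
  rw [weight_eq_exp hinj]
  refine (Real.exp_le_exp.2 e7).trans ?_
  rw [Real.exp_add, Real.exp_sub]
  gcongr
  rw [div_le_iff₀ (Real.exp_pos _), mul_comm (partitionFn V β n)]
  exact e4

/-- The constant A outweighs the n log n term of `exists_weight_le` and the volume (2R)ⁿ of the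
cube, leaving a further factor exp(-n). The division by log 2 turns multiples of n into multiples of
n log n for n ≥ 2. -/
lemma exists_law_discrepancy_le {R : ℝ} (hR : 2 ≤ R) : ∃ A : ℝ, 0 ≤ A ∧ ∀ n : ℕ, 2 ≤ n →
    Integrable (weight V β n) →
    law V β n {l | (∀ i, |l i| ≤ R) ∧ A * (n * Real.log n) < discrepancy μ l} ≤
      ENNReal.ofReal (Real.exp (-n)) := by
  have h := S.density
  have hβ := S.beta_pos
  obtain ⟨C, hC, hC'⟩ := S.exists_weight_le hR
  have hlog2 : 0 < Real.log 2 := Real.log_pos (by norm_num)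
  have hlogR : 0 ≤ Real.log (2 * R) := Real.log_nonneg (by linarith)
  refine ⟨2 / β * (C + (1 + Real.log (2 * R)) / Real.log 2), by positivity, fun n hn hint => ?_⟩
  set A := 2 / β * (C + (1 + Real.log (2 * R)) / Real.log 2) with hA
  have hn2 : (2 : ℝ) ≤ n := by exact_mod_cast hn
  have hQ := partitionFn_pos hβ S.continuous_V hint
  set E := {l : Fin n → ℝ | (∀ i, |l i| ≤ R) ∧ A * (n * Real.log n) < discrepancy μ l} with hE
  have hcube : {l : Fin n → ℝ | ∀ i, |l i| ≤ R} = Set.univ.pi fun _ => Set.Icc (-R) R := by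
    ext l; simp only [Set.mem_ofPred_eq, Set.mem_univ_pi, Set.mem_Icc, abs_le]
  have hEm : MeasurableSet E := by
    have hm : MeasurableSet {l : Fin n → ℝ | ∀ i, |l i| ≤ R} := by
      rw [hcube]
      exact MeasurableSet.univ_pi fun _ => measurableSet_Icc
    exact hm.inter (measurableSet_lt measurable_const
      (h.continuous_discrepancy (by omega)).measurable)
  rw [← lintegral_indicator_one hEm, lintegral_law S.continuous_V hβ]
  have e1 : ∀ l, ENNReal.ofReal (weight V β n l) * E.indicator 1 l ≤
      (Set.univ.pi fun _ : Fin n => Set.Icc (-R) R).indicator (fun _ => ENNReal.ofReal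
        (partitionFn V β n * Real.exp (-(n * (1 + Real.log (2 * R)))))) l := by
    intro l
    by_cases hl : l ∈ E
    · rw [Set.indicator_of_mem hl, Set.indicator_of_mem (by rw [← hcube]; exact hl.1), Pi.one_apply,
        mul_one]
      refine ENNReal.ofReal_le_ofReal ((hC' n hn hint l hl.1).trans ?_)
      gcongr
      have e2 := mul_le_mul_of_nonneg_left hl.2.le (show 0 ≤ β / 2 by positivity)
      have e3 : β / 2 * (A * (n * Real.log n)) = C * (n * Real.log n) +
          n * (1 + Real.log (2 * R)) * (Real.log n / Real.log 2) := by
        rw [hA]; field_simp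
      have e4 : n * (1 + Real.log (2 * R)) ≤
          n * (1 + Real.log (2 * R)) * (Real.log n / Real.log 2) := by
        refine le_mul_of_one_le_right (by positivity) ?_
        rw [one_le_div hlog2]
        exact Real.log_le_log (by norm_num) hn2
      linarith
    · rw [Set.indicator_of_notMem hl, mul_zero]; exact zero_le
  calc _ ≤ ENNReal.ofReal (partitionFn V β n)⁻¹ * ∫⁻ l : Fin n → ℝ,
        (Set.univ.pi fun _ : Fin n => Set.Icc (-R) R).indicator (fun _ => ENNReal.ofReal
        (partitionFn V β n * Real.exp (-(n * (1 + Real.log (2 * R)))))) l := by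
        gcongr with l; exact e1 l
    _ = ENNReal.ofReal ((partitionFn V β n)⁻¹ * ((partitionFn V β n *
        Real.exp (-(n * (1 + Real.log (2 * R))))) * (2 * R) ^ n)) := by
        rw [lintegral_indicator (MeasurableSet.univ_pi fun _ => measurableSet_Icc), setLIntegral_const,
          volume_pi_pi]
        simp only [Real.volume_Icc, Finset.prod_const, Finset.card_univ, Fintype.card_fin]
        rw [← ENNReal.ofReal_pow (by linarith), ← ENNReal.ofReal_mul (by positivity),
          ← ENNReal.ofReal_mul (by positivity)]
        congr 4; ring
    _ = ENNReal.ofReal (Real.exp (-n)) := by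
        congr 1
        have : (2 * R) ^ n = Real.exp (n * Real.log (2 * R)) := by
          rw [← Real.log_pow, Real.exp_log (by positivity)]
        rw [this, mul_assoc (partitionFn V β n), ← Real.exp_add, ← mul_assoc,
          inv_mul_cancel₀ hQ.ne', one_mul]
        congr 1; ring

end EquilibriumSetting

end BetaEnsemble

/-! ### Consequences of a small discrepancy, and reduction to conditional densities. -/

namespace BetaEnsemble

lemma log_le_four_mul_rpow {x : ℝ} (hx : 0 < x) : Real.log x ≤ 4 * x ^ (1 / 4 : ℝ) := by
  have h1 := Real.log_le_sub_one_of_pos (Real.rpow_pos_of_pos hx (1 / 4))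
  rw [Real.log_rpow hx] at h1
  linarith

/-- The logarithm is traded for a power of n. What matters later is that 5/8 is less than 1. -/
lemma sqrt_mul_log_le {A : ℝ} (hA : 0 ≤ A) {n : ℕ} (hn : n ≠ 0) :
    √(2 * (A * (n * Real.log n))) ≤ √(8 * A) * (n : ℝ) ^ (5 / 8 : ℝ) := by
  have hn0 : (0 : ℝ) < n := by positivity
  have h1 : 2 * (A * (n * Real.log n)) ≤ 8 * A * (((n : ℝ) ^ (5 / 8 : ℝ)) ^ 2) := by
    have h2 := log_le_four_mul_rpow hn0
    have h3 : ((n : ℝ) ^ (5 / 8 : ℝ)) ^ 2 = n * (n : ℝ) ^ (1 / 4 : ℝ) := by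
      rw [← Real.rpow_natCast, ← Real.rpow_mul hn0.le]
      nth_rw 2 [← Real.rpow_one (n : ℝ)]
      rw [← Real.rpow_add hn0]; norm_num
    rw [h3]
    have := mul_le_mul_of_nonneg_left h2 (show 0 ≤ 2 * A * n by positivity)
    linarith
  refine (Real.sqrt_le_sqrt h1).trans_eq ?_
  rw [Real.sqrt_mul (by positivity), Real.sqrt_sq (by positivity)]

lemma norm_resolventFluct_le_of_im {μ : Measure ℝ} [IsProbabilityMeasure μ] {n : ℕ}
    (l : Fin n → ℝ) {η T D : ℝ} (hη : 0 < η)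
    (hD : energy μ l (fun u => smoothLog T u - smoothLog η u) ≤ D) {z : ℂ} (hz1 : 2 * η ≤ z.im)
    (hz2 : z.im ≤ T) : ‖resolventFluct μ l z‖ ≤ √(2 * D) / z.im := by
  have hy : 0 < z.im := by linarith
  have h1 := (sq_im_mul_sq_resolventFluct_le (μ := μ) l hη hz1 hz2).trans hD
  rw [le_div_iff₀ hy]
  apply Real.le_sqrt_of_sq_le
  rw [mul_pow]
  linarith

namespace BoundedDensity

variable {μ : Measure ℝ} {b : ℝ≥0} (h : BoundedDensity μ b) {n : ℕ} (l : Fin n → ℝ)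
include h

/-- The logarithm at scale a is the one at scale T minus an integral of Cauchy kernels. The centred
sum of the Cauchy kernel at scale τ is minus the imaginary part of the centred resolvent trace at x
+ iτ, hence at most √(2D)/τ, and integration gives the factor log(T/a). At scale T the logarithm is
almost constant, and constants are annihilated by centring. -/
lemma abs_sum_smoothLog_sub_le {R η a T D x : ℝ} (hR : 2 ≤ R) (hl : ∀ i, |l i| ≤ R) (hx : |x| ≤ R)
    (hη : 0 < η) (ha : 2 * η ≤ a) (hT : a ≤ T)
    (hD : energy μ l (fun u => smoothLog T u - smoothLog η u) ≤ D) :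
    |∑ j, smoothLog a (l j - x) - n * ∫ y, smoothLog a (y - x) ∂μ| ≤
      √(2 * D) * Real.log (T / a) + 4 * n * R ^ 2 / T ^ 2 := by
  have := h.prob
  have ha0 : 0 < a := by linarith
  have hT0 : 0 < T := by linarith
  set f : (ℝ → ℝ) → ℝ := fun κ => ∑ j, κ (l j - x) - n * ∫ y, κ (y - x) ∂μ with hf
  have hsub : Set.uIcc a T ⊆ Set.Ioi 0 := by
    rw [Set.uIcc_of_le hT]; exact fun t ht => lt_of_lt_of_le ha0 ht.1
  have hpos : ∀ τ ∈ Set.uIoc a T, 0 < τ := fun τ hτ => by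
    rw [Set.uIoc_of_le hT] at hτ; exact ha0.trans hτ.1
  have hci : ∀ u, IntervalIntegrable (fun τ => τ / (u ^ 2 + τ ^ 2)) volume a T := fun u =>
    ((continuousOn_cauchyKernel u).mono hsub).intervalIntegrable
  have hF : Integrable (Function.uncurry fun (τ : ℝ) (y : ℝ) => τ / ((y - x) ^ 2 + τ ^ 2))
      ((volume.restrict (Set.uIoc a T)).prod μ) := by
    have hfin : IsFiniteMeasure (volume.restrict (Set.uIoc a T)) := by
      rw [Set.uIoc_of_le hT]; infer_instance
    refine (integrable_const (1 / a)).mono' (Measurable.aestronglyMeasurable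
      (by unfold Function.uncurry; fun_prop)) ?_
    have h1 : ∀ᵐ q ∂((volume.restrict (Set.uIoc a T)).prod μ), q.1 ∈ Set.uIoc a T := by
      have h2 : ∀ᵐ τ ∂(volume.restrict (Set.uIoc a T)), τ ∈ Set.uIoc a T :=
        ae_restrict_mem measurableSet_uIoc
      exact Measure.quasiMeasurePreserving_fst.ae h2
    filter_upwards [h1] with q hq
    refine (abs_cauchyKernel_le (hpos _ hq) _).trans ?_
    rw [Set.uIoc_of_le hT] at hq
    exact one_div_le_one_div_of_le ha0 hq.1.le
  have hswap := intervalIntegral_integral_swap hF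
  have hint := hF.integral_prod_left
  have hii : IntervalIntegrable (fun τ => ∫ y, τ / ((y - x) ^ 2 + τ ^ 2) ∂μ) volume a T := by
    rw [intervalIntegrable_iff]; exact hint
  have h1 : f (smoothLog a) = f (smoothLog T) - ∫ τ in a..T, f (fun u => τ / (u ^ 2 + τ ^ 2)) := by
    simp only [hf]
    rw [intervalIntegral.integral_sub, intervalIntegral.integral_const_mul, hswap,
      intervalIntegral.integral_finsetSum fun j _ => hci (l j - x)]
    · simp_rw [integral_cauchyKernel ha0 hT]
      rw [integral_sub (h.integrable_smoothLog hT0 x) (h.integrable_smoothLog ha0 x),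
        Finset.sum_sub_distrib]
      ring
    · have := IntervalIntegrable.sum Finset.univ fun j _ => hci (l j - x)
      convert! this using 1
      ext τ; simp
    · exact hii.const_mul _
  have h2 : |f (smoothLog T)| ≤ 4 * n * R ^ 2 / T ^ 2 := by
    have e1 : f (smoothLog T) = f (fun u => smoothLog T u - Real.log T) := by
      simp only [hf]
      rw [integral_sub (h.integrable_smoothLog hT0 x) (integrable_const _), Finset.sum_sub_distrib]
      simp
      ring
    have e2 : ∀ u, |u| ≤ 2 * R → |smoothLog T u - Real.log T| ≤ 2 * R ^ 2 / T ^ 2 := fun u hu => by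
      refine (abs_smoothLog_sub_log_le hT0).trans ?_
      have : u ^ 2 ≤ (2 * R) ^ 2 := by rw [← sq_abs]; gcongr
      rw [div_le_div_iff₀ (by positivity) (by positivity)]
      nlinarith [sq_nonneg T]
    have e3 := h.abs_integral_le_of_bound hR hx e2
    have e4 : |∑ j, (smoothLog T (l j - x) - Real.log T)| ≤ n * (2 * R ^ 2 / T ^ 2) := by
      refine (Finset.abs_sum_le_sum_abs _ _).trans ?_
      refine (Finset.sum_le_card_nsmul _ _ _ fun j _ => e2 _ ?_).trans_eq (by simp)
      exact (abs_sub _ _).trans (by linarith [hl j])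
    rw [e1]
    simp only [hf]
    refine (abs_sub _ _).trans ?_
    rw [abs_mul, Nat.abs_cast]
    have e5 := mul_le_mul_of_nonneg_left e3 (show (0 : ℝ) ≤ n by positivity)
    have e6 : 4 * n * R ^ 2 / T ^ 2 = n * (2 * R ^ 2 / T ^ 2) + n * (2 * R ^ 2 / T ^ 2) := by ring
    linarith
  have h3 : ∀ τ ∈ Set.uIoc a T, ‖f (fun u => τ / (u ^ 2 + τ ^ 2))‖ ≤ √(2 * D) * τ⁻¹ := by
    intro τ hτ
    have hτ0 := hpos τ hτ
    rw [Set.uIoc_of_le hT] at hτ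
    have e1 := norm_resolventFluct_le_of_im (μ := μ) l hη hD (z := x + τ * Complex.I)
      (by simp; linarith [hτ.1]) (by simp; exact hτ.2)
    have e2 : (resolventFluct μ l (x + τ * Complex.I)).im = -f (fun u => τ / (u ^ 2 + τ ^ 2)) := by
      have e3 : ∀ y : ℝ, ((x + τ * Complex.I - y : ℂ)⁻¹).im = -(τ / ((y - x) ^ 2 + τ ^ 2)) := by
        intro y
        rw [Complex.inv_im, Complex.normSq_apply]
        simp
        ring
      have e4 : Integrable (fun y : ℝ => (x + τ * Complex.I - y : ℂ)⁻¹) μ := by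
        refine h.integrable_of_continuous (Continuous.continuousOn (Continuous.inv₀ (by fun_prop) ?_))
        intro y hy
        have := congrArg Complex.im hy
        simp at this; linarith
      have e5 := Complex.imCLM.integral_comp_comm e4
      simp only [Complex.imCLM_apply, e3] at e5
      simp only [resolventFluct, fluct, hf, Complex.sub_im, Complex.im_sum, e3]
      rw [← Complex.ofReal_natCast, Complex.im_ofReal_mul, ← e5, integral_neg]
      simp
      ring
    have e6 := Complex.abs_im_le_norm (resolventFluct μ l (x + τ * Complex.I))
    rw [e2, abs_neg] at e6
    simp only [Complex.add_im, Complex.ofReal_im, Complex.mul_im, Complex.ofReal_re, Complex.I_im,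
      mul_one, Complex.I_re, mul_zero, add_zero, zero_add] at e1
    exact e6.trans (e1.trans_eq (div_eq_mul_inv _ _))
  have h4 : |∫ τ in a..T, f (fun u => τ / (u ^ 2 + τ ^ 2))| ≤ √(2 * D) * Real.log (T / a) := by
    have hinv : IntervalIntegrable (fun τ : ℝ => √(2 * D) * τ⁻¹) volume a T := by
      refine (ContinuousOn.intervalIntegrable ?_)
      exact continuousOn_const.mul (continuousOn_id.inv₀ fun t ht => (hsub ht).ne')
    refine (intervalIntegral.norm_integral_le_of_norm_le hT
      (Filter.Eventually.of_forall fun τ hτ => h3 τ (by rwa [Set.uIoc_of_le hT])) hinv).trans_eq ?_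
    rw [intervalIntegral.integral_const_mul, integral_inv_of_pos ha0 hT0]
  change |f (smoothLog a)| ≤ _
  rw [h1]
  refine (abs_sub _ _).trans ?_
  linarith

end BoundedDensity

/-- Integrating the i-th eigenvalue first: a bound on the conditional expectation that is uniform in
the other eigenvalues is a bound on the expectation. -/
lemma lintegral_law_le_of_condWeight {V : ℝ → ℝ} {β : ℝ} (hV : Continuous V) (hβ : 0 < β) {n : ℕ}
    (hint : Integrable (weight V β n)) (i : Fin n) {f : (Fin n → ℝ) → ℝ≥0∞} (hf : Measurable f)
    {c : ℝ≥0∞} (hc : ∀ l, ∫⁻ x, f (Function.update l i x) * ENNReal.ofReal (condWeight V β n l i x) ≤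
      c * ∫⁻ x, ENNReal.ofReal (condWeight V β n l i x)) :
    ∫⁻ l, f l ∂(law V β n) ≤ c := by
  have hw : Measurable fun l : Fin n → ℝ => ENNReal.ofReal (weight V β n l) :=
    (continuous_weight hβ hV).measurable.ennreal_ofReal
  have hprob := isProbabilityMeasure_law hβ hV hint
  have hcm : ∀ l, Measurable fun x => ENNReal.ofReal (condWeight V β n l i x) := by
    intro l
    unfold condWeight
    have := hV.measurable
    fun_prop
  have h1 : ∫⁻ l, ENNReal.ofReal (weight V β n l) * f l ≤
      ∫⁻ l, ENNReal.ofReal (weight V β n l) * c := by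
    rw [volume_pi]
    refine lintegral_le_of_lmarginal_le {i} (hw.mul hf) (hw.mul_const c) ?_
    rw [lmarginal_singleton, lmarginal_singleton]
    intro l
    obtain ⟨r, hr, hr'⟩ := exists_weight_update (V := V) (β := β) l i
    simp only [hr', ENNReal.ofReal_mul hr, mul_assoc]
    rw [lintegral_const_mul' _ _ ENNReal.ofReal_ne_top, lintegral_const_mul' _ _ ENNReal.ofReal_ne_top]
    refine mul_le_mul' le_rfl ?_
    rw [lintegral_mul_const _ (hcm l), mul_comm _ c]
    refine le_trans (le_of_eq ?_) (hc l)
    exact lintegral_congr fun x => mul_comm _ _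
  have h2 := lintegral_law (V := V) (β := β) hV hβ n fun _ => c
  rw [lintegral_const, measure_univ, mul_one] at h2
  rw [lintegral_law hV hβ, h2]
  exact mul_le_mul' le_rfl h1

end BetaEnsemble

/-! ### Confinement of the eigenvalues to a neighbourhood of the cut. -/

namespace BetaEnsemble

/-- Configurations in `[-2 - e, 2 + e]` with small discrepancy. -/
def typicalSet (μ : Measure ℝ) (n : ℕ) (e A : ℝ) : Set (Fin n → ℝ) :=
  {l | (∀ i, |l i| ≤ 2 + e) ∧ discrepancy μ l ≤ A * (n * Real.log n)}

namespace EquilibriumSetting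

variable {V : ℝ → ℝ} {β : ℝ} {μ : Measure ℝ} {b : ℝ≥0} {ε L : ℝ}
  (S : EquilibriumSetting V β μ b ε L)
include S

lemma integrable_weight {n : ℕ} (hn : sizeThreshold β ε 0 ≤ n) : Integrable (weight V β n) :=
  BetaEnsemble.integrable_weight S.beta_pos S.eps_pos S.continuous_V S.growth hn

omit S in
lemma sizeThreshold_mono (hβ : 0 < β) (hε : 0 < ε) {κ : ℝ} (hκ : 0 ≤ κ) :
    sizeThreshold β ε 0 ≤ sizeThreshold β ε κ := by
  unfold sizeThreshold
  gcongr

/-- Comparison of an integral against the conditional density of one eigenvalue with a bound that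
involves the logarithmic potential of the remaining ones. -/
lemma lintegral_condWeight_le {n : ℕ} {l : Fin n → ℝ} {i : Fin n} {I : ℝ≥0∞} {c : ℝ} (hc : 0 ≤ c)
    (hI : I ≤ ENNReal.ofReal (c * Real.exp (β * ∑ j ∈ ({i}ᶜ : Finset (Fin n)), logPot μ (l j) -
      n * β / 2 * ∫ x, V x ∂μ))) :
    I ≤ ENNReal.ofReal (c * b) * ∫⁻ x, ENNReal.ofReal (condWeight V β n l i x) := by
  refine hI.trans ?_
  rw [ENNReal.ofReal_mul hc, ENNReal.ofReal_mul hc, mul_assoc, ENNReal.ofReal_coe_nnreal]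
  exact mul_le_mul' le_rfl (S.density.ofReal_exp_le_lintegral_condWeight S.continuous_V l i)

/-- The conditional density beyond R is at most its envelope times a product of 1 + |λⱼ|, and that
product is comparable, up to exp(O(n)), with the Jensen bound for the normalisation. No information
on the other eigenvalues is needed, and R can be taken independent of κ. -/
lemma exists_far_tail : ∃ R : ℝ, 2 ≤ R ∧ ∀ κ ≥ 0, ∃ K : ℝ, 0 ≤ K ∧ ∀ n : ℕ,
    sizeThreshold β ε κ ≤ n → ∀ i : Fin n,
    ∫⁻ l, {x : ℝ | R < |x|}.indicator (fun x => ENNReal.ofReal (Real.exp (2 * κ * V x))) (l i)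
      ∂(law V β n) ≤ ENNReal.ofReal (K * Real.exp (-n)) := by
  obtain ⟨C, hC, hC'⟩ := S.density.exists_logPot_ge
  have hβ := S.beta_pos
  have hε := S.eps_pos
  have hV := S.continuous_V
  set v₀ := ∫ x, V x ∂μ with hv₀
  set a := β * C + β / 2 * |v₀| with ha
  have ha0 : 0 ≤ a := by positivity
  -- The loss in the comparison is exp(a n). This R makes the decay of the envelope exp(-(a + 1)(n -
  -- m)), so that exp(-n) is left over.
  set R := max (max 2 L) (Real.exp ((a + 1) / (ε * β))) with hR
  have hR2 : 2 ≤ R := (le_max_left _ _).trans (le_max_left _ _)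
  have hRL : L ≤ R := (le_max_right _ _).trans (le_max_left _ _)
  have hRe : a + 1 ≤ ε * β * Real.log (1 + R) := by
    have h1 : (a + 1) / (ε * β) ≤ Real.log (1 + R) := by
      rw [Real.le_log_iff_exp_le (by positivity)]
      have := le_max_right (max 2 L) (Real.exp ((a + 1) / (ε * β)))
      linarith
    rw [div_le_iff₀ (by positivity)] at h1
    linarith
  refine ⟨R, hR2, fun κ hκ => ?_⟩
  set I := ∫ x : ℝ, (1 + |x|) ^ (-2 : ℝ) with hI
  have hI0 : 0 ≤ I := integral_nonneg fun x => by positivity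
  set m := sizeThreshold β ε κ with hm
  refine ⟨I * Real.exp ((a + 1) * m) * b, by positivity, fun n hn i => ?_⟩
  have hint := S.integrable_weight ((sizeThreshold_mono hβ hε hκ).trans hn)
  have hmeas : MeasurableSet {x : ℝ | R < |x|} := measurableSet_lt measurable_const (by fun_prop)
  have hfm : Measurable ({x : ℝ | R < |x|}.indicator
      (fun x => ENNReal.ofReal (Real.exp (2 * κ * V x)))) := by
    refine Measurable.indicator ?_ hmeas
    have := hV.measurable
    fun_prop
  refine lintegral_law_le_of_condWeight hV hβ hint i (hfm.comp (measurable_pi_apply i)) fun l => ?_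
  simp only [Function.comp_apply, Function.update_self]
  set s := Real.exp (β * ∑ j ∈ ({i}ᶜ : Finset (Fin n)), Real.log (1 + |l j|)) with hs
  have e1 : ∀ x, {x : ℝ | R < |x|}.indicator (fun x => ENNReal.ofReal (Real.exp (2 * κ * V x))) x *
      ENNReal.ofReal (condWeight V β n l i x) ≤
      ENNReal.ofReal ((1 + R) ^ (-(ε * β * (n - m))) * (1 + |x|) ^ (-2 : ℝ) * s) := by
    intro x
    by_cases hx : x ∈ {x : ℝ | R < |x|}
    · rw [Set.indicator_of_mem hx, ← ENNReal.ofReal_mul (by positivity)]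
      apply ENNReal.ofReal_le_ofReal
      have h1 := condWeight_le (V := V) (n := n) hβ l i x
      have h2 := envelope_le hβ hε S.growth hκ hn hRL (by linarith) hx.le
      calc Real.exp (2 * κ * V x) * condWeight V β n l i x
          ≤ Real.exp (2 * κ * V x) * (Real.exp (-((n : ℝ) * β * V x / 2)) *
            (1 + |x|) ^ (β * ((n : ℝ) - 1)) * s) := by gcongr
        _ = envelope V β n κ x * s := by unfold envelope; ring
        _ ≤ _ := by gcongr
    · rw [Set.indicator_of_notMem hx, zero_mul]; exact zero_le
  have e2 : I * (1 + R) ^ (-(ε * β * (n - m))) * s ≤ (I * Real.exp ((a + 1) * m) * Real.exp (-n)) *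
      Real.exp (β * ∑ j ∈ ({i}ᶜ : Finset (Fin n)), logPot μ (l j) - n * β / 2 * v₀) := by
    have h1 : (1 + R) ^ (-(ε * β * (n - m))) ≤ Real.exp (-((a + 1) * (n - m))) := by
      rw [Real.rpow_def_of_pos (by positivity)]
      apply Real.exp_le_exp.2
      have := mul_le_mul_of_nonneg_right hRe (show 0 ≤ n - m by linarith)
      linarith
    have h2 : s ≤ Real.exp (β * ∑ j ∈ ({i}ᶜ : Finset (Fin n)), logPot μ (l j) - n * β / 2 * v₀) *
        Real.exp (n * a) := by
      rw [hs, ← Real.exp_add]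
      apply Real.exp_le_exp.2
      have h3 : ∑ j ∈ ({i}ᶜ : Finset (Fin n)), Real.log (1 + |l j|) ≤
          ∑ j ∈ ({i}ᶜ : Finset (Fin n)), logPot μ (l j) + n * C := by
        have h4 : ∑ j ∈ ({i}ᶜ : Finset (Fin n)), Real.log (1 + |l j|) ≤
            ∑ j ∈ ({i}ᶜ : Finset (Fin n)), (logPot μ (l j) + C) :=
          Finset.sum_le_sum fun j _ => by linarith [hC' (l j)]
        refine h4.trans ?_
        rw [Finset.sum_add_distrib, Finset.sum_const, nsmul_eq_mul]
        gcongr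
        exact (Finset.card_le_univ _).trans_eq (by simp)
      have h5 := mul_le_mul_of_nonneg_left h3 hβ.le
      have h6 := mul_le_mul_of_nonneg_left (le_abs_self v₀) (show 0 ≤ n * β / 2 by positivity)
      rw [ha]
      nlinarith
    have h7 : Real.exp (-((a + 1) * (n - m))) * Real.exp (n * a) =
        Real.exp ((a + 1) * m) * Real.exp (-n) := by
      rw [← Real.exp_add, ← Real.exp_add]; congr 1; ring
    calc _ ≤ I * Real.exp (-((a + 1) * (n - m))) * (Real.exp (β *
          ∑ j ∈ ({i}ᶜ : Finset (Fin n)), logPot μ (l j) - n * β / 2 * v₀) * Real.exp (n * a)) := by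
          gcongr
      _ = I * (Real.exp (-((a + 1) * (n - m))) * Real.exp (n * a)) * Real.exp (β *
          ∑ j ∈ ({i}ᶜ : Finset (Fin n)), logPot μ (l j) - n * β / 2 * v₀) := by ring
      _ = _ := by rw [h7]; ring
  have e3 := S.lintegral_condWeight_le (n := n) (l := l) (i := i)
    (I := ∫⁻ x, {x : ℝ | R < |x|}.indicator (fun x => ENNReal.ofReal (Real.exp (2 * κ * V x))) x *
      ENNReal.ofReal (condWeight V β n l i x))
    (c := I * Real.exp ((a + 1) * m) * Real.exp (-n)) (by positivity) ?_
  · convert! e3 using 3; ring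
  · refine (lintegral_mono e1).trans ?_
    refine le_trans (le_of_eq ?_) (ENNReal.ofReal_le_ofReal e2)
    rw [← ofReal_integral_eq_lintegral_ofReal ((integrable_one_add_abs_rpow.const_mul _).mul_const _)
      (Filter.Eventually.of_forall fun x => by positivity), integral_mul_const, integral_const_mul]
    congr 1; ring

/-- Strict maximality off the cut becomes uniform by compactness, since the effective potential is
continuous. -/
lemma exists_gap {e R : ℝ} (he : 0 < e) : ∃ γ > 0, ∀ x, 2 + e ≤ |x| → |x| ≤ R →
    2 * logPot μ x - V x ≤ 2 * (∫ x, logPot μ x ∂μ) - (∫ x, V x ∂μ) - γ := by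
  set A := {x : ℝ | 2 + e ≤ |x| ∧ |x| ≤ R} with hA
  have hAc : IsCompact A := by
    refine (isCompact_Icc (a := -R) (b := R)).of_isClosed_subset ?_ fun x hx => abs_le.1 hx.2
    exact (isClosed_le continuous_const continuous_abs).inter (isClosed_le continuous_abs continuous_const)
  rcases A.eq_empty_or_nonempty with hE | hE
  · refine ⟨1, one_pos, fun x h1 h2 => ?_⟩
    have : x ∈ A := ⟨h1, h2⟩
    rw [hE] at this; exact absurd this (Set.notMem_empty x)
  · have hc : Continuous fun x => 2 * logPot μ x - V x :=
      (continuous_const.mul S.density.continuous_logPot).sub S.continuous_V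
    obtain ⟨x₀, hx₀, hmax⟩ := hAc.exists_isMaxOn hE hc.continuousOn
    refine ⟨2 * (∫ x, logPot μ x ∂μ) - (∫ x, V x ∂μ) - (2 * logPot μ x₀ - V x₀), ?_, fun x h1 h2 => ?_⟩
    · have := S.lt_max x₀ fun hmem => by
        have h3 := abs_le.2 hmem
        linarith [hx₀.1]
      linarith
    · have := hmax (show x ∈ A from ⟨h1, h2⟩)
      simp only [Set.mem_ofPred_eq] at this
      linarith

/-- Small discrepancy forces the sum of logarithms at x to be close to n times the potential of μ,
and the sum of potentials at the other eigenvalues to be close to n times its mean. So the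
conditional density at x, divided by the Jensen bound for its integral, is about exp(nβ/2 · (v(x) -
max v)), where the gap γ dominates all errors. -/
lemma exists_moderate_tail {e R A : ℝ} (he : 0 < e) (hR : 2 ≤ R) (hA : 0 ≤ A) :
    ∃ K c : ℝ, 0 ≤ K ∧ 0 < c ∧ ∃ N : ℕ, ∀ n ≥ N, Integrable (weight V β n) → ∀ i : Fin n,
      law V β n {l | (∀ i, |l i| ≤ R) ∧ discrepancy μ l ≤ A * (n * Real.log n) ∧ 2 + e ≤ |l i|} ≤
        ENNReal.ofReal (K * Real.exp (-(c * n))) := by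
  have h := S.density
  have hprob := h.prob
  have hβ := S.beta_pos
  have hV := S.continuous_V
  obtain ⟨γ, hγ, hgap⟩ := S.exists_gap (R := R) he
  obtain ⟨C, hC, hC'⟩ := h.exists_smoothLog_le
  set v₀ := ∫ x, V x ∂μ with hv₀
  set u₀ := ∫ x, logPot μ x ∂μ with hu₀
  set δ := γ / 16 with hδ
  have hδ0 : 0 < δ := by positivity
  -- The smoothing scale is fixed, independent of n, and small enough for smoothing to change the
  -- potential by at most δ/4.
  set a := min 1 ((δ / (4 * C)) ^ 2) with ha
  have ha0 : 0 < a := by positivity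
  have hCa : C * √a ≤ δ / 4 := by
    have : √a ≤ δ / (4 * C) := by
      rw [← Real.sqrt_sq (show 0 ≤ δ / (4 * C) by positivity)]
      exact Real.sqrt_le_sqrt (min_le_right _ _)
    calc C * √a ≤ C * (δ / (4 * C)) := by gcongr
      _ = δ / 4 := by field_simp
  have ca := BoundedDensity.continuous_smoothLog ha0
  set B := |Real.log a| + |Real.log ((2 * R) ^ 2 + a ^ 2)| with hB
  have hBb : ∀ u, |u| ≤ 2 * R → |smoothLog a u| ≤ B := fun u hu =>
    BoundedDensity.abs_smoothLog_le ha0 hu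
  -- The fluctuation error is O(n^(5/8) log n), and leaving out the i-th eigenvalue costs at most B.
  -- Both are o(n), hence eventually below nδ/2.
  obtain ⟨N, hN⟩ : ∃ N : ℕ, ∀ n ≥ N, 2 ≤ n ∧ 2 * ((n : ℝ) ^ 4)⁻¹ ≤ a ∧ a ≤ n ∧
      √(2 * (A * (n * Real.log n))) * Real.log (n / a) + 4 * n * R ^ 2 / n ^ 2 + B ≤ n * (δ / 2) := by
    have hr : ∀ r : ℝ, 0 < r → Filter.Tendsto (fun n : ℕ => (n : ℝ) ^ (-r)) Filter.atTop (𝓝 0) :=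
      fun r hr => (tendsto_rpow_neg_atTop hr).comp tendsto_natCast_atTop_atTop
    have t1 : Filter.Tendsto (fun n : ℕ => √(8 * A) * (4 * (n : ℝ) ^ (-(1 / 8) : ℝ) +
        |Real.log a| * (n : ℝ) ^ (-(3 / 8) : ℝ)) + (4 * R ^ 2) * (n : ℝ) ^ (-2 : ℝ) +
        B * (n : ℝ) ^ (-1 : ℝ)) Filter.atTop (𝓝 (√(8 * A) * (4 * 0 + |Real.log a| * 0) +
          4 * R ^ 2 * 0 + B * 0)) :=
      (((((hr _ (by norm_num)).const_mul _).add ((hr _ (by norm_num)).const_mul _)).const_mul _).add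
        ((hr _ (by norm_num)).const_mul _)).add ((hr _ (by norm_num)).const_mul _)
    simp only [mul_zero, add_zero] at t1
    have t2 : Filter.Tendsto (fun n : ℕ => 2 * (n : ℝ) ^ (-4 : ℝ)) Filter.atTop (𝓝 (2 * 0)) :=
      (hr _ (by norm_num)).const_mul _
    rw [mul_zero] at t2
    have h1 := t1.eventually (gt_mem_nhds (show 0 < δ / 2 by positivity))
    have h2 := t2.eventually (gt_mem_nhds ha0)
    have h3 := tendsto_natCast_atTop_atTop.eventually (Filter.eventually_ge_atTop a)
    obtain ⟨N, hN⟩ := Filter.eventually_atTop.1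
      ((h1.and h2).and (h3.and (Filter.eventually_ge_atTop 2)))
    refine ⟨N, fun n hn => ?_⟩
    obtain ⟨⟨f1, f2⟩, f3, f4⟩ := hN n hn
    have hn0 : (0 : ℝ) < n := by positivity
    refine ⟨f4, ?_, f3, ?_⟩
    · rw [Real.rpow_neg hn0.le, show (4 : ℝ) = ((4 : ℕ) : ℝ) by norm_num, Real.rpow_natCast] at f2
      exact f2.le
    · have g1 := sqrt_mul_log_le hA (show n ≠ 0 by omega)
      have g2 : Real.log (n / a) ≤ 4 * (n : ℝ) ^ (1 / 4 : ℝ) + |Real.log a| := by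
        rw [Real.log_div hn0.ne' ha0.ne']
        have := log_le_four_mul_rpow hn0
        linarith [neg_abs_le (Real.log a)]
      have g3 : 0 ≤ Real.log (n / a) := Real.log_nonneg ((one_le_div ha0).2 f3)
      have g4 : √(2 * (A * (n * Real.log n))) * Real.log (n / a) ≤ √(8 * A) * (n : ℝ) ^ (5 / 8 : ℝ) *
          (4 * (n : ℝ) ^ (1 / 4 : ℝ) + |Real.log a|) := by gcongr
      have p1 : (n : ℝ) ^ (5 / 8 : ℝ) * (n : ℝ) ^ (1 / 4 : ℝ) = n * (n : ℝ) ^ (-(1 / 8) : ℝ) := by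
        nth_rw 3 [← Real.rpow_one (n : ℝ)]
        rw [← Real.rpow_add hn0, ← Real.rpow_add hn0]; norm_num
      have p2 : (n : ℝ) ^ (5 / 8 : ℝ) = n * (n : ℝ) ^ (-(3 / 8) : ℝ) := by
        nth_rw 2 [← Real.rpow_one (n : ℝ)]
        rw [← Real.rpow_add hn0]; norm_num
      have p3 : 4 * n * R ^ 2 / n ^ 2 = n * ((4 * R ^ 2) * (n : ℝ) ^ (-2 : ℝ)) := by
        rw [Real.rpow_neg hn0.le, show (2 : ℝ) = ((2 : ℕ) : ℝ) by norm_num, Real.rpow_natCast]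
        field_simp
      have p4 : B = n * (B * (n : ℝ) ^ (-1 : ℝ)) := by
        rw [Real.rpow_neg_one]; field_simp
      have g5 := mul_le_mul_of_nonneg_left f1.le hn0.le
      have g6 : √(8 * A) * (n : ℝ) ^ (5 / 8 : ℝ) * (4 * (n : ℝ) ^ (1 / 4 : ℝ) + |Real.log a|) =
          n * (√(8 * A) * (4 * (n : ℝ) ^ (-(1 / 8) : ℝ) + |Real.log a| * (n : ℝ) ^ (-(3 / 8) : ℝ))) := by
        have : √(8 * A) * (n : ℝ) ^ (5 / 8 : ℝ) * (4 * (n : ℝ) ^ (1 / 4 : ℝ) + |Real.log a|) =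
          √(8 * A) * (4 * ((n : ℝ) ^ (5 / 8 : ℝ) * (n : ℝ) ^ (1 / 4 : ℝ)) +
            |Real.log a| * (n : ℝ) ^ (5 / 8 : ℝ)) := by ring
        rw [this, p1, p2]; ring
      rw [g6] at g4
      rw [p3]
      calc _ ≤ n * (√(8 * A) * (4 * (n : ℝ) ^ (-(1 / 8) : ℝ) + |Real.log a| *
            (n : ℝ) ^ (-(3 / 8) : ℝ))) + n * ((4 * R ^ 2) * (n : ℝ) ^ (-2 : ℝ)) +
            n * (B * (n : ℝ) ^ (-1 : ℝ)) := by rw [← p4]; linarith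
        _ ≤ _ := by linarith
  refine ⟨2 * R * b, β * γ / 8, by positivity, by positivity, N, fun n hn hint i => ?_⟩
  obtain ⟨hn2, hn3, hn4, hn5⟩ := hN n hn
  have hn0 : (0 : ℝ) < n := by positivity
  set η : ℝ := ((n : ℝ) ^ 4)⁻¹ with hη
  have hη0 : 0 < η := by positivity
  set W : ℝ → ℝ := fun x => ∫ y, smoothLog a (y - x) ∂μ with hW
  have hWc : Continuous W := h.continuous_integral_sub ca
  have hUc := h.continuous_logPot
  -- the two typical properties of the other eigenvalues
  set f : (Fin n → ℝ) → ℝ≥0∞ := Set.indicator {l | (2 + e ≤ |l i| ∧ |l i| ≤ R) ∧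
    (∑ j ∈ ({i}ᶜ : Finset (Fin n)), smoothLog a (l j - l i) ≤ n * (W (l i) + δ)) ∧
    n * (u₀ - δ) ≤ ∑ j ∈ ({i}ᶜ : Finset (Fin n)), logPot μ (l j)} 1 with hf
  have hGm : MeasurableSet {l : Fin n → ℝ | (2 + e ≤ |l i| ∧ |l i| ≤ R) ∧
    (∑ j ∈ ({i}ᶜ : Finset (Fin n)), smoothLog a (l j - l i) ≤ n * (W (l i) + δ)) ∧
    n * (u₀ - δ) ≤ ∑ j ∈ ({i}ᶜ : Finset (Fin n)), logPot μ (l j)} := by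
    have m1 : Continuous fun l : Fin n → ℝ => ∑ j ∈ ({i}ᶜ : Finset (Fin n)), smoothLog a (l j - l i) :=
      continuous_finsetSum _ fun j _ => ca.comp (by fun_prop)
    have m2 : Continuous fun l : Fin n → ℝ => n * (W (l i) + δ) := by fun_prop
    have m3 : Continuous fun l : Fin n → ℝ => ∑ j ∈ ({i}ᶜ : Finset (Fin n)), logPot μ (l j) :=
      continuous_finsetSum _ fun j _ => hUc.comp (by fun_prop)
    have m4 : Continuous fun l : Fin n → ℝ => |l i| := by fun_prop
    exact (((isClosed_le continuous_const m4).inter (isClosed_le m4 continuous_const)).inter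
      ((isClosed_le m1 m2).inter (isClosed_le continuous_const m3))).measurableSet
  have hfm : Measurable f := measurable_one.indicator hGm
  have hsub : {l : Fin n → ℝ | (∀ i, |l i| ≤ R) ∧ discrepancy μ l ≤ A * (n * Real.log n) ∧
      2 + e ≤ |l i|} ⊆ {l | (2 + e ≤ |l i| ∧ |l i| ≤ R) ∧
    (∑ j ∈ ({i}ᶜ : Finset (Fin n)), smoothLog a (l j - l i) ≤ n * (W (l i) + δ)) ∧
    n * (u₀ - δ) ≤ ∑ j ∈ ({i}ᶜ : Finset (Fin n)), logPot μ (l j)} := by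
    rintro l ⟨hl, hD, hli⟩
    have key : ∀ x, |x| ≤ R → |∑ j, smoothLog a (l j - x) - n * W x| ≤ n * (δ / 2) - B := by
      intro x hx
      have := h.abs_sum_smoothLog_sub_le l hR hl hx hη0 hn3 hn4 hD
      linarith
    have hB0 : 0 ≤ B := by positivity
    refine ⟨⟨hli, hl i⟩, ?_, ?_⟩
    · have h1 := (abs_le.1 (key (l i) (hl i))).2
      rw [Fintype.sum_eq_add_sum_compl i] at h1
      have h2 := (abs_le.1 (hBb (l i - l i) (by simp; linarith))).1
      have h3 : n * (δ / 2) ≤ n * δ := by nlinarith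
      linarith
    -- The kernel is even, so the sum of smoothed potentials at the eigenvalues is the μ-average of
    -- the smoothed logarithmic sums, and `key` bounds these below at every point of the support.
    · have h1 : ∑ j, W (l j) = ∫ x, ∑ j, smoothLog a (l j - x) ∂μ := by
        rw [integral_finsetSum]
        · refine Finset.sum_congr rfl fun j _ => ?_
          rw [hW]
          refine integral_congr_ae (Filter.Eventually.of_forall fun y => ?_)
          simp only [smoothLog]
          ring_nf
        · exact fun j _ => h.integrable_of_continuous (ca.comp (by fun_prop)).continuousOn
      have h2 : n * u₀ - (n * (δ / 2) - B) ≤ ∑ j, W (l j) := by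
        rw [h1]
        have h3 : ∫ x, (n * logPot μ x - (n * (δ / 2) - B)) ∂μ ≤
            ∫ x, ∑ j, smoothLog a (l j - x) ∂μ := by
          refine integral_mono_ae ?_ ?_ ?_
          · exact h.integrable_of_continuous (by fun_prop)
          · refine h.integrable_of_continuous (Continuous.continuousOn ?_)
            exact continuous_finsetSum _ fun j _ => ca.comp (by fun_prop)
          · filter_upwards [h.ae_mem] with x hx
            have h4 := (abs_le.1 (key x ((abs_le.2 hx).trans hR))).1
            have h5 := mul_le_mul_of_nonneg_left (h.logPot_le_smoothLog ha0 x) hn0.le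
            simp only [hW] at h4
            linarith
        rw [integral_sub ((h.integrable_of_continuous hUc.continuousOn).const_mul _)
          (integrable_const _), integral_const_mul] at h3
        simpa using h3
      have h3 : ∑ j, W (l j) ≤ ∑ j ∈ ({i}ᶜ : Finset (Fin n)), logPot μ (l j) + n * (δ / 4) + B := by
        rw [Fintype.sum_eq_add_sum_compl i]
        have h4 := (abs_le.1 (h.abs_integral_le_of_bound hR (hl i) hBb)).2
        have h5 : ∑ j ∈ ({i}ᶜ : Finset (Fin n)), W (l j) ≤
            ∑ j ∈ ({i}ᶜ : Finset (Fin n)), (logPot μ (l j) + δ / 4) :=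
          Finset.sum_le_sum fun j _ => (hC' a ha0 (l j)).trans (by linarith)
        rw [Finset.sum_add_distrib, Finset.sum_const, nsmul_eq_mul] at h5
        have h6 : ((({i}ᶜ : Finset (Fin n)).card : ℝ)) * (δ / 4) ≤ n * (δ / 4) := by
          gcongr
          exact (Finset.card_le_univ _).trans_eq (by simp)
        simp only [hW] at h5 ⊢
        linarith
      have h7 : 0 < n * δ := by positivity
      linarith
  have hle : law V β n {l | (∀ i, |l i| ≤ R) ∧ discrepancy μ l ≤ A * (n * Real.log n) ∧
      2 + e ≤ |l i|} ≤ ∫⁻ l, f l ∂(law V β n) := by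
    refine (measure_mono hsub).trans ?_
    rw [hf, lintegral_indicator_one hGm]
  refine hle.trans ?_
  refine lintegral_law_le_of_condWeight hV hβ hint i hfm fun l => ?_
  have e3 := S.lintegral_condWeight_le (n := n) (l := l) (i := i)
    (I := ∫⁻ x, f (Function.update l i x) * ENNReal.ofReal (condWeight V β n l i x))
    (c := 2 * R * Real.exp (-(β * γ / 8 * n))) (by positivity) ?_
  · convert! e3 using 3; ring
  have hupd : ∀ x, ∑ j ∈ ({i}ᶜ : Finset (Fin n)), logPot μ (Function.update l i x j) =
      ∑ j ∈ ({i}ᶜ : Finset (Fin n)), logPot μ (l j) := fun x => by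
    refine Finset.sum_congr rfl fun j hj => ?_
    rw [Function.update_of_ne (by simpa using hj)]
  -- This condition does not involve the i-th eigenvalue. Where it fails the integrand vanishes
  -- identically.
  by_cases hU : n * (u₀ - δ) ≤ ∑ j ∈ ({i}ᶜ : Finset (Fin n)), logPot μ (l j)
  swap
  · have : ∀ x, f (Function.update l i x) = 0 := fun x => by
      rw [hf]
      apply Set.indicator_of_notMem
      rintro ⟨_, _, h3⟩
      rw [hupd] at h3
      exact hU h3
    simp [this]
  set E := Real.exp (β * ∑ j ∈ ({i}ᶜ : Finset (Fin n)), logPot μ (l j) - n * β / 2 * v₀) with hE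
  have hpt : ∀ x, f (Function.update l i x) * ENNReal.ofReal (condWeight V β n l i x) ≤
      (Set.Icc (-R) R).indicator (fun _ => ENNReal.ofReal (Real.exp (-(β * γ / 8 * n)) * E)) x := by
    intro x
    by_cases hx : Function.update l i x ∈ {l | (2 + e ≤ |l i| ∧ |l i| ≤ R) ∧
      (∑ j ∈ ({i}ᶜ : Finset (Fin n)), smoothLog a (l j - l i) ≤ n * (W (l i) + δ)) ∧
      n * (u₀ - δ) ≤ ∑ j ∈ ({i}ᶜ : Finset (Fin n)), logPot μ (l j)}
    swap
    · rw [hf, Set.indicator_of_notMem hx, zero_mul]; exact zero_le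
    rw [hf, Set.indicator_of_mem hx, Pi.one_apply, one_mul]
    obtain ⟨⟨g1, g2⟩, g3, -⟩ := hx
    rw [Function.update_self] at g1 g2 g3
    rw [Set.indicator_of_mem (by exact abs_le.1 g2)]
    apply ENNReal.ofReal_le_ofReal
    have g4 : ∑ j ∈ ({i}ᶜ : Finset (Fin n)), smoothLog a (Function.update l i x j - x) =
        ∑ j ∈ ({i}ᶜ : Finset (Fin n)), smoothLog a (l j - x) := by
      refine Finset.sum_congr rfl fun j hj => ?_
      rw [Function.update_of_ne (by simpa using hj)]
    rw [g4] at g3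
    have g5 : ∏ j ∈ ({i}ᶜ : Finset (Fin n)), |x - l j| ^ β ≤
        Real.exp (β * ∑ j ∈ ({i}ᶜ : Finset (Fin n)), smoothLog a (l j - x)) := by
      rw [Finset.mul_sum, Real.exp_sum]
      refine Finset.prod_le_prod (fun _ _ => by positivity) fun j _ => ?_
      by_cases hne : l j - x = 0
      · rw [show x - l j = 0 by linarith, abs_zero, Real.zero_rpow hβ.ne']
        positivity
      · rw [abs_sub_comm, Real.rpow_def_of_pos (abs_pos.2 hne), mul_comm]
        apply Real.exp_le_exp.2
        gcongr
        exact log_abs_le_smoothLog hne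
    rw [condWeight]
    calc _ ≤ Real.exp (-((n : ℝ) * β * V x / 2)) *
          Real.exp (β * ∑ j ∈ ({i}ᶜ : Finset (Fin n)), smoothLog a (l j - x)) := by gcongr
      _ ≤ _ := by
        rw [hE, ← Real.exp_add, ← Real.exp_add]
        apply Real.exp_le_exp.2
        have k1 := mul_le_mul_of_nonneg_left g3 hβ.le
        have k2 := mul_le_mul_of_nonneg_left hU hβ.le
        have k3 : W x ≤ logPot μ x + δ / 4 := (hC' a ha0 x).trans (by linarith)
        have k4 := mul_le_mul_of_nonneg_left k3 (show 0 ≤ β * n by positivity)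
        have k5 := mul_le_mul_of_nonneg_left (hgap x g1 g2) (show 0 ≤ n * β / 2 by positivity)
        have k6 : 0 ≤ n * β * γ := by positivity
        rw [hδ] at k1 k2 k4
        nlinarith
  refine (lintegral_mono hpt).trans ?_
  rw [lintegral_indicator measurableSet_Icc, setLIntegral_const, Real.volume_Icc,
    ← ENNReal.ofReal_mul (by positivity)]
  apply ENNReal.ofReal_le_ofReal
  apply le_of_eq; ring

lemma measurableSet_typicalSet {n : ℕ} (hn : n ≠ 0) (e A : ℝ) :
    MeasurableSet (typicalSet μ n e A) := by
  have h1 : IsClosed {l : Fin n → ℝ | ∀ i, |l i| ≤ 2 + e} := by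
    rw [show {l : Fin n → ℝ | ∀ i, |l i| ≤ 2 + e} = ⋂ i, {l | |l i| ≤ 2 + e} by ext; simp]
    exact isClosed_iInter fun i => isClosed_le (by fun_prop) continuous_const
  exact (h1.inter (isClosed_le (S.density.continuous_discrepancy hn) continuous_const)).measurableSet

omit S in
lemma natCast_mul_exp_neg_le {c : ℝ} (hc : 0 < c) (n : ℕ) :
    n * Real.exp (-(c * n)) ≤ 2 / c * Real.exp (-(c / 2 * n)) := by
  have h1 : c / 2 * n ≤ Real.exp (c / 2 * n) := by
    linarith [Real.add_one_le_exp (c / 2 * n)]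
  have h2 : Real.exp (-(c * n)) = Real.exp (-(c / 2 * n)) * Real.exp (-(c / 2 * n)) := by
    rw [← Real.exp_add]; congr 1; ring
  have h3 : c / 2 * n * Real.exp (-(c / 2 * n)) ≤ 1 := by
    rw [Real.exp_neg, ← div_eq_mul_inv, div_le_one (Real.exp_pos _)]
    exact h1
  rw [h2]
  have h4 : n * (Real.exp (-(c / 2 * n)) * Real.exp (-(c / 2 * n))) =
      2 / c * (c / 2 * n * Real.exp (-(c / 2 * n))) * Real.exp (-(c / 2 * n)) := by
    field_simp
  rw [h4]
  gcongr
  exact mul_le_of_le_one_right (by positivity) h3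

/-- A configuration that is not typical has an eigenvalue beyond R, or lies in the cube with large
discrepancy, or has small discrepancy and an eigenvalue between 2 + e and R. Each event is
exponentially unlikely; the union over eigenvalues costs a factor n, absorbed by halving the rate.
-/
theorem exists_typicalSet {e : ℝ} (he : 0 < e) : ∃ A K c : ℝ, 0 ≤ A ∧ 0 ≤ K ∧ 0 < c ∧
    ∀ n : ℕ, 2 ≤ n → sizeThreshold β ε 0 ≤ n →
      law V β n (typicalSet μ n e A)ᶜ ≤ ENNReal.ofReal (K * Real.exp (-(c * n))) := by
  obtain ⟨R, hR, hfar⟩ := S.exists_far_tail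
  obtain ⟨K₁, hK₁, hfar⟩ := hfar 0 le_rfl
  obtain ⟨A, hA, hdisc⟩ := S.exists_law_discrepancy_le hR
  obtain ⟨K₂, c₂, hK₂, hc₂, N, hmod⟩ := S.exists_moderate_tail he hR hA
  set c := min 1 c₂ with hc
  have hc0 : 0 < c := by positivity
  -- The last summand of the constant makes the bound at least 1, hence trivial, for n below N.
  refine ⟨A, K₁ * (2 / c) + 1 + K₂ * (2 / c) + Real.exp (c / 2 * N), c / 2, hA, by positivity,
    by positivity, fun n hn hthr => ?_⟩
  have hint := S.integrable_weight hthr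
  have hprob := isProbabilityMeasure_law S.beta_pos S.continuous_V hint
  rcases lt_or_ge n N with hlt | hge
  · refine prob_le_one.trans ?_
    rw [← ENNReal.ofReal_one]
    apply ENNReal.ofReal_le_ofReal
    have h1 : 1 ≤ Real.exp (c / 2 * N) * Real.exp (-(c / 2 * n)) := by
      rw [← Real.exp_add]
      apply Real.one_le_exp
      have : (n : ℝ) ≤ N := by exact_mod_cast hlt.le
      nlinarith
    refine h1.trans ?_
    gcongr
    have : 0 ≤ K₁ * (2 / c) + 1 + K₂ * (2 / c) := by positivity
    linarith
  have e1 : ∀ i : Fin n, law V β n {l | R < |l i|} ≤ ENNReal.ofReal (K₁ * Real.exp (-n)) := by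
    intro i
    refine le_trans ?_ (hfar n hthr i)
    have hm : MeasurableSet {l : Fin n → ℝ | R < |l i|} :=
      measurableSet_lt measurable_const (by fun_prop)
    rw [← lintegral_indicator_one hm]
    refine lintegral_mono fun l => le_of_eq ?_
    simp [Set.indicator]
  have hsub : (typicalSet μ n e A)ᶜ ⊆ ((⋃ i : Fin n, {l : Fin n → ℝ | R < |l i|}) ∪
      {l | (∀ i, |l i| ≤ R) ∧ A * (n * Real.log n) < discrepancy μ l}) ∪
      ⋃ i : Fin n, {l : Fin n → ℝ | (∀ i, |l i| ≤ R) ∧ discrepancy μ l ≤ A * (n * Real.log n) ∧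
        2 + e ≤ |l i|} := by
    intro l hl
    by_cases h1 : ∀ i, |l i| ≤ R
    · by_cases h2 : discrepancy μ l ≤ A * (n * Real.log n)
      · right
        have h3 : ¬ ∀ i, |l i| ≤ 2 + e := fun h3 => hl ⟨h3, h2⟩
        push Not at h3
        obtain ⟨i, hi⟩ := h3
        exact Set.mem_iUnion.2 ⟨i, h1, h2, hi.le⟩
      · left; right
        exact ⟨h1, not_le.1 h2⟩
    · left; left
      push Not at h1
      exact Set.mem_iUnion.2 h1
  calc law V β n (typicalSet μ n e A)ᶜ
      ≤ (∑ i : Fin n, ENNReal.ofReal (K₁ * Real.exp (-n)) + ENNReal.ofReal (Real.exp (-n))) +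
        ∑ i : Fin n, ENNReal.ofReal (K₂ * Real.exp (-(c₂ * n))) := by
        refine (measure_mono hsub).trans ((measure_union_le _ _).trans ?_)
        refine add_le_add ((measure_union_le _ _).trans (add_le_add ?_ (hdisc n hn hint))) ?_
        · exact (measure_iUnion_fintype_le _ _).trans (Finset.sum_le_sum fun i _ => e1 i)
        · exact (measure_iUnion_fintype_le _ _).trans (Finset.sum_le_sum fun i _ => hmod n hge hint i)
    _ = ENNReal.ofReal (n * (K₁ * Real.exp (-n)) + Real.exp (-n) +
        n * (K₂ * Real.exp (-(c₂ * n)))) := by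
        rw [ENNReal.ofReal_add (by positivity) (by positivity),
          ENNReal.ofReal_add (by positivity) (by positivity),
          ENNReal.ofReal_mul (p := (n : ℝ)) (by positivity),
          ENNReal.ofReal_mul (p := (n : ℝ)) (by positivity)]
        simp
    _ ≤ _ := by
        apply ENNReal.ofReal_le_ofReal
        have h0 := natCast_mul_exp_neg_le hc0 n
        have hn0 : (0 : ℝ) ≤ n := by positivity
        have h1 : Real.exp (-(n : ℝ)) ≤ Real.exp (-(c * n)) := by
          apply Real.exp_le_exp.2
          nlinarith [min_le_left 1 c₂]
        have h2 : Real.exp (-(c₂ * n)) ≤ Real.exp (-(c * n)) := by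
          apply Real.exp_le_exp.2
          nlinarith [min_le_right 1 c₂]
        have h3 : Real.exp (-(c * n)) ≤ Real.exp (-(c / 2 * n)) := by
          apply Real.exp_le_exp.2
          nlinarith
        have h4 : 0 ≤ Real.exp (c / 2 * N) * Real.exp (-(c / 2 * n)) := by positivity
        calc n * (K₁ * Real.exp (-n)) + Real.exp (-n) + n * (K₂ * Real.exp (-(c₂ * n)))
            ≤ n * (K₁ * Real.exp (-(c * n))) + Real.exp (-(c / 2 * n)) +
              n * (K₂ * Real.exp (-(c * n))) := by
              have h5 := h1.trans h3
              gcongr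
          _ = K₁ * (n * Real.exp (-(c * n))) + Real.exp (-(c / 2 * n)) +
              K₂ * (n * Real.exp (-(c * n))) := by ring
          _ ≤ K₁ * (2 / c * Real.exp (-(c / 2 * n))) + Real.exp (-(c / 2 * n)) +
              K₂ * (2 / c * Real.exp (-(c / 2 * n))) := by gcongr
          _ ≤ _ := by linarith

/-- Beyond R the far tail applies. Between 2 + e and R the exponential is bounded and the
configuration is not typical. -/
theorem exists_tail_bound {e κ : ℝ} (he : 0 < e) (hκ : 0 ≤ κ) : ∃ K c : ℝ, 0 ≤ K ∧ 0 < c ∧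
    ∀ n : ℕ, 2 ≤ n → sizeThreshold β ε κ ≤ n → ∀ i : Fin n,
      ∫⁻ l, {x : ℝ | 2 + e < |x|}.indicator (fun x => ENNReal.ofReal (Real.exp (2 * κ * V x))) (l i)
        ∂(law V β n) ≤ ENNReal.ofReal (K * Real.exp (-(c * n))) := by
  obtain ⟨R, hR, hfar⟩ := S.exists_far_tail
  obtain ⟨K₁, hK₁, hfar⟩ := hfar κ hκ
  obtain ⟨A, K₂, c₂, hA, hK₂, hc₂, htyp⟩ := S.exists_typicalSet he
  obtain ⟨B, hB⟩ := (isCompact_Icc (a := -R) (b := R)).exists_bound_of_continuousOn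
    (S.continuous_V.continuousOn)
  refine ⟨K₁ + Real.exp (2 * κ * B) * K₂, min 1 c₂, by positivity, by positivity,
    fun n hn hthr i => ?_⟩
  have hthr0 := (sizeThreshold_mono S.beta_pos S.eps_pos hκ).trans hthr
  have hmR : MeasurableSet {x : ℝ | R < |x|} := measurableSet_lt measurable_const (by fun_prop)
  have hfm : Measurable ({x : ℝ | R < |x|}.indicator
      (fun x => ENNReal.ofReal (Real.exp (2 * κ * V x)))) := by
    refine Measurable.indicator ?_ hmR
    have := S.continuous_V.measurable
    fun_prop
  have hTm := (S.measurableSet_typicalSet (show n ≠ 0 by omega) e A).compl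
  have hpt : ∀ l : Fin n → ℝ, {x : ℝ | 2 + e < |x|}.indicator
      (fun x => ENNReal.ofReal (Real.exp (2 * κ * V x))) (l i) ≤
      {x : ℝ | R < |x|}.indicator (fun x => ENNReal.ofReal (Real.exp (2 * κ * V x))) (l i) +
      (typicalSet μ n e A)ᶜ.indicator (fun _ => ENNReal.ofReal (Real.exp (2 * κ * B))) l := by
    intro l
    by_cases h1 : l i ∈ {x : ℝ | 2 + e < |x|}
    swap
    · rw [Set.indicator_of_notMem h1]; exact zero_le
    by_cases h2 : l i ∈ {x : ℝ | R < |x|}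
    · rw [Set.indicator_of_mem h1, Set.indicator_of_mem h2]
      exact le_self_add
    · rw [Set.indicator_of_mem h1, Set.indicator_of_notMem h2, zero_add, Set.indicator_of_mem]
      · apply ENNReal.ofReal_le_ofReal
        apply Real.exp_le_exp.2
        have h3 : |l i| ≤ R := not_lt.1 h2
        have := (le_abs_self _).trans (hB (l i) (abs_le.1 h3))
        gcongr
      · rintro ⟨h3, -⟩
        exact absurd (h3 i) (not_le.2 h1)
  refine (lintegral_mono hpt).trans ?_
  have hfm' : Measurable fun l : Fin n → ℝ => {x : ℝ | R < |x|}.indicator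
      (fun x => ENNReal.ofReal (Real.exp (2 * κ * V x))) (l i) :=
    hfm.comp (measurable_pi_apply i)
  rw [lintegral_add_left hfm', lintegral_indicator_const hTm]
  calc _ ≤ ENNReal.ofReal (K₁ * Real.exp (-n)) + ENNReal.ofReal (Real.exp (2 * κ * B)) *
        ENNReal.ofReal (K₂ * Real.exp (-(c₂ * n))) := by
        gcongr
        · exact hfar n hthr i
        · exact htyp n hn hthr0
    _ = ENNReal.ofReal (K₁ * Real.exp (-n) + Real.exp (2 * κ * B) * (K₂ * Real.exp (-(c₂ * n)))) := by
        rw [ENNReal.ofReal_add (by positivity) (by positivity),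
          ENNReal.ofReal_mul (p := Real.exp (2 * κ * B)) (by positivity)]
    _ ≤ _ := by
        apply ENNReal.ofReal_le_ofReal
        have hn0 : (0 : ℝ) ≤ n := by positivity
        have h1 : Real.exp (-(n : ℝ)) ≤ Real.exp (-(min 1 c₂ * n)) := by
          apply Real.exp_le_exp.2
          nlinarith [min_le_left 1 c₂]
        have h2 : Real.exp (-(c₂ * n)) ≤ Real.exp (-(min 1 c₂ * n)) := by
          apply Real.exp_le_exp.2
          nlinarith [min_le_right 1 c₂]
        calc _ ≤ K₁ * Real.exp (-(min 1 c₂ * n)) +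
              Real.exp (2 * κ * B) * (K₂ * Real.exp (-(min 1 c₂ * n))) := by gcongr
          _ = _ := by ring

end EquilibriumSetting

end BetaEnsemble

namespace BetaEnsemble

/-! ### The distance to the cut -/

lemma isCompact_cut : IsCompact cut := isCompact_Icc.image Complex.continuous_ofReal

lemma cut_nonempty : cut.Nonempty := ⟨_, 0, by norm_num, rfl⟩

lemma infDist_cut_le {t : ℝ} (ht : t ∈ Set.Icc (-2 : ℝ) 2) (z : ℂ) :
    Metric.infDist z cut ≤ ‖z - t‖ := by
  rw [← dist_eq_norm]
  exact Metric.infDist_le_dist_of_mem ⟨t, ht, rfl⟩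

lemma exists_infDist_cut_eq (z : ℂ) :
    ∃ t ∈ Set.Icc (-2 : ℝ) 2, Metric.infDist z cut = ‖z - t‖ := by
  obtain ⟨_, ⟨t, ht, rfl⟩, h⟩ := isCompact_cut.exists_infDist_eq_dist cut_nonempty z
  exact ⟨t, ht, by rw [h, dist_eq_norm]⟩

lemma abs_im_le_infDist_cut (z : ℂ) : |z.im| ≤ Metric.infDist z cut := by
  obtain ⟨t, ht, h⟩ := exists_infDist_cut_eq z
  rw [h]
  simpa using Complex.abs_im_le_norm (z - t)

lemma infDist_cut_conj (z : ℂ) : Metric.infDist (conj z) cut = Metric.infDist z cut := by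
  have key : ∀ w : ℂ, Metric.infDist (conj w) cut ≤ Metric.infDist w cut := by
    intro w
    obtain ⟨t, ht, h⟩ := exists_infDist_cut_eq w
    rw [h]
    refine (infDist_cut_le ht _).trans (le_of_eq ?_)
    rw [← Complex.norm_conj (w - t)]; simp
  exact le_antisymm (key z) (by simpa using key (conj z))

lemma abs_infDist_cut_sub_le (z w : ℂ) :
    Metric.infDist z cut ≤ Metric.infDist w cut + ‖z - w‖ := by
  rw [← dist_eq_norm]; exact Metric.infDist_le_infDist_add_dist

lemma infDist_cut_ofReal_le_iff {e : ℝ} (he : 0 ≤ e) (x : ℝ) :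
    Metric.infDist (x : ℂ) cut ≤ e ↔ |x| ≤ 2 + e := by
  constructor
  · intro h
    obtain ⟨t, ht, h'⟩ := exists_infDist_cut_eq x
    rw [h', ← Complex.ofReal_sub, Complex.norm_real, Real.norm_eq_abs] at h
    have := abs_le.2 ht
    calc |x| = |(x - t) + t| := by ring_nf
      _ ≤ _ := (abs_add_le _ _).trans (by linarith)
  · intro h
    rw [abs_le] at h
    have ht : max (-2) (min x 2) ∈ Set.Icc (-2 : ℝ) 2 :=
      ⟨le_max_left _ _, max_le (by norm_num) (min_le_right _ _)⟩
    refine (infDist_cut_le ht _).trans ?_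
    rw [← Complex.ofReal_sub, Complex.norm_real, Real.norm_eq_abs, abs_le]
    rcases max_cases (-2) (min x 2) with ⟨h1, h2⟩ | ⟨h1, h2⟩ <;>
    rcases min_cases x 2 with ⟨h3, h4⟩ | ⟨h3, h4⟩ <;> rw [h1] <;> (try rw [h3]) <;>
    (try rw [h3] at h2) <;> constructor <;> linarith

lemma infDist_cut_sub_le_norm_sub {e x : ℝ} (he : 0 ≤ e) (hx : |x| ≤ 2 + e) (z : ℂ) :
    Metric.infDist z cut - e ≤ ‖z - x‖ := by
  have h1 := abs_infDist_cut_sub_le z x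
  have h2 := (infDist_cut_ofReal_le_iff he x).2 hx
  linarith

lemma convex_cut : Convex ℝ cut := by
  have : cut = Complex.ofRealCLM '' Set.Icc (-2) 2 := rfl
  rw [this]
  exact (convex_Icc _ _).is_linear_image Complex.ofRealCLM.isLinear

lemma setOf_infDist_cut_lt (r : ℝ) : {z | Metric.infDist z cut < r} = Metric.thickening r cut := by
  ext z; exact (Metric.mem_thickening_iff_infDist_lt cut_nonempty).symm

lemma isOpen_infDist_cut_lt (r : ℝ) : IsOpen {z | Metric.infDist z cut < r} :=
  isOpen_lt (Metric.continuous_infDist_pt _) continuous_const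

lemma convex_infDist_cut_lt (r : ℝ) : Convex ℝ {z | Metric.infDist z cut < r} := by
  rw [setOf_infDist_cut_lt]; exact convex_cut.thickening _

lemma isCompact_cutNhd (r : ℝ) : IsCompact (cutNhd r) := by
  refine Metric.isCompact_of_isClosed_isBounded
    (isClosed_le (Metric.continuous_infDist_pt _) continuous_const) ?_
  refine (Metric.isBounded_closedBall (x := (0 : ℂ)) (r := 2 + r)).subset fun z hz => ?_
  obtain ⟨t, ht, h⟩ := exists_infDist_cut_eq z
  rw [mem_closedBall_zero_iff]
  have h1 : ‖(t : ℂ)‖ ≤ 2 := by rw [Complex.norm_real]; exact abs_le.2 ht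
  have h2 : Metric.infDist z cut ≤ r := hz
  calc ‖z‖ = ‖(z - t) + t‖ := by ring_nf
    _ ≤ _ := (norm_add_le _ _).trans (by linarith)

/-! ### Cauchy transforms of measures on the cut -/

section Cauchy

variable {ν : Measure ℝ} [IsFiniteMeasure ν]

lemma integrable_inv_sub (hν : ∀ᵐ x ∂ν, x ∈ Set.Icc (-2 : ℝ) 2) {z : ℂ}
    (hz : 0 < Metric.infDist z cut) : Integrable (fun x : ℝ => (z - x)⁻¹) ν := by
  refine Integrable.of_bound (by fun_prop) (Metric.infDist z cut)⁻¹ ?_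
  filter_upwards [hν] with x hx
  rw [norm_inv]
  exact inv_anti₀ hz (infDist_cut_le hx z)

lemma hasDerivAt_integral_inv_sub (hν : ∀ᵐ x ∂ν, x ∈ Set.Icc (-2 : ℝ) 2) {z : ℂ}
    (hz : 0 < Metric.infDist z cut) :
    HasDerivAt (fun w : ℂ => ∫ x : ℝ, (w - x)⁻¹ ∂ν) (-∫ x : ℝ, ((z - x) ^ 2)⁻¹ ∂ν) z := by
  set δ := Metric.infDist z cut with hδ
  have hb : ∀ x : ℝ, x ∈ Set.Icc (-2 : ℝ) 2 → ∀ w ∈ Metric.ball z (δ / 2), δ / 2 ≤ ‖w - x‖ := by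
    intro x hx w hw
    rw [mem_ball_iff_norm'] at hw
    have h1 := abs_infDist_cut_sub_le z w
    have h2 := infDist_cut_le hx w
    linarith
  rw [← integral_neg]
  refine (hasDerivAt_integral_of_dominated_loc_of_deriv_le (μ := ν)
    (F := fun w x => (w - (x : ℂ))⁻¹) (F' := fun w x => -((w - (x : ℂ)) ^ 2)⁻¹)
    (bound := fun _ => ((δ / 2) ^ 2)⁻¹) (s := Metric.ball z (δ / 2))
    (Metric.ball_mem_nhds z (by positivity)) ?_ (integrable_inv_sub hν hz) ?_ ?_ ?_ ?_).2
  · exact Filter.Eventually.of_forall fun w => by fun_prop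
  · fun_prop
  · filter_upwards [hν] with x hx w hw
    rw [norm_neg, norm_inv, norm_pow]
    have := hb x hx w hw
    gcongr
  · exact integrable_const _
  · filter_upwards [hν] with x hx w hw
    have h0 : w - (x : ℂ) ≠ 0 := norm_pos_iff.1 (lt_of_lt_of_le (by positivity) (hb x hx w hw))
    have := ((hasDerivAt_id w).sub_const (x : ℂ)).inv h0
    simp only [neg_div, one_div] at this
    exact this

end Cauchy

/-! ### The centred resolvent trace away from the cut. -/

lemma BoundedDensity.differentiableAt_resolventFluct {μ : Measure ℝ} {b : ℝ≥0}
    (h : BoundedDensity μ b) {n : ℕ} {l : Fin n → ℝ} {z : ℂ} (hz : 0 < Metric.infDist z cut)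
    (hl : ∀ i, z ≠ l i) : DifferentiableAt ℂ (resolventFluct μ l) z := by
  have := h.prob
  have h1 := (hasDerivAt_integral_inv_sub h.ae_mem hz).differentiableAt
  unfold resolventFluct fluct
  refine DifferentiableAt.sub ?_ (h1.const_mul _)
  refine DifferentiableAt.fun_sum fun i _ => ?_
  exact (differentiableAt_id.sub_const _).inv (sub_ne_zero.2 (hl i))

lemma resolventFluct_conj {μ : Measure ℝ} {n : ℕ} (l : Fin n → ℝ) (z : ℂ) :
    resolventFluct μ l (conj z) = conj (resolventFluct μ l z) := by
  simp [resolventFluct, fluct, ← integral_conj]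

lemma BoundedDensity.norm_resolventFluct_le {μ : Measure ℝ} {b : ℝ≥0}
    (h : BoundedDensity μ b) {n : ℕ} {l : Fin n → ℝ} {e : ℝ} (he : 0 ≤ e)
    (hl : ∀ i, |l i| ≤ 2 + e) {z : ℂ} {δ : ℝ} (hδ : 0 < δ) (hz : e + δ ≤ Metric.infDist z cut) :
    ‖resolventFluct μ l z‖ ≤ 2 * n / δ := by
  have := h.prob
  have hb : ∀ x : ℝ, |x| ≤ 2 + e → ‖(z - x : ℂ)⁻¹‖ ≤ δ⁻¹ := by
    intro x hx
    rw [norm_inv]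
    exact inv_anti₀ hδ (by linarith [infDist_cut_sub_le_norm_sub he hx z])
  have h1 : ‖∑ i, (z - l i : ℂ)⁻¹‖ ≤ n * δ⁻¹ := by
    refine (norm_sum_le_of_le _ fun i _ => hb (l i) (hl i)).trans (by simp)
  have h2 : ‖∫ x : ℝ, (z - x : ℂ)⁻¹ ∂μ‖ ≤ δ⁻¹ := by
    have := norm_integral_le_of_norm_le_const (μ := μ) (C := δ⁻¹) (f := fun x : ℝ => (z - x : ℂ)⁻¹)
      (by filter_upwards [h.ae_mem] with x hx using hb x ((abs_le.2 hx).trans (by linarith)))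
    simpa using this
  calc _ ≤ ‖∑ i, (z - l i : ℂ)⁻¹‖ + ‖(n : ℂ) * ∫ x : ℝ, (z - x : ℂ)⁻¹ ∂μ‖ := norm_sub_le _ _
    _ ≤ n * δ⁻¹ + n * δ⁻¹ := by
        rw [norm_mul, Complex.norm_natCast]; gcongr
    _ = _ := by ring

lemma norm_sq_sub_sq_of_mem_sphere {u : ℂ} {ρ : ℝ} (hu : ‖u‖ = ρ) :
    ‖u ^ 2 - ρ ^ 2‖ = 2 * ρ * |u.im| := by
  have h1 : u ^ 2 - (ρ : ℂ) ^ 2 = u * (2 * u.im * Complex.I) := by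
    have h2 := Complex.sub_conj u
    push_cast at h2
    rw [← hu, ← Complex.ofReal_pow, ← Complex.normSq_eq_norm_sq, Complex.normSq_eq_conj_mul_self,
      ← h2]
    ring
  rw [h1]; simp [hu]; ring

/-- A bound `B / |Im z|` on an analytic function near the real axis improves to a uniform bound
at a slightly larger distance from the singularities. -/
lemma norm_le_of_norm_mul_abs_im_le {f : ℂ → ℂ} {z : ℂ} {ρ B : ℝ} (hρ : 0 < ρ)
    (hf : ∀ w, ‖w - z‖ ≤ 2 * ρ → DifferentiableAt ℂ f w)
    (hB : ∀ w, ‖w - z‖ ≤ 2 * ρ → ‖f w‖ * |w.im| ≤ B) : ‖f z‖ ≤ 2 * B / ρ := by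
  have hz0 := hB z (by simpa using hρ.le)
  have hB0 : 0 ≤ B := le_trans (by positivity) hz0
  rw [le_div_iff₀ hρ]
  rcases le_total ρ |z.im| with h | h
  · nlinarith [norm_nonneg (f z)]
  · set x₀ : ℂ := (z.re : ℂ) with hx₀
    have hzx : z - x₀ = z.im * Complex.I := by
      apply Complex.ext <;> simp [hx₀]
    have hzx' : ‖z - x₀‖ ≤ ρ := by rw [hzx]; simpa using h
    have hball : ∀ w, ‖w - x₀‖ ≤ ρ → ‖w - z‖ ≤ 2 * ρ := fun w hw => by
      calc ‖w - z‖ = ‖(w - x₀) - (z - x₀)‖ := by ring_nf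
        _ ≤ _ := (norm_sub_le _ _).trans (by linarith)
    -- On the circle of radius ρ about the real point x₀, the factor (w - x₀)² - ρ² has modulus
    -- 2ρ|Im w|, which cancels the singular bound. At z its modulus is at least ρ², because z - x₀
    -- is imaginary.
    have key := Complex.norm_le_of_forall_mem_frontier_norm_le
      (f := fun w => f w * ((w - x₀) ^ 2 - ρ ^ 2)) (U := Metric.ball x₀ ρ) (C := 2 * ρ * B)
      Metric.isBounded_ball ?_ ?_ (z := z) ?_
    · rw [norm_mul] at key
      have h2 : ρ ^ 2 ≤ ‖(z - x₀) ^ 2 - (ρ : ℂ) ^ 2‖ := by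
        have e1 : (z - x₀) ^ 2 - (ρ : ℂ) ^ 2 = -((z.im ^ 2 + ρ ^ 2 : ℝ) : ℂ) := by
          rw [hzx, mul_pow, Complex.I_sq]; push_cast; ring
        rw [e1, norm_neg, Complex.norm_real, Real.norm_eq_abs, abs_of_nonneg (by positivity)]
        nlinarith [sq_nonneg z.im]
      have h3 : ‖f z‖ * ρ ^ 2 ≤ 2 * ρ * B :=
        (mul_le_mul_of_nonneg_left h2 (norm_nonneg _)).trans key
      have : ρ * (‖f z‖ * ρ) ≤ ρ * (2 * B) := by nlinarith
      exact le_of_mul_le_mul_left this hρ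
    · apply DifferentiableOn.diffContOnCl
      rw [closure_ball _ hρ.ne']
      intro w hw
      rw [mem_closedBall_iff_norm] at hw
      exact ((hf w (hball w hw)).mul (by fun_prop)).differentiableWithinAt
    · intro w hw
      rw [frontier_ball _ hρ.ne', mem_sphere_iff_norm] at hw
      rw [norm_mul, norm_sq_sub_sq_of_mem_sphere hw]
      have h4 : (w - x₀).im = w.im := by simp [hx₀]
      rw [h4]
      nlinarith [hB w (hball w hw.le)]
    · rw [closure_ball _ hρ.ne', mem_closedBall_iff_norm]; exact hzx'

/-- On typical configurations the centred resolvent trace is `O(n ^ (5 / 8))` away from the cut. -/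
theorem BoundedDensity.exists_resolventFluct_le {μ : Measure ℝ} {b : ℝ≥0} (h : BoundedDensity μ b)
    {e r R A : ℝ} (he : 0 ≤ e) (her : e < r) (hR : 0 ≤ R) (hA : 0 ≤ A) : ∃ C : ℝ, 0 ≤ C ∧
      ∀ n : ℕ, 2 ≤ n → ∀ l ∈ typicalSet μ n e A, ∀ z : ℂ, r ≤ Metric.infDist z cut →
        Metric.infDist z cut ≤ R → ‖resolventFluct μ l z‖ ≤ C * (n : ℝ) ^ (5 / 8 : ℝ) := by
  have := h.prob
  set ρ := (r - e) / 4 with hρ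
  have hρ0 : 0 < ρ := by rw [hρ]; linarith
  set B₁ := √(8 * A) + 2 / ρ with hB₁
  have hB₁0 : 0 ≤ B₁ := by positivity
  refine ⟨2 * B₁ / ρ + 2 * (R + 2 * ρ) / ρ, by positivity, ?_⟩
  intro n hn l hl z hz hzR
  have hn2 : (2 : ℝ) ≤ n := by exact_mod_cast hn
  have hpow : (1 : ℝ) ≤ (n : ℝ) ^ (5 / 8 : ℝ) := Real.one_le_rpow (by linarith) (by norm_num)
  -- For small n the upper scale n of the discrepancy does not reach the height of the region, and
  -- the trivial bound suffices.
  rcases lt_or_ge (n : ℝ) (R + 2 * ρ) with hnR | hnR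
  · have h1 := h.norm_resolventFluct_le he hl.1 hρ0 (z := z) (by linarith)
    calc _ ≤ 2 * n / ρ := h1
      _ ≤ 2 * (R + 2 * ρ) / ρ := by gcongr
      _ ≤ (2 * B₁ / ρ + 2 * (R + 2 * ρ) / ρ) * 1 := by
          have : 0 ≤ 2 * B₁ / ρ := by positivity
          linarith
      _ ≤ _ := by gcongr
  have hdist : ∀ w : ℂ, ‖w - z‖ ≤ 2 * ρ → e + ρ ≤ Metric.infDist w cut := fun w hw => by
    have := abs_infDist_cut_sub_le z w
    rw [norm_sub_rev] at this
    linarith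
  have hn40 : (0 : ℝ) < ((n : ℝ) ^ 4)⁻¹ := by positivity
  have hup : ∀ w : ℂ, 2 * ((n : ℝ) ^ 4)⁻¹ ≤ w.im → w.im ≤ n →
      ‖resolventFluct μ l w‖ * |w.im| ≤ √(8 * A) * (n : ℝ) ^ (5 / 8 : ℝ) := by
    intro w h1 h2
    have hw : 0 < w.im := by linarith
    have h3 := norm_resolventFluct_le_of_im (μ := μ) l hn40 hl.2 h1 h2
    rw [le_div_iff₀ hw] at h3
    rw [abs_of_pos hw]
    exact h3.trans (sqrt_mul_log_le hA (by omega))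
  have hmain := norm_le_of_norm_mul_abs_im_le (f := resolventFluct μ l) (z := z)
    (B := B₁ * (n : ℝ) ^ (5 / 8 : ℝ)) hρ0 ?_ ?_
  · calc _ ≤ 2 * (B₁ * (n : ℝ) ^ (5 / 8 : ℝ)) / ρ := hmain
      _ = 2 * B₁ / ρ * (n : ℝ) ^ (5 / 8 : ℝ) := by ring
      _ ≤ _ := by
        gcongr
        have : 0 ≤ 2 * (R + 2 * ρ) / ρ := by positivity
        linarith
  · intro w hw
    have h1 := hdist w hw
    refine h.differentiableAt_resolventFluct (by linarith) fun i hi => ?_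
    have h2 := infDist_cut_sub_le_norm_sub he (hl.1 i) w
    rw [hi] at h1 h2
    simp at h2
    linarith
  · intro w hw
    have h1 := hdist w hw
    have h2 : |w.im| ≤ n := by
      refine (abs_im_le_infDist_cut w).trans ?_
      have := abs_infDist_cut_sub_le w z
      linarith
    have hle : √(8 * A) * (n : ℝ) ^ (5 / 8 : ℝ) ≤ B₁ * (n : ℝ) ^ (5 / 8 : ℝ) := by
      gcongr
      have : 0 ≤ 2 / ρ := by positivity
      linarith
    -- Above the lower scale the discrepancy gives the bound, with conjugation for the lower half
    -- plane. Below it the trivial bound O(n) is multiplied by an imaginary part O(n⁻⁴).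
    rcases le_or_gt (2 * ((n : ℝ) ^ 4)⁻¹) |w.im| with h3 | h3
    · rcases le_abs.1 h3 with h4 | h4
      · exact (hup w h4 ((le_abs_self _).trans h2)).trans hle
      · have h5 := hup (conj w) (by simpa using h4) (by simpa using (neg_le_abs _).trans h2)
        rw [resolventFluct_conj] at h5
        simp only [Complex.norm_conj, Complex.conj_im, abs_neg] at h5
        exact h5.trans hle
    · have h4 := h.norm_resolventFluct_le he hl.1 hρ0 h1
      have h5 : (2 * n / ρ) * (2 * ((n : ℝ) ^ 4)⁻¹) ≤ 2 / ρ := by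
        have : (n : ℝ) * ((n : ℝ) ^ 4)⁻¹ ≤ 1 / 2 := by
          have h6 : (n : ℝ) * ((n : ℝ) ^ 4)⁻¹ = ((n : ℝ) ^ 3)⁻¹ := by field_simp
          rw [h6, one_div]
          apply inv_anti₀ (by norm_num)
          nlinarith [sq_nonneg ((n : ℝ) - 2)]
        calc _ = 4 / ρ * ((n : ℝ) * ((n : ℝ) ^ 4)⁻¹) := by ring
          _ ≤ 4 / ρ * (1 / 2) := by gcongr
          _ = _ := by ring
      calc _ ≤ (2 * n / ρ) * (2 * ((n : ℝ) ^ 4)⁻¹) := by gcongr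
        _ ≤ 2 / ρ := h5
        _ ≤ B₁ * 1 := by
          have : 0 ≤ √(8 * A) := by positivity
          linarith
        _ ≤ _ := by gcongr

end BetaEnsemble

namespace BetaEnsemble

/-! ### The contour integral as an integral against arc length -/

/-- The contour `{z : dist(z, σ) = r}`. -/
def contour (r : ℝ) : Set ℂ := {z | Metric.infDist z cut = r}

/-- Arc length on the contour `{z : dist(z, σ) = r}`. -/
noncomputable def contourMeasure (r : ℝ) : Measure ℂ :=
  (volume.restrict (Set.Ioc (-2 : ℝ) 2)).map (fun x : ℝ => (x : ℂ) - r * Complex.I) +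
  ENNReal.ofReal r • (volume.restrict (Set.Ioc (-(Real.pi / 2)) (Real.pi / 2))).map
    (fun θ : ℝ => 2 + r * Complex.exp (θ * Complex.I)) +
  (volume.restrict (Set.Ioc (-2 : ℝ) 2)).map (fun x : ℝ => (x : ℂ) + r * Complex.I) +
  ENNReal.ofReal r • (volume.restrict (Set.Ioc (Real.pi / 2) (3 * Real.pi / 2))).map
    (fun θ : ℝ => -2 + r * Complex.exp (θ * Complex.I))

/-- The unit tangent of the contour `{z : dist(z, σ) = r}`, counterclockwise. -/
noncomputable def contourTangent (r : ℝ) (z : ℂ) : ℂ :=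
  Complex.I * (z - (max (-2) (min z.re 2) : ℝ)) / r

/-- The Cauchy integral `(2πi)⁻¹ ∮ F(z) dz` over `{z : dist(z, σ) = r}`. -/
noncomputable def cauchyIntegral (r : ℝ) (F : ℂ → ℂ) : ℂ :=
  ∫ z, F z * (contourTangent r z / (2 * Real.pi * Complex.I)) ∂(contourMeasure r)

instance (r : ℝ) : IsFiniteMeasure (contourMeasure r) := by
  unfold contourMeasure
  have h : ∀ (c : ℝ≥0∞) (m : Measure ℂ) [IsFiniteMeasure m], c ≠ ⊤ → IsFiniteMeasure (c • m) :=
    fun c m _ hc => Measure.smul_finite _ hc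
  have := h (ENNReal.ofReal r) ((volume.restrict (Set.Ioc (-(Real.pi / 2)) (Real.pi / 2))).map
    (fun θ : ℝ => 2 + r * Complex.exp (θ * Complex.I))) ENNReal.ofReal_ne_top
  have := h (ENNReal.ofReal r) ((volume.restrict (Set.Ioc (Real.pi / 2) (3 * Real.pi / 2))).map
    (fun θ : ℝ => -2 + r * Complex.exp (θ * Complex.I))) ENNReal.ofReal_ne_top
  infer_instance

/-- The last hypothesis is the variational characterisation of t as the point of the cut nearest to
z. -/
lemma mem_contour_of_closest {z : ℂ} {t r : ℝ} (ht : t ∈ Set.Icc (-2 : ℝ) 2) (hz : ‖z - t‖ = r)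
    (h : ∀ s ∈ Set.Icc (-2 : ℝ) 2, 0 ≤ (z.re - t) * (t - s)) : z ∈ contour r := by
  refine le_antisymm (hz ▸ infDist_cut_le ht z) ?_
  obtain ⟨s, hs, h'⟩ := exists_infDist_cut_eq z
  rw [h', ← hz]
  have h1 := h s hs
  rw [← sq_le_sq₀ (norm_nonneg _) (norm_nonneg _), ← Complex.normSq_eq_norm_sq,
    ← Complex.normSq_eq_norm_sq, Complex.normSq_apply, Complex.normSq_apply]
  simp only [Complex.sub_re, Complex.ofReal_re, Complex.sub_im, Complex.ofReal_im]
  nlinarith [sq_nonneg (t - s)]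

section pieces

variable {r : ℝ} (hr : 0 < r)
include hr

lemma lower_mem_contour {x : ℝ} (hx : x ∈ Set.Icc (-2 : ℝ) 2) :
    (x : ℂ) - r * Complex.I ∈ contour r :=
  mem_contour_of_closest hx (by simp [abs_of_pos hr]) fun s _ => by simp

lemma upper_mem_contour {x : ℝ} (hx : x ∈ Set.Icc (-2 : ℝ) 2) :
    (x : ℂ) + r * Complex.I ∈ contour r :=
  mem_contour_of_closest hx (by simp [abs_of_pos hr]) fun s _ => by simp

lemma right_mem_contour {θ : ℝ} (hθ : θ ∈ Set.Icc (-(Real.pi / 2)) (Real.pi / 2)) :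
    (2 : ℂ) + r * Complex.exp (θ * Complex.I) ∈ contour r := by
  have h1 := Real.cos_nonneg_of_mem_Icc hθ
  refine mem_contour_of_closest (t := 2) (by norm_num)
    (by simp [Complex.norm_exp_ofReal_mul_I, abs_of_pos hr]) fun s hs => ?_
  simp [Complex.exp_ofReal_mul_I_re]
  have := hs.2
  exact mul_nonneg (by positivity) (by linarith)

omit hr in
lemma cos_nonpos_of_mem {θ : ℝ} (hθ : θ ∈ Set.Icc (Real.pi / 2) (3 * Real.pi / 2)) :
    Real.cos θ ≤ 0 :=
  Real.cos_nonpos_of_pi_div_two_le_of_le hθ.1 (by linarith [hθ.2])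

lemma left_mem_contour {θ : ℝ} (hθ : θ ∈ Set.Icc (Real.pi / 2) (3 * Real.pi / 2)) :
    (-2 : ℂ) + r * Complex.exp (θ * Complex.I) ∈ contour r := by
  have h1 := cos_nonpos_of_mem hθ
  refine mem_contour_of_closest (t := -2) (by norm_num)
    (by simp [Complex.norm_exp_ofReal_mul_I, abs_of_pos hr]) fun s hs => ?_
  simp [Complex.exp_ofReal_mul_I_re]
  have := hs.1
  exact mul_nonneg_of_nonpos_of_nonpos (mul_nonpos_of_nonneg_of_nonpos hr.le h1) (by linarith)

lemma contourTangent_lower {x : ℝ} (hx : x ∈ Set.Icc (-2 : ℝ) 2) :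
    contourTangent r ((x : ℂ) - r * Complex.I) = 1 := by
  have h0 : (r : ℂ) ≠ 0 := by exact_mod_cast hr.ne'
  simp only [contourTangent, Complex.sub_re, Complex.ofReal_re, Complex.mul_re, Complex.I_re,
    mul_zero, Complex.ofReal_im, Complex.I_im, mul_one, sub_self, sub_zero]
  rw [min_eq_left hx.2, max_eq_right hx.1]
  field_simp
  ring_nf
  simp

lemma contourTangent_upper {x : ℝ} (hx : x ∈ Set.Icc (-2 : ℝ) 2) :
    contourTangent r ((x : ℂ) + r * Complex.I) = -1 := by
  have h0 : (r : ℂ) ≠ 0 := by exact_mod_cast hr.ne'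
  simp only [contourTangent, Complex.add_re, Complex.ofReal_re, Complex.mul_re, Complex.I_re,
    mul_zero, Complex.ofReal_im, Complex.I_im, mul_one, sub_self, add_zero]
  rw [min_eq_left hx.2, max_eq_right hx.1]
  field_simp
  ring_nf
  simp

lemma contourTangent_right {θ : ℝ} (hθ : θ ∈ Set.Icc (-(Real.pi / 2)) (Real.pi / 2)) :
    contourTangent r ((2 : ℂ) + r * Complex.exp (θ * Complex.I)) =
      Complex.I * Complex.exp (θ * Complex.I) := by
  have h0 : (r : ℂ) ≠ 0 := by exact_mod_cast hr.ne'
  have h1 := mul_nonneg hr.le (Real.cos_nonneg_of_mem_Icc hθ)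
  have h2 : ((2 : ℂ) + r * Complex.exp (θ * Complex.I)).re = 2 + r * Real.cos θ := by
    simp [Complex.exp_ofReal_mul_I_re]
  rw [contourTangent, h2, min_eq_right (by linarith), max_eq_right (by norm_num)]
  push_cast
  field_simp
  ring

lemma contourTangent_left {θ : ℝ} (hθ : θ ∈ Set.Icc (Real.pi / 2) (3 * Real.pi / 2)) :
    contourTangent r ((-2 : ℂ) + r * Complex.exp (θ * Complex.I)) =
      Complex.I * Complex.exp (θ * Complex.I) := by
  have h0 : (r : ℂ) ≠ 0 := by exact_mod_cast hr.ne'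
  have h1 := mul_nonpos_of_nonneg_of_nonpos hr.le (cos_nonpos_of_mem hθ)
  have h2 : ((-2 : ℂ) + r * Complex.exp (θ * Complex.I)).re = -2 + r * Real.cos θ := by
    simp [Complex.exp_ofReal_mul_I_re]
  rw [contourTangent, h2, min_eq_left (by linarith), max_eq_left (by linarith)]
  push_cast
  field_simp
  ring

end pieces

lemma isClosed_contour (r : ℝ) : IsClosed (contour r) :=
  isClosed_eq (Metric.continuous_infDist_pt _) continuous_const

lemma isCompact_contour (r : ℝ) : IsCompact (contour r) :=
  (isCompact_cutNhd r).of_isClosed_subset (isClosed_contour r) fun _ hz => le_of_eq hz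

lemma continuous_contourTangent (r : ℝ) : Continuous (contourTangent r) := by
  unfold contourTangent; fun_prop

lemma ae_contourMeasure {r : ℝ} (hr : 0 < r) :
    ∀ᵐ z ∂(contourMeasure r), z ∈ contour r ∧ ‖contourTangent r z‖ = 1 := by
  have hm : MeasurableSet {z : ℂ | z ∈ contour r ∧ ‖contourTangent r z‖ = 1} :=
    (isClosed_contour r).measurableSet.inter
      (measurableSet_eq_fun (continuous_contourTangent r).norm.measurable measurable_const)
  have key : ∀ (γ : ℝ → ℂ) (a b : ℝ), Continuous γ →
      (∀ t ∈ Set.Icc a b, γ t ∈ contour r ∧ ‖contourTangent r (γ t)‖ = 1) →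
      ∀ᵐ z ∂((volume.restrict (Set.Ioc a b)).map γ), z ∈ contour r ∧ ‖contourTangent r z‖ = 1 := by
    intro γ a b hγ h
    rw [ae_map_iff hγ.aemeasurable hm]
    exact (ae_restrict_iff' measurableSet_Ioc).2
      (Filter.Eventually.of_forall fun t ht => h t (Set.Ioc_subset_Icc_self ht))
  unfold contourMeasure
  simp only [ae_add_measure_iff]
  refine ⟨⟨⟨key _ _ _ (by fun_prop) fun t ht => ⟨lower_mem_contour hr ht, ?_⟩,
    Measure.ae_smul_measure (key _ _ _ (by fun_prop) fun t ht => ⟨right_mem_contour hr ht, ?_⟩) _⟩,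
    key _ _ _ (by fun_prop) fun t ht => ⟨upper_mem_contour hr ht, ?_⟩⟩,
    Measure.ae_smul_measure (key _ _ _ (by fun_prop) fun t ht => ⟨left_mem_contour hr ht, ?_⟩) _⟩
  · simp [contourTangent_lower hr ht]
  · simp [contourTangent_right hr ht, Complex.norm_exp_ofReal_mul_I]
  · simp [contourTangent_upper hr ht]
  · simp [contourTangent_left hr ht, Complex.norm_exp_ofReal_mul_I]

lemma integrable_of_continuousOn_compact {m : Measure ℂ} [IsFiniteMeasure m] {K : Set ℂ}
    (hK : IsCompact K) (hm : ∀ᵐ z ∂m, z ∈ K) {F : ℂ → ℂ} (hF : ContinuousOn F K) :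
    Integrable F m := by
  have h1 : m.restrict K = m := Measure.restrict_eq_self_of_ae_mem hm
  rw [← h1]
  exact hF.integrableOn_compact hK

lemma integrable_contourMeasure {r : ℝ} (hr : 0 < r) {F : ℂ → ℂ} (hF : ContinuousOn F (contour r)) :
    Integrable F (contourMeasure r) :=
  integrable_of_continuousOn_compact (isCompact_contour r)
    ((ae_contourMeasure hr).mono fun _ h => h.1) hF

lemma integrable_mul_contourTangent {r : ℝ} (hr : 0 < r) {F : ℂ → ℂ}
    (hF : ContinuousOn F (contour r)) :
    Integrable (fun z => F z * (contourTangent r z / (2 * Real.pi * Complex.I)))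
      (contourMeasure r) :=
  integrable_contourMeasure hr (hF.mul ((continuous_contourTangent r).div_const _).continuousOn)

/-- An integral against a finite measure, with a unimodular tangent as density, gives Fubini,
linearity and norm bounds at once. This lemma connects it with the parametrised contour integral. -/
lemma cauchyIntegral_eq {r : ℝ} (hr : 0 < r) {F : ℂ → ℂ} (hF : ContinuousOn F (contour r)) :
    cauchyIntegral r F = (2 * Real.pi * Complex.I)⁻¹ * contourIntegral r F := by
  have hG : ContinuousOn (fun z => F z * contourTangent r z) (contour r) :=
    hF.mul (continuous_contourTangent r).continuousOn
  have hGi := integrable_contourMeasure hr hG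
  have h1 : cauchyIntegral r F = (2 * Real.pi * Complex.I)⁻¹ *
      ∫ z, F z * contourTangent r z ∂(contourMeasure r) := by
    rw [← integral_const_mul, cauchyIntegral]
    congr 1; funext z; ring
  rw [h1]
  congr 1
  unfold contourMeasure at hGi ⊢
  have i1 := hGi.left_of_add_measure
  have i2 := i1.left_of_add_measure
  rw [integral_add_measure i1 hGi.right_of_add_measure,
    integral_add_measure i2 i1.right_of_add_measure,
    integral_add_measure i2.left_of_add_measure i2.right_of_add_measure,
    integral_smul_measure, integral_smul_measure, ENNReal.toReal_ofReal hr.le]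
  have i3 := i2.left_of_add_measure
  have i4 := i1.right_of_add_measure
  have hne : ENNReal.ofReal r ≠ 0 := by simpa using hr
  have i5 := (integrable_smul_measure hne ENNReal.ofReal_ne_top).1 i2.right_of_add_measure
  have i6 := (integrable_smul_measure hne ENNReal.ofReal_ne_top).1 hGi.right_of_add_measure
  rw [integral_map (by fun_prop) i3.1, integral_map (by fun_prop) i4.1,
    integral_map (by fun_prop) i5.1, integral_map (by fun_prop) i6.1, contourIntegral,
    intervalIntegral.integral_of_le (show (-2 : ℝ) ≤ 2 by norm_num),
    intervalIntegral.integral_of_le (show (-2 : ℝ) ≤ 2 by norm_num),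
    intervalIntegral.integral_of_le (show -(Real.pi / 2) ≤ Real.pi / 2 by linarith [Real.pi_pos]),
    intervalIntegral.integral_of_le (show Real.pi / 2 ≤ 3 * Real.pi / 2 by linarith [Real.pi_pos]),
    ← integral_smul, ← integral_smul,
    sub_eq_add_neg, ← integral_neg]
  congr 1
  · congr 1
    · congr 1
      · refine setIntegral_congr_fun measurableSet_Ioc fun x hx => ?_
        simp [contourTangent_lower hr (Set.Ioc_subset_Icc_self hx)]
      · refine setIntegral_congr_fun measurableSet_Ioc fun x hx => ?_
        simp only [contourTangent_right hr (Set.Ioc_subset_Icc_self hx), Complex.real_smul]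
        ring
    · refine setIntegral_congr_fun measurableSet_Ioc fun x hx => ?_
      simp [contourTangent_upper hr (Set.Ioc_subset_Icc_self hx)]
  · refine setIntegral_congr_fun measurableSet_Ioc fun x hx => ?_
    simp only [contourTangent_left hr (Set.Ioc_subset_Icc_self hx), Complex.real_smul]
    ring

lemma norm_cauchyIntegral_le {r : ℝ} (hr : 0 < r) {F : ℂ → ℂ} :
    ‖cauchyIntegral r F‖ ≤ ∫ z, ‖F z‖ ∂(contourMeasure r) := by
  have h2 : ∀ z : ℂ, ‖contourTangent r z‖ = 1 →
      ‖F z * (contourTangent r z / (2 * Real.pi * Complex.I))‖ = (2 * Real.pi)⁻¹ * ‖F z‖ := by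
    intro z hz
    rw [norm_mul, norm_div, hz]
    simp [abs_of_pos Real.pi_pos]
    ring
  have h3 : (2 * Real.pi)⁻¹ ≤ 1 := inv_le_one_of_one_le₀ (by linarith [Real.pi_gt_three])
  calc ‖cauchyIntegral r F‖ ≤
      ∫ z, ‖F z * (contourTangent r z / (2 * Real.pi * Complex.I))‖ ∂(contourMeasure r) :=
        norm_integral_le_integral_norm _
    _ = ∫ z, (2 * Real.pi)⁻¹ * ‖F z‖ ∂(contourMeasure r) :=
        integral_congr_ae ((ae_contourMeasure hr).mono fun z hz => h2 z hz.2)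
    _ = (2 * Real.pi)⁻¹ * ∫ z, ‖F z‖ ∂(contourMeasure r) := integral_const_mul _ _
    _ ≤ 1 * _ := by
        gcongr
    _ = _ := one_mul _

lemma norm_cauchyIntegral_le_of_bound {r B : ℝ} (hr : 0 < r) {F : ℂ → ℂ}
    (hF : ∀ z ∈ contour r, ‖F z‖ ≤ B) :
    ‖cauchyIntegral r F‖ ≤ B * (contourMeasure r).real Set.univ := by
  have h2 : ∀ z : ℂ, z ∈ contour r ∧ ‖contourTangent r z‖ = 1 →
      ‖F z * (contourTangent r z / (2 * Real.pi * Complex.I))‖ ≤ B := by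
    intro z hz
    have h3 : (2 * Real.pi)⁻¹ ≤ 1 := inv_le_one_of_one_le₀ (by linarith [Real.pi_gt_three])
    rw [norm_mul, norm_div, hz.2]
    refine le_trans ?_ (hF z hz.1)
    refine mul_le_of_le_one_right (norm_nonneg _) ?_
    simpa [abs_of_pos Real.pi_pos] using h3
  exact norm_integral_le_of_norm_le_const ((ae_contourMeasure hr).mono h2)

lemma cauchyIntegral_congr {r : ℝ} (hr : 0 < r) {F G : ℂ → ℂ} (h : Set.EqOn F G (contour r)) :
    cauchyIntegral r F = cauchyIntegral r G :=
  integral_congr_ae ((ae_contourMeasure hr).mono fun z hz => by simp only [h hz.1])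

lemma cauchyIntegral_add {r : ℝ} (hr : 0 < r) {F G : ℂ → ℂ} (hF : ContinuousOn F (contour r))
    (hG : ContinuousOn G (contour r)) :
    cauchyIntegral r (fun z => F z + G z) = cauchyIntegral r F + cauchyIntegral r G := by
  simp only [cauchyIntegral, add_mul]
  exact integral_add (integrable_mul_contourTangent hr hF) (integrable_mul_contourTangent hr hG)

lemma cauchyIntegral_const_mul (r : ℝ) (c : ℂ) (F : ℂ → ℂ) :
    cauchyIntegral r (fun z => c * F z) = c * cauchyIntegral r F := by
  simp only [cauchyIntegral, mul_assoc]
  exact integral_const_mul _ _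

lemma cauchyIntegral_neg (r : ℝ) (F : ℂ → ℂ) :
    cauchyIntegral r (fun z => -F z) = -cauchyIntegral r F := by
  simpa using cauchyIntegral_const_mul r (-1) F

lemma cauchyIntegral_sub {r : ℝ} (hr : 0 < r) {F G : ℂ → ℂ} (hF : ContinuousOn F (contour r))
    (hG : ContinuousOn G (contour r)) :
    cauchyIntegral r (fun z => F z - G z) = cauchyIntegral r F - cauchyIntegral r G := by
  have h1 := cauchyIntegral_add hr hF (G := fun z => -G z) hG.neg
  simp only [cauchyIntegral_neg] at h1
  simpa only [sub_eq_add_neg] using h1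

lemma cauchyIntegral_sum {r : ℝ} (hr : 0 < r) {ι : Type*} (s : Finset ι) {F : ι → ℂ → ℂ}
    (hF : ∀ i ∈ s, ContinuousOn (F i) (contour r)) :
    cauchyIntegral r (fun z => ∑ i ∈ s, F i z) = ∑ i ∈ s, cauchyIntegral r (F i) := by
  simp only [cauchyIntegral, Finset.sum_mul]
  exact integral_finsetSum _ fun i hi => integrable_mul_contourTangent hr (hF i hi)

lemma cauchyIntegral_mul_integral {r : ℝ} (hr : 0 < r) {α : Type*} [MeasurableSpace α]
    {ν : Measure α} [IsFiniteMeasure ν] {F : ℂ → ℂ} (hF : ContinuousOn F (contour r))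
    {k : ℂ → α → ℂ} (hk : AEStronglyMeasurable (Function.uncurry k) ((contourMeasure r).prod ν))
    {B : ℝ} (hB : ∀ᵐ x ∂ν, ∀ z ∈ contour r, ‖k z x‖ ≤ B) :
    cauchyIntegral r (fun z => F z * ∫ x, k z x ∂ν) =
      ∫ x, cauchyIntegral r (fun z => F z * k z x) ∂ν := by
  have hFi := integrable_mul_contourTangent hr hF
  have key : Integrable (Function.uncurry fun (z : ℂ) (x : α) =>
      F z * (contourTangent r z / (2 * Real.pi * Complex.I)) * k z x)
      ((contourMeasure r).prod ν) := by
    refine Integrable.mul_bdd (c := B) (f := fun p : ℂ × α =>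
      F p.1 * (contourTangent r p.1 / (2 * Real.pi * Complex.I))) (hFi.comp_fst ν) hk ?_
    have h1 : ∀ᵐ p ∂((contourMeasure r).prod ν), p.1 ∈ contour r :=
      Measure.quasiMeasurePreserving_fst.ae ((ae_contourMeasure hr).mono fun _ h => h.1)
    have h2 : ∀ᵐ p ∂((contourMeasure r).prod ν), ∀ z ∈ contour r, ‖k z p.2‖ ≤ B :=
      Measure.quasiMeasurePreserving_snd.ae hB
    filter_upwards [h1, h2] with p hp1 hp2 using hp2 _ hp1
  calc cauchyIntegral r (fun z => F z * ∫ x, k z x ∂ν)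
      = ∫ z, ∫ x, F z * (contourTangent r z / (2 * Real.pi * Complex.I)) * k z x ∂ν
          ∂(contourMeasure r) := by
        unfold cauchyIntegral
        congr 1; funext z
        rw [integral_const_mul]; ring
    _ = ∫ x, ∫ z, F z * (contourTangent r z / (2 * Real.pi * Complex.I)) * k z x
          ∂(contourMeasure r) ∂ν := integral_integral_swap key
    _ = _ := by
        unfold cauchyIntegral
        congr 1; funext x
        congr 1; funext z
        ring

/-! ### Cauchy's theorem and integral formula -/

lemma integral_mul_deriv_eq_sub {F G : ℂ → ℂ} {γ γ' : ℝ → ℂ} {a b : ℝ} (hab : a ≤ b)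
    (hγ : ∀ t, HasDerivAt γ (γ' t) t) (hγ' : Continuous γ')
    (hG : ∀ t ∈ Set.Icc a b, HasDerivAt G (F (γ t)) (γ t))
    (hF : ∀ t ∈ Set.Icc a b, ContinuousAt F (γ t)) :
    ∫ t in a..b, F (γ t) * γ' t = G (γ b) - G (γ a) := by
  refine intervalIntegral.integral_eq_sub_of_hasDerivAt (f := G ∘ γ) ?_ ?_
  · intro t ht
    rw [Set.uIcc_of_le hab] at ht
    exact (hG t ht).comp t (hγ t)
  · apply ContinuousOn.intervalIntegrable
    rw [Set.uIcc_of_le hab]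
    intro t ht
    exact (((hF t ht).comp (hγ t).continuousAt).mul hγ'.continuousAt).continuousWithinAt

lemma hasDerivAt_arc (c : ℂ) (r t : ℝ) :
    HasDerivAt (fun θ : ℝ => c + r * Complex.exp (θ * Complex.I))
      (r * Complex.I * Complex.exp (t * Complex.I)) t := by
  have h1 : HasDerivAt (fun θ : ℝ => (θ : ℂ) * Complex.I) Complex.I t := by
    simpa using (Complex.ofRealCLM.hasDerivAt (x := t)).mul_const Complex.I
  have h2 := ((h1.cexp).const_mul (r : ℂ)).const_add c
  exact h2.congr_deriv (by ring)

lemma hasDerivAt_ofReal_add (c : ℂ) (t : ℝ) : HasDerivAt (fun x : ℝ => (x : ℂ) + c) 1 t := by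
  simpa using (Complex.ofRealCLM.hasDerivAt (x := t)).add_const c

lemma contourIntegral_eq_zero_of_primitive {r : ℝ} (hr : 0 < r) {F G : ℂ → ℂ}
    (hF : ∀ z ∈ contour r, ContinuousAt F z) (hG : ∀ z ∈ contour r, HasDerivAt G (F z) z) :
    contourIntegral r F = 0 := by
  have hpi := Real.pi_pos
  have e1 := integral_mul_deriv_eq_sub (F := F) (G := G) (γ := fun x : ℝ => (x : ℂ) + -(r * Complex.I))
    (a := -2) (b := 2) (by norm_num) (fun t => hasDerivAt_ofReal_add _ t) continuous_const
    (fun t ht => hG _ (by simpa [sub_eq_add_neg] using lower_mem_contour hr ht))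
    (fun t ht => hF _ (by simpa [sub_eq_add_neg] using lower_mem_contour hr ht))
  have e3 := integral_mul_deriv_eq_sub (F := F) (G := G) (γ := fun x : ℝ => (x : ℂ) + r * Complex.I)
    (a := -2) (b := 2) (by norm_num) (fun t => hasDerivAt_ofReal_add _ t) continuous_const
    (fun t ht => hG _ (upper_mem_contour hr ht)) (fun t ht => hF _ (upper_mem_contour hr ht))
  have e2 := integral_mul_deriv_eq_sub (F := F) (G := G) (a := -(Real.pi / 2)) (b := Real.pi / 2)
    (by linarith) (hasDerivAt_arc 2 r) (by fun_prop)
    (fun t ht => hG _ (right_mem_contour hr ht)) (fun t ht => hF _ (right_mem_contour hr ht))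
  have e4 := integral_mul_deriv_eq_sub (F := F) (G := G) (a := Real.pi / 2) (b := 3 * Real.pi / 2)
    (by linarith) (hasDerivAt_arc (-2) r) (by fun_prop)
    (fun t ht => hG _ (left_mem_contour hr ht)) (fun t ht => hF _ (left_mem_contour hr ht))
  simp only [mul_one, ← sub_eq_add_neg] at e1 e3
  unfold contourIntegral
  have h1 : Complex.exp (((Real.pi / 2 : ℝ) : ℂ) * Complex.I) = Complex.I := by
    push_cast; exact Complex.exp_pi_div_two_mul_I
  have h2 : Complex.exp (((-(Real.pi / 2) : ℝ) : ℂ) * Complex.I) = -Complex.I := by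
    push_cast
    rw [neg_mul, Complex.exp_neg, Complex.exp_pi_div_two_mul_I, Complex.inv_I]
  have h3 : Complex.exp (((3 * Real.pi / 2 : ℝ) : ℂ) * Complex.I) = -Complex.I := by
    rw [← h2, Complex.exp_eq_exp_iff_exists_int]
    exact ⟨1, by push_cast; ring⟩
  rw [e1, e2, e3, e4, h1, h2, h3]
  push_cast
  simp only [mul_neg, ← sub_eq_add_neg]
  ring

lemma cauchyIntegral_eq_zero_of_primitive {r : ℝ} (hr : 0 < r) {F G : ℂ → ℂ}
    (hF : ∀ z ∈ contour r, ContinuousAt F z) (hG : ∀ z ∈ contour r, HasDerivAt G (F z) z) :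
    cauchyIntegral r F = 0 := by
  rw [cauchyIntegral_eq hr fun z hz => (hF z hz).continuousWithinAt,
    contourIntegral_eq_zero_of_primitive hr hF hG, mul_zero]

/-- Cauchy's theorem on a neighbourhood of the cut. -/
lemma cauchyIntegral_eq_zero {r r' : ℝ} (hr : 0 < r) (hrr : r < r') {F : ℂ → ℂ}
    (hF : DifferentiableOn ℂ F {z | Metric.infDist z cut < r'}) : cauchyIntegral r F = 0 := by
  -- The neighbourhood of the segment is convex, so F has a primitive on it and the integral along
  -- the closed contour telescopes.
  obtain ⟨G, hG⟩ := (convex_infDist_cut_lt r').exists_forall_hasDerivWithinAt hF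
  have hmem : ∀ z ∈ contour r, {z | Metric.infDist z cut < r'} ∈ 𝓝 z := fun z hz =>
    (isOpen_infDist_cut_lt r').mem_nhds (by rw [Set.mem_ofPred_eq, show _ = r from hz]; exact hrr)
  exact cauchyIntegral_eq_zero_of_primitive hr
    (fun z hz => (hF.differentiableAt (hmem z hz)).continuousAt)
    (fun z hz => (hG z (mem_of_mem_nhds (hmem z hz))).hasDerivAt (hmem z hz))

end BetaEnsemble

namespace BetaEnsemble

section

variable {r : ℝ} (hr : 0 < r)
include hr

lemma infDist_cut_ofReal_lt {x : ℝ} (hx : |x| < 2 + r) : Metric.infDist (x : ℂ) cut < r := by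
  have h1 : Metric.infDist (x : ℂ) cut ≤ max 0 (|x| - 2) :=
    (infDist_cut_ofReal_le_iff (le_max_left _ _) x).2 (by linarith [le_max_right 0 (|x| - 2)])
  exact h1.trans_lt (max_lt hr (by linarith))

lemma sub_ofReal_ne_zero {x : ℝ} (hx : |x| < 2 + r) {z : ℂ} (hz : z ∈ contour r) :
    z - x ≠ 0 := by
  intro h
  have h1 := infDist_cut_ofReal_lt hr hx
  rw [← sub_eq_zero.1 h, show _ = r from hz] at h1
  exact lt_irrefl _ h1

/-- On the two segments and the right arc, log(z - x) is a primitive. On the left arc, where z - x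
crosses the negative axis, log(x - z) is used instead. The two branches differ by ±πi at the two
junctions, which adds up to 2πi. -/
lemma contourIntegral_inv_sub {x : ℝ} (hx : |x| < 2 + r) :
    contourIntegral r (fun z => (z - x)⁻¹) = 2 * Real.pi * Complex.I := by
  have hpi := Real.pi_pos
  obtain ⟨hx1, hx2⟩ := abs_lt.1 hx
  have hcont : ∀ z ∈ contour r, ContinuousAt (fun z : ℂ => (z - x)⁻¹) z := fun z hz =>
    ContinuousAt.fun_inv₀ (by fun_prop) (sub_ofReal_ne_zero hr hx hz)
  have hlog : ∀ z : ℂ, z - x ∈ Complex.slitPlane →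
      HasDerivAt (fun z : ℂ => Complex.log (z - x)) (z - x)⁻¹ z := fun z hz => by
    simpa using ((hasDerivAt_id z).sub_const (x : ℂ)).clog hz
  have hlog' : ∀ z : ℂ, -(z - x) ∈ Complex.slitPlane →
      HasDerivAt (fun z : ℂ => Complex.log (-(z - x))) (z - x)⁻¹ z := fun z hz => by
    have h1 := ((hasDerivAt_id z).sub_const (x : ℂ)).neg.clog hz
    exact h1.congr_deriv (by simp [div_eq_mul_inv, inv_neg, -neg_sub])
  have s2 : ∀ t ∈ Set.Icc (-(Real.pi / 2)) (Real.pi / 2),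
      (2 : ℂ) + r * Complex.exp (t * Complex.I) - x ∈ Complex.slitPlane := by
    intro t ht
    rw [Complex.mem_slitPlane_iff]
    simp only [Complex.sub_re, Complex.add_re, Complex.re_ofNat, Complex.re_ofReal_mul,
      Complex.exp_ofReal_mul_I_re, Complex.ofReal_re, Complex.sub_im, Complex.add_im,
      Complex.im_ofNat, Complex.im_ofReal_mul, Complex.exp_ofReal_mul_I_im, Complex.ofReal_im]
    by_cases hs : Real.sin t = 0
    · left
      have h1 : Real.cos t = 1 := by
        have h2 := Real.cos_nonneg_of_mem_Icc ht
        have h3 := Real.sin_sq_add_cos_sq t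
        rw [hs] at h3
        nlinarith
      rw [h1]; linarith
    · right; simp [hr.ne', hs]
  have s4 : ∀ t ∈ Set.Icc (Real.pi / 2) (3 * Real.pi / 2),
      -((-2 : ℂ) + r * Complex.exp (t * Complex.I) - x) ∈ Complex.slitPlane := by
    intro t ht
    rw [Complex.mem_slitPlane_iff]
    simp only [Complex.neg_re, Complex.neg_im, Complex.sub_re, Complex.add_re, Complex.neg_re, Complex.re_ofNat,
      Complex.re_ofReal_mul, Complex.exp_ofReal_mul_I_re, Complex.ofReal_re, Complex.sub_im,
      Complex.add_im, Complex.im_ofNat, Complex.im_ofReal_mul, Complex.exp_ofReal_mul_I_im,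
      Complex.ofReal_im]
    by_cases hs : Real.sin t = 0
    · left
      have h1 : Real.cos t = -1 := by
        have h2 := cos_nonpos_of_mem ht
        have h3 := Real.sin_sq_add_cos_sq t
        rw [hs] at h3
        nlinarith
      rw [h1]; linarith
    · right; simp [hr.ne', hs]
  have e1 := integral_mul_deriv_eq_sub (F := fun z : ℂ => (z - x)⁻¹)
    (G := fun z => Complex.log (z - x)) (γ := fun t : ℝ => (t : ℂ) + -(r * Complex.I))
    (a := -2) (b := 2) (by norm_num) (fun t => hasDerivAt_ofReal_add _ t) continuous_const
    (fun t ht => hlog _ (Or.inr (by simp [hr.ne'])))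
    (fun t ht => hcont _ (by simpa [sub_eq_add_neg] using lower_mem_contour hr ht))
  have e3 := integral_mul_deriv_eq_sub (F := fun z : ℂ => (z - x)⁻¹)
    (G := fun z => Complex.log (z - x)) (γ := fun t : ℝ => (t : ℂ) + r * Complex.I)
    (a := -2) (b := 2) (by norm_num) (fun t => hasDerivAt_ofReal_add _ t) continuous_const
    (fun t ht => hlog _ (Or.inr (by simp [hr.ne'])))
    (fun t ht => hcont _ (upper_mem_contour hr ht))
  have e2 := integral_mul_deriv_eq_sub (F := fun z : ℂ => (z - x)⁻¹)
    (G := fun z => Complex.log (z - x)) (a := -(Real.pi / 2)) (b := Real.pi / 2)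
    (by linarith) (hasDerivAt_arc 2 r) (by fun_prop)
    (fun t ht => hlog _ (s2 t ht)) (fun t ht => hcont _ (right_mem_contour hr ht))
  have e4 := integral_mul_deriv_eq_sub (F := fun z : ℂ => (z - x)⁻¹)
    (G := fun z => Complex.log (-(z - x))) (a := Real.pi / 2) (b := 3 * Real.pi / 2)
    (by linarith) (hasDerivAt_arc (-2) r) (by fun_prop)
    (fun t ht => hlog' _ (s4 t ht)) (fun t ht => hcont _ (left_mem_contour hr ht))
  simp only [mul_one, ← sub_eq_add_neg] at e1 e3
  have h1 : Complex.exp (((Real.pi / 2 : ℝ) : ℂ) * Complex.I) = Complex.I := by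
    push_cast; exact Complex.exp_pi_div_two_mul_I
  have h2 : Complex.exp (((-(Real.pi / 2) : ℝ) : ℂ) * Complex.I) = -Complex.I := by
    push_cast
    rw [neg_mul, Complex.exp_neg, Complex.exp_pi_div_two_mul_I, Complex.inv_I]
  have h3 : Complex.exp (((3 * Real.pi / 2 : ℝ) : ℂ) * Complex.I) = -Complex.I := by
    rw [← h2, Complex.exp_eq_exp_iff_exists_int]
    exact ⟨1, by push_cast; ring⟩
  rw [h1, h2] at e2
  rw [h1, h3] at e4
  unfold contourIntegral
  rw [e1, e2, e3, e4]
  push_cast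
  set q : ℂ := 2 + x with hq
  have l1 : Complex.log (-(q - r * Complex.I)) =
      Complex.log (q - r * Complex.I) + Real.pi * Complex.I := by
    rw [Complex.log, Complex.log, norm_neg, Complex.arg_neg_eq_arg_add_pi_of_im_neg (by simpa [hq])]
    push_cast; ring
  have l2 : Complex.log (-(q + r * Complex.I)) =
      Complex.log (q + r * Complex.I) - Real.pi * Complex.I := by
    rw [Complex.log, Complex.log, norm_neg, Complex.arg_neg_eq_arg_sub_pi_of_im_pos (by simpa [hq])]
    push_cast; ring
  rw [show (-2 : ℂ) - r * Complex.I - x = -(q + r * Complex.I) by rw [hq]; ring,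
    show (-2 : ℂ) + r * Complex.I - x = -(q - r * Complex.I) by rw [hq]; ring,
    show -((-2 : ℂ) + r * -Complex.I - x) = q + r * Complex.I by rw [hq]; ring,
    neg_neg, l1, l2]
  simp only [mul_neg, ← sub_eq_add_neg]
  ring

lemma continuousOn_inv_sub {x : ℝ} (hx : |x| < 2 + r) :
    ContinuousOn (fun z : ℂ => (z - x)⁻¹) (contour r) :=
  ContinuousOn.inv₀ (by fun_prop) fun _ hz => sub_ofReal_ne_zero hr hx hz

lemma cauchyIntegral_inv_sub {x : ℝ} (hx : |x| < 2 + r) :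
    cauchyIntegral r (fun z => (z - x)⁻¹) = 1 := by
  rw [cauchyIntegral_eq hr (continuousOn_inv_sub hr hx), contourIntegral_inv_sub hr hx]
  exact inv_mul_cancel₀ (by simp [Real.pi_ne_zero])

lemma cauchyIntegral_inv_sub_sq {x : ℝ} (hx : |x| < 2 + r) :
    cauchyIntegral r (fun z => ((z - x) ^ 2)⁻¹) = 0 := by
  refine cauchyIntegral_eq_zero_of_primitive hr (G := fun z => -(z - x)⁻¹) ?_ ?_
  · exact fun z hz => ContinuousAt.fun_inv₀ (by fun_prop) (pow_ne_zero 2 (sub_ofReal_ne_zero hr hx hz))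
  · intro z hz
    have h1 := (((hasDerivAt_id z).sub_const (x : ℂ)).inv (sub_ofReal_ne_zero hr hx hz)).neg
    simp only [id, neg_div, neg_neg, one_div] at h1
    exact h1

variable {r' : ℝ} (hrr : r < r') {F : ℂ → ℂ}
  (hF : DifferentiableOn ℂ F {z | Metric.infDist z cut < r'})

omit hr in
include hrr hF in
lemma continuousOn_contour_of_differentiableOn : ContinuousOn F (contour r) :=
  hF.continuousOn.mono fun z hz => by
    rw [Set.mem_ofPred_eq, show _ = r from hz]; exact hrr

include hrr in
lemma ofReal_mem_nhds {x : ℝ} (hx : |x| < 2 + r) : {z | Metric.infDist z cut < r'} ∈ 𝓝 (x : ℂ) :=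
  (isOpen_infDist_cut_lt r').mem_nhds ((infDist_cut_ofReal_lt hr hx).trans hrr)

include hrr hF

/-- Cauchy's integral formula at real points. -/
lemma cauchyIntegral_mul_inv_sub {x : ℝ} (hx : |x| < 2 + r) :
    cauchyIntegral r (fun z => F z * (z - x)⁻¹) = F x := by
  -- The divided difference removes the pole, so only F(x) times the winding integral remains.
  have hd : DifferentiableOn ℂ (dslope F x) {z | Metric.infDist z cut < r'} :=
    (Complex.differentiableOn_dslope (ofReal_mem_nhds hr hrr hx)).2 hF
  have h1 : Set.EqOn (fun z => F z * (z - x)⁻¹) (fun z => dslope F x z + F x * (z - x)⁻¹)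
      (contour r) := by
    intro z hz
    have h0 := sub_ofReal_ne_zero hr hx hz
    simp only [dslope_of_ne _ (sub_ne_zero.1 h0), slope_def_field]
    field_simp
    ring
  rw [cauchyIntegral_congr hr h1, cauchyIntegral_add hr
    (continuousOn_contour_of_differentiableOn hrr hd)
    (continuousOn_const.fun_mul (continuousOn_inv_sub hr hx)), cauchyIntegral_eq_zero hr hrr hd,
    cauchyIntegral_const_mul, cauchyIntegral_inv_sub hr hx]
  ring

lemma cauchyIntegral_mul_inv_sub_sq {x : ℝ} (hx : |x| < 2 + r) :
    cauchyIntegral r (fun z => F z * ((z - x) ^ 2)⁻¹) = deriv F x := by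
  have hd : DifferentiableOn ℂ (dslope F x) {z | Metric.infDist z cut < r'} :=
    (Complex.differentiableOn_dslope (ofReal_mem_nhds hr hrr hx)).2 hF
  have h1 : Set.EqOn (fun z => F z * ((z - x) ^ 2)⁻¹)
      (fun z => dslope F x z * (z - x)⁻¹ + F x * ((z - x) ^ 2)⁻¹) (contour r) := by
    intro z hz
    have h0 := sub_ofReal_ne_zero hr hx hz
    simp only [dslope_of_ne _ (sub_ne_zero.1 h0), slope_def_field]
    field_simp
    ring
  have hc2 : ContinuousOn (fun z : ℂ => ((z - x) ^ 2)⁻¹) (contour r) := 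
    ContinuousOn.inv₀ (by fun_prop) fun z hz => pow_ne_zero 2 (sub_ofReal_ne_zero hr hx hz)
  rw [cauchyIntegral_congr hr h1, cauchyIntegral_add hr
    ((continuousOn_contour_of_differentiableOn hrr hd).fun_mul (continuousOn_inv_sub hr hx))
    (continuousOn_const.fun_mul hc2), cauchyIntegral_mul_inv_sub hr hrr hd hx,
    cauchyIntegral_const_mul, cauchyIntegral_inv_sub_sq hr hx, dslope_same]
  ring

/-- Cauchy's integral formula for divided differences. -/
lemma cauchyIntegral_mul_inv_sub_mul_inv_sub {x y : ℝ} (hx : |x| < 2 + r) (hy : |y| < 2 + r)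
    (hxy : x ≠ y) : cauchyIntegral r (fun z => F z * ((z - x)⁻¹ * (z - y)⁻¹)) =
      (F x - F y) / (x - y) := by
  have hxy' : (x : ℂ) - y ≠ 0 := sub_ne_zero.2 (by exact_mod_cast hxy)
  have h1 : Set.EqOn (fun z => F z * ((z - x)⁻¹ * (z - y)⁻¹))
      (fun z => ((x : ℂ) - y)⁻¹ * (F z * (z - x)⁻¹ - F z * (z - y)⁻¹)) (contour r) := by
    intro z hz
    have h0 := sub_ofReal_ne_zero hr hx hz
    have h0' := sub_ofReal_ne_zero hr hy hz
    simp only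
    field_simp
    ring
  have hFc := continuousOn_contour_of_differentiableOn hrr hF
  rw [cauchyIntegral_congr hr h1, cauchyIntegral_const_mul, cauchyIntegral_sub hr
    (hFc.fun_mul (continuousOn_inv_sub hr hx)) (hFc.fun_mul (continuousOn_inv_sub hr hy)),
    cauchyIntegral_mul_inv_sub hr hrr hF hx, cauchyIntegral_mul_inv_sub hr hrr hF hy]
  rw [inv_mul_eq_div]

end

end BetaEnsemble

namespace BetaEnsemble

/-! ### The square root -/

lemma cpow_half_sq (z : ℂ) : (z ^ (1 / 2 : ℂ)) ^ 2 = z := by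
  rw [one_div]; exact_mod_cast Complex.cpow_nat_inv_pow z two_ne_zero

lemma sqrtX_sq (z : ℂ) : sqrtX z ^ 2 = z ^ 2 - 4 := by
  rw [sqrtX, mul_pow, cpow_half_sq, cpow_half_sq]; ring

/-- The square of the modulus is |z - 2| |z + 2|, and both endpoints belong to the cut. This bound
allows division by the square root in the loop equation. -/
lemma infDist_cut_le_norm_sqrtX (z : ℂ) : Metric.infDist z cut ≤ ‖sqrtX z‖ := by
  have h1 : ‖sqrtX z‖ ^ 2 = ‖z - 2‖ * ‖z + 2‖ := by
    rw [← norm_pow, sqrtX_sq, ← norm_mul]; congr 1; ring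
  have h2 := infDist_cut_le (t := 2) (by norm_num) z
  have h3 := infDist_cut_le (t := -2) (by norm_num) z
  push_cast at h2 h3
  rw [sub_neg_eq_add] at h3
  have h4 : 0 ≤ Metric.infDist z cut := Metric.infDist_nonneg
  refine abs_le_of_sq_le_sq' ?_ (norm_nonneg _) |>.2
  rw [h1, sq]
  gcongr

lemma sqrtX_ne_zero {z : ℂ} (hz : 0 < Metric.infDist z cut) : sqrtX z ≠ 0 :=
  norm_pos_iff.1 (hz.trans_le (infDist_cut_le_norm_sqrtX z))

/-- Both principal roots have nonnegative real part, and their imaginary parts have the same sign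
because z - 2 and z + 2 have the same imaginary part. Positivity of the sum singles out the
Joukowski preimage outside the unit disc. -/
lemma cpow_half_mul_conj_re_pos {z : ℂ} (hz : 0 < Metric.infDist z cut) :
    0 < ((z - 2) ^ (1 / 2 : ℂ) * conj ((z + 2) ^ (1 / 2 : ℂ))).re := by
  have him : (z - 2).im = z.im ∧ (z + 2).im = z.im := by simp
  have hre : (z - 2).re = z.re - 2 ∧ (z + 2).re = z.re + 2 := by simp
  rw [Complex.mul_re, Complex.conj_re, Complex.conj_im, mul_neg, sub_neg_eq_add, one_div,
    Complex.cpow_inv_two_re, Complex.cpow_inv_two_re]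
  have himeq : ((z - 2) ^ (2⁻¹ : ℂ)).im * ((z + 2) ^ (2⁻¹ : ℂ)).im =
      √((‖z - 2‖ - (z - 2).re) / 2) * √((‖z + 2‖ - (z + 2).re) / 2) := by
    rcases le_or_gt 0 z.im with h | h
    · rw [Complex.cpow_inv_two_im_eq_sqrt (by rw [him.1]; exact h),
        Complex.cpow_inv_two_im_eq_sqrt (by rw [him.2]; exact h)]
    · rw [Complex.cpow_inv_two_im_eq_neg_sqrt (by rw [him.1]; exact h),
        Complex.cpow_inv_two_im_eq_neg_sqrt (by rw [him.2]; exact h)]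
      ring
  rw [himeq]
  by_cases h0 : z.im = 0
  · have hzr : z = (z.re : ℂ) := Complex.ext rfl (by simpa using h0)
    have hx : 2 < |z.re| := by
      by_contra hcon
      have := (infDist_cut_ofReal_le_iff le_rfl z.re).2 (by simpa using hcon)
      rw [← hzr] at this
      linarith
    rcases lt_abs.1 hx with hx | hx
    · refine add_pos_of_pos_of_nonneg (mul_pos (Real.sqrt_pos.2 ?_) (Real.sqrt_pos.2 ?_))
        (by positivity)
      · rw [hre.1]; linarith [norm_nonneg (z - 2)]
      · rw [hre.2]; linarith [norm_nonneg (z + 2)]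
    · refine add_pos_of_nonneg_of_pos (by positivity)
        (mul_pos (Real.sqrt_pos.2 ?_) (Real.sqrt_pos.2 ?_))
      · rw [hre.1]; linarith [norm_nonneg (z - 2)]
      · rw [hre.2]; linarith [norm_nonneg (z + 2)]
  · have h1 : ∀ w : ℂ, w.im ≠ 0 → 0 < (‖w‖ - w.re) / 2 := fun w hw => by
      have := (Complex.abs_re_lt_norm (z := w)).2 hw
      linarith [le_abs_self w.re]
    exact add_pos_of_nonneg_of_pos (by positivity)
      (mul_pos (Real.sqrt_pos.2 (h1 _ (by rw [him.1]; exact h0)))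
        (Real.sqrt_pos.2 (h1 _ (by rw [him.2]; exact h0))))

/-- The inverse Joukowski map. -/
lemma exists_joukowski {z : ℂ} (hz : 0 < Metric.infDist z cut) :
    ∃ w : ℂ, 1 < ‖w‖ ∧ z = w + w⁻¹ ∧ sqrtX z = w - w⁻¹ := by
  set a := (z - 2) ^ (1 / 2 : ℂ) with ha
  set b := (z + 2) ^ (1 / 2 : ℂ) with hb
  have ha2 : a ^ 2 = z - 2 := cpow_half_sq _
  have hb2 : b ^ 2 = z + 2 := cpow_half_sq _
  have hlt : ‖b - a‖ < ‖a + b‖ := by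
    have h1 := cpow_half_mul_conj_re_pos hz
    rw [← ha, ← hb] at h1
    have h2 : ‖a + b‖ ^ 2 = ‖b - a‖ ^ 2 + 4 * (a * conj b).re := by
      simp only [← Complex.normSq_eq_norm_sq, Complex.normSq_apply, Complex.add_re, Complex.add_im,
        Complex.sub_re, Complex.sub_im, Complex.mul_re, Complex.conj_re, Complex.conj_im]
      ring
    exact lt_of_pow_lt_pow_left₀ 2 (norm_nonneg _) (by linarith)
  -- The preimage is w = ((a + b)/2)² with inverse ((b - a)/2)². Then w + 1/w = (a² + b²)/2 = z and
  -- w - 1/w = ab.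
  have hprod : (a + b) * (b - a) = 4 := by
    linear_combination hb2 - ha2
  have hw : ((a + b) / 2) ^ 2 * ((b - a) / 2) ^ 2 = 1 := by
    linear_combination (((a + b) * (b - a) + 4) / 16) * hprod
  have hinv : (((a + b) / 2) ^ 2)⁻¹ = ((b - a) / 2) ^ 2 := 
    inv_eq_of_mul_eq_one_right hw
  refine ⟨((a + b) / 2) ^ 2, ?_, ?_, ?_⟩
  · have h3 : ‖((a + b) / 2) ^ 2‖ * ‖((b - a) / 2) ^ 2‖ = 1 := by rw [← norm_mul, hw, norm_one]
    simp only [norm_pow, norm_div, Complex.norm_ofNat] at h3 ⊢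
    by_contra hcon
    have h4 : 0 ≤ ‖b - a‖ := norm_nonneg _
    have h5 : (‖b - a‖ / 2) ^ 2 < (‖a + b‖ / 2) ^ 2 := by gcongr
    have h6 : 0 ≤ (‖b - a‖ / 2) ^ 2 := by positivity
    nlinarith
  · rw [hinv]; linear_combination -(ha2 + hb2) / 2
  · rw [hinv, sqrtX, ← ha, ← hb]; ring

/-! ### The arcsine law -/

/-- The arcsine law on `[-2, 2]`. -/
noncomputable def arcsine : Measure ℝ :=
  (volume.restrict (Set.Ioc (-2 : ℝ) 2)).withDensity
    fun x => ENNReal.ofReal (1 / (Real.pi * √(4 - x ^ 2)))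

lemma ae_arcsine : ∀ᵐ x ∂arcsine, x ∈ Set.Icc (-2 : ℝ) 2 :=
  (withDensity_absolutelyContinuous _ _).ae_le
    ((ae_restrict_mem measurableSet_Ioc).mono fun _ h => Set.Ioc_subset_Icc_self h)

lemma arcsine_absolutelyContinuous : arcsine ≪ volume :=
  (withDensity_absolutelyContinuous _ _).trans Measure.absolutelyContinuous_restrict

lemma sqrt_four_sub_mul_sq (y : ℝ) : √(4 - (2 * y) ^ 2) = 2 * √(1 - y ^ 2) := by
  rw [show 4 - (2 * y) ^ 2 = 2 ^ 2 * (1 - y ^ 2) by ring, Real.sqrt_mul (by norm_num),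
    Real.sqrt_sq (by norm_num)]

instance : IsFiniteMeasure arcsine := by
  refine isFiniteMeasure_withDensity_ofReal (Integrable.hasFiniteIntegral ?_)
  have h1 := Polynomial.Chebyshev.intervalIntegrable_sqrt_one_sub_sq_inv.comp_mul_left (c := 1 / 2)
    |>.const_mul (1 / (2 * Real.pi))
  have h2 : IntervalIntegrable (fun x : ℝ => 1 / (Real.pi * √(4 - x ^ 2))) volume (-2) 2 := by
    convert! h1 using 1
    · funext x
      have := sqrt_four_sub_mul_sq (1 / 2 * x)
      rw [show 2 * (1 / 2 * x) = x by ring] at this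
      rw [this, Real.sqrt_inv]
      ring
    · norm_num
    · norm_num
  rw [intervalIntegrable_iff, Set.uIoc_of_le (by norm_num)] at h2
  exact h2

lemma integral_arcsine {E : Type*} [NormedAddCommGroup E] [NormedSpace ℝ E] (F : ℝ → E) :
    ∫ x, F x ∂arcsine = ∫ x in (-2 : ℝ)..2, (1 / (Real.pi * √(4 - x ^ 2))) • F x := by
  rw [arcsine, integral_withDensity_eq_integral_toReal_smul (by fun_prop)
      (Filter.Eventually.of_forall fun _ => ENNReal.ofReal_lt_top),
    intervalIntegral.integral_of_le (by norm_num)]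
  congr 1; funext x
  rw [ENNReal.toReal_ofReal (by positivity)]

lemma integral_arcsine_eq_integral_cos (F : ℝ → ℝ) :
    ∫ x, F x ∂arcsine = Real.pi⁻¹ * ∫ θ in (0 : ℝ)..Real.pi, F (2 * Real.cos θ) := by
  have h1 := Polynomial.Chebyshev.integral_measureT_eq_integral_cos (f := fun y => F (2 * y))
  rw [← h1, Polynomial.Chebyshev.integral_measureT, integral_arcsine]
  have h2 := intervalIntegral.integral_comp_mul_left (a := -1) (b := 1)
    (fun x => (1 / (Real.pi * √(4 - x ^ 2))) • F x) (c := 2) two_ne_zero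
  norm_num at h2
  rw [← intervalIntegral.integral_const_mul]
  simp only [smul_eq_mul, one_div, mul_inv_rev]
  have h3 : ∀ x : ℝ, Real.pi⁻¹ * (F (2 * x) * √(1 - x ^ 2)⁻¹) =
      2 * ((√(4 - (2 * x) ^ 2))⁻¹ * Real.pi⁻¹ * F (2 * x)) := by
    intro x
    rw [sqrt_four_sub_mul_sq, Real.sqrt_inv]
    ring
  simp_rw [h3]
  rw [intervalIntegral.integral_const_mul, h2]
  ring

lemma integrable_arcsine {F : ℝ → ℂ} (hF : ContinuousOn F (Set.Icc (-2) 2)) :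
    Integrable F arcsine := by
  rw [← Measure.restrict_eq_self_of_ae_mem ae_arcsine]
  exact hF.integrableOn_compact isCompact_Icc

lemma integral_arcsine_eq_integral_cos_complex {F : ℝ → ℂ} (hF : ContinuousOn F (Set.Icc (-2) 2)) :
    ∫ x, F x ∂arcsine = (Real.pi : ℂ)⁻¹ * ∫ θ in (0 : ℝ)..Real.pi, F (2 * Real.cos θ) := by
  have hi := integrable_arcsine hF
  have hc : Continuous fun θ : ℝ => F (2 * Real.cos θ) :=
    hF.comp_continuous (by fun_prop) fun θ =>
      ⟨by linarith [Real.neg_one_le_cos θ], by linarith [Real.cos_le_one θ]⟩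
  have hi' := hc.intervalIntegrable (μ := volume) 0 Real.pi
  apply Complex.ext
  · have h1 := integral_arcsine_eq_integral_cos fun x => (F x).re
    have h2 := Complex.reCLM.integral_comp_comm hi
    have h3 := Complex.reCLM.intervalIntegral_comp_comm hi'
    simp only [Complex.reCLM_apply] at h2 h3
    rw [← h2, h1, h3, ← Complex.ofReal_inv, Complex.re_ofReal_mul]
  · have h1 := integral_arcsine_eq_integral_cos fun x => (F x).im
    have h2 := Complex.imCLM.integral_comp_comm hi
    have h3 := Complex.imCLM.intervalIntegral_comp_comm hi'
    simp only [Complex.imCLM_apply] at h2 h3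
    rw [← h2, h1, h3, ← Complex.ofReal_inv, Complex.im_ofReal_mul]

lemma integral_comp_two_pi_sub {E : Type*} [NormedAddCommGroup E] [NormedSpace ℝ E] (G : ℝ → E)
    (a b : ℝ) : ∫ θ in a..b, G (2 * Real.pi - θ) =
      ∫ θ in (2 * Real.pi - b)..(2 * Real.pi - a), G θ :=
  intervalIntegral.integral_comp_sub_left G _

/-- With x = 2 cos θ and z = w + 1/w, the integrand factors over u = exp(iθ) and 1/u. Partial
fractions leave two functions analytic in the closed unit disc, because |w| > 1, and the mean value
property evaluates them. -/
lemma integral_inv_sub_arcsine {z : ℂ} (hz : 0 < Metric.infDist z cut) :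
    ∫ x : ℝ, (z - x)⁻¹ ∂arcsine = (sqrtX z)⁻¹ := by
  obtain ⟨w, hw1, hzw, hsw⟩ := exists_joukowski hz
  have hw0 : w ≠ 0 := norm_pos_iff.1 (by linarith)
  have hs0 := sqrtX_ne_zero hz
  have hcont : ContinuousOn (fun x : ℝ => (z - x)⁻¹) (Set.Icc (-2) 2) :=
    ContinuousOn.inv₀ (by fun_prop) fun x hx =>
      norm_pos_iff.1 (hz.trans_le (infDist_cut_le hx z))
  rw [integral_arcsine_eq_integral_cos_complex hcont]
  set G : ℝ → ℂ := fun θ => (z - (2 * Real.cos θ : ℝ))⁻¹ with hG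
  have hGc : Continuous G := hcont.comp_continuous (by fun_prop) fun θ =>
      ⟨by linarith [Real.neg_one_le_cos θ], by linarith [Real.cos_le_one θ]⟩
  -- symmetrisation
  have hsym : ∫ θ in (0 : ℝ)..(2 * Real.pi), G θ = 2 * ∫ θ in (0 : ℝ)..Real.pi, G θ := by
    have h1 := integral_comp_two_pi_sub G 0 Real.pi
    rw [show 2 * Real.pi - Real.pi = Real.pi by ring, sub_zero] at h1
    rw [← intervalIntegral.integral_add_adjacent_intervals (hGc.intervalIntegrable _ _)
      (hGc.intervalIntegrable Real.pi _), ← h1]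
    simp only [hG, Real.cos_two_pi_sub]
    ring
  -- the two mean values
  have hne : ∀ u : ℂ, ‖u‖ ≤ 1 → w - u ≠ 0 := fun u hu h => by
    rw [sub_eq_zero.1 h] at hw1; linarith
  have hmean : ∀ f : ℂ → ℂ, Differentiable ℂ f →
      ∫ θ in (0 : ℝ)..(2 * Real.pi), f (Complex.exp (θ * Complex.I)) /
        (w - Complex.exp (θ * Complex.I)) = 2 * Real.pi * (f 0 / w) := by
    intro f hf
    have h1 := DiffContOnCl.circleAverage (f := fun u => f u / (w - u)) (c := 0) (R := 1) (by
      apply DifferentiableOn.diffContOnCl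
      rw [abs_one, closure_ball _ one_ne_zero]
      intro u hu
      exact (hf.differentiableAt.div (by fun_prop)
        (hne u (by simpa using hu))).differentiableWithinAt)
    rw [Real.circleAverage_def] at h1
    simp only [circleMap, Complex.ofReal_one, one_mul, zero_add, sub_zero] at h1
    have hpi : (Real.pi : ℂ) ≠ 0 := by exact_mod_cast Real.pi_ne_zero
    rw [← h1, Complex.real_smul]
    push_cast
    rw [← mul_assoc, mul_inv_cancel₀ (by simp [hpi]), one_mul]
  have hE : ∀ θ : ℝ, G θ = (sqrtX z)⁻¹ * (w / (w - Complex.exp (θ * Complex.I)) +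
      Complex.exp ((2 * Real.pi - θ : ℝ) * Complex.I) /
        (w - Complex.exp ((2 * Real.pi - θ : ℝ) * Complex.I))) := by
    intro θ
    have hu : Complex.exp ((2 * Real.pi - θ : ℝ) * Complex.I) =
        (Complex.exp (θ * Complex.I))⁻¹ := by
      rw [← Complex.exp_neg, Complex.exp_eq_exp_iff_exists_int]
      exact ⟨1, by push_cast; ring⟩
    have hcos : ((2 * Real.cos θ : ℝ) : ℂ) =
        Complex.exp (θ * Complex.I) + (Complex.exp (θ * Complex.I))⁻¹ := by
      rw [← Complex.exp_neg]; push_cast [Complex.cos]; ring_nf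
    have hu1 : ‖Complex.exp (θ * Complex.I)‖ = 1 := Complex.norm_exp_ofReal_mul_I θ
    set u := Complex.exp (θ * Complex.I) with hudef
    have hu0 : u ≠ 0 := norm_pos_iff.1 (by rw [hu1]; exact one_pos)
    have n1 := hne u hu1.le
    have n2 := hne u⁻¹ (by rw [norm_inv, hu1, inv_one])
    rw [hu]
    simp only [hG, hcos]
    have e1 : z - (u + u⁻¹) = (w - u) * (w - u⁻¹) * w⁻¹ := by
      rw [hzw]; field_simp; ring
    have e2 : w / (w - u) + u⁻¹ / (w - u⁻¹) = sqrtX z * w * ((w - u) * (w - u⁻¹))⁻¹ := by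
      rw [hsw, div_add_div _ _ n1 n2, div_eq_mul_inv]
      congr 1
      field_simp
      ring
    rw [e1, e2, mul_inv, inv_inv]
    field_simp
  have hI : ∫ θ in (0 : ℝ)..(2 * Real.pi), G θ = (sqrtX z)⁻¹ * (2 * Real.pi) := by
    simp_rw [hE]
    have hc1 : Continuous fun θ : ℝ => w / (w - Complex.exp (θ * Complex.I)) :=
      Continuous.div (by fun_prop) (by fun_prop) fun θ =>
        hne _ (Complex.norm_exp_ofReal_mul_I θ).le
    have hc2 : Continuous fun θ : ℝ => Complex.exp (θ * Complex.I) /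
        (w - Complex.exp (θ * Complex.I)) :=
      Continuous.div (by fun_prop) (by fun_prop) fun θ =>
        hne _ (Complex.norm_exp_ofReal_mul_I θ).le
    have hc2' : Continuous fun θ : ℝ => Complex.exp ((2 * Real.pi - θ : ℝ) * Complex.I) /
        (w - Complex.exp ((2 * Real.pi - θ : ℝ) * Complex.I)) := hc2.comp (by fun_prop)
    rw [intervalIntegral.integral_const_mul, intervalIntegral.integral_add
      (hc1.intervalIntegrable _ _) (hc2'.intervalIntegrable _ _),
      integral_comp_two_pi_sub (fun θ : ℝ => Complex.exp (θ * Complex.I) /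
        (w - Complex.exp (θ * Complex.I))), sub_self, sub_zero,
      hmean (fun _ => w) (by fun_prop), hmean (fun u => u) (by fun_prop), div_self hw0]
    ring
  have hpi : (Real.pi : ℂ) ≠ 0 := by exact_mod_cast Real.pi_ne_zero
  have h4 : ∫ θ in (0 : ℝ)..Real.pi, G θ = (sqrtX z)⁻¹ * Real.pi := by
    have := hsym.symm.trans hI
    linear_combination this / 2
  have h5 : ∫ θ in (0 : ℝ)..Real.pi, (fun x : ℝ => (z - x)⁻¹) (2 * Real.cos θ) =
    ∫ θ in (0 : ℝ)..Real.pi, G θ := rfl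
  rw [h5, h4]
  field_simp

end BetaEnsemble

namespace BetaEnsemble

lemma integral_one_arcsine : ∫ _x : ℝ, (1 : ℂ) ∂arcsine = 1 := by
  rw [integral_arcsine_eq_integral_cos_complex continuousOn_const]
  simp [Real.pi_ne_zero]

lemma integral_id_arcsine : ∫ x : ℝ, (x : ℂ) ∂arcsine = 0 := by
  rw [integral_arcsine_eq_integral_cos_complex (by fun_prop)]
  rw [intervalIntegral.integral_ofReal, intervalIntegral.integral_const_mul, integral_cos]
  simp

lemma continuousOn_inv_sub_Icc {z : ℂ} (hz : 0 < Metric.infDist z cut) :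
    ContinuousOn (fun x : ℝ => (z - x)⁻¹) (Set.Icc (-2) 2) :=
  ContinuousOn.inv₀ (by fun_prop) fun _ hx => norm_pos_iff.1 (hz.trans_le (infDist_cut_le hx z))

lemma ae_arcsine_ne (x : ℝ) : ∀ᵐ t ∂arcsine, t ≠ x :=
  arcsine_absolutelyContinuous.ae_le
    (((Set.countable_singleton x).ae_notMem volume).mono fun _ ht h => ht h)

/-- The Stieltjes transform of the semicircle law. -/
lemma integral_four_sub_sq_mul_inv_sub_arcsine {z : ℂ} (hz : 0 < Metric.infDist z cut) :
    ∫ x : ℝ, (4 - x ^ 2) * (z - x)⁻¹ ∂arcsine = z - sqrtX z := by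
  have hs0 := sqrtX_ne_zero hz
  have h1 : ∀ x ∈ Set.Icc (-2 : ℝ) 2,
      (4 - x ^ 2) * (z - x)⁻¹ = (4 - z ^ 2) * (z - x)⁻¹ + (z * 1 + x) := by
    intro x hx
    have : z - x ≠ 0 := norm_pos_iff.1 (hz.trans_le (infDist_cut_le hx z))
    field_simp
    ring
  rw [integral_congr_ae (ae_arcsine.mono h1), integral_add
    ((integrable_arcsine (continuousOn_inv_sub_Icc hz)).const_mul _)
    (integrable_arcsine (by fun_prop)), integral_add (integrable_arcsine (by fun_prop))
    (integrable_arcsine (by fun_prop)), integral_const_mul, integral_const_mul,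
    integral_inv_sub_arcsine hz, integral_one_arcsine, integral_id_arcsine]
  have h2 := sqrtX_sq z
  field_simp
  linear_combination h2

/-- Each principal power jumps across the real axis to the left of -2, although the product does
not. Writing the inverse as a Cauchy transform of the arcsine law avoids any discussion of branches.
-/
lemma differentiableAt_sqrtX {z : ℂ} (hz : 0 < Metric.infDist z cut) :
    DifferentiableAt ℂ sqrtX z := by
  have h1 : ∀ᶠ w in 𝓝 z, 0 < Metric.infDist w cut :=
    (Metric.continuous_infDist_pt _).continuousAt.eventually (lt_mem_nhds hz)
  have h2 : sqrtX =ᶠ[𝓝 z] fun w => (∫ x : ℝ, (w - x)⁻¹ ∂arcsine)⁻¹ := by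
    filter_upwards [h1] with w hw
    rw [integral_inv_sub_arcsine hw, inv_inv]
  rw [h2.differentiableAt_iff]
  refine (hasDerivAt_integral_inv_sub ae_arcsine hz).differentiableAt.inv ?_
  rw [integral_inv_sub_arcsine hz]
  exact inv_ne_zero (sqrtX_ne_zero hz)

lemma continuousOn_sqrtX {r : ℝ} (hr : 0 < r) : ContinuousOn sqrtX (contour r) := fun z hz =>
  (differentiableAt_sqrtX (show 0 < Metric.infDist z cut from
    lt_of_lt_of_eq hr (Eq.symm hz))).continuousAt.continuousWithinAt

lemma differentiableOn_inv_sub_right (z : ℂ) :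
    DifferentiableOn ℂ (fun ζ : ℂ => (z - ζ)⁻¹)
      {ζ | Metric.infDist ζ cut < Metric.infDist z cut} := by
  refine DifferentiableOn.inv (by fun_prop) fun ζ hζ h => ?_
  rw [sub_eq_zero.1 h] at hζ
  exact lt_irrefl _ (show Metric.infDist ζ cut < Metric.infDist ζ cut from hζ)

lemma aestronglyMeasurable_uncurry_mul_inv_sub {m : Measure ℂ} [SFinite m] {ν : Measure ℝ}
    [SFinite ν] {φ : ℝ → ℂ} (hφ : AEStronglyMeasurable φ ν) :
    AEStronglyMeasurable (Function.uncurry fun (ζ : ℂ) (x : ℝ) => φ x * (ζ - x)⁻¹)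
      (m.prod ν) := by
  refine hφ.comp_snd.mul ?_
  apply Measurable.aestronglyMeasurable
  fun_prop

lemma ae_norm_mul_inv_sub_le {ν : Measure ℝ} {r B : ℝ} (hr : 0 < r) {φ : ℝ → ℂ}
    (hν : ∀ᵐ x ∂ν, x ∈ Set.Icc (-2 : ℝ) 2) (hφ : ∀ x ∈ Set.Icc (-2 : ℝ) 2, ‖φ x‖ ≤ B) :
    ∀ᵐ x ∂ν, ∀ ζ ∈ contour r, ‖φ x * (ζ - x)⁻¹‖ ≤ B * r⁻¹ := by
  filter_upwards [hν] with x hx ζ hζ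
  have h1 := infDist_cut_le hx ζ
  rw [show Metric.infDist ζ cut = r from hζ] at h1
  have hB : 0 ≤ B := (norm_nonneg _).trans (hφ x hx)
  rw [norm_mul, norm_inv]
  gcongr
  exact hφ x hx

/-- Interchange of a contour integral with a Cauchy transform. -/
lemma cauchyIntegral_mul_integral_inv_sub {ν : Measure ℝ} [IsFiniteMeasure ν] {r : ℝ} (hr : 0 < r)
    (hν : ∀ᵐ x ∂ν, x ∈ Set.Icc (-2 : ℝ) 2) {φ : ℝ → ℂ} (hφ : ContinuousOn φ (Set.Icc (-2) 2))
    {F : ℂ → ℂ} (hF : ContinuousOn F (contour r)) :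
    cauchyIntegral r (fun ζ => F ζ * ∫ x : ℝ, φ x * (ζ - x)⁻¹ ∂ν) =
      ∫ x, φ x * cauchyIntegral r (fun ζ => F ζ * (ζ - x)⁻¹) ∂ν := by
  obtain ⟨B, hB⟩ := isCompact_Icc.exists_bound_of_continuousOn hφ
  have hφm : AEStronglyMeasurable φ ν := by
    rw [← Measure.restrict_eq_self_of_ae_mem hν]
    exact hφ.aestronglyMeasurable measurableSet_Icc
  rw [cauchyIntegral_mul_integral hr hF (aestronglyMeasurable_uncurry_mul_inv_sub hφm)
    (ae_norm_mul_inv_sub_le hr hν hB)]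
  congr 1; funext x
  rw [← cauchyIntegral_const_mul]
  congr 1; funext ζ; ring

lemma abs_lt_two_add {x r : ℝ} (hr : 0 < r) (hx : x ∈ Set.Icc (-2 : ℝ) 2) : |x| < 2 + r :=
  (abs_le.2 hx).trans_lt (by linarith)

/-- These are the residues outside the contour, at z and at infinity. No deformation to infinity is
needed: √(ζ² - 4) equals ζ minus a Cauchy transform of a measure on the cut, so Fubini reduces
everything to Cauchy's formula at real points. -/
lemma cauchyIntegral_sqrtX_mul {r : ℝ} (hr : 0 < r) {z : ℂ} (hz : r < Metric.infDist z cut)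
    {x : ℝ} (hx : |x| < 2 + r) :
    cauchyIntegral r (fun ζ => sqrtX ζ * ((z - ζ)⁻¹ * (ζ - x)⁻¹)) = sqrtX z * (z - x)⁻¹ - 1 := by
  have hinv := differentiableOn_inv_sub_right z
  have hinvc := continuousOn_contour_of_differentiableOn hz hinv
  have hxc := continuousOn_inv_sub hr hx
  have hzx : z - x ≠ 0 := by
    intro h
    have := infDist_cut_ofReal_lt hr hx
    rw [← sub_eq_zero.1 h] at this
    linarith
  have h1 : Set.EqOn (fun ζ => sqrtX ζ * ((z - ζ)⁻¹ * (ζ - x)⁻¹))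
      (fun ζ => ζ * (z - ζ)⁻¹ * (ζ - x)⁻¹ -
        ((z - ζ)⁻¹ * (ζ - x)⁻¹) * ∫ t : ℝ, (4 - t ^ 2) * (ζ - t)⁻¹ ∂arcsine) (contour r) := by
    intro ζ hζ
    simp only
    rw [integral_four_sub_sq_mul_inv_sub_arcsine (lt_of_lt_of_eq hr (Eq.symm hζ))]
    ring
  have hd : DifferentiableOn ℂ (fun ζ : ℂ => ζ * (z - ζ)⁻¹)
      {ζ | Metric.infDist ζ cut < Metric.infDist z cut} := differentiableOn_id.mul hinv
  have hFc : ContinuousOn (fun ζ => (z - ζ)⁻¹ * (ζ - x)⁻¹) (contour r) := hinvc.fun_mul hxc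
  have hkc : ContinuousOn (fun ζ : ℂ => ∫ t : ℝ, ((4 : ℂ) - t ^ 2) * (ζ - t)⁻¹ ∂arcsine)
      (contour r) := by
    refine ContinuousOn.congr (f := fun ζ => ζ - sqrtX ζ)
      (continuousOn_id.sub (continuousOn_sqrtX hr)) fun ζ hζ => ?_
    exact integral_four_sub_sq_mul_inv_sub_arcsine (lt_of_lt_of_eq hr (Eq.symm hζ))
  have h2 : ∀ t : ℝ, t ∈ Set.Icc (-2 : ℝ) 2 → t ≠ x →
      ((4 : ℂ) - t ^ 2) * cauchyIntegral r (fun ζ => (z - ζ)⁻¹ * (ζ - x)⁻¹ * (ζ - t)⁻¹) =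
      (z - x)⁻¹ * ((4 - t ^ 2) * (z - t)⁻¹) := by
    intro t ht htx
    have hzt : z - t ≠ 0 := norm_pos_iff.1 ((hr.trans hz).trans_le (infDist_cut_le ht z))
    have htx' : (x : ℂ) - t ≠ 0 := sub_ne_zero.2 (by exact_mod_cast htx.symm)
    have h3 := cauchyIntegral_mul_inv_sub_mul_inv_sub hr hz hinv hx (abs_lt_two_add hr ht) htx.symm
    simp only [← mul_assoc] at h3
    rw [h3]
    field_simp
    ring
  have h4 : ∀ᵐ t ∂arcsine, t ≠ x :=
    ae_arcsine_ne x
  rw [cauchyIntegral_congr hr h1, cauchyIntegral_sub hr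
    ((continuousOn_contour_of_differentiableOn hz hd).fun_mul hxc) (hFc.fun_mul hkc),
    cauchyIntegral_mul_inv_sub hr hz hd hx,
    cauchyIntegral_mul_integral_inv_sub hr ae_arcsine (by fun_prop) hFc]
  rw [integral_congr_ae (by filter_upwards [ae_arcsine, h4] with t ht htx using h2 t ht htx),
    integral_const_mul, integral_four_sub_sq_mul_inv_sub_arcsine (hr.trans hz)]
  field_simp
  ring

/-! ### The function `P` -/

lemma P_eq_integral_arcsine (W : ℂ → ℂ) (z : ℂ) :
    P W z = ∫ x : ℝ, (deriv W z - deriv W x) * (z - x)⁻¹ ∂arcsine := by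
  rw [integral_arcsine, P, ← intervalIntegral.integral_const_mul]
  congr 1; funext x
  rw [Complex.real_smul]
  push_cast
  simp only [mul_inv, div_eq_mul_inv]
  ring

section Analytic

variable {W : ℂ → ℂ} {R : ℝ} (hR : 0 < R)
  (hW : AnalyticOnNhd ℂ W {z | Metric.infDist z cut < R})

include hR in
lemma ofReal_mem_region {x : ℝ} (hx : x ∈ Set.Icc (-2 : ℝ) 2) :
    (x : ℂ) ∈ {z | Metric.infDist z cut < R} := infDist_cut_ofReal_lt hR (abs_lt_two_add hR hx)

include hR in
lemma segment_mem_region {x t : ℝ} (hx : x ∈ Set.Icc (-2 : ℝ) 2) (ht : t ∈ Set.Icc (0 : ℝ) 1)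
    {z : ℂ} (hz : Metric.infDist z cut < R) :
    (x : ℂ) + t * (z - x) ∈ {z | Metric.infDist z cut < R} := by
  have h1 := convex_infDist_cut_lt R (ofReal_mem_region hR hx) hz (sub_nonneg.2 ht.2) ht.1
    (by ring)
  convert h1 using 1
  simp only [Complex.real_smul]
  push_cast; ring

include hR hW

lemma continuousOn_deriv_ofReal : ContinuousOn (fun x : ℝ => deriv W x) (Set.Icc (-2) 2) :=
  hW.deriv.continuousOn.comp (by fun_prop) fun _ hx => ofReal_mem_region hR hx

/-- The divided difference of W' is an average of W'' over the segment from x to z, which stays in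
the convex neighbourhood. The apparent singularity at z = x disappears, and analyticity of P across
the cut follows by differentiating under the integral. -/
lemma P_eq_integral_deriv_deriv {z : ℂ} (hz : Metric.infDist z cut < R) :
    P W z = ∫ p : ℝ × ℝ, deriv (deriv W) ((p.1 : ℂ) + p.2 * (z - p.1))
      ∂(arcsine.prod (volume.restrict (Set.Icc 0 1))) := by
  have hW2 := hW.deriv.deriv
  have hae : ∀ᵐ p ∂(arcsine.prod (volume.restrict (Set.Icc (0 : ℝ) 1))),
      p ∈ Set.Icc (-2 : ℝ) 2 ×ˢ Set.Icc (0 : ℝ) 1 := by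
    filter_upwards [Measure.quasiMeasurePreserving_fst.ae ae_arcsine,
      Measure.quasiMeasurePreserving_snd.ae (ae_restrict_mem measurableSet_Icc)] with p h1 h2
    exact ⟨h1, h2⟩
  have hcont : ContinuousOn (fun p : ℝ × ℝ => deriv (deriv W) ((p.1 : ℂ) + p.2 * (z - p.1)))
      (Set.Icc (-2 : ℝ) 2 ×ˢ Set.Icc (0 : ℝ) 1) :=
    hW2.continuousOn.comp (by fun_prop) fun p hp => segment_mem_region hR hp.1 hp.2 hz
  have hint : Integrable (fun p : ℝ × ℝ => deriv (deriv W) ((p.1 : ℂ) + p.2 * (z - p.1)))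
      (arcsine.prod (volume.restrict (Set.Icc 0 1))) := by
    rw [← Measure.restrict_eq_self_of_ae_mem hae]
    exact hcont.integrableOn_compact (isCompact_Icc.prod isCompact_Icc)
  rw [integral_prod _ hint, P_eq_integral_arcsine]
  have hne : ∀ᵐ x ∂arcsine, x ≠ z.re := ae_arcsine_ne _
  refine integral_congr_ae ?_
  filter_upwards [ae_arcsine, hne] with x hx hxz
  have hzx : z - x ≠ 0 := fun h => hxz (by rw [sub_eq_zero.1 h]; simp)
  have h1 := integral_mul_deriv_eq_sub (F := deriv (deriv W)) (G := deriv W)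
    (γ := fun t : ℝ => (x : ℂ) + t * (z - x)) (γ' := fun _ => z - x) (a := 0) (b := 1)
    zero_le_one (fun t => by
      simpa using ((Complex.ofRealCLM.hasDerivAt (x := t)).mul_const (z - x)).const_add (x : ℂ))
    continuous_const
    (fun t ht => (hW.deriv _ (segment_mem_region hR hx ht hz)).differentiableAt.hasDerivAt)
    (fun t ht => (hW2 _ (segment_mem_region hR hx ht hz)).continuousAt)
  rw [intervalIntegral.integral_mul_const] at h1
  simp only [Complex.ofReal_one, one_mul, Complex.ofReal_zero, zero_mul, add_zero,
    add_sub_cancel] at h1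
  rw [← h1, mul_assoc, mul_inv_cancel₀ hzx, mul_one, intervalIntegral.integral_of_le zero_le_one,
    integral_Icc_eq_integral_Ioc]

lemma differentiableOn_P : DifferentiableOn ℂ (P W) {z | Metric.infDist z cut < R} := by
  have hW2 := hW.deriv.deriv
  have hopen := isOpen_infDist_cut_lt R
  intro z hz
  refine DifferentiableAt.differentiableWithinAt ?_
  have hev : P W =ᶠ[𝓝 z] fun w => ∫ p : ℝ × ℝ, deriv (deriv W) ((p.1 : ℂ) + p.2 * (w - p.1))
      ∂(arcsine.prod (volume.restrict (Set.Icc 0 1))) :=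
    Filter.eventuallyEq_of_mem (hopen.mem_nhds hz) fun w hw => P_eq_integral_deriv_deriv hR hW hw
  rw [hev.differentiableAt_iff]
  obtain ⟨ε, hε, hball⟩ := Metric.isOpen_iff.1 hopen z hz
  have hcl : Metric.closedBall z (ε / 2) ⊆ {z | Metric.infDist z cut < R} :=
    (Metric.closedBall_subset_ball (by linarith)).trans hball
  have hae : ∀ᵐ p ∂(arcsine.prod (volume.restrict (Set.Icc (0 : ℝ) 1))),
      p ∈ Set.Icc (-2 : ℝ) 2 ×ˢ Set.Icc (0 : ℝ) 1 := by
    filter_upwards [Measure.quasiMeasurePreserving_fst.ae ae_arcsine,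
      Measure.quasiMeasurePreserving_snd.ae (ae_restrict_mem measurableSet_Icc)] with p h1 h2
    exact ⟨h1, h2⟩
  have hcont : ∀ F : ℂ → ℂ, AnalyticOnNhd ℂ F {z | Metric.infDist z cut < R} →
      ContinuousOn (fun q : ℂ × ℝ × ℝ => (q.2.2 : ℂ) * F ((q.2.1 : ℂ) + q.2.2 * (q.1 - q.2.1)))
        (Metric.closedBall z (ε / 2) ×ˢ Set.Icc (-2 : ℝ) 2 ×ˢ Set.Icc (0 : ℝ) 1) := fun F hF =>
    ContinuousOn.mul (by fun_prop) (hF.continuousOn.comp (by fun_prop)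
      fun q hq => segment_mem_region hR hq.2.1 hq.2.2 (hcl hq.1))
  have hcont0 : ∀ F : ℂ → ℂ, AnalyticOnNhd ℂ F {z | Metric.infDist z cut < R} →
      ∀ w ∈ Metric.closedBall z (ε / 2),
      ContinuousOn (fun p : ℝ × ℝ => F ((p.1 : ℂ) + p.2 * (w - p.1)))
        (Set.Icc (-2 : ℝ) 2 ×ˢ Set.Icc (0 : ℝ) 1) := fun F hF w hw =>
    hF.continuousOn.comp (by fun_prop)
      fun q hq => segment_mem_region hR hq.1 hq.2 (hcl hw)
  have hmeas : ∀ G : ℝ × ℝ → ℂ, ContinuousOn G (Set.Icc (-2 : ℝ) 2 ×ˢ Set.Icc (0 : ℝ) 1) →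
      Integrable G (arcsine.prod (volume.restrict (Set.Icc 0 1))) := fun G hG => by
    rw [← Measure.restrict_eq_self_of_ae_mem hae]
    exact hG.integrableOn_compact (isCompact_Icc.prod isCompact_Icc)
  obtain ⟨B, hB⟩ := ((isCompact_closedBall z (ε / 2)).prod
    (isCompact_Icc.prod isCompact_Icc)).exists_bound_of_continuousOn (hcont _ hW2.deriv)
  have hz' : z ∈ Metric.closedBall z (ε / 2) := Metric.mem_closedBall_self (by positivity)
  refine (hasDerivAt_integral_of_dominated_loc_of_deriv_le (𝕜 := ℂ)
    (F := fun w p => deriv (deriv W) ((p.1 : ℂ) + p.2 * (w - p.1)))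
    (F' := fun w p => (p.2 : ℂ) * deriv (deriv (deriv W)) ((p.1 : ℂ) + p.2 * (w - p.1)))
    (bound := fun _ => B) (s := Metric.closedBall z (ε / 2))
    (Metric.closedBall_mem_nhds z (by positivity)) ?_ (hmeas _ (hcont0 _ hW2 z hz')) ?_ ?_
    (integrable_const _) ?_).2.differentiableAt
  · filter_upwards [Metric.closedBall_mem_nhds z (show 0 < ε / 2 by positivity)] with w hw
    exact (hmeas _ (hcont0 _ hW2 w hw)).1
  · exact (hmeas _ (ContinuousOn.mul (by fun_prop) (hcont0 _ hW2.deriv z hz'))).1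
  · filter_upwards [hae] with p hp w hw
    exact hB (w, p) ⟨hw, hp⟩
  · filter_upwards [hae] with p hp w hw
    have h1 := (hW2 _ (segment_mem_region hR hp.1 hp.2 (hcl hw))).differentiableAt.hasDerivAt
    have h2 : HasDerivAt (fun w : ℂ => (p.1 : ℂ) + p.2 * (w - p.1)) (p.2 : ℂ) w := by
      simpa using (((hasDerivAt_id w).sub_const (p.1 : ℂ)).const_mul (p.2 : ℂ)).const_add (p.1 : ℂ)
    have h3 := h1.comp w h2
    rw [mul_comm] at h3
    exact h3

lemma P_mul_sqrtX {z : ℂ} (hz : 0 < Metric.infDist z cut) :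
    P W z * sqrtX z = deriv W z - sqrtX z * ∫ x : ℝ, deriv W x * (z - x)⁻¹ ∂arcsine := by
  have hc := continuousOn_inv_sub_Icc hz
  have h1 : P W z = deriv W z * (sqrtX z)⁻¹ - ∫ x : ℝ, deriv W x * (z - x)⁻¹ ∂arcsine := by
    rw [P_eq_integral_arcsine, ← integral_inv_sub_arcsine hz, ← integral_const_mul, ← integral_sub
      ((integrable_arcsine hc).const_mul _)
      (integrable_arcsine ((continuousOn_deriv_ofReal hR hW).fun_mul hc))]
    congr 1; funext x; ring
  rw [h1, sub_mul, mul_assoc, inv_mul_cancel₀ (sqrtX_ne_zero hz), mul_one]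
  ring

end Analytic

end BetaEnsemble

/-! ### The Stieltjes transform of the equilibrium measure. -/

namespace BetaEnsemble

section Analytic

variable {W : ℂ → ℂ} {R : ℝ} (hR : 0 < R)
  (hW : AnalyticOnNhd ℂ W {z | Metric.infDist z cut < R})
include hR hW

/-- The Stieltjes transform of `P(x) √(4 - x²) / π` in terms of `P`. -/
lemma integral_P_mul_inv_sub_arcsine {z : ℂ} (hz : 0 < Metric.infDist z cut)
    (hzR : Metric.infDist z cut < R) :
    ∫ x : ℝ, P W x * (4 - x ^ 2) * (z - x)⁻¹ ∂arcsine =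
      deriv W z - P W z * sqrtX z - ∫ x : ℝ, deriv W x ∂arcsine := by
  obtain ⟨r, hr, hrz⟩ := exists_between hz
  have hPd := differentiableOn_P hR hW
  have hinv := differentiableOn_inv_sub_right z
  have hinvc := continuousOn_contour_of_differentiableOn hrz hinv
  have hmono : {ζ | Metric.infDist ζ cut < Metric.infDist z cut} ⊆
      {ζ | Metric.infDist ζ cut < R} := fun ζ (hζ : Metric.infDist ζ cut < _) => hζ.trans hzR
  have hPi : DifferentiableOn ℂ (fun ζ => P W ζ * (z - ζ)⁻¹)
      {ζ | Metric.infDist ζ cut < Metric.infDist z cut} := (hPd.mono hmono).mul hinv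
  have hPic := continuousOn_contour_of_differentiableOn hrz hPi
  have hWd : DifferentiableOn ℂ (fun ζ => deriv W ζ * (z - ζ)⁻¹)
      {ζ | Metric.infDist ζ cut < Metric.infDist z cut} :=
    (hW.deriv.differentiableOn.mono hmono).mul hinv
  have hWc := continuousOn_contour_of_differentiableOn hrz hWd
  have hW' := continuousOn_deriv_ofReal hR hW
  have hsc := continuousOn_sqrtX hr
  have hpos : ∀ ζ ∈ contour r, 0 < Metric.infDist ζ cut := fun ζ hζ =>
    lt_of_lt_of_eq hr (Eq.symm hζ)
  -- represent the left side by a contour integral of `P * sqrtX`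
  have h1 : ∫ x : ℝ, P W x * (4 - x ^ 2) * (z - x)⁻¹ ∂arcsine =
      -cauchyIntegral r (fun ζ => P W ζ * sqrtX ζ * (z - ζ)⁻¹) := by
    have e1 : ∀ᵐ x : ℝ ∂arcsine, P W x * (4 - x ^ 2) * (z - x)⁻¹ =
        ((4 : ℂ) - x ^ 2) * cauchyIntegral r (fun ζ => P W ζ * (z - ζ)⁻¹ * (ζ - x)⁻¹) := by
      filter_upwards [ae_arcsine] with x hx
      rw [cauchyIntegral_mul_inv_sub hr hrz hPi (abs_lt_two_add hr hx)]
      ring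
    rw [integral_congr_ae e1, ← cauchyIntegral_mul_integral_inv_sub hr ae_arcsine
      (by fun_prop) hPic]
    have e2 : Set.EqOn (fun ζ => P W ζ * (z - ζ)⁻¹ * ∫ x : ℝ, ((4 : ℂ) - x ^ 2) * (ζ - x)⁻¹ ∂arcsine)
        (fun ζ => P W ζ * (z - ζ)⁻¹ * ζ - P W ζ * sqrtX ζ * (z - ζ)⁻¹) (contour r) := by
      intro ζ hζ
      simp only
      rw [integral_four_sub_sq_mul_inv_sub_arcsine (hpos ζ hζ)]
      ring
    rw [cauchyIntegral_congr hr e2, cauchyIntegral_sub hr (hPic.fun_mul (g := fun ζ => ζ) continuousOn_id)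
      (((continuousOn_contour_of_differentiableOn (hrz.trans hzR) hPd).fun_mul hsc).fun_mul hinvc),
      cauchyIntegral_eq_zero hr hrz (hPi.fun_mul (b := fun ζ => ζ) differentiableOn_id), zero_sub]
  -- evaluate it
  have h2 : Set.EqOn (fun ζ => P W ζ * sqrtX ζ * (z - ζ)⁻¹)
      (fun ζ => deriv W ζ * (z - ζ)⁻¹ - sqrtX ζ * (z - ζ)⁻¹ *
        ∫ x : ℝ, deriv W x * (ζ - x)⁻¹ ∂arcsine) (contour r) := by
    intro ζ hζ
    simp only
    rw [P_mul_sqrtX hR hW (hpos ζ hζ)]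
    ring
  have hHc : ContinuousOn (fun ζ : ℂ => ∫ x : ℝ, deriv W x * (ζ - x)⁻¹ ∂arcsine) (contour r) := by
    refine ContinuousOn.congr (f := fun ζ => (deriv W ζ - P W ζ * sqrtX ζ) / sqrtX ζ)
      (((continuousOn_contour_of_differentiableOn (hrz.trans hzR) hW.deriv.differentiableOn).sub
        ((continuousOn_contour_of_differentiableOn (hrz.trans hzR) hPd).fun_mul hsc)).div hsc
        fun ζ hζ => sqrtX_ne_zero (hpos ζ hζ)) fun ζ hζ => ?_
    simp only
    rw [P_mul_sqrtX hR hW (hpos ζ hζ), sub_sub_cancel,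
      mul_div_cancel_left₀ _ (sqrtX_ne_zero (hpos ζ hζ))]
  have h3 : ∀ᵐ x : ℝ ∂arcsine, deriv W x * cauchyIntegral r
      (fun ζ => sqrtX ζ * (z - ζ)⁻¹ * (ζ - x)⁻¹) =
      sqrtX z * (deriv W x * (z - x)⁻¹) - deriv W x := by
    filter_upwards [ae_arcsine] with x hx
    simp only [mul_assoc]
    rw [cauchyIntegral_sqrtX_mul hr hrz (abs_lt_two_add hr hx)]
    ring
  rw [h1, cauchyIntegral_congr hr h2, cauchyIntegral_sub hr hWc ((hsc.fun_mul hinvc).fun_mul hHc),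
    cauchyIntegral_eq_zero hr hrz hWd, cauchyIntegral_mul_integral_inv_sub hr ae_arcsine hW'
      (hsc.fun_mul hinvc), integral_congr_ae h3, integral_sub
      ((integrable_arcsine (hW'.fun_mul (continuousOn_inv_sub_Icc hz))).const_mul _)
      (integrable_arcsine hW'), integral_const_mul, P_mul_sqrtX hR hW hz]
  ring

omit hR in
lemma hasDerivAt_real {V : ℝ → ℝ} (hWV : ∀ x : ℝ, Metric.infDist (x : ℂ) cut < R → W x = V x)
    {x : ℝ} (hx : Metric.infDist (x : ℂ) cut < R) :
    HasDerivAt V (deriv W x).re x ∧ (deriv W x).im = 0 := by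
  have h1 := (hW _ hx).differentiableAt.hasDerivAt
  have hev : ∀ᶠ t : ℝ in 𝓝 x, W t = V t := by
    have h2 : {t : ℝ | Metric.infDist (t : ℂ) cut < R} ∈ 𝓝 x :=
      (isOpen_lt (by fun_prop) continuous_const).mem_nhds hx
    filter_upwards [h2] with t ht using hWV t ht
  have h3 : HasDerivAt V (deriv W x).re x := by
    refine h1.real_of_complex.congr_of_eventuallyEq ?_
    filter_upwards [hev] with t ht
    rw [ht, Complex.ofReal_re]
  refine ⟨h3, ?_⟩
  have h4 : HasDerivAt (fun t : ℝ => W t) (deriv W x) x := h1.comp_ofReal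
  have h5 : HasDerivAt (fun t : ℝ => W t) ((deriv W x).re : ℂ) x :=
    h3.ofReal_comp.congr_of_eventuallyEq hev
  rw [h4.unique h5, Complex.ofReal_im]

lemma P_ofReal_im {V : ℝ → ℝ} (hWV : ∀ x : ℝ, Metric.infDist (x : ℂ) cut < R → W x = V x)
    {x : ℝ} (hx : Metric.infDist (x : ℂ) cut < R) : (P W x).im = 0 := by
  have h1 : P W x = ∫ t : ℝ, ((((deriv W x).re - (deriv W t).re) * (x - t)⁻¹ : ℝ) : ℂ) ∂arcsine := by
    rw [P_eq_integral_arcsine]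
    refine integral_congr_ae ?_
    have hre : ∀ y : ℝ, Metric.infDist (y : ℂ) cut < R → deriv W y = (deriv W y).re := fun y hy =>
      Complex.ext rfl (by simpa using (hasDerivAt_real hW hWV hy).2)
    filter_upwards [ae_arcsine] with t ht
    push_cast
    rw [← hre x hx, ← hre t (ofReal_mem_region hR ht)]
  rw [h1, integral_complex_ofReal, Complex.ofReal_im]

end Analytic

lemma BoundedDensity.hasDerivAt_logPot {μ : Measure ℝ} {b : ℝ≥0} (h : BoundedDensity μ b) {x : ℝ}
    (hx : 0 < Metric.infDist (x : ℂ) cut) :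
    HasDerivAt (logPot μ) (∫ y : ℝ, (x - y : ℂ)⁻¹ ∂μ).re x := by
  have := h.prob
  set δ := Metric.infDist (x : ℂ) cut with hδ
  have hb : ∀ y : ℝ, y ∈ Set.Icc (-2 : ℝ) 2 → ∀ w ∈ Metric.ball x (δ / 2), δ / 2 ≤ |w - y| := by
    intro y hy w hw
    rw [mem_ball_iff_norm', Real.norm_eq_abs] at hw
    have h1 := infDist_cut_le hy (x : ℂ)
    rw [← Complex.ofReal_sub, Complex.norm_real, Real.norm_eq_abs] at h1
    have h2 := abs_sub_le x w y
    linarith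
  have e1 : (∫ y : ℝ, (x - y : ℂ)⁻¹ ∂μ).re = ∫ y : ℝ, (x - y)⁻¹ ∂μ := by
    have : ∀ y : ℝ, (x - y : ℂ)⁻¹ = (((x - y)⁻¹ : ℝ) : ℂ) := fun y => by push_cast; rfl
    simp_rw [this]
    rw [integral_complex_ofReal, Complex.ofReal_re]
  rw [e1]
  refine (hasDerivAt_integral_of_dominated_loc_of_deriv_le (μ := μ)
    (F := fun w y => Real.log |y - w|) (F' := fun w y => (w - y)⁻¹)
    (bound := fun _ => (δ / 2)⁻¹) (s := Metric.ball x (δ / 2))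
    (Metric.ball_mem_nhds x (by positivity)) ?_ (h.integrable_log x) ?_ ?_ ?_ ?_).2
  · refine Filter.Eventually.of_forall fun w => ?_
    have : Measurable fun y : ℝ => Real.log |y - w| := by fun_prop
    exact this.aestronglyMeasurable
  · have : Measurable fun y : ℝ => (x - y)⁻¹ := by fun_prop
    exact this.aestronglyMeasurable
  · filter_upwards [h.ae_mem] with y hy w hw
    rw [norm_inv, Real.norm_eq_abs]
    exact inv_anti₀ (by positivity) (hb y hy w hw)
  · exact integrable_const _
  · filter_upwards [h.ae_mem] with y hy w hw
    have h0 : w - y ≠ 0 := abs_pos.1 (lt_of_lt_of_le (by positivity) (hb y hy w hw))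
    have h1 := ((hasDerivAt_id w).const_sub y).log (by simpa using sub_ne_zero.2 (sub_ne_zero.1 h0).symm)
    simp only [id] at h1
    simp only [Real.log_abs]
    refine h1.congr_deriv ?_
    rw [← neg_sub w y, neg_div_neg_eq, one_div]

/-- If the effective potential is maximal at `±2`, the constant in the equation
`2 g - W' = -P √(z² - 4) - c` vanishes. -/
lemma re_eq_zero_of_effective_max {W : ℂ → ℂ} {R : ℝ} (hR : 0 < R)
    (hW : AnalyticOnNhd ℂ W {z | Metric.infDist z cut < R}) {V : ℝ → ℝ} (hV : Continuous V)
    (hWV : ∀ x : ℝ, Metric.infDist (x : ℂ) cut < R → W x = V x) {μ : Measure ℝ} {b : ℝ≥0}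
    (h : BoundedDensity μ b) {c : ℂ}
    (hg : ∀ z, 0 < Metric.infDist z cut → Metric.infDist z cut < R →
      2 * (∫ x : ℝ, (z - x)⁻¹ ∂μ) - deriv W z = -(P W z * sqrtX z) - c)
    (h2 : ∀ y, 2 * logPot μ y - V y ≤ 2 * logPot μ 2 - V 2)
    (h2' : ∀ y, 2 * logPot μ y - V y ≤ 2 * logPot μ (-2) - V (-2)) : c.re = 0 := by
  by_contra hc
  set v : ℝ → ℝ := fun y => 2 * logPot μ y - V y with hv
  have hvc : Continuous v := (h.continuous_logPot.const_mul 2).sub hV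
  have hderiv : ∀ x : ℝ, 2 < |x| → |x| < 2 + R →
      HasDerivAt v ((-(P W x * sqrtX x)).re - c.re) x := by
    intro x hx hxR
    have hx0 : 0 < Metric.infDist (x : ℂ) cut := by
      by_contra hcon
      have := (infDist_cut_ofReal_le_iff le_rfl x).1 (not_lt.1 hcon)
      linarith
    have hx1 := infDist_cut_ofReal_lt hR hxR
    have h3 := ((h.hasDerivAt_logPot hx0).const_mul 2).sub (hasDerivAt_real hW hWV hx1).1
    refine h3.congr_deriv ?_
    rw [← Complex.sub_re, ← hg x hx0 hx1]
    simp
  -- The derivative of the effective potential outside the cut is -Re(P √(x² - 4)) - Re c, and the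
  -- first term vanishes at ±2. If Re c ≠ 0 the potential would rise on leaving the cut at 2 (Re c <
  -- 0) or at -2 (Re c > 0). Squares are used so that no continuity of the root at the endpoints is
  -- needed.
  have hsmall : ∀ s : ℝ, s ^ 2 = 4 → |s| = 2 → ∀ᶠ x : ℝ in 𝓝 s, ‖P W x * sqrtX x‖ < |c.re| := by
    intro s hs hs2
    have h3 : ContinuousAt (fun x : ℝ => ‖P W x‖ ^ 2 * ‖(x : ℂ) ^ 2 - 4‖) s := by
      have h4 : ContinuousAt (P W) (s : ℂ) :=
        ((differentiableOn_P hR hW).differentiableAt ((isOpen_infDist_cut_lt R).mem_nhds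
          (infDist_cut_ofReal_lt hR (by linarith)))).continuousAt
      have h5 : ContinuousAt (fun x : ℝ => P W x) s :=
        ContinuousAt.comp (f := fun x : ℝ => (x : ℂ)) h4 Complex.continuous_ofReal.continuousAt
      exact (h5.norm.pow 2).mul (by fun_prop)
    have h6 : ‖P W s‖ ^ 2 * ‖(s : ℂ) ^ 2 - 4‖ < |c.re| ^ 2 := by
      have : (s : ℂ) ^ 2 = 4 := by exact_mod_cast hs
      rw [this, sub_self, norm_zero, mul_zero]
      have := abs_pos.2 hc
      positivity
    filter_upwards [h3.eventually (gt_mem_nhds h6)] with x hx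
    refine lt_of_pow_lt_pow_left₀ 2 (abs_nonneg _) ?_
    rw [norm_mul, mul_pow, ← norm_pow (sqrtX x), sqrtX_sq]
    exact hx
  have hre : ∀ w : ℂ, |(-w).re| ≤ ‖w‖ := fun w => by
    simpa using Complex.abs_re_le_norm (-w)
  rcases lt_or_gt_of_ne hc with hc | hc
  · obtain ⟨δ, hδ, hball⟩ := Metric.eventually_nhds_iff.1 (hsmall 2 (by norm_num) (by norm_num))
    set t := min (δ / 2) (R / 2) with ht
    have ht0 : 0 < t := by positivity
    have hmono : StrictMonoOn v (Set.Icc 2 (2 + t)) := by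
      refine strictMonoOn_of_deriv_pos (convex_Icc _ _) hvc.continuousOn fun x hx => ?_
      rw [interior_Icc] at hx
      have hx3 : |x| = x := abs_of_pos (by linarith [hx.1])
      have h4 := hball (y := x) (by
        rw [Real.dist_eq, abs_of_pos (by linarith [hx.1])]
        linarith [hx.2, min_le_left (δ / 2) (R / 2)])
      rw [(hderiv x (by rw [hx3]; exact hx.1)
        (by rw [hx3]; linarith [hx.2, min_le_right (δ / 2) (R / 2)])).deriv]
      have h5 := (abs_le.1 (hre (P W x * sqrtX x))).1
      rw [abs_of_neg hc] at h4
      linarith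
    have h6 := hmono (Set.left_mem_Icc.2 (by linarith)) (Set.right_mem_Icc.2 (by linarith))
      (by linarith : (2 : ℝ) < 2 + t)
    exact absurd (h2 (2 + t)) (not_le.2 h6)
  · obtain ⟨δ, hδ, hball⟩ := Metric.eventually_nhds_iff.1 (hsmall (-2) (by norm_num) (by norm_num))
    set t := min (δ / 2) (R / 2) with ht
    have ht0 : 0 < t := by positivity
    have hmono : StrictAntiOn v (Set.Icc (-2 - t) (-2)) := by
      refine strictAntiOn_of_deriv_neg (convex_Icc _ _) hvc.continuousOn fun x hx => ?_
      rw [interior_Icc] at hx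
      have hx3 : |x| = -x := abs_of_neg (by linarith [hx.2])
      have h4 := hball (y := x) (by
        rw [Real.dist_eq, abs_of_neg (by linarith [hx.2])]
        linarith [hx.1, min_le_left (δ / 2) (R / 2)])
      rw [(hderiv x (by rw [hx3]; linarith [hx.2])
        (by rw [hx3]; linarith [hx.1, min_le_right (δ / 2) (R / 2)])).deriv]
      have h5 := (abs_le.1 (hre (P W x * sqrtX x))).2
      rw [abs_of_pos hc] at h4
      linarith
    have h6 := hmono (Set.left_mem_Icc.2 (by linarith)) (Set.right_mem_Icc.2 (by linarith))
      (by linarith : (-2 - t : ℝ) < -2)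
    exact absurd (h2' (-2 - t)) (not_le.2 h6)

end BetaEnsemble

namespace BetaEnsemble

/-! ### The loop equation -/

/-- The regularised divided difference `x / (x² + δ²)`. -/
noncomputable def regInv (δ x : ℝ) : ℝ := x / (x ^ 2 + δ ^ 2)

lemma abs_regInv_mul_le (δ x : ℝ) : |regInv δ x| * |x| ≤ 1 := by
  rw [regInv, abs_div, abs_of_nonneg (by positivity : 0 ≤ x ^ 2 + δ ^ 2), div_mul_eq_mul_div]
  apply div_le_one_of_le₀ _ (by positivity)
  rw [← sq, sq_abs]; nlinarith [sq_nonneg δ]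

lemma regInv_zero (x : ℝ) : regInv 0 x = x⁻¹ := by
  rcases eq_or_ne x 0 with rfl | hx
  · simp [regInv]
  · rw [regInv]; field_simp; ring

lemma continuousAt_regInv (x : ℝ) : ContinuousAt (fun δ => regInv δ x) 0 := by
  rcases eq_or_ne x 0 with rfl | hx
  · simp only [regInv, zero_div]; exact continuousAt_const
  · unfold regInv
    exact ContinuousAt.div (by fun_prop) (by fun_prop) (by positivity)

section

variable {V : ℝ → ℝ} {β : ℝ} {n : ℕ}

lemma regWeight_eq_exp {δ : ℝ} (hδ : 0 < δ) (l : Fin n → ℝ) : regWeight V β n δ l =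
    Real.exp (∑ a, (-((n : ℝ) * β * V (l a) / 2)) +
      ∑ a, ∑ b ∈ ({a}ᶜ : Finset (Fin n)), β / 4 * Real.log ((l a - l b) ^ 2 + δ ^ 2)) := by
  rw [regWeight, Real.exp_add, Real.exp_sum, Real.exp_sum]
  congr 1
  refine Finset.prod_congr rfl fun a _ => ?_
  rw [Real.exp_sum]
  refine Finset.prod_congr rfl fun b _ => ?_
  rw [Real.rpow_def_of_pos (by positivity), mul_comm]

lemma hasDerivAt_coord (l v : Fin n → ℝ) (a : Fin n) :
    HasDerivAt (fun t : ℝ => (l + t • v) a) (v a) 0 := by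
  simpa using ((hasDerivAt_id (0 : ℝ)).mul_const (v a)).const_add (l a)

/-- Differentiability is required only if the direction moves this coordinate. This matters because
V is known to be differentiable only near the cut. -/
lemma hasLineDerivAt_comp_coord {E : Type*} [NormedAddCommGroup E] [NormedSpace ℝ E] {f : ℝ → E}
    {f' : E} {l v : Fin n → ℝ} {a : Fin n} (hf : v a ≠ 0 → HasDerivAt f f' (l a)) :
    HasLineDerivAt ℝ (fun l : Fin n → ℝ => f (l a)) (v a • f') l v := by
  unfold HasLineDerivAt
  by_cases hv : v a = 0
  · simp only [Pi.add_apply, Pi.smul_apply, hv, smul_zero, add_zero, zero_smul]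
    exact hasDerivAt_const _ _
  · have h1 := hasDerivAt_coord l v a
    have h2 : HasDerivAt f f' ((l + (0 : ℝ) • v) a) := by simpa using hf hv
    exact h2.scomp (0 : ℝ) h1

lemma hasLineDerivAt_regWeight {V' : ℝ → ℝ} {δ : ℝ} (hδ : 0 < δ) {l v : Fin n → ℝ}
    (hV' : ∀ a, v a ≠ 0 → HasDerivAt V (V' (l a)) (l a)) :
    HasLineDerivAt ℝ (regWeight V β n δ) (regWeight V β n δ l *
      (-(n * β / 2) * ∑ a, V' (l a) * v a +
        β / 2 * ∑ a, ∑ b ∈ ({a}ᶜ : Finset (Fin n)), regInv δ (l a - l b) * (v a - v b))) l v := by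
  have h1 : ∀ a, HasDerivAt (fun t : ℝ => -((n : ℝ) * β * V ((l + t • v) a) / 2))
      (-(n * β / 2) * (V' (l a) * v a)) 0 := fun a => by
    have h2 := ((hasLineDerivAt_comp_coord (hV' a)).const_mul ((n : ℝ) * β)).div_const 2 |>.neg
    refine h2.congr_deriv ?_
    simp only [smul_eq_mul]; ring
  have h3 : ∀ a b, HasDerivAt (fun t : ℝ => β / 4 *
      Real.log (((l + t • v) a - (l + t • v) b) ^ 2 + δ ^ 2))
      (β / 2 * (regInv δ (l a - l b) * (v a - v b))) 0 := fun a b => by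
    have h4 := (((hasDerivAt_coord l v a).sub (hasDerivAt_coord l v b)).pow 2).add_const (δ ^ 2)
    have h5 := (h4.log (by simp only [Pi.pow_apply, Pi.sub_apply]; positivity)).const_mul (β / 4)
    refine h5.congr_deriv ?_
    simp [regInv]
    ring
  have h6 := ((HasDerivAt.fun_sum (u := Finset.univ) fun a _ => h1 a).add
    (HasDerivAt.fun_sum (u := Finset.univ) fun a _ =>
      HasDerivAt.fun_sum (u := ({a}ᶜ : Finset (Fin n))) fun b _ => h3 a b)).exp
  unfold HasLineDerivAt
  simp_rw [regWeight_eq_exp hδ]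
  refine h6.congr_deriv ?_
  simp only [Pi.add_apply, add_zero, Pi.smul_apply, smul_eq_mul, zero_mul,
    Finset.mul_sum]

/-- The functional whose expectation vanishes by the loop equation, with regularised divided
differences. -/
noncomputable def loopFunctional (V' : ℝ → ℝ) (β : ℝ) (n : ℕ) (h h' k k' : ℝ → ℂ) (c : ℂ) (δ : ℝ)
    (l : Fin n → ℝ) : ℂ :=
  (β / 2 * ∑ a, ∑ b ∈ ({a}ᶜ : Finset (Fin n)), (regInv δ (l a - l b) : ℂ) * (h (l a) - h (l b)) +
    ∑ a, h' (l a) - n * β / 2 * ∑ a, V' (l a) * h (l a)) * (∑ a, k (l a) + c) +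
  ∑ a, h (l a) * k' (l a)

/-- The Lipschitz bound for h compensates the regularised inverse, so the bound does not depend on
δ. It serves as dominating function for δ → 0 and, being polynomial in n, is negligible on
exponentially unlikely events. -/
lemma norm_loopFunctional_le {V' : ℝ → ℝ} (hβ : 0 ≤ β) {h h' k k' : ℝ → ℂ} {c : ℂ} {B K C : ℝ}
    (hB : 0 ≤ B) (hlip : ∀ x y, ‖h x - h y‖ ≤ B * |x - y|) (hh : ∀ x, ‖h x‖ ≤ B)
    (hh' : ∀ x, ‖h' x‖ ≤ B) (hVh : ∀ x, ‖(V' x : ℂ) * h x‖ ≤ B) (hk : ∀ x, ‖k x‖ ≤ K)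
    (hk' : ∀ x, ‖k' x‖ ≤ K) (hc : ‖c‖ ≤ n * C) (δ : ℝ) (l : Fin n → ℝ) :
    ‖loopFunctional V' β n h h' k k' c δ l‖ ≤
      (β * n ^ 2 * B + n * B) * (n * K + n * C) + n * (B * K) := by
  have h1 : ‖(β / 2 * ∑ a, ∑ b ∈ ({a}ᶜ : Finset (Fin n)),
      (regInv δ (l a - l b) : ℂ) * (h (l a) - h (l b)) : ℂ)‖ ≤ β / 2 * (n * (n * B)) := by
    rw [norm_mul, norm_div, Complex.norm_real, Real.norm_of_nonneg hβ, Complex.norm_ofNat]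
    gcongr
    refine (norm_sum_le_of_le _ fun a _ => ?_).trans (b := ∑ _a : Fin n, n * B) (by simp)
    refine (norm_sum_le_of_le (n := fun _ => B) _ fun b _ => ?_).trans ?_
    · rw [norm_mul, Complex.norm_real, Real.norm_eq_abs]
      calc _ ≤ |regInv δ (l a - l b)| * (B * |l a - l b|) := by gcongr; exact hlip _ _
        _ = B * (|regInv δ (l a - l b)| * |l a - l b|) := by ring
        _ ≤ B * 1 := by gcongr; exact abs_regInv_mul_le _ _
        _ = B := mul_one _
    · rw [Finset.sum_const, nsmul_eq_mul]
      gcongr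
      exact (Finset.card_le_univ _).trans_eq (by simp)
  have h2 : ‖∑ a, h' (l a)‖ ≤ n * B := (norm_sum_le_of_le _ fun a _ => hh' _).trans (by simp)
  have h3 : ‖(n * β / 2 * ∑ a, V' (l a) * h (l a) : ℂ)‖ ≤ n * β / 2 * (n * B) := by
    rw [norm_mul, norm_div, norm_mul, Complex.norm_real, Real.norm_of_nonneg hβ,
      Complex.norm_ofNat, Complex.norm_natCast]
    gcongr
    exact (norm_sum_le_of_le _ fun a _ => hVh _).trans (by simp)
  have h4 : ‖∑ a, k (l a) + c‖ ≤ n * K + n * C := by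
    refine (norm_add_le _ _).trans (add_le_add ?_ hc)
    exact (norm_sum_le_of_le _ fun a _ => hk _).trans (by simp)
  have h5 : ‖∑ a, h (l a) * k' (l a)‖ ≤ n * (B * K) := by
    refine (norm_sum_le_of_le (n := fun _ => B * K) _ fun a _ => ?_).trans (by simp)
    rw [norm_mul]
    gcongr
    · exact hh _
    · exact hk' _
  refine (norm_add_le _ _).trans (add_le_add ?_ h5)
  rw [norm_mul]
  refine mul_le_mul ?_ h4 (norm_nonneg _) (by positivity)
  refine (norm_sub_le _ _).trans ?_
  have := (norm_add_le _ _).trans (add_le_add h1 h2)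
  linarith

lemma measurable_loopFunctional {V' : ℝ → ℝ} {h h' k k' : ℝ → ℂ} (c : ℂ) (δ : ℝ)
    (hV' : Measurable fun x => (V' x : ℂ) * h x) (hh : Measurable h) (hh' : Measurable h')
    (hk : Measurable k) (hk' : Measurable k') :
    Measurable (loopFunctional V' β n h h' k k' c δ) := by
  unfold loopFunctional regInv
  have e : ∀ {f : ℝ → ℂ}, Measurable f → ∀ a, Measurable fun l : Fin n → ℝ => f (l a) :=
    fun hf a => hf.comp (measurable_pi_apply a)
  have e1 := fun a => e hV' a
  have e2 := fun a => e hh a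
  have e3 := fun a => e hh' a
  have e4 := fun a => e hk a
  have e5 := fun a => e hk' a
  fun_prop

variable {ε L : ℝ}

/-- For each i, integrate by parts in the i-th eigenvalue with the function h(λᵢ)(∑ k(λₐ) + c), and
add up. For δ > 0 the logarithmic interaction is smooth also at coinciding eigenvalues. -/
theorem integral_regWeight_smul_loopFunctional (hβ : 0 < β) (hε : 0 < ε) (hV : Continuous V)
    (hgrowth : ∀ x : ℝ, L ≤ |x| → 2 * (1 + ε) * Real.log (1 + |x|) ≤ V x)
    (hn : sizeThreshold β ε 0 ≤ n) {V' : ℝ → ℝ} {h h' k k' : ℝ → ℂ} {B K : ℝ}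
    (hVd : ∀ x ∈ tsupport h, HasDerivAt V (V' x) x) (hVm : Measurable fun x => (V' x : ℂ) * h x)
    (hVB : ∀ x, ‖(V' x : ℂ) * h x‖ ≤ B)
    (hd : ∀ x, HasDerivAt h (h' x) x) (hhm : Measurable h') (hhB : ∀ x, ‖h x‖ ≤ B)
    (hh'B : ∀ x, ‖h' x‖ ≤ B) (hkd : ∀ x, HasDerivAt k (k' x) x) (hkm : Measurable k')
    (hkB : ∀ x, ‖k x‖ ≤ K) (hk'B : ∀ x, ‖k' x‖ ≤ K) (c : ℂ) {δ : ℝ} (hδ : 0 < δ) (hδ1 : δ ≤ 1) :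
    ∫ l : Fin n → ℝ, regWeight V β n δ l • loopFunctional V' β n h h' k k' c δ l = 0 := by
  have hB : 0 ≤ B := (norm_nonneg _).trans (hhB 0)
  have hK : 0 ≤ K := (norm_nonneg _).trans (hkB 0)
  have hf := integrable_regWeight hβ hε hV hgrowth hn (δ := δ) (by rwa [abs_of_pos hδ])
  have hhc : Continuous h := continuous_iff_continuousAt.2 fun x => (hd x).continuousAt
  have hkc : Continuous k := continuous_iff_continuousAt.2 fun x => (hkd x).continuousAt
  set A : (Fin n → ℝ) → ℂ := fun l => ∑ a, k (l a) + c with hA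
  have hAc : Continuous A := by
    refine Continuous.add (continuous_finsetSum _ fun a _ => hkc.comp (continuous_apply a))
      continuous_const
  have hAB : ∀ l, ‖A l‖ ≤ n * K + ‖c‖ := fun l =>
    (norm_add_le _ _).trans (add_le_add
      ((norm_sum_le_of_le _ fun a _ => hkB _).trans (by simp)) le_rfl)
  have hint : ∀ {F : (Fin n → ℝ) → ℂ} {M : ℝ}, Measurable F → (∀ l, ‖F l‖ ≤ M) →
      Integrable fun l => regWeight V β n δ l • F l := fun hF hM =>
    hf.smul_bdd _ hF.aestronglyMeasurable (Filter.Eventually.of_forall hM)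
  have e : ∀ {f : ℝ → ℂ}, Measurable f → ∀ a, Measurable fun l : Fin n → ℝ => f (l a) :=
    fun hf a => hf.comp (measurable_pi_apply a)
  have hAm := hAc.measurable
  have e1 := fun a => e hVm a
  have e2 := fun a => e hhc.measurable a
  have e3 := fun a => e hhm a
  have e5 := fun a => e hkm a
  -- the logarithmic derivative of the weight times `h`
  set D : Fin n → (Fin n → ℝ) → ℂ := fun i l => -(n * β / 2) * (V' (l i) * h (l i)) +
      β / 2 * ∑ a, ∑ b ∈ ({a}ᶜ : Finset (Fin n)), (regInv δ (l a - l b) : ℂ) *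
        ((Pi.single i (1 : ℝ) : Fin n → ℝ) a - (Pi.single i (1 : ℝ) : Fin n → ℝ) b : ℝ) * h (l i)
    with hD
  have hreg : ∀ x, |regInv δ x| ≤ δ⁻¹ ^ 2 + 1 := by
    intro x
    rw [regInv, abs_div, abs_of_pos (by positivity : 0 < x ^ 2 + δ ^ 2),
      div_le_iff₀ (by positivity)]
    have h1 : (δ⁻¹ ^ 2 + 1) * (x ^ 2 + δ ^ 2) = δ⁻¹ ^ 2 * x ^ 2 + 1 + x ^ 2 + δ ^ 2 := by
      field_simp; ring
    rw [h1, ← sq_abs x]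
    have : 0 ≤ δ⁻¹ ^ 2 * |x| ^ 2 := by positivity
    nlinarith [sq_nonneg (|x| - 1), sq_nonneg δ]
  have hDm : ∀ i, Measurable (D i) := fun i => by
    simp only [hD, regInv]
    fun_prop
  have hDB : ∀ i, ∃ M, ∀ l, ‖D i l‖ ≤ M := by
    intro i
    refine ⟨‖(-(n * β / 2) : ℂ)‖ * B + ‖(β / 2 : ℂ)‖ * ∑ a : Fin n, ∑ b ∈ ({a}ᶜ : Finset (Fin n)),
      (δ⁻¹ ^ 2 + 1) * ‖(((Pi.single i (1 : ℝ) : Fin n → ℝ) a -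
        (Pi.single i (1 : ℝ) : Fin n → ℝ) b : ℝ) : ℂ)‖ * B, fun l => ?_⟩
    refine (norm_add_le _ _).trans (add_le_add ?_ ?_)
    · rw [norm_mul]; gcongr; exact hVB _
    · rw [norm_mul]
      gcongr
      refine norm_sum_le_of_le _ fun a _ => norm_sum_le_of_le _ fun b _ => ?_
      rw [norm_mul, norm_mul, Complex.norm_real (regInv _ _)]
      gcongr
      · exact hreg _
      · exact hhB _
  -- integration by parts in each variable
  have key : ∀ i : Fin n, ∫ l : Fin n → ℝ, regWeight V β n δ l •
      ((D i l + h' (l i)) * A l + h (l i) * k' (l i)) = 0 := by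
    intro i
    obtain ⟨M, hM⟩ := hDB i
    set v : Fin n → ℝ := Pi.single i 1 with hv
    have hvi : v i = 1 := by simp [hv]
    have hvj : ∀ j, v j ≠ 0 → j = i := fun j hj => by
      by_contra hne; exact hj (by simp [hv, hne])
    set f' : (Fin n → ℝ) → ℝ := fun l => regWeight V β n δ l *
      (-(n * β / 2) * ∑ a, V' (l a) * v a +
        β / 2 * ∑ a, ∑ b ∈ ({a}ᶜ : Finset (Fin n)), regInv δ (l a - l b) * (v a - v b)) with hf'
    set g : (Fin n → ℝ) → ℂ := fun l => h (l i) * A l with hg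
    set g' : (Fin n → ℝ) → ℂ := fun l => h' (l i) * A l + h (l i) * k' (l i) with hg'
    have hfg : ∀ l, f' l • g l = regWeight V β n δ l • (D i l * A l) := by
      intro l
      have h1 : ∑ a, V' (l a) * v a = V' (l i) := by simp [hv, Pi.single_apply]
      simp only [hf', hg, hD, h1, Complex.real_smul]
      push_cast
      rw [mul_assoc]
      congr 1
      simp only [← Finset.sum_mul]
      ring
    have hIf : Integrable fun l => f' l • g l := by
      simp_rw [hfg]
      refine hint (M := M * (n * K + ‖c‖)) ((hDm i).mul hAm) fun l => ?_
      rw [norm_mul]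
      exact mul_le_mul (hM l) (hAB l) (norm_nonneg _) ((norm_nonneg _).trans (hM l))
    have hIg : Integrable fun l => regWeight V β n δ l • g' l := by
      refine hint (M := B * (n * K + ‖c‖) + B * K)
        (((e3 i).mul hAm).add ((e2 i).mul (e5 i))) fun l => ?_
      refine (norm_add_le _ _).trans (add_le_add ?_ ?_) <;> rw [norm_mul]
      · exact mul_le_mul (hh'B _) (hAB l) (norm_nonneg _) hB
      · exact mul_le_mul (hhB _) (hk'B _) (norm_nonneg _) hB
    have hI0 : Integrable fun l => regWeight V β n δ l • g l := by
      refine hint (M := B * (n * K + ‖c‖)) ((e2 i).mul hAm) fun l => ?_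
      rw [norm_mul]
      exact mul_le_mul (hhB _) (hAB l) (norm_nonneg _) hB
    -- Differentiability of V is thus only used where h lives.
    have hsupp : ∀ l ∈ tsupport g, l i ∈ tsupport h := by
      have hcl : IsClosed {l : Fin n → ℝ | l i ∈ tsupport h} :=
        (isClosed_tsupport h).preimage (continuous_apply i)
      refine fun l hl => closure_minimal (fun l hl => ?_) hcl hl
      refine subset_tsupport h fun h0 => hl ?_
      simp [hg, h0]
    have ibp := integral_bilinear_hasLineDerivAt_right_eq_neg_left_of_integrable
      (μ := (volume : Measure (Fin n → ℝ))) (f := regWeight V β n δ) (f' := f') (g := g) (g' := g')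
      (v := v) (B := ContinuousLinearMap.lsmul ℝ ℝ) hIf hIg hI0
      (fun l hl => hasLineDerivAt_regWeight hδ fun a ha => by
        rw [hvj a ha]; exact hVd _ (hsupp l hl))
      (fun l _ => by
        have h1 : HasLineDerivAt ℝ (fun l : Fin n → ℝ => h (l i)) (v i • h' (l i)) l v :=
          hasLineDerivAt_comp_coord fun _ => hd _
        have h2 : ∀ a, HasLineDerivAt ℝ (fun l : Fin n → ℝ => k (l a)) (v a • k' (l a)) l v :=
          fun a => hasLineDerivAt_comp_coord fun _ => hkd _
        have h3 : HasLineDerivAt ℝ A (k' (l i)) l v := by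
          have h4 := (HasDerivAt.fun_sum (u := Finset.univ) fun a _ => h2 a).add_const c
          refine h4.congr_deriv ?_
          simp [hv, Pi.single_apply]
        refine (HasDerivAt.mul h1 h3).congr_deriv ?_
        simp [hvi, hg'])
    simp only [ContinuousLinearMap.lsmul_apply] at ibp
    have h5 : ∀ l, regWeight V β n δ l • ((D i l + h' (l i)) * A l + h (l i) * k' (l i)) =
        f' l • g l + regWeight V β n δ l • g' l := by
      intro l
      rw [hfg, ← smul_add]
      congr 1
      simp only [hg']
      ring
    simp_rw [h5]
    rw [integral_add hIf hIg, ibp, add_neg_cancel]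
  have hsum : ∀ l, regWeight V β n δ l • loopFunctional V' β n h h' k k' c δ l =
      ∑ i, regWeight V β n δ l • ((D i l + h' (l i)) * A l + h (l i) * k' (l i)) := by
    intro l
    rw [← Finset.smul_sum, Finset.sum_add_distrib, ← Finset.sum_mul, Finset.sum_add_distrib]
    congr 1
    rw [loopFunctional]
    congr 2
    -- Summation over i moves the test function onto both members of each pair and produces the
    -- differences h(λₐ) - h(λ_b), which tame the interaction.
    have h6 : ∑ i, D i l = -(n * β / 2) * ∑ i, (V' (l i) * h (l i)) +
        β / 2 * ∑ a, ∑ b ∈ ({a}ᶜ : Finset (Fin n)), (regInv δ (l a - l b) : ℂ) *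
          (h (l a) - h (l b)) := by
      simp only [hD]
      rw [Finset.sum_add_distrib, ← Finset.mul_sum, ← Finset.mul_sum, Finset.sum_comm]
      congr 2
      refine Finset.sum_congr rfl fun a _ => ?_
      rw [Finset.sum_comm]
      refine Finset.sum_congr rfl fun b _ => ?_
      have h7 : ∀ x : Fin n, ((Pi.single x (1 : ℝ) : Fin n → ℝ) a : ℂ) = if x = a then 1 else 0 := by
        intro x
        rcases eq_or_ne x a with rfl | hx
        · simp
        · rw [Pi.single_eq_of_ne hx.symm, if_neg hx, Complex.ofReal_zero]
      have h8 : ∀ x : Fin n, ((Pi.single x (1 : ℝ) : Fin n → ℝ) b : ℂ) = if x = b then 1 else 0 := by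
        intro x
        rcases eq_or_ne x b with rfl | hx
        · simp
        · rw [Pi.single_eq_of_ne hx.symm, if_neg hx, Complex.ofReal_zero]
      simp only [mul_assoc, ← Finset.mul_sum]
      congr 1
      push_cast
      simp only [h7, h8, sub_mul, Finset.sum_sub_distrib, ite_mul, one_mul, zero_mul,
        Finset.sum_ite_eq', Finset.mem_univ, if_true]
    rw [h6]
    ring
  simp_rw [hsum]
  rw [integral_finsetSum]
  · exact Finset.sum_eq_zero fun i _ => key i
  · intro i _
    obtain ⟨M, hM⟩ := hDB i
    refine hint (M := (M + B) * (n * K + ‖c‖) + B * K) ((((hDm i).add (e3 i)).mul hAm).add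
      ((e2 i).mul (e5 i))) fun l => ?_
    refine (norm_add_le _ _).trans (add_le_add ?_ ?_) <;> rw [norm_mul]
    · refine mul_le_mul ((norm_add_le _ _).trans (add_le_add (hM l) (hh'B _))) (hAB l)
        (norm_nonneg _) (add_nonneg ((norm_nonneg _).trans (hM l)) hB)
    · exact mul_le_mul (hhB _) (hk'B _) (norm_nonneg _) hB

end

end BetaEnsemble

namespace BetaEnsemble

/-! ### Removing the regularisation from the loop equation. -/

/-- `f` is bounded by `B` and has the measurable derivative `f'`, also bounded by `B`. -/
structure HasBoundedDeriv (f f' : ℝ → ℂ) (B : ℝ) : Prop where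
  hasDerivAt : ∀ x, HasDerivAt f (f' x) x
  measurable_deriv : Measurable f'
  norm_le : ∀ x, ‖f x‖ ≤ B
  norm_deriv_le : ∀ x, ‖f' x‖ ≤ B

namespace HasBoundedDeriv

variable {f f' : ℝ → ℂ} {B : ℝ} (hf : HasBoundedDeriv f f' B)
include hf

lemma nonneg : 0 ≤ B := (norm_nonneg _).trans (hf.norm_le 0)

lemma continuous : Continuous f := continuous_iff_continuousAt.2 fun x => (hf.hasDerivAt x).continuousAt

lemma norm_sub_le (x y : ℝ) : ‖f x - f y‖ ≤ B * |x - y| :=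
  convex_univ.norm_image_sub_le_of_norm_hasDerivWithin_le
    (fun x _ => (hf.hasDerivAt x).hasDerivWithinAt) (fun x _ => hf.norm_deriv_le x)
    (Set.mem_univ y) (Set.mem_univ x)

end HasBoundedDeriv

variable {V : ℝ → ℝ} {β : ℝ} {n : ℕ} {ε L : ℝ}

/-- The loop equation. -/
theorem EquilibriumSetting.integral_loopFunctional_law {μ : Measure ℝ} {b : ℝ≥0}
    (S : EquilibriumSetting V β μ b ε L) (hn0 : n ≠ 0)
    (hn : sizeThreshold β ε 0 ≤ n) {V' : ℝ → ℝ} {h h' k k' : ℝ → ℂ} {B K : ℝ}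
    (hh : HasBoundedDeriv h h' B) (hk : HasBoundedDeriv k k' K)
    (hVd : ∀ x ∈ tsupport h, HasDerivAt V (V' x) x) (hVm : Measurable fun x => (V' x : ℂ) * h x)
    (hVB : ∀ x, ‖(V' x : ℂ) * h x‖ ≤ B) (c : ℂ) :
    ∫ l, loopFunctional V' β n h h' k k' c 0 l ∂(law V β n) = 0 := by
  have hint := S.integrable_weight hn
  obtain ⟨hβ, hV, hε, hgrowth, -⟩ := S
  have hQ := partitionFn_pos hβ hV hint
  rw [integral_law hV hβ hQ]
  suffices hmain : ∫ l, weight V β n l • loopFunctional V' β n h h' k k' c 0 l = 0 by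
    rw [hmain, smul_zero]
  -- Dominated convergence along δ → 0. Where two eigenvalues coincide, `regInv` is 0 for every δ,
  -- so the functional is continuous at δ = 0 everywhere.
  set δ : ℕ → ℝ := fun m => 1 / ((m : ℝ) + 1) with hδ
  have hδ0 : ∀ m, 0 < δ m := fun m => by simp only [hδ]; positivity
  have hδ1 : ∀ m, δ m ≤ 1 := fun m => by
    simp only [hδ]; rw [div_le_one (by positivity)]; linarith [(Nat.cast_nonneg m : (0:ℝ) ≤ m)]
  have hlim : Filter.Tendsto δ Filter.atTop (𝓝 0) := tendsto_one_div_add_atTop_nhds_zero_nat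
  have hmeas : ∀ d, Measurable (loopFunctional V' β n h h' k k' c d) := fun d =>
    measurable_loopFunctional c d hVm hh.continuous.measurable hh.measurable_deriv
      hk.continuous.measurable hk.measurable_deriv
  have hc : ‖c‖ ≤ n * ‖c‖ := le_mul_of_one_le_left (norm_nonneg _)
    (by exact_mod_cast Nat.one_le_iff_ne_zero.2 hn0)
  set M := (β * n ^ 2 * B + n * B) * (n * K + n * ‖c‖) + n * (B * K) with hM
  have hbd : ∀ d l, ‖loopFunctional V' β n h h' k k' c d l‖ ≤ M := fun d l =>
    norm_loopFunctional_le hβ.le hh.nonneg hh.norm_sub_le hh.norm_le hh.norm_deriv_le hVB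
      hk.norm_le hk.norm_deriv_le hc d l
  have htend := tendsto_integral_of_dominated_convergence
    (μ := (volume : Measure (Fin n → ℝ)))
    (F := fun m l => regWeight V β n (δ m) l • loopFunctional V' β n h h' k k' c (δ m) l)
    (f := fun l => weight V β n l • loopFunctional V' β n h h' k k' c 0 l)
    (fun l => (∏ i, envelope V β n 0 (l i)) * M)
    (fun m => ((continuous_regWeight hβ hV (δ m)).measurable.smul (hmeas _)).aestronglyMeasurable)
    ((integrable_prod_envelope hβ hε hV hgrowth hn).mul_const M)
    (fun m => Filter.Eventually.of_forall fun l => ?_)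
    (Filter.Eventually.of_forall fun l => ?_)
  · refine tendsto_nhds_unique htend ?_
    have h0 : ∀ m, ∫ l : Fin n → ℝ,
        regWeight V β n (δ m) l • loopFunctional V' β n h h' k k' c (δ m) l = 0 := fun m =>
      integral_regWeight_smul_loopFunctional hβ hε hV hgrowth hn hVd hVm hVB hh.hasDerivAt
        hh.measurable_deriv hh.norm_le hh.norm_deriv_le hk.hasDerivAt hk.measurable_deriv
        hk.norm_le hk.norm_deriv_le c (hδ0 m) (hδ1 m)
    simp_rw [h0]
    exact tendsto_const_nhds
  · rw [norm_smul, Real.norm_of_nonneg (regWeight_nonneg _ _)]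
    have h1 := regWeight_le_prod_envelope (V := V) hβ (δ := δ m)
      (by rw [abs_of_pos (hδ0 m)]; exact hδ1 m) l
    exact mul_le_mul h1 (hbd _ _) (norm_nonneg _) ((regWeight_nonneg _ _).trans h1)
  · rw [← regWeight_zero]
    have h1 : Continuous fun d => regWeight V β n d l := by
      unfold regWeight
      refine continuous_const.mul (continuous_finsetProd _ fun i _ => continuous_finsetProd _
        fun j _ => Continuous.rpow_const (by fun_prop) fun _ => Or.inr (by positivity))
    have h2 : ContinuousAt (fun d => loopFunctional V' β n h h' k k' c d l) 0 := by
      unfold loopFunctional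
      have h3 : ∀ x : ℝ, ContinuousAt (fun d => ((regInv d x : ℝ) : ℂ)) 0 := fun x =>
        Complex.continuous_ofReal.continuousAt.comp (continuousAt_regInv x)
      have h4 : ContinuousAt (fun d => ∑ a, ∑ b ∈ ({a}ᶜ : Finset (Fin n)),
          (regInv d (l a - l b) : ℂ) * (h (l a) - h (l b))) 0 :=
        tendsto_finsetSum _ fun a _ => tendsto_finsetSum _ fun b _ => (h3 _).mul continuousAt_const
      exact ((((continuousAt_const.mul h4).add continuousAt_const).sub continuousAt_const).mul
        continuousAt_const).add continuousAt_const
    exact (h1.continuousAt.smul h2).tendsto.comp hlim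

end BetaEnsemble

/-! ### The loop equation in terms of the centred resolvent trace. -/

namespace BetaEnsemble

/-- An equilibrium setting whose potential is analytic near the cut, with the density of the
equilibrium measure governed by a nonvanishing `P`. -/
structure RegularSetting (V : ℝ → ℝ) (β : ℝ) (μ : Measure ℝ) (b : ℝ≥0) (ε L : ℝ) (W : ℂ → ℂ)
    (R : ℝ) : Prop extends EquilibriumSetting V β μ b ε L where
  R_pos : 0 < R
  analytic : AnalyticOnNhd ℂ W {z | Metric.infDist z cut < R}
  eq_V : ∀ x : ℝ, Metric.infDist (x : ℂ) cut < R → W x = V x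
  P_ne_zero : ∀ z, Metric.infDist z cut < R → P W z ≠ 0
  two_mul_sub : ∀ z, 0 < Metric.infDist z cut → Metric.infDist z cut < R →
    2 * (∫ x : ℝ, (z - x)⁻¹ ∂μ) - deriv W z = -(P W z * sqrtX z)

section contour

variable {μ : Measure ℝ} {b : ℝ≥0} (h : BoundedDensity μ b) {n : ℕ} {l : Fin n → ℝ} {r : ℝ}
  (hr : 0 < r) (hl : ∀ i, |l i| < 2 + r)
include h hr

lemma BoundedDensity.continuousOn_integral_inv_sub :
    ContinuousOn (fun ζ : ℂ => ∫ x : ℝ, (ζ - x)⁻¹ ∂μ) (contour r) := fun ζ hζ => by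
  have := h.prob
  exact (hasDerivAt_integral_inv_sub h.ae_mem
    (lt_of_lt_of_eq hr (Eq.symm hζ))).continuousAt.continuousWithinAt

include hl

lemma BoundedDensity.continuousOn_resolventFluct :
    ContinuousOn (resolventFluct μ l) (contour r) := fun _ hζ =>
  (h.differentiableAt_resolventFluct (lt_of_lt_of_eq hr (Eq.symm hζ)) fun i hi =>
    sub_ofReal_ne_zero hr (hl i) hζ (sub_eq_zero.2 hi)).continuousAt.continuousWithinAt

/-- A contour integral of the centred resolvent trace is a centred linear statistic. -/
lemma BoundedDensity.cauchyIntegral_mul_resolventFluct {F : ℂ → ℂ}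
    (hF : ContinuousOn F (contour r)) :
    cauchyIntegral r (fun ζ => F ζ * resolventFluct μ l ζ) =
      fluct μ l fun x => cauchyIntegral r fun ζ => F ζ * (ζ - x)⁻¹ := by
  have := h.prob
  have hgc := h.continuousOn_integral_inv_sub hr
  have h1 : (fun ζ => F ζ * resolventFluct μ l ζ) = fun ζ =>
      (∑ i, F ζ * (ζ - l i)⁻¹) - n * (F ζ * ∫ x : ℝ, (ζ - x)⁻¹ ∂μ) := by
    funext ζ; rw [resolventFluct, fluct, mul_sub, Finset.mul_sum]; ring
  have h2 := cauchyIntegral_mul_integral_inv_sub hr h.ae_mem (φ := fun _ => 1)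
    continuousOn_const hF
  simp only [one_mul] at h2
  have hFi : ∀ i ∈ Finset.univ, ContinuousOn (fun ζ => F ζ * (ζ - l i)⁻¹) (contour r) :=
    fun i _ => hF.fun_mul (continuousOn_inv_sub hr (hl i))
  rw [h1, cauchyIntegral_sub hr (continuousOn_finsetSum _ hFi)
    (continuousOn_const.fun_mul (hF.fun_mul hgc)), cauchyIntegral_sum hr _ hFi,
    cauchyIntegral_const_mul, h2, fluct]

/-- Cauchy's formula at each eigenvalue and under the integral over μ; the contour encloses all of
these points. -/
lemma BoundedDensity.fluct_eq_cauchyIntegral {r' : ℝ} (hrr : r < r') {F : ℂ → ℂ}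
    (hF : DifferentiableOn ℂ F {z | Metric.infDist z cut < r'}) :
    fluct μ l (fun x => F x) = cauchyIntegral r (fun ζ => F ζ * resolventFluct μ l ζ) := by
  rw [h.cauchyIntegral_mul_resolventFluct hr hl (continuousOn_contour_of_differentiableOn hrr hF),
    fluct, fluct]
  congr 1
  · exact Finset.sum_congr rfl fun i _ => (cauchyIntegral_mul_inv_sub hr hrr hF (hl i)).symm
  · congr 1
    refine integral_congr_ae ?_
    filter_upwards [h.ae_mem] with x hx
    exact (cauchyIntegral_mul_inv_sub hr hrr hF (abs_lt_two_add hr hx)).symm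

/-- The term -1 in `cauchyIntegral_sqrtX_mul`, coming from infinity, drops out because ∑ δ_{λᵢ} - n
μ has total mass zero. -/
lemma BoundedDensity.cauchyIntegral_sqrtX_mul_resolventFluct {z : ℂ}
    (hz : r < Metric.infDist z cut) :
    cauchyIntegral r (fun ζ => sqrtX ζ * (z - ζ)⁻¹ * resolventFluct μ l ζ) =
      sqrtX z * resolventFluct μ l z := by
  have := h.prob
  rw [h.cauchyIntegral_mul_resolventFluct hr hl ((continuousOn_sqrtX hr).fun_mul
    (continuousOn_contour_of_differentiableOn hz (differentiableOn_inv_sub_right z))),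
    resolventFluct, fluct, fluct]
  have h1 : ∀ x : ℝ, |x| < 2 + r → cauchyIntegral r (fun ζ => sqrtX ζ * (z - ζ)⁻¹ * (ζ - x)⁻¹) =
      sqrtX z * (z - x)⁻¹ - 1 := fun x hx => by
    simp only [mul_assoc]
    exact cauchyIntegral_sqrtX_mul hr hz hx
  have hi : Integrable (fun x : ℝ => (z - x)⁻¹) μ := integrable_inv_sub h.ae_mem (hr.trans hz)
  rw [Finset.sum_congr rfl fun i _ => h1 (l i) (hl i),
    integral_congr_ae (h.ae_mem.mono fun x hx => h1 x (abs_lt_two_add hr hx)),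
    integral_sub (hi.const_mul _) (integrable_const _), integral_const_mul,
    Finset.sum_sub_distrib, ← Finset.mul_sum]
  simp
  ring

omit h in
-- Expanding the square, off-diagonal products give divided differences of F and diagonal ones its
-- derivative. This rewrites the interaction term of the loop equation.
lemma cauchyIntegral_mul_sq_sum (hinj : Function.Injective l) {r' : ℝ} (hrr : r < r') {F : ℂ → ℂ}
    (hF : DifferentiableOn ℂ F {z | Metric.infDist z cut < r'}) :
    cauchyIntegral r (fun ζ => F ζ * (∑ a, (ζ - l a)⁻¹) ^ 2) =
      ∑ a, ∑ b ∈ ({a}ᶜ : Finset (Fin n)), ((l a - l b)⁻¹ : ℝ) * (F (l a) - F (l b)) +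
        ∑ a, deriv F (l a) := by
  have hFc := continuousOn_contour_of_differentiableOn hrr hF
  have h1 : (fun ζ => F ζ * (∑ a, (ζ - l a)⁻¹) ^ 2) =
      fun ζ => ∑ a, ∑ b, F ζ * ((ζ - l a)⁻¹ * (ζ - l b)⁻¹) := by
    funext ζ
    rw [sq, Finset.sum_mul_sum, Finset.mul_sum]
    simp only [Finset.mul_sum]
  have h2 : ∀ a b, ContinuousOn (fun ζ => F ζ * ((ζ - l a)⁻¹ * (ζ - l b)⁻¹)) (contour r) :=
    fun a b => hFc.fun_mul ((continuousOn_inv_sub hr (hl a)).fun_mul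
      (continuousOn_inv_sub hr (hl b)))
  rw [h1, cauchyIntegral_sum hr _ fun a _ => continuousOn_finsetSum _ fun b _ => h2 a b,
    ← Finset.sum_add_distrib]
  refine Finset.sum_congr rfl fun a _ => ?_
  rw [cauchyIntegral_sum hr _ fun b _ => h2 a b, ← Finset.sum_compl_add_sum {a}, Finset.sum_singleton]
  congr 1
  · refine Finset.sum_congr rfl fun b hb => ?_
    have hab : a ≠ b := by
      simp only [Finset.mem_compl, Finset.mem_singleton] at hb
      exact fun h => hb h.symm
    rw [cauchyIntegral_mul_inv_sub_mul_inv_sub hr hrr hF (hl a) (hl b) (hinj.ne hab)]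
    push_cast
    rw [div_eq_inv_mul]
  · rw [← cauchyIntegral_mul_inv_sub_sq hr hrr hF (hl a)]
    congr 1
    funext ζ
    rw [← mul_inv, ← sq]

end contour

/-- The test function `ζ ↦ 1 / (P(ζ) (z - ζ))` for the loop equation. -/
noncomputable def loopTest (W : ℂ → ℂ) (z ζ : ℂ) : ℂ := (P W ζ)⁻¹ * (z - ζ)⁻¹

namespace RegularSetting

variable {V : ℝ → ℝ} {β : ℝ} {μ : Measure ℝ} {b : ℝ≥0} {ε L : ℝ} {W : ℂ → ℂ} {R : ℝ}
  (S : RegularSetting V β μ b ε L W R)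
include S

lemma differentiableOn_loopTest (z : ℂ) : DifferentiableOn ℂ (loopTest W z)
    {ζ | Metric.infDist ζ cut < min R (Metric.infDist z cut)} := by
  refine DifferentiableOn.mul (DifferentiableOn.inv ((differentiableOn_P S.R_pos S.analytic).mono ?_)
    ?_) ((differentiableOn_inv_sub_right z).mono ?_)
  · exact fun ζ (hζ : Metric.infDist ζ cut < min R (Metric.infDist z cut)) =>
      show Metric.infDist ζ cut < R from hζ.trans_le (min_le_left _ _)
  · exact fun ζ (hζ : Metric.infDist ζ cut < min R (Metric.infDist z cut)) =>
      S.P_ne_zero ζ (hζ.trans_le (min_le_left _ _))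
  · exact fun ζ (hζ : Metric.infDist ζ cut < min R (Metric.infDist z cut)) =>
      show Metric.infDist ζ cut < Metric.infDist z cut from hζ.trans_le (min_le_right _ _)

/-- The terms of the loop equation expressed by the centred resolvent trace. -/
theorem loop_sum_eq {n : ℕ} {l : Fin n → ℝ} (hinj : Function.Injective l) {r : ℝ} (hr : 0 < r)
    (hrR : r < R) (hl : ∀ i, |l i| < 2 + r) {z : ℂ} (hz : r < Metric.infDist z cut) :
    β / 2 * ∑ a, ∑ b ∈ ({a}ᶜ : Finset (Fin n)), ((l a - l b)⁻¹ : ℝ) *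
        (loopTest W z (l a) - loopTest W z (l b)) + ∑ a, deriv (loopTest W z) (l a) -
      n * β / 2 * ∑ a, deriv W (l a) * loopTest W z (l a) =
    -(β / 2 * n * sqrtX z * resolventFluct μ l z) +
      β / 2 * cauchyIntegral r (fun ζ => loopTest W z ζ * resolventFluct μ l ζ ^ 2) +
      (1 - β / 2) * (n * ∫ x : ℝ, deriv (loopTest W z) x ∂μ +
        cauchyIntegral r (fun ζ => deriv (loopTest W z) ζ * resolventFluct μ l ζ)) := by
  have hd := S.density
  have := hd.prob
  set ψ := loopTest W z with hψ
  set m := resolventFluct μ l with hm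
  set ρ := min R (Metric.infDist z cut) with hρ
  have hrρ : r < ρ := lt_min hrR hz
  have hψd := S.differentiableOn_loopTest z
  have hψc := continuousOn_contour_of_differentiableOn hrρ hψd
  have hψ'd : DifferentiableOn ℂ (deriv ψ) {ζ | Metric.infDist ζ cut < ρ} :=
    hψd.deriv (isOpen_infDist_cut_lt ρ)
  have hsub : {ζ | Metric.infDist ζ cut < ρ} ⊆ {ζ | Metric.infDist ζ cut < R} :=
    fun ζ (hζ : Metric.infDist ζ cut < ρ) =>
      show Metric.infDist ζ cut < R from hζ.trans_le (min_le_left _ _)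
  have hW'd : DifferentiableOn ℂ (deriv W) {ζ | Metric.infDist ζ cut < ρ} :=
    S.analytic.deriv.differentiableOn.mono hsub
  have hPd := (differentiableOn_P S.R_pos S.analytic).mono hsub
  have hmc := hd.continuousOn_resolventFluct hr hl
  set G : ℂ → ℂ := fun ζ => ∑ a, (ζ - l a)⁻¹ with hG
  set g : ℂ → ℂ := fun ζ => ∫ x : ℝ, (ζ - x)⁻¹ ∂μ with hg
  have hGc : ContinuousOn G (contour r) :=
    continuousOn_finsetSum _ fun a _ => continuousOn_inv_sub hr (hl a)
  have hGm : ∀ ζ, G ζ = n * g ζ + m ζ := fun ζ => by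
    simp only [hG, hg, hm, resolventFluct, fluct]; ring
  -- the three contributions
  have e1 := cauchyIntegral_mul_sq_sum hr hl hinj hrρ hψd
  have e2 : cauchyIntegral r (fun ζ => ψ ζ * deriv W ζ * G ζ) = ∑ a, deriv W (l a) * ψ (l a) := by
    simp only [hG, Finset.mul_sum]
    rw [cauchyIntegral_sum hr _ fun a _ => (hψc.fun_mul
      (continuousOn_contour_of_differentiableOn hrρ hW'd)).fun_mul (continuousOn_inv_sub hr (hl a))]
    refine Finset.sum_congr rfl fun a _ => ?_
    rw [cauchyIntegral_mul_inv_sub hr hrρ (hψd.fun_mul hW'd) (hl a), mul_comm]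
  have e3 := hd.fluct_eq_cauchyIntegral hr hl hrρ hψ'd
  have e4 := hd.cauchyIntegral_sqrtX_mul_resolventFluct hr hl hz
  -- With G = n g + m and 2g = W' - P√X, the n² part of ψ(G² - n W' G) is ψ(P² X - W'²)/4. It
  -- contains X = ζ² - 4 but not its root, so it is analytic inside the contour and integrates to
  -- zero. In the part of order n, ψ cancels P and leaves -√X (z - ζ)⁻¹ m.
  set Φ : ℂ → ℂ := fun ζ => ψ ζ * (((P W ζ) ^ 2 * (ζ ^ 2 - 4) - (deriv W ζ) ^ 2) / 4) with hΦ
  have hΦd : DifferentiableOn ℂ Φ {ζ | Metric.infDist ζ cut < ρ} :=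
    hψd.mul ((((hPd.pow 2).mul (by fun_prop)).sub (hW'd.pow 2)).div_const 4)
  have hΦ0 := cauchyIntegral_eq_zero hr hrρ hΦd
  have hsc := continuousOn_sqrtX hr
  have hinvc := continuousOn_contour_of_differentiableOn hz (differentiableOn_inv_sub_right z)
  have hpt : Set.EqOn (fun ζ => ψ ζ * G ζ ^ 2) (fun ζ => n * (ψ ζ * deriv W ζ * G ζ) +
      (n ^ 2 * Φ ζ - n * (sqrtX ζ * (z - ζ)⁻¹ * m ζ) + ψ ζ * m ζ ^ 2)) (contour r) := by
    intro ζ hζ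
    have hζr : Metric.infDist ζ cut = r := hζ
    have hPne := S.P_ne_zero ζ (by rw [hζr]; exact hrR)
    have e5 : g ζ = (deriv W ζ - P W ζ * sqrtX ζ) / 2 := by
      have := S.two_mul_sub ζ (by rw [hζr]; exact hr) (by rw [hζr]; exact hrR)
      simp only [hg]
      linear_combination this / 2
    have e6 : (z - ζ)⁻¹ = ψ ζ * P W ζ := by
      simp only [hψ, loopTest]; field_simp
    simp only
    rw [hGm, e5, e6, hΦ]
    simp only
    rw [← sqrtX_sq]
    ring
  have e7 : cauchyIntegral r (fun ζ => ψ ζ * G ζ ^ 2) =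
      n * cauchyIntegral r (fun ζ => ψ ζ * deriv W ζ * G ζ) - n * (sqrtX z * m z) +
        cauchyIntegral r (fun ζ => ψ ζ * m ζ ^ 2) := by
    have c1 : ContinuousOn (fun ζ => (n : ℂ) * (ψ ζ * deriv W ζ * G ζ)) (contour r) :=
      continuousOn_const.mul ((hψc.mul (continuousOn_contour_of_differentiableOn hrρ hW'd)).mul hGc)
    have c2 : ContinuousOn (fun ζ => (n : ℂ) ^ 2 * Φ ζ) (contour r) :=
      continuousOn_const.mul (continuousOn_contour_of_differentiableOn hrρ hΦd)
    have c3 : ContinuousOn (fun ζ => (n : ℂ) * (sqrtX ζ * (z - ζ)⁻¹ * m ζ)) (contour r) :=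
      continuousOn_const.mul ((hsc.mul hinvc).mul hmc)
    have c4 : ContinuousOn (fun ζ => ψ ζ * m ζ ^ 2) (contour r) := hψc.mul (hmc.pow 2)
    rw [cauchyIntegral_congr hr hpt, cauchyIntegral_add hr c1 ((c2.fun_sub c3).fun_add c4),
      cauchyIntegral_add hr (c2.fun_sub c3) c4, cauchyIntegral_sub hr c2 c3,
      cauchyIntegral_const_mul, cauchyIntegral_const_mul, cauchyIntegral_const_mul, hΦ0, e4]
    ring
  rw [e1, e2] at e7
  rw [fluct] at e3
  -- The diagonal of the square supplies β/2 times the sum of ψ', whereas the loop equation contains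
  -- it once; the defect 1 - β/2 multiplies the sum, split into its mean part and its fluctuation.
  linear_combination (β / 2 : ℂ) * e7 + (1 - β / 2 : ℂ) * e3

end RegularSetting

end BetaEnsemble

namespace BetaEnsemble

/-! ### Extending test functions from a neighbourhood of the cut -/

lemma exists_cutoff {e r : ℝ} (he : 0 < e) (her : e < r) : ∃ (χ : ℝ → ℝ) (B : ℝ),
    ContDiff ℝ 1 χ ∧ (∀ x, |x| ≤ 2 + e → χ x = 1 ∧ deriv χ x = 0) ∧ (∀ x, |χ x| ≤ 1) ∧
      0 ≤ B ∧ (∀ x, |deriv χ x| ≤ B) ∧ tsupport χ ⊆ {x | |x| ≤ 2 + r} := by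
  let f : ContDiffBump (0 : ℝ) := ⟨2 + e, 2 + r, by linarith, by linarith⟩
  have hf1 : ContDiff ℝ 1 f := f.contDiff
  obtain ⟨B, hB⟩ := (hf1.continuous_deriv le_rfl).bounded_above_of_compact_support
    f.hasCompactSupport.deriv
  refine ⟨f, B, hf1, fun x hx => ?_, fun x => ?_, (norm_nonneg _).trans (hB 0), hB, ?_⟩
  · have h1 : f x = 1 := f.one_of_mem_closedBall (by simpa using hx)
    -- The bump attains its maximum at these points, so its derivative vanishes there, the boundary
    -- of the interval included.
    have h2 : IsLocalMax f x := Filter.Eventually.of_forall fun y => by rw [h1]; exact f.le_one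
    exact ⟨h1, h2.deriv_eq_zero⟩
  · rw [abs_of_nonneg f.nonneg]; exact f.le_one
  · rw [f.tsupport_eq]
    intro x hx
    simpa using hx

/-- A function analytic near the cut agrees near the cut with a function on the line that has a
bounded derivative. -/
lemma exists_hasBoundedDeriv_extension {e r : ℝ} (he : 0 < e) (her : e < r) : ∃ C : ℝ, 1 ≤ C ∧
    ∀ (F : ℂ → ℂ) (r' B : ℝ), r < r' → DifferentiableOn ℂ F {z | Metric.infDist z cut < r'} →
      (∀ z ∈ cutNhd r, ‖F z‖ ≤ B ∧ ‖deriv F z‖ ≤ B) → ∃ h h' : ℝ → ℂ,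
        HasBoundedDeriv h h' (C * B) ∧ (∀ x : ℝ, |x| ≤ 2 + e → h x = F x ∧ h' x = deriv F x) ∧
          tsupport h ⊆ {x | |x| ≤ 2 + r} := by
  obtain ⟨χ, B₀, hχ, hχ1, hχb, hB₀, hχ', hχs⟩ := exists_cutoff he her
  refine ⟨1 + B₀, by linarith, fun F r' B hr' hF hB => ?_⟩
  have hr : 0 < r := he.trans her
  have hmem : ∀ x : ℝ, |x| ≤ 2 + r → (x : ℂ) ∈ cutNhd r := fun x hx =>
    (infDist_cut_ofReal_le_iff hr.le x).2 hx
  have hopen : ∀ x : ℝ, |x| ≤ 2 + r → {z : ℂ | Metric.infDist z cut < r'} ∈ 𝓝 (x : ℂ) :=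
    fun x hx => (isOpen_infDist_cut_lt r').mem_nhds
      (show Metric.infDist (x : ℂ) cut < r' from (hmem x hx).trans_lt hr')
  have hB0 : 0 ≤ B := (norm_nonneg _).trans (hB ((0 : ℝ) : ℂ) (hmem 0 (by simp; linarith))).1
  have hχd : ∀ x, HasDerivAt χ (deriv χ x) x := fun x =>
    (hχ.differentiable (by norm_num) x).hasDerivAt
  have hd : ∀ x : ℝ, HasDerivAt (fun x : ℝ => (χ x : ℂ) * F x)
      (deriv χ x * F x + χ x * deriv F x) x := fun x => by
    by_cases hx : |x| ≤ 2 + r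
    · exact (hχd x).ofReal_comp.fun_mul
        ((hF.differentiableAt (hopen x hx)).hasDerivAt.comp_ofReal)
    · have h1 : χ =ᶠ[𝓝 x] 0 := notMem_tsupport_iff_eventuallyEq.1 fun h => hx (hχs h)
      have h2 : deriv χ x = 0 := by rw [h1.deriv_eq]; simp
      have h3 : (fun x : ℝ => (χ x : ℂ) * F x) =ᶠ[𝓝 x] fun _ => 0 := by
        filter_upwards [h1] with y hy
        simp [hy]
      rw [h2, h1.eq_of_nhds]
      simpa using (hasDerivAt_const x (0 : ℂ)).congr_of_eventuallyEq h3
  have hzero : ∀ x, ¬ |x| ≤ 2 + r → χ x = 0 ∧ deriv χ x = 0 := fun x hx => by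
    have h1 : χ =ᶠ[𝓝 x] 0 := notMem_tsupport_iff_eventuallyEq.1 fun h => hx (hχs h)
    exact ⟨h1.eq_of_nhds, by rw [h1.deriv_eq]; simp⟩
  refine ⟨fun x => χ x * F x, deriv fun x : ℝ => (χ x : ℂ) * F x, ⟨fun x => ?_,
    measurable_deriv _, fun x => ?_, fun x => ?_⟩, fun x hx => ?_, ?_⟩
  · exact (hd x).differentiableAt.hasDerivAt
  · by_cases hx : |x| ≤ 2 + r
    · rw [norm_mul, Complex.norm_real, Real.norm_eq_abs]
      have := (hB x (hmem x hx)).1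
      calc |χ x| * ‖F x‖ ≤ 1 * B := by gcongr; exact hχb x
        _ ≤ (1 + B₀) * B := by gcongr; linarith
    · rw [(hzero x hx).1]; simp; positivity
  · rw [(hd x).deriv]
    by_cases hx : |x| ≤ 2 + r
    · refine (norm_add_le _ _).trans ?_
      rw [norm_mul, norm_mul, Complex.norm_real, Complex.norm_real, Real.norm_eq_abs,
        Real.norm_eq_abs]
      have h1 := hB x (hmem x hx)
      calc |deriv χ x| * ‖F x‖ + |χ x| * ‖deriv F x‖ ≤ B₀ * B + 1 * B := by
            gcongr
            · exact hχ' x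
            · exact h1.1
            · exact hχb x
            · exact h1.2
        _ = (1 + B₀) * B := by ring
    · rw [(hzero x hx).1, (hzero x hx).2]; simp; positivity
  · rw [(hd x).deriv]
    simp [(hχ1 x hx).1, (hχ1 x hx).2]
  · refine (closure_mono fun x hx => ?_).trans hχs
    intro h0
    exact hx (by simp [h0])

lemma norm_inv_sub_le {z ζ : ℂ} {r r₁ : ℝ} (hr₁ : r < r₁) (hz : r₁ ≤ Metric.infDist z cut)
    (hζ : ζ ∈ cutNhd r) : ‖(z - ζ)⁻¹‖ ≤ (r₁ - r)⁻¹ := by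
  have h1 := abs_infDist_cut_sub_le z ζ
  have h2 : Metric.infDist ζ cut ≤ r := hζ
  rw [norm_inv]
  exact inv_anti₀ (by linarith) (by linarith)

lemma hasDerivAt_inv_sub {z ζ : ℂ} (h : z - ζ ≠ 0) :
    HasDerivAt (fun ζ => (z - ζ)⁻¹) ((z - ζ)⁻¹ ^ 2) ζ := by
  have := ((hasDerivAt_id ζ).const_sub z).inv h
  refine this.congr_deriv ?_
  simp only [id, neg_neg, one_div, inv_pow]

lemma sub_ne_zero_of_mem_cutNhd {z ζ : ℂ} {r : ℝ} (hz : r < Metric.infDist z cut)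
    (hζ : ζ ∈ cutNhd r) : z - ζ ≠ 0 := fun h0 => by
  have h2 : Metric.infDist ζ cut ≤ r := hζ
  rw [← sub_eq_zero.1 h0] at h2
  linarith

variable {V : ℝ → ℝ} {β : ℝ} {μ : Measure ℝ} {b : ℝ≥0} {ε L : ℝ} {W : ℂ → ℂ} {R : ℝ}

lemma RegularSetting.exists_loopTest_le (S : RegularSetting V β μ b ε L W R) {r r₁ : ℝ}
    (hrR : r < R) (hr₁ : r < r₁) : ∃ B : ℝ, 0 ≤ B ∧ ∀ z, r₁ ≤ Metric.infDist z cut →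
      ∀ ζ ∈ cutNhd r, ‖loopTest W z ζ‖ ≤ B ∧ ‖deriv (loopTest W z) ζ‖ ≤ B := by
  have hopen := isOpen_infDist_cut_lt R
  have hPd : DifferentiableOn ℂ (fun ζ => (P W ζ)⁻¹) {ζ | Metric.infDist ζ cut < R} :=
    (differentiableOn_P S.R_pos S.analytic).fun_inv S.P_ne_zero
  have hsub : cutNhd r ⊆ {ζ | Metric.infDist ζ cut < R} := fun ζ hζ =>
    show Metric.infDist ζ cut < R from lt_of_le_of_lt hζ hrR
  obtain ⟨B₁, hB₁⟩ := (isCompact_cutNhd r).exists_bound_of_continuousOn (hPd.continuousOn.mono hsub)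
  obtain ⟨B₂, hB₂⟩ := (isCompact_cutNhd r).exists_bound_of_continuousOn
    ((hPd.deriv hopen).continuousOn.mono hsub)
  have hs : 0 < r₁ - r := by linarith
  set s := (r₁ - r)⁻¹ with hsdef
  have hs0 : 0 < s := inv_pos.2 hs
  refine ⟨|B₁| * s + (|B₂| * s + |B₁| * s ^ 2), by positivity, fun z hz ζ hζ => ?_⟩
  have h1 := (hB₁ ζ hζ).trans (le_abs_self B₁)
  have h2 := (hB₂ ζ hζ).trans (le_abs_self B₂)
  have h3 := norm_inv_sub_le hr₁ hz hζ
  have h4 : HasDerivAt (loopTest W z)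
      (deriv (fun ζ => (P W ζ)⁻¹) ζ * (z - ζ)⁻¹ + (P W ζ)⁻¹ * (z - ζ)⁻¹ ^ 2) ζ :=
    (hPd.differentiableAt (hopen.mem_nhds (hsub hζ))).hasDerivAt.fun_mul
      (hasDerivAt_inv_sub (sub_ne_zero_of_mem_cutNhd (hr₁.trans_le hz) hζ))
  have h5 : ‖loopTest W z ζ‖ ≤ |B₁| * s := by
    rw [loopTest, norm_mul]; gcongr
  have h6 : ‖deriv (loopTest W z) ζ‖ ≤ |B₂| * s + |B₁| * s ^ 2 := by
    rw [h4.deriv]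
    refine (norm_add_le _ _).trans ?_
    rw [norm_mul, norm_mul, norm_pow]
    gcongr
  have : 0 ≤ |B₁| * s := by positivity
  have : 0 ≤ |B₂| * s + |B₁| * s ^ 2 := by positivity
  constructor <;> linarith

/-- The second moment of the centred resolvent trace along the contour. -/
noncomputable def contourEnergy (μ : Measure ℝ) (r : ℝ) {n : ℕ} (l : Fin n → ℝ) : ℝ :=
  ∫ ζ, ‖resolventFluct μ l ζ‖ ^ 2 ∂(contourMeasure r)

lemma measurable_resolventFluct [SFinite μ] {n : ℕ} :
    Measurable fun p : (Fin n → ℝ) × ℂ => resolventFluct μ p.1 p.2 := by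
  unfold resolventFluct fluct
  refine Measurable.sub ?_ (Measurable.const_mul ?_ _)
  · refine Finset.measurable_sum _ fun i _ => Measurable.inv ?_
    exact measurable_snd.sub
      (Complex.measurable_ofReal.comp ((measurable_pi_apply i).comp measurable_fst))
  · have : StronglyMeasurable fun q : ((Fin n → ℝ) × ℂ) × ℝ => (q.1.2 - (q.2 : ℂ))⁻¹ :=
      (((measurable_snd.comp measurable_fst).sub
        (Complex.measurable_ofReal.comp measurable_snd)).inv).stronglyMeasurable
    exact (this.integral_prod_right' (ν := μ)).measurable

lemma contourEnergy_nonneg (r : ℝ) {n : ℕ} (l : Fin n → ℝ) : 0 ≤ contourEnergy μ r l :=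
  integral_nonneg fun _ => by positivity

end BetaEnsemble

namespace BetaEnsemble

/-! ### The loop equation restricted to typical configurations -/

lemma natCast_pow_three_mul_exp_neg_le {c : ℝ} (hc : 0 < c) (n : ℕ) :
    (n : ℝ) ^ 3 * Real.exp (-(c * n)) ≤ 6 / c ^ 3 := by
  have h1 := Real.pow_div_factorial_le_exp (c * n) (by positivity) 3
  rw [Real.exp_neg, ← div_eq_mul_inv, div_le_div_iff₀ (Real.exp_pos _) (by positivity)]
  rw [show (Nat.factorial 3 : ℝ) = 6 by norm_num [Nat.factorial]] at h1
  nlinarith [mul_pow c (n : ℝ) 3]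

lemma ae_law_injective {V : ℝ → ℝ} {β : ℝ} (hβ : 0 < β) {n : ℕ}
    (hint : Integrable (weight V β n)) : ∀ᵐ l ∂(law V β n), Function.Injective l := by
  rw [law, ae_withDensity_iff' (by have := hint.1.aemeasurable; fun_prop)]
  refine Filter.Eventually.of_forall fun l hl i j hij => ?_
  by_contra hne
  exact hl (by rw [weight_eq_zero_of_eq hβ hne hij]; simp)

/-- The integral over T is minus the one over its complement. This is how an exact identity survives
restriction to typical configurations. -/
lemma norm_setIntegral_le_of_integral_eq_zero {α : Type*} [MeasurableSpace α] {ν : Measure α}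
    [IsFiniteMeasure ν] {Y : α → ℂ} {B δ : ℝ} (hB0 : 0 ≤ B) (hδ : 0 ≤ δ) (hY : AEStronglyMeasurable Y ν)
    (hB : ∀ x, ‖Y x‖ ≤ B) (h0 : ∫ x, Y x ∂ν = 0) {T : Set α} (hT : MeasurableSet T)
    (hTδ : ν Tᶜ ≤ ENNReal.ofReal δ) : ‖∫ x in T, Y x ∂ν‖ ≤ B * δ := by
  have hi : Integrable Y ν := Integrable.of_bound hY B (Filter.Eventually.of_forall hB)
  have h1 := integral_add_compl hT hi
  rw [h0] at h1
  rw [eq_neg_of_add_eq_zero_left h1, norm_neg]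
  have h2 : ν.real Tᶜ ≤ δ := by
    rw [Measure.real, ← ENNReal.toReal_ofReal hδ]
    exact ENNReal.toReal_mono ENNReal.ofReal_ne_top hTδ
  exact (norm_setIntegral_le_of_norm_le_const (measure_lt_top _ _) fun x _ => hB x).trans
    (by gcongr)

lemma norm_resolvent_le {μ : Measure ℝ} {b : ℝ≥0} (h : BoundedDensity μ b) {r : ℝ} (hr : 0 < r)
    {z : ℂ} (hz : r ≤ Metric.infDist z cut) : ‖∫ x : ℝ, (z - x)⁻¹ ∂μ‖ ≤ r⁻¹ := by
  have := h.prob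
  refine (norm_integral_le_of_norm_le_const (C := r⁻¹) ?_).trans (by simp)
  filter_upwards [h.ae_mem] with x hx
  rw [norm_inv]
  exact inv_anti₀ hr (hz.trans (infDist_cut_le hx z))

namespace RegularSetting

variable {V : ℝ → ℝ} {β : ℝ} {μ : Measure ℝ} {b : ℝ≥0} {ε L : ℝ} {W : ℂ → ℂ} {R : ℝ}
  (S : RegularSetting V β μ b ε L W R)
include S

/-- The quadratic part of the loop equation is controlled by the energy on a contour. -/
lemma norm_loop_sum_sub_le {n : ℕ} {l : Fin n → ℝ} (hinj : Function.Injective l) {r : ℝ}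
    (hr : 0 < r) (hrR : r < R) (hl : ∀ i, |l i| < 2 + r) {z : ℂ} (hz : r < Metric.infDist z cut)
    {B : ℝ} (hB0 : 0 ≤ B)
    (hB : ∀ ζ ∈ cutNhd r, ‖loopTest W z ζ‖ ≤ B ∧ ‖deriv (loopTest W z) ζ‖ ≤ B) :
    ‖(β / 2 * ∑ a, ∑ b ∈ ({a}ᶜ : Finset (Fin n)), ((l a - l b)⁻¹ : ℝ) *
        (loopTest W z (l a) - loopTest W z (l b)) + ∑ a, deriv (loopTest W z) (l a) -
      n * β / 2 * ∑ a, deriv W (l a) * loopTest W z (l a)) +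
      (β / 2 * n * sqrtX z * resolventFluct μ l z) -
      (1 - β / 2) * (n * ∫ x : ℝ, deriv (loopTest W z) x ∂μ)‖ ≤
    (β / 2 * B + |1 - β / 2| * B * (1 + (contourMeasure r).real Set.univ)) *
      (1 + contourEnergy μ r l) := by
  have hβ := S.beta_pos
  set m := resolventFluct μ l with hm
  have hmc := S.density.continuousOn_resolventFluct hr hl
  rw [S.loop_sum_eq hinj hr hrR hl hz]
  have hi2 : Integrable (fun ζ => ‖m ζ‖ ^ 2) (contourMeasure r) := by
    have := (integrable_contourMeasure hr (hmc.pow 2)).norm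
    simpa only [Pi.pow_apply, norm_pow] using this
  have hae := ae_contourMeasure hr
  have hsub : ∀ ζ ∈ contour r, ζ ∈ cutNhd r := fun ζ hζ => le_of_eq hζ
  have h1 : ‖cauchyIntegral r (fun ζ => loopTest W z ζ * m ζ ^ 2)‖ ≤ B * contourEnergy μ r l := by
    refine (norm_cauchyIntegral_le hr).trans ?_
    rw [contourEnergy, ← integral_const_mul]
    refine integral_mono_of_nonneg (Filter.Eventually.of_forall fun _ => norm_nonneg _)
      (hi2.const_mul _) ?_
    filter_upwards [hae] with ζ hζ
    rw [norm_mul, norm_pow]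
    gcongr
    exact (hB ζ (hsub ζ hζ.1)).1
  have h2 : ‖cauchyIntegral r (fun ζ => deriv (loopTest W z) ζ * m ζ)‖ ≤
      B * ((contourMeasure r).real Set.univ + contourEnergy μ r l) := by
    refine (norm_cauchyIntegral_le hr).trans ?_
    have h3 : (contourMeasure r).real Set.univ + contourEnergy μ r l =
        ∫ ζ, (1 + ‖m ζ‖ ^ 2) ∂(contourMeasure r) := by
      rw [integral_add (integrable_const _) hi2, integral_const, smul_eq_mul, mul_one, contourEnergy]
    rw [h3, ← integral_const_mul]
    refine integral_mono_of_nonneg (Filter.Eventually.of_forall fun _ => norm_nonneg _)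
      (((integrable_const _).add hi2).const_mul _) ?_
    filter_upwards [hae] with ζ hζ
    rw [norm_mul]
    have h4 := (hB ζ (hsub ζ hζ.1)).2
    gcongr
    nlinarith [sq_nonneg (‖m ζ‖ - 1)]
  have hJ := contourEnergy_nonneg (μ := μ) r l
  set J := contourEnergy μ r l
  set Q := (contourMeasure r).real Set.univ
  have hQ : 0 ≤ Q := measureReal_nonneg
  set D : ℂ := ∫ x : ℝ, deriv (loopTest W z) x ∂μ
  set I₁ := cauchyIntegral r (fun ζ => loopTest W z ζ * m ζ ^ 2)
  set I₂ := cauchyIntegral r (fun ζ => deriv (loopTest W z) ζ * m ζ)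
  have h5 : -(β / 2 * n * sqrtX z * m z) + β / 2 * I₁ + (1 - β / 2) * (n * D + I₂) +
      β / 2 * n * sqrtX z * m z - (1 - β / 2) * (n * D) =
      ((β / 2 : ℝ) : ℂ) * I₁ + ((1 - β / 2 : ℝ) : ℂ) * I₂ := by
    push_cast; ring
  rw [h5]
  refine (norm_add_le _ _).trans ?_
  rw [norm_mul, norm_mul, Complex.norm_real, Complex.norm_real, Real.norm_eq_abs,
    Real.norm_eq_abs, abs_of_pos (by positivity : 0 < β / 2)]
  calc β / 2 * ‖I₁‖ + |1 - β / 2| * ‖I₂‖ ≤ β / 2 * (B * J) + |1 - β / 2| * (B * (Q + J)) := by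
        gcongr
    _ ≤ β / 2 * (B * (1 + J)) + |1 - β / 2| * (B * ((1 + Q) * (1 + J))) := by
        gcongr
        · linarith
        · nlinarith
    _ = _ := by ring

/-- Integration by parts needs test functions on the whole line, while `loopTest` is controlled only
near the cut. A cutoff leaves it unchanged at the eigenvalues of typical configurations, and keeps
its support where V is differentiable. -/
lemma exists_loopTest_extension {e r r₁ : ℝ} (he : 0 < e) (her : e < r) (hrR : r < R)
    (hr₁ : r < r₁) : ∃ B : ℝ, 0 ≤ B ∧ ∀ z, r₁ ≤ Metric.infDist z cut →
      (∀ ζ ∈ cutNhd r, ‖loopTest W z ζ‖ ≤ B ∧ ‖deriv (loopTest W z) ζ‖ ≤ B) ∧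
      ∃ h h' : ℝ → ℂ, HasBoundedDeriv h h' B ∧
        (∀ x : ℝ, |x| ≤ 2 + e → h x = loopTest W z x ∧ h' x = deriv (loopTest W z) x) ∧
        (∀ x ∈ tsupport h, HasDerivAt V (deriv W x).re x) ∧
        ∀ x : ℝ, ‖((deriv W x).re : ℂ) * h x‖ ≤ B := by
  have hr : 0 < r := he.trans her
  obtain ⟨Cχ, hCχ, hext⟩ := exists_hasBoundedDeriv_extension he her
  obtain ⟨B₀, hB₀, hψ⟩ := S.exists_loopTest_le hrR hr₁
  obtain ⟨G, hG⟩ := (isCompact_cutNhd r).exists_bound_of_continuousOn (f := deriv W)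
    (S.analytic.deriv.continuousOn.mono fun ζ hζ =>
      show Metric.infDist ζ cut < R from lt_of_le_of_lt hζ hrR)
  set B := (1 + |G|) * (Cχ * B₀) with hBdef
  have hB0 : 0 ≤ B := by positivity
  have hBle : Cχ * B₀ ≤ B := le_mul_of_one_le_left (by positivity) (by linarith [abs_nonneg G])
  have hBle₀ : B₀ ≤ B := (le_mul_of_one_le_left hB₀ hCχ).trans hBle
  refine ⟨B, hB0, fun z hz =>
    ⟨fun ζ hζ => ⟨(hψ z hz ζ hζ).1.trans hBle₀, (hψ z hz ζ hζ).2.trans hBle₀⟩, ?_⟩⟩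
  obtain ⟨h, h', hh, hhF, hhs⟩ := hext (loopTest W z) (min R (Metric.infDist z cut)) B₀
    (lt_min hrR (hr₁.trans_le hz)) (S.differentiableOn_loopTest z) (hψ z hz)
  have hmem : ∀ x : ℝ, |x| ≤ 2 + r → (x : ℂ) ∈ cutNhd r := fun x hx =>
    (infDist_cut_ofReal_le_iff hr.le x).2 hx
  refine ⟨h, h', ⟨hh.hasDerivAt, hh.measurable_deriv,
    fun x => (hh.norm_le x).trans hBle, fun x => (hh.norm_deriv_le x).trans hBle⟩, hhF,
    fun x hx => (hasDerivAt_real S.analytic S.eq_V (lt_of_le_of_lt (hmem x (hhs hx)) hrR)).1,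
    fun x => ?_⟩
  by_cases hx : x ∈ tsupport h
  · have h1 : |(deriv W x).re| ≤ |G| :=
      (Complex.abs_re_le_norm _).trans ((hG _ (hmem x (hhs hx))).trans (le_abs_self G))
    rw [norm_mul, Complex.norm_real, Real.norm_eq_abs]
    exact mul_le_mul (by linarith) (hh.norm_le x) (norm_nonneg _) (by positivity)
  · rw [image_eq_zero_of_notMem_tsupport hx, mul_zero, norm_zero]
    exact hB0

omit S in
lemma exists_resolvent_extension {e r r₁ : ℝ} (he : 0 < e) (her : e < r) (hr₁ : r < r₁) :
    ∃ K : ℝ, 0 ≤ K ∧ ∀ z, r₁ ≤ Metric.infDist z cut → ∃ k k' : ℝ → ℂ,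
      HasBoundedDeriv k k' K ∧ ∀ x : ℝ, |x| ≤ 2 + e → k x = (z - x)⁻¹ := by
  obtain ⟨Cχ, hCχ, hext⟩ := exists_hasBoundedDeriv_extension he her
  set s := (r₁ - r)⁻¹ with hs
  have hs0 : 0 < s := inv_pos.2 (by linarith)
  refine ⟨Cχ * (s + s ^ 2), by positivity, fun z hz => ?_⟩
  have hzr : r < Metric.infDist z cut := hr₁.trans_le hz
  obtain ⟨k, k', hk, hkF, -⟩ := hext (fun ζ => (z - ζ)⁻¹) (Metric.infDist z cut)
    (s + s ^ 2) hzr (differentiableOn_inv_sub_right z) fun ζ hζ => by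
      have h1 := norm_inv_sub_le hr₁ hz hζ
      rw [(hasDerivAt_inv_sub (sub_ne_zero_of_mem_cutNhd hzr hζ)).deriv, norm_pow]
      constructor
      · exact h1.trans (by nlinarith)
      · exact (pow_le_pow_left₀ (norm_nonneg _) h1 2).trans (by linarith)
  exact ⟨k, k', hk, fun x hx => (hkF x hx).1⟩

omit S in
lemma _root_.BetaEnsemble.EquilibriumSetting.norm_setIntegral_loopFunctional_le
    (S : EquilibriumSetting V β μ b ε L) {V' : ℝ → ℝ} {h h' k k' : ℝ → ℂ} {B K q δ : ℝ} {c : ℂ}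
    (hδ : 0 ≤ δ) (hq : 0 ≤ q) {n : ℕ} (hn0 : n ≠ 0) (hn : sizeThreshold β ε 0 ≤ n)
    (hh : HasBoundedDeriv h h' B) (hk : HasBoundedDeriv k k' K)
    (hVd : ∀ x ∈ tsupport h, HasDerivAt V (V' x) x) (hV' : Measurable V')
    (hVB : ∀ x, ‖(V' x : ℂ) * h x‖ ≤ B) (hc : ‖c‖ ≤ n * q) {T : Set (Fin n → ℝ)}
    (hT : MeasurableSet T) (hTδ : law V β n Tᶜ ≤ ENNReal.ofReal δ) :
    Measurable (loopFunctional V' β n h h' k k' c 0) ∧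
      (∀ l, ‖loopFunctional V' β n h h' k k' c 0 l‖ ≤
        ((β * B + B) * (K + q) + B * K) * (n : ℝ) ^ 3) ∧
      ‖∫ l in T, loopFunctional V' β n h h' k k' c 0 l ∂(law V β n)‖ ≤
        ((β * B + B) * (K + q) + B * K) * (n : ℝ) ^ 3 * δ := by
  have hβ := S.beta_pos
  have hlaw := isProbabilityMeasure_law hβ S.continuous_V (S.integrable_weight hn)
  have hn1 : (1 : ℝ) ≤ n := by exact_mod_cast (by omega : 1 ≤ n)
  have hB := hh.nonneg
  have hK := hk.nonneg
  have hhm := hh.continuous.measurable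
  have hVm : Measurable fun x => (V' x : ℂ) * h x := (Complex.measurable_ofReal.comp hV').mul hhm
  have hm := measurable_loopFunctional (β := β) (n := n) c 0 hVm hhm hh.measurable_deriv
    hk.continuous.measurable hk.measurable_deriv
  have hb : ∀ l, ‖loopFunctional V' β n h h' k k' c 0 l‖ ≤
      ((β * B + B) * (K + q) + B * K) * (n : ℝ) ^ 3 := fun l => by
    refine (norm_loopFunctional_le hβ.le hB hh.norm_sub_le hh.norm_le hh.norm_deriv_le hVB
      hk.norm_le hk.norm_deriv_le hc 0 l).trans ?_
    have e1 : (n : ℝ) ≤ n ^ 2 := by nlinarith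
    have e2 : (n : ℝ) ≤ n ^ 3 := by nlinarith
    calc (β * n ^ 2 * B + n * B) * (n * K + n * q) + n * (B * K)
        ≤ (β * n ^ 2 * B + n ^ 2 * B) * (n * K + n * q) + n ^ 3 * (B * K) := by gcongr
      _ = ((β * B + B) * (K + q) + B * K) * (n : ℝ) ^ 3 := by ring
  exact ⟨hm, hb, norm_setIntegral_le_of_integral_eq_zero (by positivity) hδ
      hm.aestronglyMeasurable hb (S.integral_loopFunctional_law hn0 hn hh hk hVd hVm hVB c) hT hTδ⟩

/-- The loop equation restricted to typical configurations. -/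
theorem exists_loop_bound {e A K c r r₁ : ℝ} (he : 0 < e) (hK : 0 ≤ K) (hc : 0 < c)
    (hT : ∀ n : ℕ, 2 ≤ n → sizeThreshold β ε 0 ≤ n →
      law V β n (typicalSet μ n e A)ᶜ ≤ ENNReal.ofReal (K * Real.exp (-(c * n))))
    (her : e < r) (hrR : r < R) (hr₁ : r < r₁) : ∃ C : ℝ, 0 ≤ C ∧ ∀ n : ℕ, 2 ≤ n →
      sizeThreshold β ε 0 ≤ n → ∀ z, r₁ ≤ Metric.infDist z cut → ∃ X : (Fin n → ℝ) → ℂ,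
        Measurable X ∧ (∃ B, ∀ l, ‖X l‖ ≤ B) ∧
        (∀ᵐ l ∂(law V β n).restrict (typicalSet μ n e A),
          ‖X l + β / 2 * n * sqrtX z * resolventFluct μ l z -
            (1 - β / 2) * (n * ∫ x : ℝ, deriv (loopTest W z) x ∂μ)‖ ≤
              C * (1 + contourEnergy μ r l)) ∧
        ‖∫ l in typicalSet μ n e A, X l ∂(law V β n)‖ ≤ C ∧
        ‖∫ l in typicalSet μ n e A, X l * conj (resolventFluct μ l z) ∂(law V β n)‖ ≤ C * n ∧
        ‖∫ x : ℝ, deriv (loopTest W z) x ∂μ‖ ≤ C := by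
  have hβ := S.beta_pos
  have hd := S.density
  have hprob := hd.prob
  have hr : 0 < r := he.trans her
  have hr₁0 : 0 < r₁ := hr.trans hr₁
  obtain ⟨B, hB0, hψ⟩ := S.exists_loopTest_extension he her hrR hr₁
  obtain ⟨K', hK'0, hres⟩ := exists_resolvent_extension he her hr₁
  set C₀ := β / 2 * B + |1 - β / 2| * B * (1 + (contourMeasure r).real Set.univ) with hC₀
  have hC₀0 : 0 ≤ C₀ := by positivity
  set C₁ := (β * B + B) * (K' + (1 + r₁⁻¹)) + B * K' with hC₁
  have hC₁0 : 0 ≤ C₁ := by positivity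
  set C₂ := C₁ * K * (6 / c ^ 3) with hC₂
  have hC₂0 : 0 ≤ C₂ := by positivity
  have hBK0 : 0 ≤ B * K' := by positivity
  refine ⟨C₀ + C₂ + B * K' + B, by positivity, fun n hn hthr z hz => ?_⟩
  have hint := S.integrable_weight hthr
  have hlaw := isProbabilityMeasure_law hβ S.continuous_V hint
  have hn0 : n ≠ 0 := by omega
  have hn1 : (1 : ℝ) ≤ n := by exact_mod_cast (by omega : 1 ≤ n)
  have hTm := S.measurableSet_typicalSet hn0 e A
  set T := typicalSet μ n e A with hTdef
  have hzr : r < Metric.infDist z cut := hr₁.trans_le hz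
  obtain ⟨hψB, h, h', hh, hhF, hVd, hVB⟩ := hψ z hz
  have hzc : r₁ ≤ Metric.infDist (conj z) cut := by rwa [infDist_cut_conj]
  -- At the conjugate point, because on typical configurations ∑ k(λₐ) - n g(z̄) is then the
  -- conjugate of m(z).
  obtain ⟨k, k', hk, hkF⟩ := hres (conj z) hzc
  set V' : ℝ → ℝ := fun x => (deriv W x).re with hV'
  have hV'm : Measurable V' :=
    Complex.measurable_re.comp ((measurable_deriv W).comp Complex.measurable_ofReal)
  have hmem : ∀ x : ℝ, |x| ≤ 2 + r → (x : ℂ) ∈ cutNhd r := fun x hx =>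
    (infDist_cut_ofReal_le_iff hr.le x).2 hx
  have h0K : HasBoundedDeriv (fun _ => (0 : ℂ)) (fun _ => 0) K' :=
    ⟨fun x => hasDerivAt_const _ _, measurable_const, fun _ => by simpa using hK'0,
      fun _ => by simpa using hK'0⟩
  have hexp : C₁ * (n : ℝ) ^ 3 * (K * Real.exp (-(c * n))) ≤ C₂ := by
    calc C₁ * (n : ℝ) ^ 3 * (K * Real.exp (-(c * n)))
        = C₁ * K * ((n : ℝ) ^ 3 * Real.exp (-(c * n))) := by ring
      _ ≤ C₂ := by
          rw [hC₂]
          gcongr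
          exact natCast_pow_three_mul_exp_neg_le hc n
  have hg := norm_resolvent_le hd hr₁0 hzc
  set g : ℂ := ∫ x : ℝ, (conj z - x)⁻¹ ∂μ with hgdef
  have hq0 : 0 ≤ 1 + r₁⁻¹ := by positivity
  have hKe : 0 ≤ K * Real.exp (-(c * n)) := by positivity
  -- The loop equation is used twice: with second factor 1, which will give the mean, and with the
  -- conjugate of m(z), which will give the second moment.
  obtain ⟨hXm, hXb, hXT⟩ := S.norm_setIntegral_loopFunctional_le (c := 1) hKe hq0 hn0 hthr hh h0K
    hVd hV'm hVB (by rw [norm_one]; nlinarith [inv_pos.2 hr₁0]) hTm (hT n hn hthr)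
  obtain ⟨hYm, hYb, hYT⟩ := S.norm_setIntegral_loopFunctional_le (c := -(n * g)) hKe hq0 hn0 hthr
    hh hk hVd hV'm hVB
    (by rw [norm_neg, norm_mul, Complex.norm_natCast]; gcongr; linarith) hTm (hT n hn hthr)
  have hXT' := hXT.trans hexp
  have hYT' := hYT.trans hexp
  set X : (Fin n → ℝ) → ℂ := loopFunctional V' β n h h' (fun _ => 0) (fun _ => 0) 1 0 with hX
  have hD : ‖∫ x : ℝ, deriv (loopTest W z) x ∂μ‖ ≤ B := by
    refine (norm_integral_le_of_norm_le_const (C := B) ?_).trans (by simp)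
    filter_upwards [hd.ae_mem] with x hx
    exact (hψB x (hmem x (abs_lt_two_add hr hx).le)).2
  refine ⟨X, hXm, ⟨_, hXb⟩, ?_, hXT'.trans (by linarith), ?_, hD.trans (by linarith)⟩
  · have hinj := ae_restrict_of_ae (s := T) (ae_law_injective hβ hint)
    filter_upwards [hinj, ae_restrict_mem hTm] with l hl hlT
    have hle : ∀ i, |l i| ≤ 2 + e := hlT.1
    have h1 := S.norm_loop_sum_sub_le hl hr hrR (fun i => (hle i).trans_lt (by linarith)) hzr hB0
      hψB
    have h2 : X l = β / 2 * ∑ a, ∑ b ∈ ({a}ᶜ : Finset (Fin n)), ((l a - l b)⁻¹ : ℝ) *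
        (loopTest W z (l a) - loopTest W z (l b)) + ∑ a, deriv (loopTest W z) (l a) -
      n * β / 2 * ∑ a, deriv W (l a) * loopTest W z (l a) := by
      have e1 : ∀ i, (V' (l i) : ℂ) = deriv W (l i) := fun i => by
        have := (hasDerivAt_real S.analytic S.eq_V
          (lt_of_le_of_lt (hmem (l i) ((hle i).trans (by linarith))) hrR)).2
        exact Complex.ext (by simp [hV']) (by simp [this])
      simp only [hX, loopFunctional, regInv_zero, (hhF _ (hle _)).1, (hhF _ (hle _)).2, e1,
        Finset.sum_const_zero, zero_add, mul_one, mul_zero, add_zero]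
    rw [h2]
    refine h1.trans (mul_le_mul_of_nonneg_right ?_
      (by linarith [contourEnergy_nonneg (μ := μ) r l]))
    linarith
  · have hk2 : Measurable fun l : Fin n → ℝ => ∑ a, h (l a) * k' (l a) :=
      Finset.measurable_sum _ fun a _ =>
        (hh.continuous.measurable.comp (measurable_pi_apply a)).mul
          (hk.measurable_deriv.comp (measurable_pi_apply a))
    have hk3 : ∀ l : Fin n → ℝ, ‖∑ a, h (l a) * k' (l a)‖ ≤ n * (B * K') := fun l => by
      refine (norm_sum_le_of_le (n := fun _ => B * K') _ fun a _ => ?_).trans (by simp)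
      rw [norm_mul]
      exact mul_le_mul (hh.norm_le _) (hk.norm_deriv_le _) (norm_nonneg _) hB0
    have h3 : ∫ l in T, X l * conj (resolventFluct μ l z) ∂(law V β n) =
        (∫ l in T, loopFunctional V' β n h h' k k' (-(n * g)) 0 l ∂(law V β n)) -
        ∫ l in T, ∑ a, h (l a) * k' (l a) ∂(law V β n) := by
      rw [← integral_sub
        (Integrable.of_bound hYm.aestronglyMeasurable _ (Filter.Eventually.of_forall hYb))
        (Integrable.of_bound hk2.aestronglyMeasurable _ (Filter.Eventually.of_forall hk3))]
      refine setIntegral_congr_fun hTm fun l hl => ?_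
      have hle : ∀ i, |l i| ≤ 2 + e := hl.1
      simp only [← resolventFluct_conj]
      simp only [hX, loopFunctional, resolventFluct, fluct, hkF _ (hle _), ← hgdef]
      simp only [Finset.sum_const_zero, zero_add, mul_one, mul_zero, add_zero]
      ring
    rw [h3]
    refine (norm_sub_le _ _).trans ?_
    have h4 : ‖∫ l in T, ∑ a, h (l a) * k' (l a) ∂(law V β n)‖ ≤ n * (B * K') :=
      (norm_setIntegral_le_of_norm_le_const (measure_lt_top _ _) fun l _ => hk3 l).trans
        (mul_le_of_le_one_right (by positivity) measureReal_le_one)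
    have h5 : C₂ ≤ C₂ * n := le_mul_of_one_le_right hC₂0 hn1
    have h6 : 0 ≤ (C₀ + B) * n := by positivity
    calc _ ≤ C₂ + n * (B * K') := add_le_add hYT' h4
      _ ≤ (C₀ + C₂ + B * K' + B) * n := by linarith

end RegularSetting

end BetaEnsemble

namespace BetaEnsemble

/-! ### Second moments and means of the resolvent trace on typical configurations -/

lemma measurable_resolventFluct_left {μ : Measure ℝ} {n : ℕ} (z : ℂ) :
    Measurable fun l : Fin n → ℝ => resolventFluct μ l z := by
  unfold resolventFluct fluct
  refine Measurable.sub ?_ measurable_const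
  exact Finset.measurable_sum _ fun i _ => Measurable.inv (measurable_const.sub
      (Complex.measurable_ofReal.comp (measurable_pi_apply i)))

/-- Fubini reduces the averaged contour energy to pointwise second moments. The crude bound B serves
integrability only and does not enter the estimate. -/
lemma integrable_and_integral_contourEnergy_le {μ : Measure ℝ} [SFinite μ] {n : ℕ}
    {ν : Measure (Fin n → ℝ)} [IsFiniteMeasure ν] {r B Y : ℝ} (hr : 0 < r)
    (hB : ∀ᵐ l ∂ν, ∀ ζ ∈ contour r, ‖resolventFluct μ l ζ‖ ≤ B)
    (hY : ∀ ζ ∈ contour r, ∫ l, ‖resolventFluct μ l ζ‖ ^ 2 ∂ν ≤ Y) :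
    Integrable (fun l => contourEnergy μ r l) ν ∧
      ∫ l, contourEnergy μ r l ∂ν ≤ (contourMeasure r).real Set.univ * Y := by
  have hint : Integrable (Function.uncurry fun (l : Fin n → ℝ) (ζ : ℂ) =>
      ‖resolventFluct μ l ζ‖ ^ 2) (ν.prod (contourMeasure r)) := by
    refine Integrable.of_bound (C := B ^ 2)
      (measurable_resolventFluct.norm.pow_const 2).aestronglyMeasurable ?_
    have h1 : ∀ᵐ p ∂(ν.prod (contourMeasure r)), p.2 ∈ contour r :=
      Measure.quasiMeasurePreserving_snd.ae ((ae_contourMeasure hr).mono fun _ h => h.1)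
    have h2 : ∀ᵐ p ∂(ν.prod (contourMeasure r)), ∀ ζ ∈ contour r,
        ‖resolventFluct μ p.1 ζ‖ ≤ B := Measure.quasiMeasurePreserving_fst.ae hB
    filter_upwards [h1, h2] with p hp1 hp2
    rw [Function.uncurry, norm_pow, norm_norm]
    exact pow_le_pow_left₀ (norm_nonneg _) (hp2 _ hp1) 2
  refine ⟨hint.integral_prod_left, ?_⟩
  calc ∫ l, contourEnergy μ r l ∂ν
      = ∫ ζ, ∫ l, ‖resolventFluct μ l ζ‖ ^ 2 ∂ν ∂(contourMeasure r) :=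
        integral_integral_swap hint
    _ ≤ ∫ _ζ, Y ∂(contourMeasure r) := by
        refine integral_mono_of_nonneg (Filter.Eventually.of_forall fun _ =>
          integral_nonneg fun _ => by positivity) (integrable_const _) ?_
        filter_upwards [ae_contourMeasure hr] with ζ hζ using hY ζ hζ.1
    _ = _ := by simp

/-- If `X + w m` is nearly constant and `X` is nearly orthogonal to `m`, then the second moment of
`m` is small. -/
lemma integral_norm_sq_le_of_affine {α : Type*} [MeasurableSpace α] {ν : Measure α}
    [IsFiniteMeasure ν] (hν : ν.real Set.univ ≤ 1) {X m : α → ℂ} {J : α → ℝ} {w E : ℂ}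
    {B M C C' N a : ℝ} (hC : 0 ≤ C) (ha : 0 < a) (hN : 1 ≤ N) (hXm : Measurable X)
    (hXB : ∀ l, ‖X l‖ ≤ B) (hm : Measurable m) (hmM : ∀ᵐ l ∂ν, ‖m l‖ ≤ M) (hJ : Integrable J ν)
    (hJ0 : ∀ l, 0 ≤ J l) (hX1 : ∀ᵐ l ∂ν, ‖X l + w * m l - E‖ ≤ C * (1 + J l))
    (hE : ‖E‖ ≤ N * C') (hX3 : ‖∫ l, X l * conj (m l) ∂ν‖ ≤ C * N) (hw : a / 2 * N ≤ ‖w‖) :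
    N * (a / 4 * ∫ l, ‖m l‖ ^ 2 ∂ν) ≤ C * M * (∫ l, J l ∂ν) + N * (C + (C + C') ^ 2 / a) := by
  have hmi : Integrable m ν := Integrable.of_bound hm.aestronglyMeasurable M hmM
  have hm2i : Integrable (fun l => ‖m l‖ ^ 2) ν := by
    refine Integrable.of_bound (hm.norm.pow_const 2).aestronglyMeasurable (M ^ 2) ?_
    filter_upwards [hmM] with l hl
    rw [norm_pow, norm_norm]
    exact pow_le_pow_left₀ (norm_nonneg _) hl 2
  have hXi : Integrable (fun l => X l * conj (m l)) ν := by
    refine Integrable.bdd_mul (c := B) ?_ hXm.aestronglyMeasurable (Filter.Eventually.of_forall hXB)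
    exact (Complex.conjCLE : ℂ →L[ℝ] ℂ).integrable_comp hmi
  set C₃ := C + C' with hC₃
  have h1 : ‖∫ l, (w * (‖m l‖ ^ 2 : ℝ) + X l * conj (m l)) ∂ν‖ ≤
      C * M * (∫ l, J l ∂ν) + N * (a / 4 * (∫ l, ‖m l‖ ^ 2 ∂ν) + C₃ ^ 2 / a) := by
    have hmc : Integrable (fun l => a / 4 * ‖m l‖ ^ 2 + C₃ ^ 2 / a) ν :=
      (hm2i.const_mul _).add (integrable_const _)
    have hdi : Integrable (fun l => C * M * J l + N * (a / 4 * ‖m l‖ ^ 2 + C₃ ^ 2 / a)) ν :=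
      (hJ.const_mul _).add (hmc.const_mul _)
    refine (norm_integral_le_of_norm_le hdi ?_).trans ?_
    · filter_upwards [hX1, hmM] with l hl1 hl2
      have e1 : w * (‖m l‖ ^ 2 : ℝ) + X l * conj (m l) =
          (X l + w * m l - E + E) * conj (m l) := by
        rw [← Complex.normSq_eq_norm_sq, ← Complex.mul_conj]
        ring
      rw [e1, norm_mul, RCLike.norm_conj]
      -- Completing the square. The coefficient a/4 is half of the a/2 provided by w, so this part
      -- is absorbed by the left side.
      have e3 : C₃ * ‖m l‖ ≤ a / 4 * ‖m l‖ ^ 2 + C₃ ^ 2 / a := by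
        have : a / 4 * ‖m l‖ ^ 2 + C₃ ^ 2 / a - C₃ * ‖m l‖ = (a / 2 * ‖m l‖ - C₃) ^ 2 / a := by
          field_simp; ring
        have : 0 ≤ (a / 2 * ‖m l‖ - C₃) ^ 2 / a := by positivity
        linarith
      have e4 := hJ0 l
      calc _ ≤ (C * (1 + J l) + N * C') * ‖m l‖ := by
            gcongr
            exact (norm_add_le _ _).trans (add_le_add hl1 hE)
        _ ≤ (C * (N + J l) + N * C') * ‖m l‖ := by gcongr
        _ = C * J l * ‖m l‖ + N * (C₃ * ‖m l‖) := by rw [hC₃]; ring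
        _ ≤ C * J l * M + N * (a / 4 * ‖m l‖ ^ 2 + C₃ ^ 2 / a) := by gcongr
        _ = _ := by ring
    · have e5 : ∫ _l, C₃ ^ 2 / a ∂ν ≤ C₃ ^ 2 / a := by
        rw [integral_const, smul_eq_mul]
        exact mul_le_of_le_one_left (by positivity) hν
      rw [integral_add (hJ.const_mul _) (hmc.const_mul _), integral_const_mul,
        integral_const_mul, integral_add (hm2i.const_mul _) (integrable_const _),
        integral_const_mul]
      gcongr
  have hwi : Integrable (fun l => w * ((‖m l‖ ^ 2 : ℝ) : ℂ)) ν := hm2i.ofReal.const_mul w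
  have hof : ∫ l, ((‖m l‖ ^ 2 : ℝ) : ℂ) ∂ν = ((∫ l, ‖m l‖ ^ 2 ∂ν : ℝ) : ℂ) := integral_ofReal
  rw [integral_add hwi hXi, integral_const_mul, hof] at h1
  set I := ∫ l, ‖m l‖ ^ 2 ∂ν with hI
  have hI0 : 0 ≤ I := integral_nonneg fun _ => by positivity
  have e1 : w * (I : ℝ) = (w * (I : ℝ) + ∫ l, X l * conj (m l) ∂ν) - ∫ l, X l * conj (m l) ∂ν := by
    ring
  have e2 := norm_sub_le (w * (I : ℝ) + ∫ l, X l * conj (m l) ∂ν) (∫ l, X l * conj (m l) ∂ν)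
  rw [← e1, norm_mul, Complex.norm_real, Real.norm_of_nonneg hI0] at e2
  have e3 : a / 2 * N * I ≤ ‖w‖ * I := by gcongr
  have e4 := e2.trans (add_le_add h1 hX3)
  linarith

namespace RegularSetting

variable {V : ℝ → ℝ} {β : ℝ} {μ : Measure ℝ} {b : ℝ≥0} {ε L : ℝ} {W : ℂ → ℂ} {R : ℝ}
  (S : RegularSetting V β μ b ε L W R)
include S

/-- The loop equation improves a bound on the second moment by a factor `n ^ (-3 / 8)`. -/
theorem exists_second_moment_step {e A K c r r₁ R' : ℝ} (he : 0 < e) (hA : 0 ≤ A) (hK : 0 ≤ K)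
    (hc : 0 < c)
    (hT : ∀ n : ℕ, 2 ≤ n → sizeThreshold β ε 0 ≤ n →
      law V β n (typicalSet μ n e A)ᶜ ≤ ENNReal.ofReal (K * Real.exp (-(c * n))))
    (her : e < r) (hrR : r < R) (hr₁ : r < r₁) : ∃ C : ℝ, 0 ≤ C ∧ ∀ n : ℕ, 2 ≤ n →
      sizeThreshold β ε 0 ≤ n → ∀ Y : ℝ,
        (∀ ζ ∈ contour r, ∫ l in typicalSet μ n e A, ‖resolventFluct μ l ζ‖ ^ 2 ∂(law V β n) ≤ Y) →
        ∀ z, r₁ ≤ Metric.infDist z cut → Metric.infDist z cut ≤ R' →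
          ∫ l in typicalSet μ n e A, ‖resolventFluct μ l z‖ ^ 2 ∂(law V β n) ≤
            C * ((n : ℝ) ^ (-(3 / 8) : ℝ) * Y + 1) := by
  have hβ := S.beta_pos
  have hprob := S.density.prob
  have hr : 0 < r := he.trans her
  have hr₁0 : 0 < r₁ := hr.trans hr₁
  obtain ⟨C, hC, hloop⟩ := S.exists_loop_bound he hK hc hT her hrR hr₁
  obtain ⟨C₅, hC₅, hm⟩ := S.density.exists_resolventFluct_le he.le her
    (R := max R' r) (hr.le.trans (le_max_right _ _)) hA
  set Q := (contourMeasure r).real Set.univ with hQ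
  have hQ0 : 0 ≤ Q := measureReal_nonneg
  set C₃ := C * (1 + |1 - β / 2|) with hC₃
  set a := β * r₁ with ha
  have ha0 : 0 < a := by positivity
  refine ⟨4 / a * (C * C₅ * Q + (C + C₃ ^ 2 / a)), by positivity,
    fun n hn hthr Y hY z hz hzR => ?_⟩
  have hlaw := isProbabilityMeasure_law hβ S.continuous_V (S.integrable_weight hthr)
  have hn0 : n ≠ 0 := by omega
  have hn1 : (1 : ℝ) ≤ n := by exact_mod_cast (by omega : 1 ≤ n)
  have hnpos : (0 : ℝ) < n := by linarith
  have hTm := S.measurableSet_typicalSet hn0 e A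
  set T := typicalSet μ n e A with hTdef
  set ν := (law V β n).restrict T with hν
  have hν1 : ν.real Set.univ ≤ 1 := by
    rw [hν, measureReal_restrict_apply_univ]; exact measureReal_le_one
  obtain ⟨X, hXm, ⟨B, hXB⟩, hX1, -, hX3, hD⟩ := hloop n hn hthr z hz
  set m : (Fin n → ℝ) → ℂ := fun l => resolventFluct μ l z with hmdef
  have hmm : Measurable m := measurable_resolventFluct_left z
  set M := C₅ * (n : ℝ) ^ (5 / 8 : ℝ) with hM
  have hmM : ∀ᵐ l ∂ν, ‖m l‖ ≤ M := (ae_restrict_mem hTm).mono fun l hl =>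
    hm n hn l hl z (hr₁.le.trans hz) (hzR.trans (le_max_left _ _))
  have hcM : ∀ᵐ l ∂ν, ∀ ζ ∈ contour r, ‖resolventFluct μ l ζ‖ ≤ M :=
    (ae_restrict_mem hTm).mono fun l hl ζ hζ =>
      hm n hn l hl ζ (le_of_eq hζ.symm) ((le_of_eq hζ).trans (le_max_right _ _))
  obtain ⟨hJi, hJ⟩ := integrable_and_integral_contourEnergy_le hr hcM hY
  set J : (Fin n → ℝ) → ℝ := fun l => contourEnergy μ r l with hJdef
  have hJ0 : ∀ l, 0 ≤ J l := fun l => contourEnergy_nonneg r l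
  set D : ℂ := ∫ x : ℝ, deriv (loopTest W z) x ∂μ with hDdef
  set w : ℂ := β / 2 * n * sqrtX z with hw
  have hwn : a / 2 * n ≤ ‖w‖ := by
    rw [hw, norm_mul, norm_mul, norm_div, Complex.norm_real, Real.norm_of_nonneg hβ.le,
      Complex.norm_ofNat, Complex.norm_natCast, ha]
    have := hz.trans (infDist_cut_le_norm_sqrtX z)
    calc β * r₁ / 2 * n = β / 2 * n * r₁ := by ring
      _ ≤ _ := by gcongr
  have h3 := integral_norm_sq_le_of_affine hν1 (C' := |1 - β / 2| * C) (E := (1 - β / 2) * (n * D))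
    hC ha0 hn1 hXm hXB hmm hmM hJi hJ0 hX1 (by
      rw [show (1 - β / 2 : ℂ) = ((1 - β / 2 : ℝ) : ℂ) by push_cast; ring, norm_mul, norm_mul,
        Complex.norm_real, Real.norm_eq_abs, Complex.norm_natCast]
      calc |1 - β / 2| * (n * ‖D‖) ≤ |1 - β / 2| * (n * C) := by gcongr
        _ = n * (|1 - β / 2| * C) := by ring) hX3 hwn
  rw [show C + |1 - β / 2| * C = C₃ by rw [hC₃]; ring] at h3
  set I := ∫ l, ‖m l‖ ^ 2 ∂ν with hI
  -- The cubic term is the a priori bound n^(5/8) for one factor times the second moment on the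
  -- inner contour. Division by the n in front of the linear term yields the gain n^(-3/8).
  have h4 : M = n * (C₅ * (n : ℝ) ^ (-(3 / 8) : ℝ)) := by
    rw [hM, show (5 / 8 : ℝ) = 1 + -(3 / 8) by norm_num, Real.rpow_add hnpos, Real.rpow_one]
    ring
  have h5 : a / 4 * I ≤ C * C₅ * Q * ((n : ℝ) ^ (-(3 / 8) : ℝ) * Y) + (C + C₃ ^ 2 / a) := by
    refine le_of_mul_le_mul_left (h3.trans ?_) hnpos
    have e1 : C * M * ∫ l, J l ∂ν ≤ C * M * (Q * Y) := by gcongr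
    rw [h4] at e1 ⊢
    linarith
  have hYn : 0 ≤ (n : ℝ) ^ (-(3 / 8) : ℝ) * Y := by
    obtain ⟨ζ, hζ⟩ : (contour r).Nonempty := ⟨_, upper_mem_contour hr (x := 0) (by norm_num)⟩
    have : 0 ≤ Y := (integral_nonneg fun _ => by positivity).trans (hY ζ hζ)
    positivity
  have h6 : 0 ≤ C * C₅ * Q := by positivity
  have h7 : 0 ≤ C + C₃ ^ 2 / a := by positivity
  calc I = 4 / a * (a / 4 * I) := by field_simp
    _ ≤ 4 / a * (C * C₅ * Q * ((n : ℝ) ^ (-(3 / 8) : ℝ) * Y) + (C + C₃ ^ 2 / a)) := by gcongr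
    _ ≤ 4 / a * ((C * C₅ * Q + (C + C₃ ^ 2 / a)) * ((n : ℝ) ^ (-(3 / 8) : ℝ) * Y + 1)) := by
        gcongr
        nlinarith
    _ = _ := by ring

end RegularSetting

end BetaEnsemble

namespace BetaEnsemble

namespace RegularSetting

variable {V : ℝ → ℝ} {β : ℝ} {μ : Measure ℝ} {b : ℝ≥0} {ε L : ℝ} {W : ℂ → ℂ} {R : ℝ}
  (S : RegularSetting V β μ b ε L W R)
include S

/-- The start is the square of the a priori bound, of order n^(5/4). Each step uses the previous
bound on a contour strictly closer to the cut, midway between e and the admissible distance, so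
finitely many steps fit into the available room. -/
lemma exists_second_moment_le_rpow {e A K c : ℝ} (he : 0 < e) (heR : e < R) (hA : 0 ≤ A)
    (hK : 0 ≤ K) (hc : 0 < c)
    (hT : ∀ n : ℕ, 2 ≤ n → sizeThreshold β ε 0 ≤ n →
      law V β n (typicalSet μ n e A)ᶜ ≤ ENNReal.ofReal (K * Real.exp (-(c * n)))) (k : ℕ) :
    ∀ r : ℝ, e < r → ∃ C : ℝ, 0 ≤ C ∧ ∀ n : ℕ, 2 ≤ n → sizeThreshold β ε 0 ≤ n →
      ∀ z, r ≤ Metric.infDist z cut → Metric.infDist z cut ≤ R →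
        ∫ l in typicalSet μ n e A, ‖resolventFluct μ l z‖ ^ 2 ∂(law V β n) ≤
          C * ((n : ℝ) ^ (5 / 4 - 3 / 8 * k : ℝ) + 1) := by
  have hβ := S.beta_pos
  induction k with
  | zero =>
    intro r her
    obtain ⟨C, hC, hm⟩ := S.density.exists_resolventFluct_le he.le her S.R_pos.le hA
    refine ⟨C ^ 2, by positivity, fun n hn hthr z hz hzR => ?_⟩
    have hlaw := isProbabilityMeasure_law hβ S.continuous_V (S.integrable_weight hthr)
    have hTm := S.measurableSet_typicalSet (show n ≠ 0 by omega) e A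
    set T := typicalSet μ n e A
    have h1 : ∀ l ∈ T, ‖(‖resolventFluct μ l z‖ ^ 2 : ℝ)‖ ≤ C ^ 2 * (n : ℝ) ^ (5 / 4 : ℝ) :=
      fun l hl => by
        have h2 := hm n hn l hl z hz hzR
        rw [norm_pow, norm_norm]
        calc ‖resolventFluct μ l z‖ ^ 2 ≤ (C * (n : ℝ) ^ (5 / 8 : ℝ)) ^ 2 := by gcongr
          _ = C ^ 2 * (n : ℝ) ^ (5 / 4 : ℝ) := by
            rw [mul_pow, ← Real.rpow_natCast ((n : ℝ) ^ (5 / 8 : ℝ)) 2,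
              ← Real.rpow_mul (by positivity)]
            norm_num
    have h3 := norm_setIntegral_le_of_norm_le_const (measure_lt_top (law V β n) T) h1
    rw [Real.norm_of_nonneg (integral_nonneg fun _ => by positivity)] at h3
    refine h3.trans ((mul_le_of_le_one_right (by positivity) measureReal_le_one).trans ?_)
    simp only [Nat.cast_zero, mul_zero, sub_zero]
    gcongr
    linarith
  | succ k ih =>
    intro r₁ her₁
    set r := (e + min r₁ R) / 2 with hr
    have h1 : e < min r₁ R := lt_min her₁ heR
    have her : e < r := by rw [hr]; linarith
    have hrm : r < min r₁ R := by rw [hr]; linarith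
    have hrR : r < R := hrm.trans_le (min_le_right _ _)
    have hr₁ : r < r₁ := hrm.trans_le (min_le_left _ _)
    obtain ⟨C₁, hC₁, ih⟩ := ih r her
    obtain ⟨C₂, hC₂, hstep⟩ := S.exists_second_moment_step (R' := R) he hA hK hc hT her hrR hr₁
    refine ⟨C₂ * (C₁ + 1), by positivity, fun n hn hthr z hz hzR => ?_⟩
    have hn1 : (1 : ℝ) ≤ n := by exact_mod_cast (by omega : 1 ≤ n)
    refine (hstep n hn hthr _ (fun ζ hζ => ih n hn hthr ζ (le_of_eq hζ.symm)
      ((le_of_eq hζ).trans hrR.le)) z hz hzR).trans ?_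
    rw [mul_assoc]
    gcongr
    have h2 : (n : ℝ) ^ (-(3 / 8) : ℝ) * (n : ℝ) ^ (5 / 4 - 3 / 8 * k : ℝ) =
        (n : ℝ) ^ (5 / 4 - 3 / 8 * (k + 1 : ℕ) : ℝ) := by
      rw [← Real.rpow_add (by linarith)]
      congr 1
      push_cast
      ring
    have h3 : (n : ℝ) ^ (-(3 / 8) : ℝ) ≤ 1 := Real.rpow_le_one_of_one_le_of_nonpos hn1 (by norm_num)
    have h4 : 0 ≤ (n : ℝ) ^ (5 / 4 - 3 / 8 * (k + 1 : ℕ) : ℝ) := by positivity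
    calc (n : ℝ) ^ (-(3 / 8) : ℝ) * (C₁ * ((n : ℝ) ^ (5 / 4 - 3 / 8 * k : ℝ) + 1)) + 1
        = C₁ * ((n : ℝ) ^ (-(3 / 8) : ℝ) * (n : ℝ) ^ (5 / 4 - 3 / 8 * k : ℝ)) +
          (C₁ * (n : ℝ) ^ (-(3 / 8) : ℝ) + 1) := by ring
      _ ≤ C₁ * (n : ℝ) ^ (5 / 4 - 3 / 8 * (k + 1 : ℕ) : ℝ) + (C₁ * 1 + 1) := by
        rw [h2]; gcongr
      _ ≤ _ := by linarith

lemma exists_second_moment_le {e A K c : ℝ} (he : 0 < e) (heR : e < R) (hA : 0 ≤ A)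
    (hK : 0 ≤ K) (hc : 0 < c)
    (hT : ∀ n : ℕ, 2 ≤ n → sizeThreshold β ε 0 ≤ n →
      law V β n (typicalSet μ n e A)ᶜ ≤ ENNReal.ofReal (K * Real.exp (-(c * n)))) {r : ℝ}
    (her : e < r) : ∃ C : ℝ, 0 ≤ C ∧ ∀ n : ℕ, 2 ≤ n → sizeThreshold β ε 0 ≤ n →
      ∀ z, r ≤ Metric.infDist z cut → Metric.infDist z cut ≤ R →
        ∫ l in typicalSet μ n e A, ‖resolventFluct μ l z‖ ^ 2 ∂(law V β n) ≤ C := by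
  -- Four steps suffice: 5/4 - 4 · 3/8 is negative.
  obtain ⟨C, hC, h⟩ := S.exists_second_moment_le_rpow he heR hA hK hc hT 4 r her
  refine ⟨C * 2, by positivity, fun n hn hthr z hz hzR => (h n hn hthr z hz hzR).trans ?_⟩
  have hn1 : (1 : ℝ) ≤ n := by exact_mod_cast (by omega : 1 ≤ n)
  have : (n : ℝ) ^ (5 / 4 - 3 / 8 * (4 : ℕ) : ℝ) ≤ 1 :=
    Real.rpow_le_one_of_one_le_of_nonpos hn1 (by norm_num)
  gcongr
  linarith

/-- The mean of the centred resolvent trace on typical configurations. -/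
lemma exists_mean_bound {e A K c : ℝ} (he : 0 < e) (heR : e < R) (hA : 0 ≤ A)
    (hK : 0 ≤ K) (hc : 0 < c)
    (hT : ∀ n : ℕ, 2 ≤ n → sizeThreshold β ε 0 ≤ n →
      law V β n (typicalSet μ n e A)ᶜ ≤ ENNReal.ofReal (K * Real.exp (-(c * n)))) {r₁ : ℝ}
    (her₁ : e < r₁) : ∃ C : ℝ, 0 ≤ C ∧ ∀ n : ℕ, 2 ≤ n → sizeThreshold β ε 0 ≤ n →
      ∀ z, r₁ ≤ Metric.infDist z cut → Metric.infDist z cut ≤ R →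
        ‖(∫ l in typicalSet μ n e A, resolventFluct μ l z ∂(law V β n)) -
          (2 / β - 1) * (∫ x : ℝ, deriv (loopTest W z) x ∂μ) / sqrtX z‖ ≤ C / n := by
  have hβ := S.beta_pos
  have hprob := S.density.prob
  set r := (e + min r₁ R) / 2 with hrdef
  have h1 : e < min r₁ R := lt_min her₁ heR
  have her : e < r := by rw [hrdef]; linarith
  have hrm : r < min r₁ R := by rw [hrdef]; linarith
  have hrR : r < R := hrm.trans_le (min_le_right _ _)
  have hr₁ : r < r₁ := hrm.trans_le (min_le_left _ _)
  have hr : 0 < r := he.trans her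
  have hr₁0 : 0 < r₁ := hr.trans hr₁
  obtain ⟨C, hC, hloop⟩ := S.exists_loop_bound he hK hc hT her hrR hr₁
  obtain ⟨C₂, hC₂, hsec⟩ := S.exists_second_moment_le he heR hA hK hc hT her
  obtain ⟨C₅, hC₅, hm⟩ := S.density.exists_resolventFluct_le he.le her S.R_pos.le hA
  set Q := (contourMeasure r).real Set.univ with hQ
  have hQ0 : 0 ≤ Q := measureReal_nonneg
  set C₆ := C * (1 + Q * C₂) + C + |1 - β / 2| * C * (K * (6 / c ^ 3)) with hC₆
  refine ⟨C₆ * (2 / (β * r₁)), by positivity, fun n hn hthr z hz hzR => ?_⟩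
  have hlaw := isProbabilityMeasure_law hβ S.continuous_V (S.integrable_weight hthr)
  have hn0 : n ≠ 0 := by omega
  have hn1 : (1 : ℝ) ≤ n := by exact_mod_cast (by omega : 1 ≤ n)
  have hnpos : (0 : ℝ) < n := by linarith
  have hTm := S.measurableSet_typicalSet hn0 e A
  have hTn := hT n hn hthr
  obtain ⟨X, hXm, ⟨B, hXB⟩, hX1, hX2, -, hD⟩ := hloop n hn hthr z hz
  have hmM : ∀ᵐ l ∂(law V β n).restrict (typicalSet μ n e A),
      ‖resolventFluct μ l z‖ ≤ C₅ * (n : ℝ) ^ (5 / 8 : ℝ) :=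
    (ae_restrict_mem hTm).mono fun l hl => hm n hn l hl z (hr₁.le.trans hz) hzR
  have hcM : ∀ᵐ l ∂(law V β n).restrict (typicalSet μ n e A), ∀ ζ ∈ contour r,
      ‖resolventFluct μ l ζ‖ ≤ C₅ * (n : ℝ) ^ (5 / 8 : ℝ) :=
    (ae_restrict_mem hTm).mono fun l hl ζ hζ =>
      hm n hn l hl ζ (le_of_eq hζ.symm) ((le_of_eq hζ).trans hrR.le)
  obtain ⟨hJi, hJ⟩ := integrable_and_integral_contourEnergy_le hr hcM fun ζ hζ =>
    hsec n hn hthr ζ (le_of_eq hζ.symm) ((le_of_eq hζ).trans hrR.le)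
  set ν := (law V β n).restrict (typicalSet μ n e A) with hν
  have hmi : Integrable (fun l => resolventFluct μ l z) ν :=
    Integrable.of_bound (measurable_resolventFluct_left z).aestronglyMeasurable _ hmM
  have hXi : Integrable X ν :=
    Integrable.of_bound hXm.aestronglyMeasurable _ (Filter.Eventually.of_forall hXB)
  set D : ℂ := ∫ x : ℝ, deriv (loopTest W z) x ∂μ with hDdef
  set w : ℂ := β / 2 * n * sqrtX z with hw
  set E : ℂ := (1 - β / 2) * (n * D) with hE
  set t := ν.real Set.univ with ht
  have ht1 : t ≤ 1 := by
    rw [ht, hν, measureReal_restrict_apply_univ]; exact measureReal_le_one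
  have ht2 : 1 - t ≤ K * Real.exp (-(c * n)) := by
    rw [ht, hν, measureReal_restrict_apply_univ, ← probReal_compl_eq_one_sub hTm, Measure.real,
      ← ENNReal.toReal_ofReal (show 0 ≤ K * Real.exp (-(c * n)) by positivity)]
    exact ENNReal.toReal_mono ENNReal.ofReal_ne_top hTn
  have hEn : ‖E‖ ≤ |1 - β / 2| * (n * C) := by
    rw [hE, show (1 - β / 2 : ℂ) = ((1 - β / 2 : ℝ) : ℂ) by push_cast; ring, norm_mul, norm_mul,
      Complex.norm_real, Real.norm_eq_abs, Complex.norm_natCast]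
    gcongr
  have e1 : ‖∫ l, (X l + w * resolventFluct μ l z - E) ∂ν‖ ≤ C * (1 + Q * C₂) := by
    have hdi : Integrable (fun l => C * (1 + contourEnergy μ r l)) ν :=
      ((integrable_const _).add hJi).const_mul _
    refine (norm_integral_le_of_norm_le hdi hX1).trans ?_
    rw [integral_const_mul, integral_add (integrable_const _) hJi, integral_const, smul_eq_mul,
      mul_one]
    gcongr
  have e2 : ∫ l, (X l + w * resolventFluct μ l z - E) ∂ν =
      (∫ l, X l ∂ν) + w * (∫ l, resolventFluct μ l z ∂ν) - t * E := by
    have i1 : Integrable (fun l => w * resolventFluct μ l z) ν := hmi.const_mul w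
    rw [integral_sub (hXi.fun_add i1) (integrable_const _), integral_add hXi i1, integral_const_mul,
      integral_const, Complex.real_smul]
  -- The constant E is averaged over typical configurations only, of mass t. Since E is O(n) and 1 -
  -- t is exponentially small, the defect is bounded.
  have e3 : ‖((1 - t : ℝ) : ℂ) * E‖ ≤ |1 - β / 2| * C * (K * (6 / c ^ 3)) := by
    rw [norm_mul, Complex.norm_real, Real.norm_of_nonneg (by linarith)]
    have e4 : (n : ℝ) ≤ n ^ 3 := le_self_pow₀ hn1 (by norm_num)
    calc (1 - t) * ‖E‖ ≤ K * Real.exp (-(c * n)) * (|1 - β / 2| * (n * C)) := by gcongr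
      _ = |1 - β / 2| * C * (K * (n * Real.exp (-(c * n)))) := by ring
      _ ≤ |1 - β / 2| * C * (K * ((n : ℝ) ^ 3 * Real.exp (-(c * n)))) := by gcongr
      _ ≤ _ := by
        gcongr
        exact natCast_pow_three_mul_exp_neg_le hc n
  set m₀ := ∫ l, resolventFluct μ l z ∂ν with hm₀
  have e5 : ‖w * m₀ - E‖ ≤ C₆ := by
    have e6 : w * m₀ - E = (∫ l, (X l + w * resolventFluct μ l z - E) ∂ν) - (∫ l, X l ∂ν) -
        ((1 - t : ℝ) : ℂ) * E := by
      rw [e2]; push_cast; ring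
    rw [e6]
    exact (norm_sub_le _ _).trans (add_le_add ((norm_sub_le _ _).trans (add_le_add e1 hX2)) e3)
  have hq : r₁ ≤ ‖sqrtX z‖ := hz.trans (infDist_cut_le_norm_sqrtX z)
  have hq0 : sqrtX z ≠ 0 := norm_pos_iff.1 (hr₁0.trans_le hq)
  have hβc : (β : ℂ) ≠ 0 := by exact_mod_cast hβ.ne'
  have hnc : (n : ℂ) ≠ 0 := by exact_mod_cast hn0
  have hw0 : w ≠ 0 := by rw [hw]; simp [hβc, hnc, hq0]
  have hwn : β * r₁ / 2 * n ≤ ‖w‖ := by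
    rw [hw, norm_mul, norm_mul, norm_div, Complex.norm_real, Real.norm_of_nonneg hβ.le,
      Complex.norm_ofNat, Complex.norm_natCast]
    calc β * r₁ / 2 * n = β / 2 * n * r₁ := by ring
      _ ≤ _ := by gcongr
  have e7 : m₀ - (2 / β - 1) * D / sqrtX z = w⁻¹ * (w * m₀ - E) := by
    rw [mul_sub, inv_mul_cancel_left₀ hw0, hw, hE]
    field_simp
  rw [e7, norm_mul, norm_inv]
  have hwpos : 0 < β * r₁ / 2 * n := by positivity
  calc ‖w‖⁻¹ * ‖w * m₀ - E‖ ≤ (β * r₁ / 2 * n)⁻¹ * C₆ := by gcongr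
    _ = C₆ * (2 / (β * r₁)) / n := by field_simp

end RegularSetting

end BetaEnsemble

namespace BetaEnsemble

/-! ### Linear statistics of functions analytic near the cut -/

lemma sq_integral_le {α : Type*} [MeasurableSpace α] {ν : Measure α} [IsFiniteMeasure ν]
    {f : α → ℝ} (hf : Integrable f ν) (hf2 : Integrable (fun x => f x ^ 2) ν) :
    (∫ x, f x ∂ν) ^ 2 ≤ ν.real Set.univ * ∫ x, f x ^ 2 ∂ν := by
  set Q := ν.real Set.univ with hQ
  set s := ∫ x, f x ∂ν with hs
  have hQ0 : 0 ≤ Q := measureReal_nonneg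
  have h1 : ∫ x, (Q * f x - s) ^ 2 ∂ν = Q * (Q * (∫ x, f x ^ 2 ∂ν) - s ^ 2) := by
    have i1 : Integrable (fun x => Q ^ 2 * f x ^ 2) ν := hf2.const_mul _
    have i2 : Integrable (fun x => 2 * Q * s * f x) ν := hf.const_mul _
    have i3 : Integrable (fun x => Q ^ 2 * f x ^ 2 - 2 * Q * s * f x) ν := i1.sub i2
    have e1 : (fun x => (Q * f x - s) ^ 2) =
        fun x => Q ^ 2 * f x ^ 2 - 2 * Q * s * f x + s ^ 2 := by funext x; ring
    rw [e1, integral_add i3 (integrable_const _), integral_sub i1 i2,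
      integral_const_mul, integral_const_mul, integral_const, smul_eq_mul, ← hs, ← hQ]
    ring
  have h2 : 0 ≤ ∫ x, (Q * f x - s) ^ 2 ∂ν := integral_nonneg fun _ => by positivity
  rw [h1] at h2
  rcases hQ0.eq_or_lt with h0 | hpos
  · have : ν = 0 := by
      rw [← Measure.measure_univ_eq_zero]
      exact (measureReal_eq_zero_iff).1 h0.symm
    rw [hs, this]; simp
  · linarith [nonneg_of_mul_nonneg_right h2 hpos]

/-- Cauchy's formula followed by Cauchy-Schwarz on the contour, so only the values of F on the
contour enter. -/
lemma BoundedDensity.sq_norm_fluct_le {μ : Measure ℝ} {b : ℝ≥0} (h : BoundedDensity μ b) {n : ℕ}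
    {l : Fin n → ℝ} {r r' B : ℝ} (hr : 0 < r) (hrr : r < r') (hl : ∀ i, |l i| < 2 + r)
    {F : ℂ → ℂ} (hF : DifferentiableOn ℂ F {z | Metric.infDist z cut < r'})
    (hB : ∀ z ∈ contour r, ‖F z‖ ≤ B) :
    ‖fluct μ l fun x => F x‖ ^ 2 ≤
      B ^ 2 * (contourMeasure r).real Set.univ * contourEnergy μ r l := by
  have hmc := h.continuousOn_resolventFluct hr hl
  have i1 : Integrable (fun ζ => ‖resolventFluct μ l ζ‖) (contourMeasure r) :=
    (integrable_contourMeasure hr hmc).norm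
  have i2 : Integrable (fun ζ => ‖resolventFluct μ l ζ‖ ^ 2) (contourMeasure r) := by
    have := (integrable_contourMeasure hr (hmc.pow 2)).norm
    simpa only [Pi.pow_apply, norm_pow] using this
  rw [h.fluct_eq_cauchyIntegral hr hl hrr hF]
  have h1 : ‖cauchyIntegral r fun ζ => F ζ * resolventFluct μ l ζ‖ ≤
      B * ∫ ζ, ‖resolventFluct μ l ζ‖ ∂(contourMeasure r) := by
    refine (norm_cauchyIntegral_le hr).trans ?_
    rw [← integral_const_mul]
    refine integral_mono_of_nonneg (Filter.Eventually.of_forall fun _ => norm_nonneg _)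
      (i1.const_mul _) ?_
    filter_upwards [ae_contourMeasure hr] with ζ hζ
    rw [norm_mul]
    gcongr
    exact hB ζ hζ.1
  calc _ ≤ (B * ∫ ζ, ‖resolventFluct μ l ζ‖ ∂(contourMeasure r)) ^ 2 := by gcongr
    _ = B ^ 2 * (∫ ζ, ‖resolventFluct μ l ζ‖ ∂(contourMeasure r)) ^ 2 := by ring
    _ ≤ B ^ 2 * ((contourMeasure r).real Set.univ * contourEnergy μ r l) := by
      gcongr
      exact sq_integral_le i1 i2
    _ = _ := by ring

namespace RegularSetting

variable {V : ℝ → ℝ} {β : ℝ} {μ : Measure ℝ} {b : ℝ≥0} {ε L : ℝ} {W : ℂ → ℂ} {R : ℝ}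
  (S : RegularSetting V β μ b ε L W R)
include S

lemma continuousOn_integral_deriv_loopTest {r : ℝ} (hr : 0 < r) :
    ContinuousOn (fun z => ∫ x : ℝ, deriv (loopTest W z) x ∂μ) (contour r) := by
  have hprob := S.density.prob
  set r₀ := min r R / 2 with hr₀
  have hm : 0 < min r R := lt_min hr S.R_pos
  have hr₀0 : 0 < r₀ := by positivity
  have hr₀m : r₀ < min r R := by rw [hr₀]; linarith
  have hr₀r : r₀ < r := hr₀m.trans_le (min_le_left _ _)
  obtain ⟨B, hB0, hB⟩ := S.exists_loopTest_le (hr₀m.trans_le (min_le_right _ _)) hr₀r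
  have hmem : ∀ x ∈ Set.Icc (-2 : ℝ) 2, (x : ℂ) ∈ cutNhd r₀ := fun x hx =>
    (infDist_cut_ofReal_le_iff hr₀0.le x).2 (abs_lt_two_add hr₀0 hx).le
  refine continuousOn_of_dominated (bound := fun _ => B) (fun z _ => ?_) (fun z hz => ?_)
    (integrable_const _) ?_
  · exact ((measurable_deriv _).comp Complex.measurable_ofReal).aestronglyMeasurable
  · filter_upwards [S.density.ae_mem] with x hx
    exact (hB z (le_of_eq hz.symm) x (hmem x hx)).2
  · filter_upwards [S.density.ae_mem] with x hx
    have hd : DifferentiableAt ℂ (fun ζ => (P W ζ)⁻¹) x :=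
      ((differentiableOn_P S.R_pos S.analytic).fun_inv S.P_ne_zero).differentiableAt
        ((isOpen_infDist_cut_lt R).mem_nhds (show Metric.infDist (x : ℂ) cut < R from
          lt_of_le_of_lt (hmem x hx) (hr₀m.trans_le (min_le_right _ _))))
    have hne : ∀ z ∈ contour r, z - x ≠ 0 := fun z hz =>
      sub_ne_zero_of_mem_cutNhd (hr₀r.trans_eq hz.symm) (hmem x hx)
    have h1 : Set.EqOn (fun z => deriv (loopTest W z) x)
        (fun z => deriv (fun ζ => (P W ζ)⁻¹) x * (z - x)⁻¹ + (P W x)⁻¹ * (z - x)⁻¹ ^ 2)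
        (contour r) := fun z hz =>
      (hd.hasDerivAt.fun_mul (hasDerivAt_inv_sub (hne z hz))).deriv
    refine ContinuousOn.congr ?_ h1
    have h2 : ContinuousOn (fun z : ℂ => (z - x)⁻¹) (contour r) :=
      ContinuousOn.inv₀ (by fun_prop) hne
    exact (continuousOn_const.fun_mul h2).fun_add (continuousOn_const.fun_mul (h2.fun_pow 2))

/-- The mean of the derivative of the test function as a contour integral. -/
lemma integral_deriv_loopTest_eq {r : ℝ} (hr : 0 < r) (hrR : r < R) {z : ℂ}
    (hz : r < Metric.infDist z cut) :
    ∫ x : ℝ, deriv (loopTest W z) x ∂μ =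
      cauchyIntegral r fun ζ => deriv (fun ζ : ℂ => ∫ x : ℝ, (ζ - x)⁻¹ ∂μ) ζ / (P W ζ * (ζ - z)) := by
  have hprob := S.density.prob
  have hrρ : r < min R (Metric.infDist z cut) := lt_min hrR hz
  have hψd := S.differentiableOn_loopTest z
  have hψc := continuousOn_contour_of_differentiableOn hrρ hψd
  have h1 : ∫ x : ℝ, deriv (loopTest W z) x ∂μ =
      ∫ x : ℝ, cauchyIntegral r (fun ζ => loopTest W z ζ * ((ζ - x) ^ 2)⁻¹) ∂μ := by
    refine integral_congr_ae ?_
    filter_upwards [S.density.ae_mem] with x hx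
    exact (cauchyIntegral_mul_inv_sub_sq hr hrρ hψd (abs_lt_two_add hr hx)).symm
  rw [h1, ← cauchyIntegral_mul_integral (k := fun ζ (x : ℝ) => ((ζ - x) ^ 2)⁻¹) hr hψc
    (B := (r ^ 2)⁻¹) (Measurable.aestronglyMeasurable (by unfold Function.uncurry; fun_prop)) ?_]
  · refine cauchyIntegral_congr hr fun ζ hζ => ?_
    have hζr : 0 < Metric.infDist ζ cut := lt_of_lt_of_eq hr (Eq.symm hζ)
    rw [(hasDerivAt_integral_inv_sub S.density.ae_mem hζr).deriv, loopTest, ← neg_sub ζ z, inv_neg,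
      div_eq_mul_inv, mul_inv]
    ring
  · filter_upwards [S.density.ae_mem] with x hx ζ hζ
    rw [norm_inv, norm_pow]
    have : r ≤ ‖ζ - x‖ := (le_of_eq (Eq.symm hζ)).trans (infDist_cut_le hx ζ)
    gcongr

end RegularSetting

end BetaEnsemble

namespace BetaEnsemble

namespace RegularSetting

variable {V : ℝ → ℝ} {β : ℝ} {μ : Measure ℝ} {b : ℝ≥0} {ε L : ℝ} {W : ℂ → ℂ} {R : ℝ}
  (S : RegularSetting V β μ b ε L W R)
include S

/-- Mean and second moment, on typical configurations, of centred linear statistics. -/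
theorem exists_fluct_bound {e A K c r : ℝ} (he : 0 < e) (heR : e < R) (hA : 0 ≤ A)
    (hK : 0 ≤ K) (hc : 0 < c)
    (hT : ∀ n : ℕ, 2 ≤ n → sizeThreshold β ε 0 ≤ n →
      law V β n (typicalSet μ n e A)ᶜ ≤ ENNReal.ofReal (K * Real.exp (-(c * n))))
    (her : e < r) (hrR : r < R) : ∃ C : ℝ, 0 ≤ C ∧ ∀ n : ℕ, 2 ≤ n → sizeThreshold β ε 0 ≤ n →
      ∀ (F : ℂ → ℂ) (B : ℝ), DifferentiableOn ℂ F {z | Metric.infDist z cut < R} →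
        (∀ z ∈ contour r, ‖F z‖ ≤ B) →
        ‖(∫ l in typicalSet μ n e A, fluct μ l (fun x => F x) ∂(law V β n)) -
          (2 / β - 1) * cauchyIntegral r (fun z => F z / sqrtX z *
            ∫ x : ℝ, deriv (loopTest W z) x ∂μ)‖ ≤ C / n * B ∧
        ∫ l in typicalSet μ n e A, ‖fluct μ l (fun x => F x)‖ ^ 2 ∂(law V β n) ≤ C * B ^ 2 := by
  have hβ := S.beta_pos
  have hprob := S.density.prob
  have hr : 0 < r := he.trans her
  obtain ⟨C₁, hC₁, hmean⟩ := S.exists_mean_bound he heR hA hK hc hT her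
  obtain ⟨C₂, hC₂, hsec⟩ := S.exists_second_moment_le he heR hA hK hc hT her
  obtain ⟨C₅, hC₅, hm⟩ := S.density.exists_resolventFluct_le he.le her S.R_pos.le hA
  set Q := (contourMeasure r).real Set.univ with hQ
  have hQ0 : 0 ≤ Q := measureReal_nonneg
  refine ⟨C₁ * Q + Q * (Q * C₂), by positivity, fun n hn hthr F B hF hB => ?_⟩
  have hlaw := isProbabilityMeasure_law hβ S.continuous_V (S.integrable_weight hthr)
  have hn0 : n ≠ 0 := by omega
  have hTm := S.measurableSet_typicalSet hn0 e A
  have hB0 : 0 ≤ B := by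
    obtain ⟨ζ, hζ⟩ : (contour r).Nonempty := ⟨_, upper_mem_contour hr (x := 0) (by norm_num)⟩
    exact (norm_nonneg _).trans (hB ζ hζ)
  have hFc := continuousOn_contour_of_differentiableOn hrR hF
  have hle : ∀ l ∈ typicalSet μ n e A, ∀ i, |l i| < 2 + r := fun l hl i =>
    (hl.1 i).trans_lt (by linarith)
  have hmM : ∀ l ∈ typicalSet μ n e A, ∀ ζ ∈ contour r,
      ‖resolventFluct μ l ζ‖ ≤ C₅ * (n : ℝ) ^ (5 / 8 : ℝ) := fun l hl ζ hζ =>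
    hm n hn l hl ζ (le_of_eq hζ.symm) ((le_of_eq hζ).trans hrR.le)
  have hcM : ∀ᵐ l ∂(law V β n).restrict (typicalSet μ n e A), ∀ ζ ∈ contour r,
      ‖resolventFluct μ l ζ‖ ≤ C₅ * (n : ℝ) ^ (5 / 8 : ℝ) := (ae_restrict_mem hTm).mono hmM
  obtain ⟨hJi, hJ⟩ := integrable_and_integral_contourEnergy_le hr hcM fun ζ hζ =>
    hsec n hn hthr ζ (le_of_eq hζ.symm) ((le_of_eq hζ).trans hrR.le)
  have hmc : ContinuousOn (fun z => ∫ l in typicalSet μ n e A, resolventFluct μ l z ∂(law V β n))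
      (contour r) := by
    refine continuousOn_of_dominated (bound := fun _ => C₅ * (n : ℝ) ^ (5 / 8 : ℝ))
      (fun z _ => (measurable_resolventFluct_left z).aestronglyMeasurable)
      (fun z hz => hcM.mono fun l hl => hl z hz) (integrable_const _) ?_
    filter_upwards [ae_restrict_mem hTm] with l hl
    exact S.density.continuousOn_resolventFluct hr (hle l hl)
  have hsq : ∀ z ∈ contour r, sqrtX z ≠ 0 := fun z hz =>
    sqrtX_ne_zero (hr.trans_eq (Eq.symm hz))
  have hcor : ContinuousOn (fun z => F z / sqrtX z * ∫ x : ℝ, deriv (loopTest W z) x ∂μ)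
      (contour r) :=
    (ContinuousOn.div hFc (continuousOn_sqrtX hr) hsq).mul
      (S.continuousOn_integral_deriv_loopTest hr)
  constructor
  · have h1 : ∫ l in typicalSet μ n e A, fluct μ l (fun x => F x) ∂(law V β n) =
        cauchyIntegral r (fun z => F z *
          ∫ l in typicalSet μ n e A, resolventFluct μ l z ∂(law V β n)) := by
      rw [cauchyIntegral_mul_integral (k := fun z l => resolventFluct μ l z) hr hFc
        ((measurable_resolventFluct (μ := μ) (n := n)).comp
          measurable_swap).aestronglyMeasurable hcM]
      exact setIntegral_congr_fun hTm fun l hl =>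
        S.density.fluct_eq_cauchyIntegral hr (hle l hl) hrR hF
    have h2 : ContinuousOn (fun z => (2 / β - 1 : ℂ) *
        (F z / sqrtX z * ∫ x : ℝ, deriv (loopTest W z) x ∂μ)) (contour r) :=
      continuousOn_const.mul hcor
    have h3 : ContinuousOn (fun z => F z *
        ∫ l in typicalSet μ n e A, resolventFluct μ l z ∂(law V β n)) (contour r) := hFc.mul hmc
    rw [h1, ← cauchyIntegral_const_mul, ← cauchyIntegral_sub hr h3 h2]
    refine (norm_cauchyIntegral_le_of_bound (B := B * (C₁ / n)) hr fun z hz => ?_).trans ?_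
    · have h4 := hmean n hn hthr z (le_of_eq hz.symm) ((le_of_eq hz).trans hrR.le)
      have h5 : F z * (∫ l in typicalSet μ n e A, resolventFluct μ l z ∂(law V β n)) -
          (2 / β - 1) * (F z / sqrtX z * ∫ x : ℝ, deriv (loopTest W z) x ∂μ) =
          F z * ((∫ l in typicalSet μ n e A, resolventFluct μ l z ∂(law V β n)) -
            (2 / β - 1) * (∫ x : ℝ, deriv (loopTest W z) x ∂μ) / sqrtX z) := by ring
      rw [h5, norm_mul]
      exact mul_le_mul (hB z hz) h4 (norm_nonneg _) hB0
    · rw [← hQ]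
      have : 0 ≤ Q * (Q * C₂) / n * B := by positivity
      calc B * (C₁ / n) * Q = C₁ * Q / n * B := by ring
        _ ≤ C₁ * Q / n * B + Q * (Q * C₂) / n * B := by linarith
        _ = _ := by ring
  · calc ∫ l in typicalSet μ n e A, ‖fluct μ l (fun x => F x)‖ ^ 2 ∂(law V β n)
        ≤ ∫ l in typicalSet μ n e A, B ^ 2 * Q * contourEnergy μ r l ∂(law V β n) := by
          refine integral_mono_of_nonneg (Filter.Eventually.of_forall fun _ => by positivity)
            (hJi.const_mul _) ?_
          filter_upwards [ae_restrict_mem hTm] with l hl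
          exact S.density.sq_norm_fluct_le hr hrR (hle l hl) hF hB
      _ ≤ B ^ 2 * Q * (Q * C₂) := by
          rw [integral_const_mul]
          gcongr
      _ ≤ (C₁ * Q + Q * (Q * C₂)) * B ^ 2 := by
          have : 0 ≤ C₁ * Q * B ^ 2 := by positivity
          linarith

end RegularSetting

end BetaEnsemble

namespace BetaEnsemble

/-! ### Adding the exceptional configurations -/

section

variable {Ω : Type*} [MeasurableSpace Ω] {ν : Measure Ω} [IsProbabilityMeasure ν]

lemma integral_norm_sub_integral_sq_le {Y : Ω → ℂ} (hY : MemLp Y 2 ν) :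
    ∫ ω, ‖Y ω - ∫ ω', Y ω' ∂ν‖ ^ 2 ∂ν ≤ 4 * ∫ ω, ‖Y ω‖ ^ 2 ∂ν := by
  have h1 : Integrable (fun ω => ‖Y ω‖ ^ 2) ν := (memLp_two_iff_integrable_sq_norm hY.1).1 hY
  have h2 : Integrable Y ν := hY.integrable one_le_two
  set a := ∫ ω, Y ω ∂ν with ha
  have h3 : ‖a‖ ^ 2 ≤ ∫ ω, ‖Y ω‖ ^ 2 ∂ν := by
    have h4 := sq_integral_le h2.norm h1
    rw [probReal_univ, one_mul] at h4
    exact (pow_le_pow_left₀ (norm_nonneg _) (norm_integral_le_integral_norm _) 2).trans h4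
  have h5 : Integrable (fun ω => 2 * ‖Y ω‖ ^ 2 + 2 * ‖a‖ ^ 2) ν :=
    (h1.const_mul 2).add (integrable_const _)
  calc ∫ ω, ‖Y ω - a‖ ^ 2 ∂ν ≤ ∫ ω, (2 * ‖Y ω‖ ^ 2 + 2 * ‖a‖ ^ 2) ∂ν := by
        refine integral_mono_of_nonneg (Filter.Eventually.of_forall fun _ => by positivity) h5
          (Filter.Eventually.of_forall fun ω => ?_)
        have := norm_sub_le (Y ω) a
        simp only
        nlinarith [sq_nonneg (‖Y ω‖ - ‖a‖), norm_nonneg (Y ω - a), norm_nonneg a,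
          norm_nonneg (Y ω)]
    _ = 2 * (∫ ω, ‖Y ω‖ ^ 2 ∂ν) + 2 * ‖a‖ ^ 2 := by
        rw [integral_add (h1.const_mul 2) (integrable_const _), integral_const_mul]; simp
    _ ≤ _ := by linarith

/-- Moments of a variable that is controlled on a set of large measure. -/
lemma moments_le_of_compl {Y : Ω → ℂ} {G : Ω → ℝ} {T : Set Ω} {a M δ η : ℝ} (ha : 0 ≤ a)
    (hM : 0 ≤ M) (hY : Measurable Y) (hT : MeasurableSet T)
    (hYG : ∀ ω, ‖Y ω‖ ≤ a + M * G ω) (hδ : ν.real Tᶜ ≤ δ)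
    (hGi : Integrable (fun ω => G ω ^ 2) ν) (hη : ∫ ω, G ω ^ 2 ∂ν ≤ η) :
    MemLp Y 2 ν ∧ ‖(∫ ω, Y ω ∂ν) - ∫ ω in T, Y ω ∂ν‖ ≤ a * δ + M * (δ + η) ∧
      ∫ ω, ‖Y ω‖ ^ 2 ∂ν ≤ (∫ ω in T, ‖Y ω‖ ^ 2 ∂ν) + (2 * a ^ 2 * δ + 2 * M ^ 2 * η) := by
  have h1 : ∀ ω, ‖Y ω‖ ^ 2 ≤ 2 * a ^ 2 + 2 * M ^ 2 * G ω ^ 2 := fun ω =>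
    (pow_le_pow_left₀ (norm_nonneg _) (hYG ω) 2).trans
      (by nlinarith [sq_nonneg (a - M * G ω)])
  have hbi : Integrable (fun ω => 2 * a ^ 2 + 2 * M ^ 2 * G ω ^ 2) ν :=
    (integrable_const _).add (hGi.const_mul _)
  have hY2 : Integrable (fun ω => ‖Y ω‖ ^ 2) ν := by
    refine Integrable.mono' hbi (hY.norm.pow_const 2).aestronglyMeasurable
      (Filter.Eventually.of_forall fun ω => ?_)
    rw [norm_pow, norm_norm]
    exact h1 ω
  have hmem : MemLp Y 2 ν := (memLp_two_iff_integrable_sq_norm hY.aestronglyMeasurable).2 hY2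
  have hYi : Integrable Y ν := hmem.integrable one_le_two
  have hG2 : ∫ ω in Tᶜ, G ω ^ 2 ∂ν ≤ η :=
    (setIntegral_le_integral hGi (Filter.Eventually.of_forall fun _ => by positivity)).trans hη
  refine ⟨hmem, ?_, ?_⟩
  · have e1 : (∫ ω, Y ω ∂ν) - ∫ ω in T, Y ω ∂ν = ∫ ω in Tᶜ, Y ω ∂ν := by
      rw [← integral_add_compl hT hYi]; ring
    have i1 : Integrable (fun ω => a + M * (1 + G ω ^ 2)) ν :=
      (integrable_const _).add (((integrable_const _).add hGi).const_mul _)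
    rw [e1]
    refine (norm_integral_le_of_norm_le i1.integrableOn
      (Filter.Eventually.of_forall fun ω => (hYG ω).trans ?_)).trans
      (b := ∫ ω in Tᶜ, (a + M * (1 + G ω ^ 2)) ∂ν) ?_
    · gcongr
      nlinarith [sq_nonneg (G ω - 1)]
    · have i2 : Integrable (fun ω => 1 + G ω ^ 2) (ν.restrict Tᶜ) :=
        ((integrable_const _).add hGi).integrableOn
      rw [integral_add (integrable_const _) (i2.const_mul _), integral_const_mul,
        integral_add (integrable_const _) hGi.integrableOn, integral_const, integral_const,
        measureReal_restrict_apply_univ, smul_eq_mul, smul_eq_mul, mul_one, mul_comm a]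
      gcongr
  · rw [← integral_add_compl hT hY2]
    gcongr
    refine (integral_mono hY2.integrableOn hbi.integrableOn h1).trans ?_
    rw [integral_add (integrable_const _) (hGi.integrableOn.const_mul _), integral_const_mul (2 * M ^ 2),
      integral_const, measureReal_restrict_apply_univ, smul_eq_mul, mul_comm (ν.real Tᶜ)]
    exact add_le_add (mul_le_mul_of_nonneg_left hδ (by positivity))
      (mul_le_mul_of_nonneg_left hG2 (by positivity))

end

lemma natCast_sq_mul_exp_neg_le {c : ℝ} (hc : 0 < c) (n : ℕ) :
    (n : ℝ) ^ 2 * Real.exp (-(c * n)) ≤ 8 / c ^ 2 * Real.exp (-(c / 4 * n)) := by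
  have h1 := EquilibriumSetting.natCast_mul_exp_neg_le hc n
  have h2 := EquilibriumSetting.natCast_mul_exp_neg_le (half_pos hc) n
  have hn : (0 : ℝ) ≤ n := by positivity
  have hc' : 0 ≤ 2 / c := by positivity
  calc (n : ℝ) ^ 2 * Real.exp (-(c * n)) = n * (n * Real.exp (-(c * n))) := by ring
    _ ≤ n * (2 / c * Real.exp (-(c / 2 * n))) := by gcongr
    _ = 2 / c * (n * Real.exp (-(c / 2 * n))) := by ring
    _ ≤ 2 / c * (2 / (c / 2) * Real.exp (-(c / 2 / 2 * n))) := by gcongr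
    _ = _ := by rw [show c / 2 / 2 = c / 4 by ring]; field_simp; ring

/-- The contribution of the eigenvalues far from the cut. -/
noncomputable def farSum (V : ℝ → ℝ) (κ e : ℝ) {n : ℕ} (l : Fin n → ℝ) : ℝ :=
  ∑ i, {x : ℝ | 2 + e < |x|}.indicator (fun x => Real.exp (κ * V x)) (l i)

lemma measurable_farSum {V : ℝ → ℝ} (hV : Continuous V) (κ e : ℝ) (n : ℕ) :
    Measurable fun l : Fin n → ℝ => farSum V κ e l := by
  have hm : MeasurableSet {x : ℝ | 2 + e < |x|} := measurableSet_lt measurable_const (by fun_prop)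
  exact Finset.measurable_sum _ fun i _ =>
    (Measurable.indicator (by fun_prop) hm).comp (measurable_pi_apply i)

/-- Cauchy-Schwarz over the n eigenvalues turns the square of the sum into a sum of exp(2κV), which
is why the tail bounds are stated with the factor 2κ. The resulting n² is absorbed by lowering the
rate. -/
lemma EquilibriumSetting.exists_farSum_bound {V : ℝ → ℝ} {β : ℝ} {μ : Measure ℝ} {b : ℝ≥0}
    {ε L : ℝ} (S : EquilibriumSetting V β μ b ε L) {e κ : ℝ} (he : 0 < e) (hκ : 0 ≤ κ) :
    ∃ K c : ℝ, 0 ≤ K ∧ 0 < c ∧ ∀ n : ℕ, 2 ≤ n → sizeThreshold β ε κ ≤ n →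
      Integrable (fun l => farSum V κ e l ^ 2) (law V β n) ∧
      ∫ l, farSum V κ e l ^ 2 ∂(law V β n) ≤ K * Real.exp (-(c * n)) := by
  obtain ⟨K, c, hK, hc, h⟩ := S.exists_tail_bound he hκ
  refine ⟨8 / c ^ 2 * K, c / 4, by positivity, by positivity, fun n hn hthr => ?_⟩
  have hV := S.continuous_V
  have hlaw := isProbabilityMeasure_law S.beta_pos hV
    (S.integrable_weight ((sizeThreshold_mono S.beta_pos S.eps_pos hκ).trans hthr))
  have hm : MeasurableSet {x : ℝ | 2 + e < |x|} := measurableSet_lt measurable_const (by fun_prop)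
  set φ : ℝ → ℝ := {x : ℝ | 2 + e < |x|}.indicator (fun x => Real.exp (2 * κ * V x)) with hφ
  have hφm : Measurable φ := Measurable.indicator (by fun_prop) hm
  have hφ0 : ∀ x, 0 ≤ φ x := fun x => Set.indicator_nonneg (fun _ _ => (Real.exp_pos _).le) x
  have hsq : ∀ x, ({x : ℝ | 2 + e < |x|}.indicator (fun x => Real.exp (κ * V x)) x) ^ 2 = φ x := by
    intro x
    by_cases hx : x ∈ {x : ℝ | 2 + e < |x|}
    · rw [hφ, Set.indicator_of_mem hx, Set.indicator_of_mem hx, ← Real.exp_nat_mul]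
      congr 1; push_cast; ring
    · rw [hφ, Set.indicator_of_notMem hx, Set.indicator_of_notMem hx]; norm_num
  have hlin : ∀ i : Fin n, ∫⁻ l, ENNReal.ofReal (φ (l i)) ∂(law V β n) ≤
      ENNReal.ofReal (K * Real.exp (-(c * n))) := fun i => by
    refine le_trans (le_of_eq ?_) (h n hn hthr i)
    congr 1; funext l
    by_cases hx : l i ∈ {x : ℝ | 2 + e < |x|}
    · rw [hφ, Set.indicator_of_mem hx, Set.indicator_of_mem hx]
    · rw [hφ, Set.indicator_of_notMem hx, Set.indicator_of_notMem hx, ENNReal.ofReal_zero]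
  have hφi : ∀ i : Fin n, Integrable (fun l : Fin n → ℝ => φ (l i)) (law V β n) := fun i => by
    refine ⟨(hφm.comp (measurable_pi_apply i)).aestronglyMeasurable, ?_⟩
    rw [hasFiniteIntegral_iff_ofReal (Filter.Eventually.of_forall fun l => hφ0 _)]
    exact (hlin i).trans_lt ENNReal.ofReal_lt_top
  have hφI : ∀ i : Fin n, ∫ l, φ (l i) ∂(law V β n) ≤ K * Real.exp (-(c * n)) := fun i => by
    rw [integral_eq_lintegral_of_nonneg_ae (Filter.Eventually.of_forall fun l => hφ0 _)
      (hφi i).1]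
    exact ENNReal.toReal_le_of_le_ofReal (by positivity) (hlin i)
  have hle : ∀ l : Fin n → ℝ, farSum V κ e l ^ 2 ≤ n * ∑ i, φ (l i) := fun l => by
    have := sq_sum_le_card_mul_sum_sq (s := Finset.univ) (f := fun i : Fin n =>
      {x : ℝ | 2 + e < |x|}.indicator (fun x => Real.exp (κ * V x)) (l i))
    simp only [hsq, Finset.card_univ, Fintype.card_fin] at this
    exact this
  have hsum : Integrable (fun l : Fin n → ℝ => n * ∑ i, φ (l i)) (law V β n) :=
    (integrable_finsetSum _ fun i _ => hφi i).const_mul _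
  have hint : Integrable (fun l => farSum V κ e l ^ 2) (law V β n) :=
    hsum.mono' ((measurable_farSum hV κ e n).pow_const 2).aestronglyMeasurable
      (Filter.Eventually.of_forall fun l => by
        rw [Real.norm_of_nonneg (by positivity)]; exact hle l)
  refine ⟨hint, (integral_mono hint hsum hle).trans ?_⟩
  rw [integral_const_mul, integral_finsetSum _ fun i _ => hφi i]
  calc (n : ℝ) * ∑ i : Fin n, ∫ l, φ (l i) ∂(law V β n)
      ≤ n * ∑ _i : Fin n, K * Real.exp (-(c * n)) := by
        gcongr with i
        exact hφI i
    _ = K * ((n : ℝ) ^ 2 * Real.exp (-(c * n))) := by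
        rw [Finset.sum_const, Finset.card_univ, Fintype.card_fin, nsmul_eq_mul]; ring
    _ ≤ K * (8 / c ^ 2 * Real.exp (-(c / 4 * n))) := by
        exact mul_le_mul_of_nonneg_left (natCast_sq_mul_exp_neg_le hc n) hK
    _ = _ := by ring

end BetaEnsemble

namespace BetaEnsemble

lemma notMem_cutNhd_iff {r : ℝ} (hr : 0 ≤ r) (x : ℝ) : (x : ℂ) ∉ cutNhd r ↔ 2 + r < |x| := by
  rw [← not_le, ← infDist_cut_ofReal_le_iff hr x]; rfl

lemma norm_le_add_indicator {V : ℝ → ℝ} {F : ℂ → ℂ} {r B M κ : ℝ} (hr : 0 ≤ r) (hM : 0 ≤ M)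
    (hB0 : 0 ≤ B) (hB : ∀ z ∈ cutNhd r, ‖F z‖ ≤ B)
    (hFM : ∀ x : ℝ, (x : ℂ) ∉ cutNhd r → ‖F x‖ ≤ M * Real.exp (κ * V x)) (x : ℝ) :
    ‖F x‖ ≤ B + M * {x : ℝ | 2 + r < |x|}.indicator (fun x => Real.exp (κ * V x)) x := by
  by_cases hx : (x : ℂ) ∈ cutNhd r
  · have : 0 ≤ {x : ℝ | 2 + r < |x|}.indicator (fun x => Real.exp (κ * V x)) x :=
      Set.indicator_nonneg (fun _ _ => (Real.exp_pos _).le) x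
    have h1 := hB _ hx
    have : 0 ≤ M * {x : ℝ | 2 + r < |x|}.indicator (fun x => Real.exp (κ * V x)) x := by
      positivity
    linarith
  · rw [Set.indicator_of_mem (show x ∈ {x : ℝ | 2 + r < |x|} from (notMem_cutNhd_iff hr x).1 hx)]
    linarith [hFM x hx]

namespace RegularSetting

variable {V : ℝ → ℝ} {β : ℝ} {μ : Measure ℝ} {b : ℝ≥0} {ε L : ℝ} {W : ℂ → ℂ} {R : ℝ}
  (S : RegularSetting V β μ b ε L W R)
include S

omit S in
lemma norm_fluct_le_farSum (hd : BoundedDensity μ b) {F : ℂ → ℂ} {r B M κ : ℝ} (hr : 0 < r)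
    (hM : 0 ≤ M) (hB0 : 0 ≤ B) (hB : ∀ z ∈ cutNhd r, ‖F z‖ ≤ B)
    (hFM : ∀ x : ℝ, (x : ℂ) ∉ cutNhd r → ‖F x‖ ≤ M * Real.exp (κ * V x)) {n : ℕ}
    (l : Fin n → ℝ) : ‖fluct μ l fun x => F x‖ ≤ 2 * n * B + M * farSum V κ r l := by
  have hprob := hd.prob
  have h1 : ‖∑ i, F (l i)‖ ≤ n * B + M * farSum V κ r l := by
    refine (norm_sum_le_of_le _ fun i _ =>
      norm_le_add_indicator hr.le hM hB0 hB hFM (l i)).trans (le_of_eq ?_)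
    rw [Finset.sum_add_distrib, ← Finset.mul_sum, farSum]
    simp
  have h2 : ‖∫ x : ℝ, F x ∂μ‖ ≤ B := by
    refine (norm_integral_le_of_norm_le_const (C := B) ?_).trans (by simp)
    filter_upwards [hd.ae_mem] with x hx
    exact hB x ((infDist_cut_ofReal_le_iff hr.le x).2 (abs_lt_two_add hr hx).le)
  have h3 : ‖(n : ℂ) * ∫ x : ℝ, F x ∂μ‖ ≤ n * B := by
    rw [norm_mul, Complex.norm_natCast]; gcongr
  rw [fluct]
  linarith [norm_sub_le (∑ i, F (l i)) ((n : ℂ) * ∫ x : ℝ, F x ∂μ)]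

/-- Mean and variance of linear statistics. -/
theorem exists_linStat_bound {d : ℝ} (hd : 0 < d) (hdR : 2 * d < R) : ∃ C : ℝ, 0 ≤ C ∧
    ∀ κ : ℝ, 0 ≤ κ → ∃ K c : ℝ, 0 ≤ K ∧ 0 < c ∧ ∀ n : ℕ, 2 ≤ n → sizeThreshold β ε κ ≤ n →
      ∀ (F : ℂ → ℂ) (B M : ℝ), 0 ≤ M → DifferentiableOn ℂ F {z | Metric.infDist z cut < R} →
        Measurable (fun x : ℝ => F x) → (∀ z ∈ cutNhd (2 * d), ‖F z‖ ≤ B) →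
        (∀ x : ℝ, (x : ℂ) ∉ cutNhd (2 * d) → ‖F x‖ ≤ M * Real.exp (κ * V x)) →
        MemLp (linStat F n) 2 (law V β n) ∧
        ‖(∫ l, linStat F n l ∂(law V β n)) - (n * (∫ x : ℝ, F x ∂μ) +
          (2 / β - 1) * cauchyIntegral (2 * d) (fun z => F z / sqrtX z *
            ∫ x : ℝ, deriv (loopTest W z) x ∂μ))‖ ≤ C / n * B + K * Real.exp (-(c * n)) * M ∧
        ∫ l, ‖linStat F n l - ∫ l', linStat F n l' ∂(law V β n)‖ ^ 2 ∂(law V β n) ≤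
          C * B ^ 2 + K * Real.exp (-(c * n)) * M ^ 2 := by
  have hβ := S.beta_pos
  have he : 0 < d / 2 := by linarith
  -- Typical eigenvalues lie within d/2 of the cut, well inside the contour at distance 2d. The
  -- typical set does not involve κ, so the constant C is fixed before κ.
  obtain ⟨A, K₁, c₁, hA, hK₁, hc₁, hT⟩ := S.exists_typicalSet he
  obtain ⟨C, hC, hfl⟩ := S.exists_fluct_bound he (by linarith) hA hK₁ hc₁ hT
    (show d / 2 < 2 * d by linarith) hdR
  refine ⟨4 * C + 200 * K₁ / c₁ ^ 3, by positivity, fun κ hκ => ?_⟩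
  obtain ⟨K₂, c₂, hK₂, hc₂, hfar⟩ := S.exists_farSum_bound (e := 2 * d) (by linarith) hκ
  refine ⟨8 * (K₁ + K₂), min c₁ c₂, by positivity, lt_min hc₁ hc₂,
    fun n hn hthr F B M hM hF hFm hB hFM => ?_⟩
  have hthr0 := (EquilibriumSetting.sizeThreshold_mono hβ S.eps_pos hκ).trans hthr
  have hlaw := isProbabilityMeasure_law hβ S.continuous_V (S.integrable_weight hthr0)
  have hTm := S.measurableSet_typicalSet (show n ≠ 0 by omega) (d / 2) A
  obtain ⟨hGi, hGI⟩ := hfar n hn hthr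
  have hn0 : (0 : ℝ) < n := by exact_mod_cast (by omega : 0 < n)
  have hB0 : 0 ≤ B := (norm_nonneg _).trans (hB ((0 : ℝ) : ℂ)
    ((infDist_cut_ofReal_le_iff (by linarith) 0).2 (by simp; linarith)))
  obtain ⟨hf1, hf2⟩ := hfl n hn hthr0 F B hF fun z hz => hB z (le_of_eq hz)
  have hδ : (law V β n).real (typicalSet μ n (d / 2) A)ᶜ ≤ K₁ * Real.exp (-(c₁ * n)) := by
    rw [Measure.real]
    exact ENNReal.toReal_le_of_le_ofReal (by positivity) (hT n hn hthr0)
  have hNm : Measurable (linStat F n) :=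
    Finset.measurable_sum _ fun i _ => hFm.comp (measurable_pi_apply i)
  set a : ℂ := n * ∫ x : ℝ, F x ∂μ with ha
  have hY : ∀ l, fluct μ l (fun x => F x) = linStat F n l - a := fun l => rfl
  obtain ⟨hmem, hm1, hm2⟩ := moments_le_of_compl (ν := law V β n)
    (Y := fun l => fluct μ l fun x => F x) (a := 2 * n * B) (by positivity) hM
    (hNm.sub_const a) hTm
    (norm_fluct_le_farSum S.density (by linarith) hM hB0 hB hFM) hδ hGi hGI
  have hNmem : MemLp (linStat F n) 2 (law V β n) := by
    refine (hmem.add (memLp_const a)).ae_eq (Filter.Eventually.of_forall fun l => ?_)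
    simp only [Pi.add_apply, hY, sub_add_cancel]
  have hNi := hNmem.integrable one_le_two
  have hEY : ∫ l, fluct μ l (fun x => F x) ∂(law V β n) = (∫ l, linStat F n l ∂(law V β n)) - a := by
    simp only [hY]
    rw [integral_sub hNi (integrable_const _)]; simp
  have hexp₁ : Real.exp (-(c₁ * n)) ≤ Real.exp (-(min c₁ c₂ * n)) := by
    gcongr; exact min_le_left _ _
  have hexp₂ : Real.exp (-(c₂ * n)) ≤ Real.exp (-(min c₁ c₂ * n)) := by
    gcongr; exact min_le_right _ _
  have hexp₃ := natCast_pow_three_mul_exp_neg_le hc₁ n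
  set E := Real.exp (-(min c₁ c₂ * n)) with hE
  have hE0 : 0 < E := Real.exp_pos _
  have hnn : (n : ℝ) ^ 2 * Real.exp (-(c₁ * n)) ≤ 6 / c₁ ^ 3 := by
    refine le_trans ?_ hexp₃
    gcongr
    · exact_mod_cast (by omega : 1 ≤ n)
    · norm_num
  refine ⟨hNmem, ?_, ?_⟩
  · set I := cauchyIntegral (2 * d) (fun z => F z / sqrtX z *
      ∫ x : ℝ, deriv (loopTest W z) x ∂μ)
    have e1 : (∫ l, linStat F n l ∂(law V β n)) - (a + (2 / β - 1) * I) =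
        ((∫ l, fluct μ l (fun x => F x) ∂(law V β n)) -
          ∫ l in typicalSet μ n (d / 2) A, fluct μ l (fun x => F x) ∂(law V β n)) +
        ((∫ l in typicalSet μ n (d / 2) A, fluct μ l (fun x => F x) ∂(law V β n)) -
          (2 / β - 1) * I) := by
      rw [hEY]; ring
    rw [e1]
    refine (norm_add_le _ _).trans ((add_le_add hm1 hf1).trans ?_)
    have e2 : 2 * n * B * (K₁ * Real.exp (-(c₁ * n))) ≤ 12 * K₁ / c₁ ^ 3 / n * B := by
      rw [show 12 * K₁ / c₁ ^ 3 / n * B = 2 * B * K₁ * (6 / c₁ ^ 3) / n by ring, le_div_iff₀ hn0]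
      calc _ = 2 * B * K₁ * ((n : ℝ) ^ 2 * Real.exp (-(c₁ * n))) := by ring
        _ ≤ _ := by gcongr
    have e3 : M * (K₁ * Real.exp (-(c₁ * n)) + K₂ * Real.exp (-(c₂ * n))) ≤
        M * (K₁ * E + K₂ * E) := by gcongr
    have e4 : 0 ≤ C / n * B := by positivity
    have e5 : 0 ≤ K₁ / c₁ ^ 3 / n * B := by positivity
    have e6 : 0 ≤ (K₁ + K₂) * E * M := by positivity
    have e7 : (4 * C + 200 * K₁ / c₁ ^ 3) / n * B =
        4 * (C / n * B) + 200 * (K₁ / c₁ ^ 3 / n * B) := by ring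
    have e8 : 12 * K₁ / c₁ ^ 3 / n * B = 12 * (K₁ / c₁ ^ 3 / n * B) := by ring
    rw [e7]
    rw [e8] at e2
    linarith
  · have e1 := integral_norm_sub_integral_sq_le hmem
    have e2 : ∀ l, fluct μ l (fun x => F x) - ∫ l', fluct μ l' (fun x => F x) ∂(law V β n) =
        linStat F n l - ∫ l', linStat F n l' ∂(law V β n) := fun l => by
      rw [hEY, hY]; ring
    simp only [e2] at e1
    refine e1.trans ?_
    have e3 : 2 * (2 * n * B) ^ 2 * (K₁ * Real.exp (-(c₁ * n))) ≤ 48 * (K₁ / c₁ ^ 3 * B ^ 2) := by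
      calc _ = 8 * B ^ 2 * K₁ * ((n : ℝ) ^ 2 * Real.exp (-(c₁ * n))) := by ring
        _ ≤ 8 * B ^ 2 * K₁ * (6 / c₁ ^ 3) := by gcongr
        _ = _ := by ring
    have e4 : 2 * M ^ 2 * (K₂ * Real.exp (-(c₂ * n))) ≤ 2 * M ^ 2 * (K₂ * E) := by gcongr
    have e5 : 0 ≤ K₁ / c₁ ^ 3 * B ^ 2 := by positivity
    have e6 : 0 ≤ K₁ * E * M ^ 2 := by positivity
    have e7 : (4 * C + 200 * K₁ / c₁ ^ 3) * B ^ 2 =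
        4 * (C * B ^ 2) + 200 * (K₁ / c₁ ^ 3 * B ^ 2) := by ring
    rw [e7]
    linarith

end RegularSetting

end BetaEnsemble

namespace BetaEnsemble

/-! ### From the hypotheses on the potential to the abstract setting -/

/-- Compactness gives some room beyond a closed neighbourhood, so contours at its boundary distance
lie in the interior of the domain of analyticity. -/
lemma exists_infDist_cut_lt_subset {U : Set ℂ} (hU : IsOpen U) {r : ℝ} (h : cutNhd r ⊆ U) :
    ∃ R, r < R ∧ {z | Metric.infDist z cut < R} ⊆ U := by
  have hK : IsCompact (cutNhd (r + 1) ∩ Uᶜ) := (isCompact_cutNhd _).inter_right hU.isClosed_compl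
  rcases (cutNhd (r + 1) ∩ Uᶜ).eq_empty_or_nonempty with h0 | hne
  · refine ⟨r + 1, by linarith, fun z (hz : Metric.infDist z cut < r + 1) => ?_⟩
    by_contra hzU
    have : z ∈ cutNhd (r + 1) ∩ Uᶜ := ⟨hz.le, hzU⟩
    rw [h0] at this
    exact this
  · obtain ⟨w, hw, hmin⟩ := hK.exists_isMinOn hne
      (Metric.continuous_infDist_pt cut).continuousOn
    have hwr : r < Metric.infDist w cut := by
      by_contra hcon
      exact hw.2 (h (not_lt.1 hcon))
    refine ⟨min (Metric.infDist w cut) (r + 1), lt_min hwr (by linarith), fun z hz => ?_⟩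
    have hz' : Metric.infDist z cut < min (Metric.infDist w cut) (r + 1) := hz
    by_contra hzU
    have h1 := hmin (show z ∈ cutNhd (r + 1) ∩ Uᶜ from
      ⟨(hz'.trans_le (min_le_right _ _)).le, hzU⟩)
    exact absurd (hz'.trans_le (min_le_left _ _)) (not_lt.2 h1)

lemma cutNhd_zero_subset {U : Set ℂ} (h : cut ⊆ U) : cutNhd 0 ⊆ U := fun z hz => by
  have h0 : Metric.infDist z cut = 0 := le_antisymm hz Metric.infDist_nonneg
  exact h ((isCompact_cut.isClosed.mem_iff_infDist_zero cut_nonempty).2 h0)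

/-- The measure with density `ρ`. -/
noncomputable def densityMeasure (ρ : ℝ → ℝ) : Measure ℝ :=
  volume.withDensity fun x => ENNReal.ofReal (ρ x)

section

variable {V ρ : ℝ → ℝ}

lemma integral_densityMeasure {E : Type*} [NormedAddCommGroup E] [NormedSpace ℝ E]
    (hρ : IsEquilibriumDensity V ρ) (F : ℝ → E) :
    ∫ x, F x ∂(densityMeasure ρ) = ∫ x, ρ x • F x := by
  rw [densityMeasure, integral_withDensity_eq_integral_toReal_smul₀
    hρ.integrable.1.aemeasurable.ennreal_ofReal
    (Filter.Eventually.of_forall fun _ => ENNReal.ofReal_lt_top)]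
  simp only [ENNReal.toReal_ofReal (hρ.nonneg _)]

lemma boundedDensity_densityMeasure (hρ : IsEquilibriumDensity V ρ)
    (hsupp : tsupport ρ = Set.Icc (-2) 2) {b : ℝ≥0} (hb : ∀ x ∈ Set.Icc (-2 : ℝ) 2, ρ x ≤ b) :
    BoundedDensity (densityMeasure ρ) b := by
  refine ⟨⟨?_⟩, ?_, ?_⟩
  · rw [densityMeasure, withDensity_apply _ MeasurableSet.univ, Measure.restrict_univ,
      ← ofReal_integral_eq_lintegral_ofReal hρ.integrable
        (Filter.Eventually.of_forall hρ.nonneg), hρ.integral_eq_one, ENNReal.ofReal_one]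
  · rw [densityMeasure, ae_withDensity_iff' hρ.integrable.1.aemeasurable.ennreal_ofReal]
    refine Filter.Eventually.of_forall fun x hx => ?_
    rw [← hsupp]
    refine subset_tsupport _ fun h0 => hx ?_
    rw [h0, ENNReal.ofReal_zero]
  · rw [densityMeasure, ← withDensity_const]
    refine withDensity_mono (Filter.Eventually.of_forall fun x => ?_)
    by_cases hx : x ∈ Set.Icc (-2 : ℝ) 2
    · exact ENNReal.ofReal_le_of_le_toReal (by simpa using hb x hx)
    · have h0 : ρ x = 0 := image_eq_zero_of_notMem_tsupport (by rwa [hsupp])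
      simp only [h0, ENNReal.ofReal_zero]
      exact zero_le

lemma effPotential_eq (hρ : IsEquilibriumDensity V ρ) (x : ℝ) :
    effPotential V ρ x = 2 * logPot (densityMeasure ρ) x - V x := by
  rw [effPotential, logPot, integral_densityMeasure hρ]
  simp only [smul_eq_mul, mul_comm]

lemma stieltjes_eq (hρ : IsEquilibriumDensity V ρ) :
    stieltjes ρ = fun z : ℂ => ∫ x : ℝ, (z - x)⁻¹ ∂(densityMeasure ρ) := by
  funext z
  rw [integral_densityMeasure hρ, stieltjes]
  simp only [Complex.real_smul, div_eq_mul_inv]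

lemma exists_density_le {D : Set ℂ} {W : ℂ → ℂ} (hD : IsOpen D) (hcut : cut ⊆ D)
    (hW : AnalyticOnNhd ℂ W D)
    (hρP : ∀ x ∈ Set.Icc (-2 : ℝ) 2,
      ρ x = 1 / (2 * Real.pi) * (P W x).re * Real.sqrt (4 - x ^ 2)) :
    ∃ b : ℝ≥0, ∀ x ∈ Set.Icc (-2 : ℝ) 2, ρ x ≤ b := by
  obtain ⟨R, hR, hRD⟩ := exists_infDist_cut_lt_subset hD (cutNhd_zero_subset hcut)
  have hPc : ContinuousOn (fun x : ℝ => P W x) (Set.Icc (-2 : ℝ) 2) :=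
    (differentiableOn_P hR (hW.mono hRD)).continuousOn.comp
      Complex.continuous_ofReal.continuousOn fun x hx => ofReal_mem_region hR hx
  have hρc : ContinuousOn ρ (Set.Icc (-2 : ℝ) 2) := by
    refine ContinuousOn.congr (f := fun x : ℝ =>
      1 / (2 * Real.pi) * (P W x).re * Real.sqrt (4 - x ^ 2)) ?_ hρP
    exact (continuousOn_const.mul (Complex.continuous_re.comp_continuousOn hPc)).mul
      (by fun_prop)
  obtain ⟨B, hB⟩ := isCompact_Icc.exists_bound_of_continuousOn hρc
  refine ⟨⟨|B|, abs_nonneg B⟩, fun x hx => ?_⟩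
  exact (le_abs_self _).trans ((hB x hx).trans (le_abs_self B))

/-- The effective potential equals its maximum almost everywhere for μ, so the maximum is its
μ-average, expressed by the energy and the mean of V. These are the quantities in Jensen's bound for
the partition function. -/
lemma equilibriumSetting {β ε L : ℝ} (hβ : 0 < β) (hV : Continuous V) (hε : 0 < ε)
    (hgrowth : ∀ x : ℝ, L ≤ |x| → 2 * (1 + ε) * Real.log (1 + |x|) ≤ V x)
    (hρ : IsEquilibriumDensity V ρ) {b : ℝ≥0} (hd : BoundedDensity (densityMeasure ρ) b)
    (hmax : ∀ x, (∀ y, effPotential V ρ y ≤ effPotential V ρ x) ↔ x ∈ Set.Icc (-2 : ℝ) 2) :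
    EquilibriumSetting V β (densityMeasure ρ) b ε L := by
  have hprob := hd.prob
  have h0 : ∀ y, effPotential V ρ y ≤ effPotential V ρ 0 := (hmax 0).2 (by norm_num)
  have hval : 2 * (∫ x, logPot (densityMeasure ρ) x ∂(densityMeasure ρ)) -
      ∫ x, V x ∂(densityMeasure ρ) = effPotential V ρ 0 := by
    rw [← integral_const_mul, ← integral_sub
      ((hd.integrable_of_continuous hd.continuous_logPot.continuousOn).const_mul (2 : ℝ))
      (hd.integrable_of_continuous hV.continuousOn)]
    have h1 : ∀ᵐ x ∂(densityMeasure ρ),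
        2 * logPot (densityMeasure ρ) x - V x = effPotential V ρ 0 := by
      filter_upwards [hd.ae_mem] with x hx
      rw [← effPotential_eq hρ]
      exact le_antisymm (h0 x) ((hmax x).2 hx 0)
    rw [integral_congr_ae h1]
    simp
  refine ⟨hβ, hV, hε, hgrowth, hd, fun x => ?_, fun x hx => ?_⟩
  · rw [hval, ← effPotential_eq hρ]; exact h0 x
  · rw [hval, ← effPotential_eq hρ]
    by_contra hcon
    exact hx ((hmax x).1 fun y => (h0 y).trans (not_lt.1 hcon))

/-- Twice the density is P(x)(4 - x²) times the arcsine density, as √(4 - x²) = (4 - x²)/√(4 - x²);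
at ±2 both sides vanish by the convention for division by zero. -/
lemma two_mul_integral_inv_sub_densityMeasure {W : ℂ → ℂ} {R : ℝ} (hR : 0 < R)
    (hW : AnalyticOnNhd ℂ W {z | Metric.infDist z cut < R})
    (hWV : ∀ x : ℝ, Metric.infDist (x : ℂ) cut < R → W x = V x)
    (hρ : IsEquilibriumDensity V ρ) (hsupp : tsupport ρ = Set.Icc (-2) 2)
    (hρP : ∀ x ∈ Set.Icc (-2 : ℝ) 2,
      ρ x = 1 / (2 * Real.pi) * (P W x).re * Real.sqrt (4 - x ^ 2)) (z : ℂ) :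
    2 * (∫ x : ℝ, (z - x)⁻¹ ∂(densityMeasure ρ)) =
      ∫ x : ℝ, P W x * (4 - x ^ 2) * (z - x)⁻¹ ∂arcsine := by
  have h1 : ∫ x : ℝ, (z - x)⁻¹ ∂(densityMeasure ρ) =
      ∫ x in (-2 : ℝ)..2, (ρ x : ℂ) * (z - x)⁻¹ := by
    rw [integral_densityMeasure hρ, intervalIntegral.integral_of_le (by norm_num),
      ← integral_Icc_eq_integral_Ioc, setIntegral_eq_integral_of_forall_compl_eq_zero]
    · simp only [Complex.real_smul]
    · intro x hx
      have h0 : ρ x = 0 := image_eq_zero_of_notMem_tsupport (by rwa [hsupp])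
      rw [h0, Complex.ofReal_zero, zero_mul]
  rw [h1, integral_arcsine, ← intervalIntegral.integral_const_mul]
  refine intervalIntegral.integral_congr fun x hx => ?_
  rw [Set.uIcc_of_le (by norm_num)] at hx
  have hPre : P W x = ((P W x).re : ℂ) :=
    Complex.ext rfl (by simpa using P_ofReal_im hR hW hWV (ofReal_mem_region hR hx))
  have hsq : (0 : ℝ) ≤ 4 - x ^ 2 := by nlinarith [hx.1, hx.2]
  have h2 : (4 - x ^ 2 : ℝ) = √(4 - x ^ 2) * √(4 - x ^ 2) := (Real.mul_self_sqrt hsq).symm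
  have h3 : 2 * ρ x = 1 / (Real.pi * √(4 - x ^ 2)) * ((P W x).re * (4 - x ^ 2)) := by
    rw [hρP x hx]
    rcases hsq.eq_or_lt with h0 | hpos
    · rw [← h0]; simp
    · have := Real.sqrt_pos.2 hpos
      nth_rw 3 [h2]
      field_simp
  have h4 : (2 * ρ x : ℂ) = (1 / (Real.pi * √(4 - x ^ 2)) : ℝ) * (P W x * (4 - x ^ 2)) := by
    rw [hPre]
    exact_mod_cast congrArg (fun t : ℝ => (t : ℂ)) h3
  simp only [Complex.real_smul]
  rw [← mul_assoc, ← mul_assoc, ← h4]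

/-- The explicit density determines 2g - W' up to the constant c, the arcsine mean of W'. It is real
because V is real on the line, and its real part vanishes because the effective potential is maximal
at ±2. -/
lemma regularSetting {β ε L R : ℝ} {b : ℝ≥0} {W : ℂ → ℂ} (hR : 0 < R)
    (S : EquilibriumSetting V β (densityMeasure ρ) b ε L)
    (hW : AnalyticOnNhd ℂ W {z | Metric.infDist z cut < R})
    (hWV : ∀ x : ℝ, Metric.infDist (x : ℂ) cut < R → W x = V x)
    (hρ : IsEquilibriumDensity V ρ) (hsupp : tsupport ρ = Set.Icc (-2) 2)
    (hρP : ∀ x ∈ Set.Icc (-2 : ℝ) 2,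
      ρ x = 1 / (2 * Real.pi) * (P W x).re * Real.sqrt (4 - x ^ 2))
    (hmax : ∀ x, (∀ y, effPotential V ρ y ≤ effPotential V ρ x) ↔ x ∈ Set.Icc (-2 : ℝ) 2)
    (hP0 : ∀ z, Metric.infDist z cut < R → P W z ≠ 0) :
    RegularSetting V β (densityMeasure ρ) b ε L W R := by
  set c : ℂ := ∫ x : ℝ, deriv W x ∂arcsine with hc
  have hg : ∀ z, 0 < Metric.infDist z cut → Metric.infDist z cut < R →
      2 * (∫ x : ℝ, (z - x)⁻¹ ∂(densityMeasure ρ)) - deriv W z = -(P W z * sqrtX z) - c := by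
    intro z hz hzR
    rw [two_mul_integral_inv_sub_densityMeasure hR hW hWV hρ hsupp hρP,
      integral_P_mul_inv_sub_arcsine hR hW hz hzR]
    ring
  have hmax' : ∀ x ∈ Set.Icc (-2 : ℝ) 2, ∀ y, 2 * logPot (densityMeasure ρ) y - V y ≤
      2 * logPot (densityMeasure ρ) x - V x := fun x hx y => by
    rw [← effPotential_eq hρ, ← effPotential_eq hρ]; exact (hmax x).2 hx y
  have hre : c.re = 0 := re_eq_zero_of_effective_max hR hW S.continuous_V hWV S.density hg
    (hmax' 2 (by norm_num)) (hmax' (-2) (by norm_num))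
  have him : c = ((∫ x : ℝ, (deriv W x).re ∂arcsine : ℝ) : ℂ) := by
    rw [hc, ← integral_complex_ofReal]
    refine integral_congr_ae ?_
    filter_upwards [ae_arcsine] with x hx
    exact Complex.ext rfl (by simpa using (hasDerivAt_real hW hWV (ofReal_mem_region hR hx)).2)
  have hc0 : c = 0 := Complex.ext hre (by rw [him, Complex.ofReal_im, Complex.zero_im])
  exact ⟨S, hR, hW, hWV, hP0, fun z hz hzR => by rw [hg z hz hzR, hc0, sub_zero]⟩

end

lemma RegularSetting.correction_eq {V ρ : ℝ → ℝ} {β ε L R : ℝ} {b : ℝ≥0} {W : ℂ → ℂ}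
    (S : RegularSetting V β (densityMeasure ρ) b ε L W R) (hρ : IsEquilibriumDensity V ρ) {d : ℝ}
    (hd : 0 < d) (hdR : 2 * d < R) {F : ℂ → ℂ}
    (hF : DifferentiableOn ℂ F {z | Metric.infDist z cut < R}) :
    correction W ρ d F = cauchyIntegral (2 * d) fun z => F z / sqrtX z *
      ∫ x : ℝ, deriv (loopTest W z) x ∂(densityMeasure ρ) := by
  have hprob := S.density.prob
  have h2d : 0 < 2 * d := by linarith
  have hdR' : d < R := by linarith
  have hpi : (2 * Real.pi * Complex.I : ℂ) ≠ 0 := by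
    simp [Real.pi_ne_zero]
  rw [correction, stieltjes_eq hρ]
  set g : ℂ → ℂ := fun z => ∫ x : ℝ, (z - x)⁻¹ ∂(densityMeasure ρ) with hg
  have hopen : IsOpen {z : ℂ | 0 < Metric.infDist z cut} :=
    isOpen_lt continuous_const (Metric.continuous_infDist_pt _)
  have hgd : DifferentiableOn ℂ g {z | 0 < Metric.infDist z cut} := fun z hz =>
    (hasDerivAt_integral_inv_sub S.density.ae_mem hz).differentiableAt.differentiableWithinAt
  have hg'c : ContinuousOn (deriv g) (contour d) := (hgd.deriv hopen).continuousOn.mono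
    fun z hz => show 0 < Metric.infDist z cut from lt_of_lt_of_eq hd (Eq.symm hz)
  have hPc := continuousOn_contour_of_differentiableOn hdR'
    (differentiableOn_P S.R_pos S.analytic)
  have hinner : ∀ z ∈ contour (2 * d), contourIntegral d (fun ζ => deriv g ζ / (P W ζ * (ζ - z))) =
      2 * Real.pi * Complex.I * ∫ x : ℝ, deriv (loopTest W z) x ∂(densityMeasure ρ) := by
    intro z hz
    have hz' : d < Metric.infDist z cut := by
      rw [show Metric.infDist z cut = 2 * d from hz]; linarith
    have hne : ∀ ζ ∈ contour d, P W ζ * (ζ - z) ≠ 0 := fun ζ hζ => by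
      refine mul_ne_zero (S.P_ne_zero ζ ((le_of_eq hζ).trans_lt hdR')) ?_
      rw [← neg_ne_zero, neg_sub]
      exact sub_ne_zero_of_mem_cutNhd hz' (le_of_eq hζ)
    have hc : ContinuousOn (fun ζ => deriv g ζ / (P W ζ * (ζ - z))) (contour d) :=
      hg'c.div (hPc.fun_mul (by fun_prop)) hne
    rw [S.integral_deriv_loopTest_eq hd hdR' hz', cauchyIntegral_eq hd hc,
      mul_inv_cancel_left₀ hpi]
  have hcont : ContinuousOn (fun z => F z / sqrtX z *
      ∫ x : ℝ, deriv (loopTest W z) x ∂(densityMeasure ρ)) (contour (2 * d)) :=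
    ((continuousOn_contour_of_differentiableOn hdR hF).div (continuousOn_sqrtX h2d) fun z hz =>
      sqrtX_ne_zero (h2d.trans_eq (Eq.symm hz))).mul (S.continuousOn_integral_deriv_loopTest h2d)
  have heq : Set.EqOn (fun z => F z / sqrtX z *
        contourIntegral d fun ζ => deriv g ζ / (P W ζ * (ζ - z)))
      (fun z => 2 * Real.pi * Complex.I * (F z / sqrtX z *
        ∫ x : ℝ, deriv (loopTest W z) x ∂(densityMeasure ρ))) (contour (2 * d)) := fun z hz => by
    simp only [hinner z hz]; ring
  have hcont' := (continuousOn_const (c := (2 * Real.pi * Complex.I : ℂ))).fun_mul hcont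
  have h1 := cauchyIntegral_eq h2d (hcont'.congr heq)
  rw [cauchyIntegral_congr h2d heq, cauchyIntegral_const_mul] at h1
  rw [eq_inv_mul_iff_mul_eq₀ hpi] at h1
  rw [← h1]
  field_simp

end BetaEnsemble

/-! ### Assembly of the main theorem. -/

theorem theorem1 (V ρ : ℝ → ℝ) (D : Set ℂ) (W : ℂ → ℂ) (β : ℝ) (hβ : 0 < β)
    -- the potential: continuity and growth
    (hV : Continuous V)
    (hgrowth : ∃ ε > 0, ∃ L : ℝ, ∀ x : ℝ, L ≤ |x| → 2 * (1 + ε) * Real.log (1 + |x|) ≤ V x)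
    -- the equilibrium density, with support `[-2, 2]`
    (hρ : BetaEnsemble.IsEquilibriumDensity V ρ)
    (hsupp : tsupport ρ = Set.Icc (-2) 2)
    -- the potential is analytic in a neighbourhood `D` of the support
    (hD : IsOpen D) (hcut : BetaEnsemble.cut ⊆ D)
    (hW : AnalyticOnNhd ℂ W D) (hWV : ∀ x : ℝ, (x : ℂ) ∈ D → W x = V x)
    -- regularity of the density, and the maximum of the effective potential
    (hρP : ∀ x ∈ Set.Icc (-2 : ℝ) 2,
      ρ x = 1 / (2 * Real.pi) * (BetaEnsemble.P W x).re * Real.sqrt (4 - x ^ 2))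
    (hP : ∃ m > 0, ∀ x ∈ Set.Icc (-2 : ℝ) 2, m ≤ (BetaEnsemble.P W x).re)
    (hmax : ∀ x, (∀ y, BetaEnsemble.effPotential V ρ y ≤ BetaEnsemble.effPotential V ρ x) ↔
      x ∈ Set.Icc (-2 : ℝ) 2) :
    ∃ n₀ : ℝ → ℕ,
      (∀ κ ≥ 0, ∀ n ≥ n₀ κ, IsProbabilityMeasure (BetaEnsemble.law V β n)) ∧
      ∀ d > 0, BetaEnsemble.cutNhd (2 * d) ⊆ D →
        (∀ z ∈ BetaEnsemble.cutNhd (2 * d), BetaEnsemble.P W z ≠ 0) →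
        ∃ C : ℝ, ∀ κ ≥ 0, ∃ K c : ℝ, 0 < c ∧ ∀ n ≥ n₀ κ, ∀ f : ℂ → ℂ, ∀ M : ℝ,
          AnalyticOnNhd ℂ f D →
          (Measurable fun x : ℝ => f x) →
          (∀ x : ℝ, (x : ℂ) ∉ BetaEnsemble.cutNhd (2 * d) →
            ‖f x‖ ≤ M * Real.exp (κ * V x)) →
          MemLp (BetaEnsemble.linStat f n) 2 (BetaEnsemble.law V β n) ∧
          ‖(∫ l, BetaEnsemble.linStat f n l ∂(BetaEnsemble.law V β n)) -
              (n * (∫ x : ℝ, f x * ρ x) +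
                (2 / β - 1 : ℝ) * BetaEnsemble.correction W ρ d f)‖ ≤
            C / n * BetaEnsemble.supNear f (2 * d) + K * Real.exp (-(c * n)) * M ∧
          (∫ l, ‖BetaEnsemble.linStat f n l -
              ∫ l', BetaEnsemble.linStat f n l' ∂(BetaEnsemble.law V β n)‖ ^ 2
              ∂(BetaEnsemble.law V β n)) ≤
            C * BetaEnsemble.supNear f (2 * d) ^ 2 + K * Real.exp (-(c * n)) * M ^ 2 := by
  obtain ⟨ε, hε, L, hL⟩ := hgrowth
  obtain ⟨b, hb⟩ := BetaEnsemble.exists_density_le hD hcut hW hρP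
  have S := BetaEnsemble.equilibriumSetting hβ hV hε hL hρ
    (BetaEnsemble.boundedDensity_densityMeasure hρ hsupp hb) hmax
  -- Beyond the threshold for integrability, n ≥ 2 is needed for log n to be bounded below.
  refine ⟨fun κ => ⌈BetaEnsemble.sizeThreshold β ε κ⌉₊ + 2, fun κ hκ n hn => ?_,
    fun d hd hdD hdP => ?_⟩
  · have hn' : ⌈BetaEnsemble.sizeThreshold β ε κ⌉₊ + 2 ≤ n := hn
    exact BetaEnsemble.isProbabilityMeasure_law hβ hV (S.integrable_weight
      ((BetaEnsemble.EquilibriumSetting.sizeThreshold_mono hβ hε hκ).trans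
        (Nat.ceil_le.1 (by omega))))
  · obtain ⟨R₁, hR₁, hR₁D⟩ := BetaEnsemble.exists_infDist_cut_lt_subset hD hdD
    have hR₁0 : 0 < R₁ := by linarith
    -- The neighbourhood is shrunk twice: first into D, then away from the zeros of P, which by
    -- continuity avoid a neighbourhood of the closed region.
    have hopen := (BetaEnsemble.differentiableOn_P hR₁0
      (hW.mono hR₁D)).continuousOn.isOpen_inter_preimage
      (BetaEnsemble.isOpen_infDist_cut_lt R₁) (isOpen_compl_singleton (x := 0))
    obtain ⟨R, hR, hRU⟩ := BetaEnsemble.exists_infDist_cut_lt_subset hopen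
      (r := 2 * d) fun z hz => ⟨show Metric.infDist z BetaEnsemble.cut < R₁ from
        lt_of_le_of_lt hz hR₁, hdP z hz⟩
    have hR0 : 0 < R := by linarith
    have hRD : {z | Metric.infDist z BetaEnsemble.cut < R} ⊆ D := fun z hz => hR₁D (hRU hz).1
    have S' := BetaEnsemble.regularSetting hR0 S (hW.mono hRD) (fun x hx => hWV x (hRD hx)) hρ hsupp
      hρP hmax fun z hz => (hRU hz).2
    obtain ⟨C, -, h⟩ := S'.exists_linStat_bound hd hR
    refine ⟨C, fun κ hκ => ?_⟩
    obtain ⟨K, c, -, hc, h⟩ := h κ hκ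
    refine ⟨K, c, hc, fun n hn f M hf hfm hfM => ?_⟩
    have hn' : ⌈BetaEnsemble.sizeThreshold β ε κ⌉₊ + 2 ≤ n := hn
    -- The growth bound at one real point outside the region already forces this sign.
    have hM : 0 ≤ M := by
      have hx : ((3 + 2 * d : ℝ) : ℂ) ∉ BetaEnsemble.cutNhd (2 * d) := by
        rw [BetaEnsemble.notMem_cutNhd_iff (by linarith), abs_of_pos (by linarith)]; linarith
      exact nonneg_of_mul_nonneg_left ((norm_nonneg _).trans (hfM _ hx)) (Real.exp_pos _)
    have hB : ∀ z ∈ BetaEnsemble.cutNhd (2 * d), ‖f z‖ ≤ BetaEnsemble.supNear f (2 * d) :=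
      fun z hz => le_csSup ((BetaEnsemble.isCompact_cutNhd (2 * d)).bddAbove_image
        (hf.continuousOn.mono hdD).norm) ⟨z, hz, rfl⟩
    have hfd : DifferentiableOn ℂ f {z | Metric.infDist z BetaEnsemble.cut < R} :=
      hf.differentiableOn.mono hRD
    obtain ⟨h1, h2, h3⟩ := h n (by omega) (Nat.ceil_le.1 (by omega)) f _ M hM hfd hfm hB hfM
    refine ⟨h1, ?_, h3⟩
    rw [S'.correction_eq hρ hd hR hfd]
    have h4 : ∫ x : ℝ, f x * ρ x = ∫ x : ℝ, f x ∂(BetaEnsemble.densityMeasure ρ) := by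
      rw [BetaEnsemble.integral_densityMeasure hρ]
      simp only [Complex.real_smul, mul_comm]
    rw [h4]
    push_cast
    exact h2
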